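/- Let $k\ge 0$, $m\ge 0$ be integers. For $n\ge 0$ put $A(u)=\prod_{1\le i<j\le n}(u_i-u_j)$, $B(x)=\prod_{i<j}\sinh(x_i-x_j)$, $C_m(\nu)=\prod_{l=1}^m\prod_{i<j}(\nu_i-\nu_j-l)$, and let $\Phi^{(n)}_m$ be the normalised trigonometric Baker–Akhiezer function of type $A_{n-1}$, that is, the function $$\Phi^{(n)}_m=\frac{P(x,\nu)}{B(x)^mC_m(\nu)}\,e^{2(\nu,x)},\qquad x,\nu\in\mathbb C^n,\ B(x)\ne0,\ C_m(\nu)\neq 0,$$ where $P$ is a trigonometric polynomial in $x$ (a finite linear combination of $e^{a_1x_1+\dots+a_nx_n}$, $a\in\mathbb Z^n$) with coefficients polynomial in $\nu$, with leading term $B(x)^mA(\nu)^m$ in $\nu$, which satisfies $$\Big(-\Delta+\sum_{i<j}\frac{2m(m+1)}{\sinh^2(x_i-x_j)}\Big)\Phi^{(n)}_m=-4(\nu,\nu)\Phi^{(n)}_m$$ and $P(x,\nu)/(B(x)^mC_m(\nu))\to 1$ when $x\in\mathbb R^n$ and all $x_i-x_j$, $i<j$, tend to $+\infty$. In the variables $u_i=e^{2x_i}$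 we write $u_i^{a}=e^{2ax_i}$ and $\Phi^{(n)}_m=\Phi^{(n)}_m(u,\nu)$; the dependence on the branch of the powers of $u$ is understood. For $w=(w_1,\dots,w_k)$ and $u=(u_1,\dots,u_{k+1})$ put $A^*(w,u)=\prod_{i\le j}(w_i-u_j)\prod_{i>j}(u_j-w_i)$. Theorem. There is a real number $R$, depending only on $k$ and $m$, with the following property. Let $u_1,\dots,u_{k+1}$ be nonzero complex numbers with pairwise different arguments and with chosen logarithms $2x_i$, and let $\nu\in\mathbb C^{k+1}$ satisfy $C_m(\nu_1,\dots,\nu_k)\neq0$ and $\operatorname{Re}(\nu_i-\nu_{k+1})>R$ for $i=1,\dots,k$. Let $\gamma^*$ be the contour $w_i=\tau_iu_i$, $\tau_i\in[0,1]$, $i=1,\dots,k$, the powers of $w_i$ being continued along the segment from $u_i$ (so $w_i^a=\tau_i^au_i^a$). Then the following integral converges absolutely and $$\prod_{i=1}^{k+1}u_i^{\nu_{k+1}}\int_{\gamma^*}\frac{A^*(w,u)^m}{A(u)^mA(w)^m}\prod_{i=1}^kw_i^{-m-1-\nu_{k+1}}\,\Phi^{(k)}_m(w,\nu_1,\dots,\nu_k)\,dw_1\cdots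 dw_k=C_3\,\Phi^{(k+1)}_m(u,\nu_1,\dots,\nu_{k+1}),$$ $$C_3=(-1)^{km}\prod_{i=1}^k\frac{\Gamma(m+1)\,\Gamma(\nu_i-\nu_{k+1})}{\Gamma(\nu_i-\nu_{k+1}+m+1)}.$$ -/

import Mathlib

open Filter Topology MeasureTheory

noncomputable section

namespace TrigBA

/-- `A(u) = ∏_{i<j} (u_i - u_j)`. -/
def vand {n : ℕ} (u : Fin n → ℂ) : ℂ :=
  ∏ i, ∏ j ∈ Finset.Ioi i, (u i - u j)

/-- `B(x) = ∏_{i<j} sinh (x_i - x_j)`. -/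
def sinhVand {n : ℕ} (x : Fin n → ℂ) : ℂ :=
  ∏ i, ∏ j ∈ Finset.Ioi i, Complex.sinh (x i - x j)

/-- `C_m(ν) = ∏_{l=1}^m ∏_{i<j} (ν_i - ν_j - l)`. -/
def normConst {n : ℕ} (m : ℕ) (ν : Fin n → ℂ) : ℂ :=
  ∏ l ∈ Finset.Icc 1 m, ∏ i, ∏ j ∈ Finset.Ioi i, (ν i - ν j - (l : ℂ))

/-- Trigonometric polynomials in `x = (x_1, …, x_n)` (finite linear combinations of the
exponentials `exp (a_1 x_1 + ⋯ + a_n x_n)`, `a ∈ ℤⁿ`) whose coefficients are polynomials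
in `ν = (ν_1, …, ν_n)`. -/
abbrev TrigPoly (n : ℕ) : Type := (Fin n → ℤ) →₀ MvPolynomial (Fin n) ℂ

/-- The value `P(x, ν)`. -/
def TrigPoly.eval {n : ℕ} (P : TrigPoly n) (x ν : Fin n → ℂ) : ℂ :=
  P.sum fun a p => MvPolynomial.eval ν p * Complex.exp (∑ i, (a i : ℂ) * x i)

/-- As a polynomial in `ν`, the leading (top degree homogeneous) term of `P(x, ν)` is
`B(x)^m A(ν)^m`; its degree in `ν` is `m n (n - 1) / 2`. -/
def HasLeadingTerm {n : ℕ} (m : ℕ) (P : TrigPoly n) : Prop :=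
  (∀ a, (P a).totalDegree ≤ m * n.choose 2) ∧
  ∀ x ν : Fin n → ℂ,
    (P.sum fun a p =>
      MvPolynomial.eval ν (MvPolynomial.homogeneousComponent (m * n.choose 2) p) *
        Complex.exp (∑ i, (a i : ℂ) * x i)) = sinhVand x ^ m * vand ν ^ m

/-- The function `P(x, ν) / (B(x)^m C_m(ν)) * exp (2 (ν, x))`. -/
def baForm {n : ℕ} (m : ℕ) (P : TrigPoly n) (x ν : Fin n → ℂ) : ℂ :=
  P.eval x ν / (sinhVand x ^ m * normConst m ν) * Complex.exp (2 * ∑ i, ν i * x i)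

/-- The Sutherland operator
`-Δ + ∑_{i<j} 2 m (m + 1) / sinh² (x_i - x_j)` applied to `f`, at the point `x`. -/
def sutherland {n : ℕ} (m : ℕ) (f : (Fin n → ℂ) → ℂ) (x : Fin n → ℂ) : ℂ :=
  -(∑ i, iteratedDeriv 2 (fun t : ℂ => f (Function.update x i t)) (x i)) +
    (∑ i, ∑ j ∈ Finset.Ioi i,
      2 * (m : ℂ) * ((m : ℂ) + 1) / Complex.sinh (x i - x j) ^ 2) * f x

/-- The filter `x → +∞` in the Weyl chamber `x_1 > x_2 > ⋯ > x_n`: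
all differences `x_i - x_j`, `i < j`, tend to `+∞`. -/
def chamberAtTop (n : ℕ) : Filter (Fin n → ℝ) :=
  ⨅ i, ⨅ j ∈ Finset.Ioi i, comap (fun x : Fin n → ℝ => x i - x j) atTop

/-- The defining properties of the numerator `P(x, ν)` of the trigonometric Baker-Akhiezer
function: leading term in `ν`, Schrödinger equation, and normalisation at infinity. -/
structure IsBANumerator (n m : ℕ) (P : TrigPoly n) : Prop where
  leading : HasLeadingTerm m P
  schrodinger : ∀ ν : Fin n → ℂ, normConst m ν ≠ 0 → ∀ x : Fin n → ℂ, sinhVand x ≠ 0 →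
    sutherland m (fun y => baForm m P y ν) x = -4 * (∑ i, ν i ^ 2) * baForm m P x ν
  normalised : ∀ ν : Fin n → ℂ, normConst m ν ≠ 0 →
    Tendsto (fun x : Fin n → ℝ =>
      P.eval (fun i => (x i : ℂ)) ν / (sinhVand (fun i => (x i : ℂ)) ^ m * normConst m ν))
      (chamberAtTop n) (𝓝 1)

/-- The trigonometric Baker-Akhiezer function `Φ^{(n)}_m`, as a function of `x` (where
`u_i = exp (2 x_i)`, so that `u^ν = exp (2 (ν, x))`) and of `ν`. -/
def Phi (n m : ℕ) (x ν : Fin n → ℂ) : ℂ :=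
  baForm m (Classical.epsilon (IsBANumerator n m)) x ν

/-- The exponential variables `u_i = exp (2 x_i)`. -/
def expVar {n : ℕ} (x : Fin n → ℂ) : Fin n → ℂ := fun i => Complex.exp (2 * x i)

/-- `A^*(w, u) = ∏_{i ≤ j} (w_i - u_j) ∏_{i > j} (u_j - w_i)`. -/
def AStar {k : ℕ} (w : Fin k → ℂ) (u : Fin (k + 1) → ℂ) : ℂ :=
  (∏ i : Fin k, ∏ j ∈ Finset.Ici i.castSucc, (w i - u j)) *
    ∏ i : Fin k, ∏ j ∈ Finset.Iio i.castSucc, (u j - w i)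

/-- The logarithmic coordinates `y_i = x_i + (1/2) log τ_i` of the point `w_i = τ_i u_i`,
`0 < τ_i ≤ 1`, of the segment joining `0` and `u_i = exp (2 x_i)`: `exp (2 y_i) = τ_i u_i`,
and the branch of the powers of `w_i` is the one continued along the segment from `u_i`. -/
def segLog {k : ℕ} (x : Fin (k + 1) → ℂ) (τ : Fin k → ℝ) : Fin k → ℂ :=
  fun i => x i.castSucc + ((Real.log (τ i) : ℝ) : ℂ) / 2

lemma expVar_segLog {k : ℕ} (x : Fin (k + 1) → ℂ) (τ : Fin k → ℝ) (i : Fin k)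
    (h : 0 < τ i) : expVar (segLog x τ) i = (τ i : ℂ) * expVar x i.castSucc := by
  have e : 2 * (x i.castSucc + ((Real.log (τ i) : ℝ) : ℂ) / 2) =
      ((Real.log (τ i) : ℝ) : ℂ) + 2 * x i.castSucc := by ring
  simp only [expVar, segLog]
  rw [e, Complex.exp_add, ← Complex.ofReal_exp, Real.exp_log h]

/-- The parameter domain of the contour `γ^*` (the end `τ_i = 0`, of measure zero, is left
out). -/
def unitCube (k : ℕ) : Set (Fin k → ℝ) := Set.univ.pi fun _ => Set.Ioc 0 1

/-- The integrand over `γ^*`,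
`A^*(w,u)^m / (A(u)^m A(w)^m) * ∏ w_i^{-m-1-ν_{k+1}} * Φ^{(k)}_m(w, ν_1, …, ν_k) dw`,
pulled back to the parameters `τ`: `w_i = τ_i u_i` and `dw = ∏ u_i dτ`. -/
def selbergIntegrand (k m : ℕ) (x ν : Fin (k + 1) → ℂ) (τ : Fin k → ℝ) : ℂ :=
  let u := expVar x
  let y := segLog x τ
  let w := expVar y
  AStar w u ^ m / (vand u ^ m * vand w ^ m) *
    (∏ i, Complex.exp (2 * (-(m : ℂ) - 1 - ν (Fin.last k)) * y i)) *
    Phi k m y (fun i => ν i.castSucc) *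
    ∏ i : Fin k, u i.castSucc

/-- `C_3`. -/
def C3 (k m : ℕ) (ν : Fin (k + 1) → ℂ) : ℂ :=
  (-1) ^ (k * m) * ∏ i : Fin k,
    Complex.Gamma ((m : ℂ) + 1) * Complex.Gamma (ν i.castSucc - ν (Fin.last k)) /
      Complex.Gamma (ν i.castSucc - ν (Fin.last k) + (m : ℂ) + 1)

end TrigBA

end

/-! Write `u_i = exp (2 x_i)`, `w_i = exp (2 y_i)` and `y_i = x_i - σ_i` with `σ_i ≥ 0`. Give the
`x` variables charge `ε = 1`, the `y` variables charge `ε = -1`, and order them as `x_0, y_0, x_1,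
y_1, …, x_k`. For an integer `q` let `K_q` be the product over pairs `a` before `b` of `(1 - exp (-2
(z_a - z_b))) ^ (-q ε_a ε_b)`. The addition theorem of the hyperbolic cotangent gives
(`kernel_identity`) that `Δ_x - Δ_y` multiplies `K_q exp (2 μ (∑ x - ∑ y))` by `2 q (q + 1) (V(x) -
V(y)) + 4 μ²`, where `V` is the sum of the `1 / sinh²`. Hence `K_q` carries an eigenfunction in `y`
to one in `x`, up to total `y`-derivatives of terms that contain the factor `T_i = 1 - exp (-2 σ_i)`
(`lapD_kerF`, `lker_add`). The coupling `q (q + 1)` is the same for `q = m` and for `q = -m - 1`,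
and both values are used.

For `q = -m - 1` the kernel has poles of order `m + 1` along `y_i = x_i`, and the iterated residue
there produces an eigenfunction in `k + 1` variables from one in `k` variables (`resOp_pde`).
Starting from the constant `1`, this recursion builds a numerator `h` with the required leading term
in `ν` and limit in the chamber (`IsFam.succ`). The indicial equation at a wall bounds its pole
order by `m` (`IsFam.exists_trigPoly`), so a Baker-Akhiezer numerator exists. The dominant exponent
along a ray of the chamber satisfies a quadratic equation with only the zero solution for generic
`ν`, which gives uniqueness (`ray_vanish`). Therefore `Phi` is `exp (2 (ν, x)) h / C_m` whichever
numerator is chosen (`IsFam.Phi_eq`), and `h` is unchanged when all `ν_i` are shifted by one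
constant (`IsFam.shift`).

For `q = m` the integrand of the theorem is `K_m` times the `k`-variable function. With `c = -2
ν_{k+1}` it contains `exp (-c ∑ σ_i)`, so the integral has a formal expansion in `1 / c` whose
coefficients are complete homogeneous polynomials in `-∂_{y_i}` applied to the rest and evaluated at
`y_i = x_i`. These coefficients obey a recursion, the Schrödinger equation read off by powers of `c`
(`acoef_rec`). The coefficients of the polynomial `c ↦ h'(x, ν, -c / 2)`, for the `(k + 1)`-variable
numerator `h'`, obey the same recursion. A solution is determined by its chamber limits
(`rec_vanish`), and on the integral side the limit is a product of beta integrals. This gives an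
identity of formal series (`series_identity`).

The formal identity becomes an identity of functions by Borel summation. A polynomial in `1 / c`
times the orthant integral is the Laplace transform of a function that is analytic along `[0, ∞)`
and whose Taylor coefficients at `0` are the formal ones, so the identity theorem applies
(`laplace_unique`). By the shift invariance the single value `c = 2` is enough. Generic `ν` are
treated first and the others follow by continuity (`integral_jfun`). The substitution `τ_i = exp (-2
σ_i)` returns to the contour. -/

set_option linter.unusedSectionVars false

noncomputable section

namespace TrigBA

/-! ### Partial derivatives of functions of several complex variables. -/

section PartialDerivative

variable {ι : Type*} [Fintype ι] [DecidableEq ι]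

/-- The partial derivative of `f` with respect to the `i`-th coordinate. -/
def pd (i : ι) (f : (ι → ℂ) → ℂ) (z : ι → ℂ) : ℂ :=
  deriv (fun t => f (Function.update z i t)) (z i)

theorem hasDerivAt_update' (z : ι → ℂ) (i : ι) (t : ℂ) :
    HasDerivAt (fun t => Function.update z i t) (Pi.single i (1 : ℂ)) t := by
  rw [hasDerivAt_pi]
  intro j
  by_cases h : j = i
  · subst h; simpa using hasDerivAt_id' t
  · simpa [Function.update_of_ne h, Pi.single_eq_of_ne h] using hasDerivAt_const t (z j)

theorem hasDerivAt_pd {i : ι} {f : (ι → ℂ) → ℂ} {z : ι → ℂ} (h : DifferentiableAt ℂ f z) :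
    HasDerivAt (fun t => f (Function.update z i t)) (fderiv ℂ f z (Pi.single i 1)) (z i) := by
  have h' : HasFDerivAt f (fderiv ℂ f z) (Function.update z i (z i)) := by
    simpa using h.hasFDerivAt
  exact h'.comp_hasDerivAt (z i) (hasDerivAt_update' z i (z i))

theorem pd_eq_fderiv {i : ι} {f : (ι → ℂ) → ℂ} {z : ι → ℂ} (h : DifferentiableAt ℂ f z) :
    pd i f z = fderiv ℂ f z (Pi.single i 1) := (hasDerivAt_pd h).deriv

theorem pd_congr {i : ι} {f g : (ι → ℂ) → ℂ} {z : ι → ℂ} (h : f =ᶠ[𝓝 z] g) :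
    pd i f z = pd i g z := by
  apply Filter.EventuallyEq.deriv_eq
  have : ContinuousAt (fun t => Function.update z i t) (z i) :=
    (hasDerivAt_update' z i (z i)).continuousAt
  have h2 : Tendsto (fun t => Function.update z i t) (𝓝 (z i)) (𝓝 z) := by
    simpa [ContinuousAt] using this
  exact h2.eventually h

theorem pd_congr_on {Ω : Set (ι → ℂ)} (hΩ : IsOpen Ω) {f g : (ι → ℂ) → ℂ} (i : ι)
    (h : Set.EqOn f g Ω) : Set.EqOn (pd i f) (pd i g) Ω := fun _ hz =>
  pd_congr (h.eventuallyEq_of_mem (hΩ.mem_nhds hz))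

theorem analyticAt_pd {i : ι} {f : (ι → ℂ) → ℂ} {z : ι → ℂ} (h : AnalyticAt ℂ f z) :
    AnalyticAt ℂ (pd i f) z := by
  have h1 : AnalyticAt ℂ (fun w => fderiv ℂ f w (Pi.single i 1)) z :=
    ((ContinuousLinearMap.apply ℂ ℂ (Pi.single i (1 : ℂ) : ι → ℂ)).analyticAt _).comp h.fderiv
  refine h1.congr ?_
  filter_upwards [h.eventually_analyticAt] with w hw
  exact (pd_eq_fderiv hw.differentiableAt).symm

/-- Both sides are values of the second Fréchet derivative, which is symmetric at an analytic point.
-/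
theorem pd_pd_comm {i j : ι} {f : (ι → ℂ) → ℂ} {z : ι → ℂ} (h : AnalyticAt ℂ f z) :
    pd i (pd j f) z = pd j (pd i f) z := by
  have key : ∀ a b : ι, pd a (pd b f) z =
      fderiv ℂ (fderiv ℂ f) z (Pi.single a 1) (Pi.single b 1) := by
    intro a b
    have e : pd b f =ᶠ[𝓝 z] fun w => fderiv ℂ f w (Pi.single b 1) := by
      filter_upwards [h.eventually_analyticAt] with w hw
      exact pd_eq_fderiv hw.differentiableAt
    rw [pd_congr e]
    have hd : DifferentiableAt ℂ (fderiv ℂ f) z := h.fderiv.differentiableAt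
    rw [pd_eq_fderiv (hd.clm_apply (differentiableAt_const _))]
    rw [fderiv_clm_apply hd (differentiableAt_const _)]
    simp
  rw [key, key]
  exact (h.contDiffAt.isSymmSndFDerivAt (n := ⊤) (by simp)) _ _

variable {i : ι} {f g : (ι → ℂ) → ℂ} {z : ι → ℂ}

theorem differentiableAt_line (h : DifferentiableAt ℂ f z) :
    DifferentiableAt ℂ (fun t => f (Function.update z i t)) (z i) := (hasDerivAt_pd h).differentiableAt

theorem pd_add (hf : DifferentiableAt ℂ f z) (hg : DifferentiableAt ℂ g z) :
    pd i (fun z => f z + g z) z = pd i f z + pd i g z :=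
  deriv_fun_add (differentiableAt_line hf) (differentiableAt_line hg)

theorem pd_sub (hf : DifferentiableAt ℂ f z) (hg : DifferentiableAt ℂ g z) :
    pd i (fun z => f z - g z) z = pd i f z - pd i g z :=
  deriv_fun_sub (differentiableAt_line hf) (differentiableAt_line hg)

theorem pd_mul (hf : DifferentiableAt ℂ f z) (hg : DifferentiableAt ℂ g z) :
    pd i (fun z => f z * g z) z = pd i f z * g z + f z * pd i g z := by
  have := deriv_fun_mul (differentiableAt_line (i := i) hf) (differentiableAt_line (i := i) hg)
  simpa [pd] using this

theorem pd_const (c : ℂ) : pd i (fun _ => c) z = 0 := by simp [pd]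

theorem pd_const_mul (c : ℂ) : pd i (fun z => c * f z) z = c * pd i f z :=
  deriv_const_mul_field (v := fun t => f (Function.update z i t)) c

theorem pd_sum {α : Type*} (s : Finset α) {F : α → (ι → ℂ) → ℂ}
    (h : ∀ a ∈ s, DifferentiableAt ℂ (F a) z) :
    pd i (fun z => ∑ a ∈ s, F a z) z = ∑ a ∈ s, pd i (F a) z :=
  deriv_fun_sum fun a ha => differentiableAt_line (h a ha)

theorem pd_inv (hf : DifferentiableAt ℂ f z) (h0 : f z ≠ 0) :
    pd i (fun z => (f z)⁻¹) z = - pd i f z / f z ^ 2 := by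
  have := deriv_fun_inv'' (differentiableAt_line (i := i) hf) (by simpa using h0)
  simpa [pd] using this

theorem pd_exp (hf : DifferentiableAt ℂ f z) :
    pd i (fun z => Complex.exp (f z)) z = Complex.exp (f z) * pd i f z := by
  have := deriv_cexp (differentiableAt_line (i := i) hf)
  simpa [pd] using this

theorem pd_coord (j : ι) : pd i (fun z => z j) z = if i = j then 1 else 0 := by
  by_cases h : i = j
  · subst h; simp [pd]
  · simp [pd, h, Function.update_of_ne (Ne.symm h)]

/-- `exp (∑ a_i z_i)`. -/
def ex (a : ι → ℂ) (z : ι → ℂ) : ℂ := Complex.exp (∑ i, a i * z i)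

theorem analyticAt_ex (a : ι → ℂ) (z : ι → ℂ) : AnalyticAt ℂ (ex a) z := by
  have : AnalyticAt ℂ (fun z : ι → ℂ => ∑ i, a i * z i) z :=
    Finset.analyticAt_fun_sum _ fun i _ =>
      analyticAt_const.mul ((ContinuousLinearMap.proj (R := ℂ) (φ := fun _ : ι => ℂ) i).analyticAt z)
  exact this.cexp

theorem pd_ex (a : ι → ℂ) (i : ι) (z : ι → ℂ) : pd i (ex a) z = a i * ex a z := by
  unfold ex
  rw [pd_exp (by fun_prop), pd_sum _ (fun _ _ => by fun_prop), mul_comm]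
  congr 1
  simp only [pd_const_mul, pd_coord]
  simp

theorem ex_add (a b : ι → ℂ) (z : ι → ℂ) : ex (a + b) z = ex a z * ex b z := by
  simp [ex, ← Complex.exp_add, add_mul, Finset.sum_add_distrib]

theorem ex_ne_zero (a z : ι → ℂ) : ex a z ≠ 0 := Complex.exp_ne_zero _

/-- Translates the second derivatives in `sutherland` into iterated `pd`, the form used from here
on. -/
theorem iteratedDeriv_two_eq (f : (ι → ℂ) → ℂ) (z : ι → ℂ) (i : ι) :
    iteratedDeriv 2 (fun t : ℂ => f (Function.update z i t)) (z i) = pd i (pd i f) z := by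
  rw [iteratedDeriv_succ, iteratedDeriv_one]
  unfold pd
  congr 1
  ext t
  simp

end PartialDerivative

/-! ### Differential operators as endomorphisms of the space of functions analytic on an open set.
-/

section Holomorphic

variable {ι : Type*} [Fintype ι] [DecidableEq ι]

/-- The functions analytic on `Ω`, extended by zero. -/
def Hol (Ω : Set (ι → ℂ)) : Submodule ℂ ((ι → ℂ) → ℂ) where
  carrier := {f | AnalyticOnNhd ℂ f Ω ∧ ∀ z ∉ Ω, f z = 0}
  add_mem' := fun hf hg => ⟨hf.1.add hg.1, fun z hz => by simp [hf.2 z hz, hg.2 z hz]⟩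
  zero_mem' := ⟨fun _ _ => analyticAt_const, fun _ _ => rfl⟩
  smul_mem' := fun c _ hf => ⟨fun z hz => analyticAt_const.smul (hf.1 z hz),
    fun z hz => by simp [hf.2 z hz]⟩

variable {Ω : Set (ι → ℂ)}

theorem Hol.analytic (f : Hol Ω) : AnalyticOnNhd ℂ f.1 Ω := f.2.1

theorem Hol.diff (f : Hol Ω) {z : ι → ℂ} (hz : z ∈ Ω) : DifferentiableAt ℂ f.1 z :=
  (f.2.1 z hz).differentiableAt

/-- The extension by zero makes an element determined by its values on `Ω`, so operator identities
can be checked pointwise there. -/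
theorem Hol.ext_on {f g : Hol Ω} (h : ∀ z ∈ Ω, f.1 z = g.1 z) : f = g := by
  apply Subtype.ext
  funext z
  by_cases hz : z ∈ Ω
  · exact h z hz
  · rw [f.2.2 z hz, g.2.2 z hz]

open Classical in
/-- Restriction of an analytic function to `Ω`. -/
def Hol.mk (hΩ : IsOpen Ω) (f : (ι → ℂ) → ℂ) (hf : AnalyticOnNhd ℂ f Ω) : Hol Ω :=
  ⟨Ω.indicator f, fun z hz => (hf z hz).congr (by
    filter_upwards [hΩ.mem_nhds hz] with w hw
    rw [Set.indicator_of_mem hw]), fun z hz => Set.indicator_of_notMem hz _⟩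

theorem Hol.mk_apply (hΩ : IsOpen Ω) {f : (ι → ℂ) → ℂ} (hf : AnalyticOnNhd ℂ f Ω) {z : ι → ℂ}
    (hz : z ∈ Ω) : (Hol.mk hΩ f hf).1 z = f z := Set.indicator_of_mem hz _

/-- The partial derivative on `Hol Ω`. -/
def pdFun (hΩ : IsOpen Ω) (i : ι) (f : Hol Ω) : Hol Ω :=
  Hol.mk hΩ (pd i f.1) fun z hz => analyticAt_pd (Hol.analytic f z hz)

theorem pdFun_apply (hΩ : IsOpen Ω) (i : ι) (f : Hol Ω) {z : ι → ℂ} (hz : z ∈ Ω) :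
    (pdFun hΩ i f).1 z = pd i f.1 z := Hol.mk_apply hΩ _ hz

/-- The partial derivative as an endomorphism of `Hol Ω`. -/
def pdOp (hΩ : IsOpen Ω) (i : ι) : Module.End ℂ (Hol Ω) where
  toFun f := pdFun hΩ i f
  map_add' f g := Hol.ext_on fun z hz => by
    change _ = (pdFun hΩ i f).1 z + (pdFun hΩ i g).1 z
    rw [pdFun_apply hΩ i _ hz, pdFun_apply hΩ i f hz, pdFun_apply hΩ i g hz]
    exact pd_add (Hol.diff f hz) (Hol.diff g hz)
  map_smul' c f := Hol.ext_on fun z hz => by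
    change _ = c * (pdFun hΩ i f).1 z
    rw [pdFun_apply hΩ i _ hz, pdFun_apply hΩ i f hz]
    exact pd_const_mul c

/-- Multiplication by an analytic function as an endomorphism of `Hol Ω`. -/
def mulOp (h : (ι → ℂ) → ℂ) (hh : AnalyticOnNhd ℂ h Ω) : Module.End ℂ (Hol Ω) where
  toFun f := ⟨fun z => h z * f.1 z, fun z hz => (hh z hz).mul (Hol.analytic f z hz),
    fun z hz => (congrArg (h z * ·) (f.2.2 z hz)).trans (mul_zero _)⟩
  map_add' f g := Subtype.ext <| funext fun z => mul_add _ _ _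
  map_smul' c f := Subtype.ext <| funext fun z => mul_left_comm _ _ _

theorem pdOp_apply (hΩ : IsOpen Ω) (i : ι) (f : Hol Ω) {z : ι → ℂ} (hz : z ∈ Ω) :
    (pdOp hΩ i f).1 z = pd i f.1 z := pdFun_apply hΩ i f hz

theorem mulOp_apply (h : (ι → ℂ) → ℂ) (hh : AnalyticOnNhd ℂ h Ω) (f : Hol Ω) (z : ι → ℂ) :
    (mulOp h hh f).1 z = h z * f.1 z := rfl

theorem pd_congr_pdOp (hΩ : IsOpen Ω) (i j : ι) (f : Hol Ω) {z : ι → ℂ} (hz : z ∈ Ω) :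
    pd j (pdOp hΩ i f).1 z = pd j (pd i f.1) z :=
  pd_congr (by filter_upwards [hΩ.mem_nhds hz] with w hw using pdOp_apply hΩ i f hw)

theorem pdOp_commute (hΩ : IsOpen Ω) (i j : ι) : Commute (pdOp hΩ i) (pdOp hΩ j) := by
  refine LinearMap.ext fun f => Hol.ext_on fun z hz => ?_
  change (pdOp hΩ i (pdOp hΩ j f)).1 z = (pdOp hΩ j (pdOp hΩ i f)).1 z
  rw [pdOp_apply hΩ _ _ hz, pdOp_apply hΩ _ _ hz, pd_congr_pdOp hΩ _ _ _ hz,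
    pd_congr_pdOp hΩ _ _ _ hz]
  exact pd_pd_comm (Hol.analytic f z hz)

theorem mulOp_commute {h h' : (ι → ℂ) → ℂ} (hh : AnalyticOnNhd ℂ h Ω) (hh' : AnalyticOnNhd ℂ h' Ω) :
    Commute (mulOp h hh) (mulOp h' hh') :=
  LinearMap.ext fun _ => Subtype.ext <| funext fun _ => mul_left_comm _ _ _

/-- The Leibniz rule as a commutator; it yields the commutation of a derivative with functions
independent of its variable. -/
theorem pdOp_mulOp (hΩ : IsOpen Ω) (i : ι) {h : (ι → ℂ) → ℂ} (hh : AnalyticOnNhd ℂ h Ω) :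
    pdOp hΩ i * mulOp h hh = mulOp h hh * pdOp hΩ i +
      mulOp (pd i h) (fun z hz => analyticAt_pd (hh z hz)) := by
  refine LinearMap.ext fun f => Hol.ext_on fun z hz => ?_
  change (pdOp hΩ i (mulOp h hh f)).1 z = h z * (pdOp hΩ i f).1 z + pd i h z * f.1 z
  rw [pdOp_apply hΩ _ _ hz, pdOp_apply hΩ _ _ hz]
  have := pd_mul (i := i) ((hh z hz).differentiableAt) (Hol.diff f hz)
  change pd i (fun z => h z * f.1 z) z = _
  rw [this]; ring

theorem pdOp_mulOp_commute (hΩ : IsOpen Ω) (i : ι) {h : (ι → ℂ) → ℂ} (hh : AnalyticOnNhd ℂ h Ω)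
    (h0 : ∀ z ∈ Ω, pd i h z = 0) : Commute (pdOp hΩ i) (mulOp h hh) := by
  refine LinearMap.ext fun f => Hol.ext_on fun z hz => ?_
  have := congrArg (fun T : Module.End ℂ (Hol Ω) => (T f).1 z) (pdOp_mulOp hΩ i hh)
  refine this.trans ?_
  change _ + pd i h z * f.1 z = _
  rw [h0 z hz, zero_mul, add_zero]

end Holomorphic

end TrigBA

end

noncomputable section

namespace TrigBA

/-! ### Rational trigonometric functions carrying a leading term in the parameters and a chamber
limit. -/

section RationalClass

variable {ι κ : Type*} [Fintype ι] [DecidableEq ι]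

/-- The partial sum of an exponent vector over the coordinates of colour at most `j`. -/
def psum (col : ι → ℕ) (a : ι → ℤ) (j : ℕ) : ℤ := ∑ i, if col i ≤ j then a i else 0

/-- Exponents in the negative cone. -/
def NegCone (col : ι → ℕ) (a : ι → ℤ) : Prop := (∀ j, psum col a j ≤ 0) ∧ ∑ i, a i = 0

/-- Exponents in the lineality face of the negative cone. -/
def Level (col : ι → ℕ) (a : ι → ℤ) : Prop := ∀ j, psum col a j = 0

/-- The points where coordinates of different colours do not collide. -/
def dom (col : ι → ℕ) : Set (ι → ℂ) :=
  {z | ∀ i j, col i < col j → Complex.exp (-2 * (z i - z j)) ≠ 1}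

/-- The real exponential with integer exponent vector. -/
def exz (a : ι → ℤ) (z : ι → ℂ) : ℂ := ex (fun i => (a i : ℂ)) z

/-- The exponent vector `-2 (e_i - e_j)`. -/
def rootExp (i j : ι) : ι → ℤ := fun l => -2 * ((if l = i then 1 else 0) - (if l = j then 1 else 0))

theorem exz_rootExp (i j : ι) (z : ι → ℂ) :
    exz (rootExp i j) z = Complex.exp (-2 * (z i - z j)) := by
  unfold exz ex rootExp
  congr 1
  push_cast
  simp only [mul_assoc, sub_mul, mul_sub, Finset.sum_sub_distrib, ← Finset.mul_sum]
  simp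

theorem exz_add (a b : ι → ℤ) (z : ι → ℂ) : exz (a + b) z = exz a z * exz b z := by
  unfold exz
  rw [← ex_add]
  congr 1
  ext i
  simp

theorem exz_zero (z : ι → ℂ) : exz (0 : ι → ℤ) z = 1 := by
  simp [exz, ex]

theorem psum_rootExp (col : ι → ℕ) (i j : ι) (n : ℕ) : psum col (rootExp i j) n =
    -2 * ((if col i ≤ n then 1 else 0) - (if col j ≤ n then 1 else 0)) := by
  unfold psum rootExp
  simp only [← mul_ite_zero, ← Finset.mul_sum]
  congr 1
  have : ∀ l : ι, (if col l ≤ n then (((if l = i then 1 else 0) - (if l = j then 1 else 0)) : ℤ) else 0) =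
      (if l = i then (if col l ≤ n then 1 else 0) else 0) -
      (if l = j then (if col l ≤ n then 1 else 0) else 0) := by
    intro l; split_ifs <;> simp
  rw [Finset.sum_congr rfl fun l _ => this l, Finset.sum_sub_distrib]
  simp

theorem negCone_rootExp {col : ι → ℕ} {i j : ι} (h : col i < col j) :
    NegCone col (rootExp i j) := by
  constructor
  · intro n
    rw [psum_rootExp]
    split_ifs <;> omega
  · unfold rootExp
    rw [← Finset.mul_sum, Finset.sum_sub_distrib]
    simp

theorem not_level_rootExp {col : ι → ℕ} {i j : ι} (h : col i < col j) :
    ¬ Level col (rootExp i j) := by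
  intro hl
  have := hl (col i)
  rw [psum_rootExp, if_pos le_rfl, if_neg (by omega)] at this
  omega

theorem psum_zero (col : ι → ℕ) (j : ℕ) : psum col 0 j = 0 := by simp [psum]

theorem level_zero (col : ι → ℕ) : Level col 0 := psum_zero col

theorem negCone_zero (col : ι → ℕ) : NegCone col 0 := ⟨fun j => (psum_zero col j).le, by simp⟩

theorem isOpen_dom (col : ι → ℕ) : IsOpen (dom col) := by
  have : dom col = ⋂ i, ⋂ j, ⋂ (_ : col i < col j), {z | Complex.exp (-2 * (z i - z j)) ≠ 1} := by
    ext z; simp [dom]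
  rw [this]
  refine isOpen_iInter_of_finite fun i => isOpen_iInter_of_finite fun j =>
    isOpen_iInter_of_finite fun _ => ?_
  exact isOpen_ne_fun (by fun_prop) continuous_const

open Classical in
/-- Rational trigonometric functions of `z`, polynomial in the parameters `ν` of degree at most
the index, together with their leading term in `ν` and their limit in the Weyl chamber. -/
inductive RT (col : ι → ℕ) : ℕ → ((ι → ℂ) → (κ → ℂ) → ℂ) → ((ι → ℂ) → (κ → ℂ) → ℂ) →
    ((ι → ℂ) → (κ → ℂ) → ℂ) → Prop
  | mono (a : ι → ℤ) (p : MvPolynomial κ ℂ) (d : ℕ) (ha : NegCone col a) (hp : p.totalDegree ≤ d) :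
      RT col d (fun z ν => MvPolynomial.eval ν p * exz a z)
        (fun z ν => MvPolynomial.eval ν (MvPolynomial.homogeneousComponent d p) * exz a z)
        (fun z ν => if Level col a then MvPolynomial.eval ν p * exz a z else 0)
  | inv (i j : ι) (h : col i < col j) :
      RT col 0 (fun z _ => (1 - Complex.exp (-2 * (z i - z j)))⁻¹)
        (fun z _ => (1 - Complex.exp (-2 * (z i - z j)))⁻¹) (fun _ _ => 1)
  | add {d f ft fl g gt gl} (hf : RT col d f ft fl) (hg : RT col d g gt gl) :
      RT col d (fun z ν => f z ν + g z ν) (fun z ν => ft z ν + gt z ν) (fun z ν => fl z ν + gl z ν)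
  | mul {d e f ft fl g gt gl} (hf : RT col d f ft fl) (hg : RT col e g gt gl) :
      RT col (d + e) (fun z ν => f z ν * g z ν) (fun z ν => ft z ν * gt z ν)
        (fun z ν => fl z ν * gl z ν)
  | congr {d f ft fl g gt gl} (hf : RT col d f ft fl) (h : ∀ z ∈ dom col, ∀ ν, g z ν = f z ν)
      (ht : ∀ z ∈ dom col, ∀ ν, gt z ν = ft z ν) (hl : ∀ z ∈ dom col, ∀ ν, gl z ν = fl z ν) :
      RT col d g gt gl

namespace RT

variable {col : ι → ℕ} {d e : ℕ} {f ft fl g gt gl : (ι → ℂ) → (κ → ℂ) → ℂ}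

theorem poly (p : MvPolynomial κ ℂ) (hp : p.totalDegree ≤ d) :
    RT col d (fun _ ν => MvPolynomial.eval ν p)
      (fun _ ν => MvPolynomial.eval ν (MvPolynomial.homogeneousComponent d p))
      (fun _ ν => MvPolynomial.eval ν p) := by
  refine (mono 0 p d (negCone_zero col) hp).congr ?_ ?_ ?_ <;> intro z _ ν <;>
    simp [exz_zero, level_zero]

theorem const (c : ℂ) : RT (κ := κ) col 0 (fun _ _ => c) (fun _ _ => c) (fun _ _ => c) := by
  refine (poly (MvPolynomial.C c) (by simp)).congr ?_ ?_ ?_ <;> intro z _ ν <;> simp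

theorem const_mul (c : ℂ) (hf : RT col d f ft fl) :
    RT col d (fun z ν => c * f z ν) (fun z ν => c * ft z ν) (fun z ν => c * fl z ν) := by
  have := (const (κ := κ) (col := col) c).mul hf
  rwa [zero_add] at this

/-- Counted with degree `d + 1` the function has no leading term. This is how terms of lower degree
in `ν` drop out of the leading term in `TwData.step`. -/
theorem raise (hf : RT col d f ft fl) : RT col (d + 1) f (fun _ _ => 0) fl := by
  refine (hf.mul (poly (d := 1) (1 : MvPolynomial κ ℂ) (by simp))).congr ?_ ?_ ?_ <;>
    intro z _ ν
  · simp
  · rw [MvPolynomial.homogeneousComponent_eq_zero _ _ (by simp)]; simp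
  · simp

theorem expo (a : ι → ℤ) (ha : Level col a) (hs : ∑ i, a i = 0) :
    RT (κ := κ) col 0 (fun z _ => exz a z) (fun z _ => exz a z) (fun z _ => exz a z) := by
  refine (mono a (1 : MvPolynomial κ ℂ) 0 ⟨fun j => (ha j).le, hs⟩ (by simp)).congr ?_ ?_ ?_ <;>
    intro z _ ν
  · simp
  · have : MvPolynomial.homogeneousComponent 0 (1 : MvPolynomial κ ℂ) = 1 := by
      simp
    rw [this]; simp
  · simp [ha]

theorem prod {α : Type*} (s : Finset α) {F Ft Fl : α → (ι → ℂ) → (κ → ℂ) → ℂ}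
    (h : ∀ a ∈ s, RT col 0 (F a) (Ft a) (Fl a)) :
    RT col 0 (fun z ν => ∏ a ∈ s, F a z ν) (fun z ν => ∏ a ∈ s, Ft a z ν)
      (fun z ν => ∏ a ∈ s, Fl a z ν) := by
  classical
  induction s using Finset.induction_on with
  | empty => simp only [Finset.prod_empty]; exact const (κ := κ) (col := col) 1
  | insert a s ha ih =>
    simp only [Finset.prod_insert ha]
    exact (h a (Finset.mem_insert_self _ _)).mul
      (ih fun b hb => h b (Finset.mem_insert_of_mem hb))

theorem pow (n : ℕ) (hf : RT col 0 f ft fl) : RT col 0 (fun z ν => f z ν ^ n)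
    (fun z ν => ft z ν ^ n) (fun z ν => fl z ν ^ n) := by
  have := prod (Finset.range n) (fun _ _ => hf)
  simpa using this

/-- A factor `1 - exp (-2 (z_i - z_j))`. -/
theorem fac (i j : ι) (h : col i < col j) :
    RT (κ := κ) col 0 (fun z _ => 1 - Complex.exp (-2 * (z i - z j)))
      (fun z _ => 1 - Complex.exp (-2 * (z i - z j))) (fun _ _ => 1) := by
  refine ((const (κ := κ) 1).add (mono (rootExp i j) (MvPolynomial.C (-1) : MvPolynomial κ ℂ) 0
    (negCone_rootExp h) (by simp))).congr ?_ ?_ ?_ <;> intro z _ ν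
  · simp [exz_rootExp, sub_eq_add_neg]
  · have : MvPolynomial.homogeneousComponent 0 (MvPolynomial.C (-1) : MvPolynomial κ ℂ) =
        MvPolynomial.C (-1) := by simp
    rw [this]; simp [exz_rootExp, sub_eq_add_neg]
  · simp [not_level_rootExp h]

theorem analytic (hf : RT col d f ft fl) (ν : κ → ℂ) :
    AnalyticOnNhd ℂ (fun z => f z ν) (dom col) ∧ AnalyticOnNhd ℂ (fun z => ft z ν) (dom col) ∧
      AnalyticOnNhd ℂ (fun z => fl z ν) (dom col) := by
  induction hf with
  | mono a p d ha hp =>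
    refine ⟨fun z _ => analyticAt_const.mul (analyticAt_ex _ z),
      fun z _ => analyticAt_const.mul (analyticAt_ex _ z), fun z _ => ?_⟩
    by_cases hl : Level col a
    · simp only [hl, if_true]; exact analyticAt_const.mul (analyticAt_ex _ z)
    · simp only [hl, if_false]; exact analyticAt_const
  | inv i j h =>
    have : AnalyticOnNhd ℂ (fun z : ι → ℂ => (1 - Complex.exp (-2 * (z i - z j)))⁻¹) (dom col) := by
      intro z hz
      have h1 : AnalyticAt ℂ (exz (rootExp i j)) z := analyticAt_ex _ z
      rw [show exz (rootExp i j) = _ from funext (exz_rootExp i j)] at h1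
      exact (analyticAt_const.sub h1).inv (sub_ne_zero.2 (hz i j h).symm)
    exact ⟨this, this, fun _ _ => analyticAt_const⟩
  | add _ _ h1 h2 => exact ⟨h1.1.add h2.1, h1.2.1.add h2.2.1, h1.2.2.add h2.2.2⟩
  | mul _ _ h1 h2 => exact ⟨h1.1.mul h2.1, h1.2.1.mul h2.2.1, h1.2.2.mul h2.2.2⟩
  | congr _ h ht hl ih =>
    have key : ∀ {F G : (ι → ℂ) → (κ → ℂ) → ℂ}, (∀ z ∈ dom col, ∀ ν, G z ν = F z ν) →
        AnalyticOnNhd ℂ (fun z => F z ν) (dom col) → AnalyticOnNhd ℂ (fun z => G z ν) (dom col) := by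
      intro F G hFG hF z hz
      refine (hF z hz).congr ?_
      filter_upwards [(isOpen_dom col).mem_nhds hz] with w hw
      exact (hFG w hw ν).symm
    exact ⟨key h ih.1, key ht ih.2.1, key hl ih.2.2⟩

/-- Leading term and limit are differentiated along with the function. For an inverse factor the
derivative carries the decaying monomial `rootExp`, so its limit is `0`, in accordance with the
constant limit `1` of the factor. -/
theorem pd (i : ι) (hf : RT col d f ft fl) :
    RT col d (fun z ν => TrigBA.pd i (fun z => f z ν) z) (fun z ν => TrigBA.pd i (fun z => ft z ν) z)
      (fun z ν => TrigBA.pd i (fun z => fl z ν) z) := by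
  have hexz : ∀ (a : ι → ℤ) z, TrigBA.pd i (fun z => exz a z) z = a i * exz a z := fun a z => pd_ex _ i z
  induction hf with
  | mono a p d ha hp =>
    refine (mono a ((a i : ℂ) • p) d ha ((MvPolynomial.totalDegree_smul_le _ _).trans hp)).congr
      ?_ ?_ ?_ <;> intro z _ ν
    · rw [pd_const_mul, hexz, MvPolynomial.smul_eval]; ring
    · rw [pd_const_mul, hexz, map_smul, MvPolynomial.smul_eval]; ring
    · by_cases hl : Level col a
      · simp only [hl, if_true]; rw [pd_const_mul, hexz, MvPolynomial.smul_eval]; ring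
      · simp only [hl, if_false]; rw [pd_const]
  | inv l j h =>
    have e : ∀ z ∈ dom col, TrigBA.pd i (fun z : ι → ℂ => (1 - Complex.exp (-2 * (z l - z j)))⁻¹) z =
        (-(-(rootExp l j i : ℂ))) * exz (rootExp l j) z *
          ((1 - Complex.exp (-2 * (z l - z j)))⁻¹ * (1 - Complex.exp (-2 * (z l - z j)))⁻¹) := by
      intro z hz
      have hd : DifferentiableAt ℂ (fun z : ι → ℂ => exz (rootExp l j) z) z :=
        (analyticAt_ex _ z).differentiableAt
      have := pd_inv (i := i) (f := fun z : ι → ℂ => 1 - exz (rootExp l j) z) (z := z)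
        ((differentiableAt_const _).sub hd)
        (by rw [exz_rootExp]; exact sub_ne_zero.2 (hz l j h).symm)
      rw [pd_sub (differentiableAt_const _) hd, pd_const, hexz] at this
      simp only [← exz_rootExp]
      rw [this, zero_sub, div_eq_mul_inv, sq, mul_inv]
      ring
    refine (((mono (rootExp l j) (MvPolynomial.C (-(-(rootExp l j i : ℂ))) : MvPolynomial κ ℂ) 0
      (negCone_rootExp h) (MvPolynomial.totalDegree_C _).le).mul ((inv l j h).mul (inv l j h)))).congr ?_ ?_ ?_ <;>
      intro z hz ν
    · rw [e z hz, MvPolynomial.eval_C]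
    · rw [e z hz, MvPolynomial.homogeneousComponent_zero, MvPolynomial.coeff_zero_C,
        MvPolynomial.eval_C]
    · rw [pd_const, if_neg (not_level_rootExp h), zero_mul]
  | add h1 h2 ih1 ih2 =>
    refine (ih1.add ih2).congr ?_ ?_ ?_ <;> intro z hz ν
    · exact pd_add ((h1.analytic ν).1 z hz).differentiableAt ((h2.analytic ν).1 z hz).differentiableAt
    · exact pd_add ((h1.analytic ν).2.1 z hz).differentiableAt
        ((h2.analytic ν).2.1 z hz).differentiableAt
    · exact pd_add ((h1.analytic ν).2.2 z hz).differentiableAt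
        ((h2.analytic ν).2.2 z hz).differentiableAt
  | mul h1 h2 ih1 ih2 =>
    refine ((ih1.mul h2).add (h1.mul ih2)).congr ?_ ?_ ?_ <;> intro z hz ν
    · exact pd_mul ((h1.analytic ν).1 z hz).differentiableAt ((h2.analytic ν).1 z hz).differentiableAt
    · exact pd_mul ((h1.analytic ν).2.1 z hz).differentiableAt
        ((h2.analytic ν).2.1 z hz).differentiableAt
    · exact pd_mul ((h1.analytic ν).2.2 z hz).differentiableAt
        ((h2.analytic ν).2.2 z hz).differentiableAt
  | congr _ h ht hl ih =>
    refine ih.congr ?_ ?_ ?_ <;> intro z hz ν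
    · exact pd_congr_on (isOpen_dom col) i (fun w hw => h w hw ν) hz
    · exact pd_congr_on (isOpen_dom col) i (fun w hw => ht w hw ν) hz
    · exact pd_congr_on (isOpen_dom col) i (fun w hw => hl w hw ν) hz

end RT

end RationalClass

end TrigBA

end

noncomputable section

namespace TrigBA

/-! ### Meaning of the leading term and of the chamber limit; change of variables. -/

theorem homogeneousComponent_rename {κ κ' : Type*} (π : κ → κ') (d : ℕ) (p : MvPolynomial κ ℂ) :
    MvPolynomial.homogeneousComponent d (MvPolynomial.rename π p) =
      MvPolynomial.rename π (MvPolynomial.homogeneousComponent d p) := by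
  conv_lhs => rw [← MvPolynomial.sum_homogeneousComponent p]
  rw [map_sum, map_sum]
  have h : ∀ i, MvPolynomial.homogeneousComponent d
      (MvPolynomial.rename π (MvPolynomial.homogeneousComponent i p)) =
      if i = d then MvPolynomial.rename π (MvPolynomial.homogeneousComponent d p) else 0 := by
    intro i
    have hh : (MvPolynomial.rename π (MvPolynomial.homogeneousComponent i p)).IsHomogeneous i :=
      (MvPolynomial.homogeneousComponent_isHomogeneous i p).rename_isHomogeneous
    rw [MvPolynomial.homogeneousComponent_of_mem
      ((MvPolynomial.mem_homogeneousSubmodule _ _).2 hh)]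
    by_cases hi : i = d
    · subst hi; simp
    · simp [hi, Ne.symm hi]
  rw [Finset.sum_congr rfl fun i _ => h i]
  rw [Finset.sum_ite_eq']
  split_ifs with h1
  · rfl
  · rw [MvPolynomial.homogeneousComponent_eq_zero _ _ (by simpa using h1), map_zero]

theorem eval_homogeneous_mul {κ : Type*} {p : MvPolynomial κ ℂ} {i : ℕ} (hp : p.IsHomogeneous i)
    (t : ℂ) (ν : κ → ℂ) :
    MvPolynomial.eval (fun j => t * ν j) p = t ^ i * MvPolynomial.eval ν p := by
  rw [MvPolynomial.eval_eq, MvPolynomial.eval_eq, Finset.mul_sum]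
  refine Finset.sum_congr rfl fun m hm => ?_
  have hd : m.degree = i := by
    have := hp (MvPolynomial.mem_support_iff.1 hm)
    rw [Finsupp.degree_eq_weight_one]
    exact this
  simp only [mul_pow, Finset.prod_mul_distrib, Finset.prod_pow_eq_pow_sum]
  rw [← hd, Finsupp.degree_apply]
  ring

/-- Each component of degree `i` scales by `t ^ i`, so division by `t ^ d` leaves only the top one.
Leading terms thus become limits, which can be compared between different expressions of the same
function. -/
theorem tendsto_top_eval {κ : Type*} (p : MvPolynomial κ ℂ) {d : ℕ} (hp : p.totalDegree ≤ d)
    (ν : κ → ℂ) :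
    Tendsto (fun t : ℝ => ((t : ℂ) ^ d)⁻¹ * MvPolynomial.eval (fun i => (t : ℂ) * ν i) p) atTop
      (𝓝 (MvPolynomial.eval ν (MvPolynomial.homogeneousComponent d p))) := by
  have hsum : p = ∑ i ∈ Finset.range (d + 1), MvPolynomial.homogeneousComponent i p := by
    conv_lhs => rw [← MvPolynomial.sum_homogeneousComponent p]
    apply Finset.sum_subset
    · intro i; simp; omega
    · intro i _ hi
      exact MvPolynomial.homogeneousComponent_eq_zero _ _ (by simpa using hi)
  have hev : ∀ (t : ℝ), MvPolynomial.eval (fun i => (t : ℂ) * ν i) p =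
      ∑ i ∈ Finset.range (d + 1), (t : ℂ) ^ i *
        MvPolynomial.eval ν (MvPolynomial.homogeneousComponent i p) := by
    intro t
    conv_lhs => rw [hsum]
    rw [map_sum]
    exact Finset.sum_congr rfl fun i _ =>
      eval_homogeneous_mul (MvPolynomial.homogeneousComponent_isHomogeneous i p) _ _
  simp only [hev, Finset.mul_sum]
  rw [← zero_add (MvPolynomial.eval ν (MvPolynomial.homogeneousComponent d p))]
  simp only [Finset.sum_range_succ]
  refine Tendsto.add ?_ ?_
  · rw [← Finset.sum_const_zero (s := Finset.range d)]
    refine tendsto_finsetSum _ fun i hi => ?_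
    have hid : i < d := Finset.mem_range.1 hi
    have h1 : Tendsto (fun t : ℝ => ((t ^ (d - i))⁻¹ : ℝ)) atTop (𝓝 0) :=
      tendsto_inv_atTop_zero.comp (tendsto_pow_atTop (by omega))
    have h2 : Tendsto (fun t : ℝ => (((t ^ (d - i))⁻¹ : ℝ) : ℂ)) atTop (𝓝 0) := by
      have := (Complex.continuous_ofReal.tendsto 0).comp h1
      rwa [Complex.ofReal_zero] at this
    have h3 := h2.mul_const (MvPolynomial.eval ν (MvPolynomial.homogeneousComponent i p))
    rw [zero_mul] at h3
    refine h3.congr' ?_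
    filter_upwards [eventually_gt_atTop 0] with t ht
    have ht' : (t : ℂ) ≠ 0 := by exact_mod_cast ht.ne'
    rw [← mul_assoc]
    congr 1
    push_cast
    rw [show d = (d - i) + i by omega, pow_add, Nat.add_sub_cancel]
    field_simp
  · refine tendsto_const_nhds.congr' ?_
    filter_upwards [eventually_gt_atTop 0] with t ht
    have ht' : (t : ℂ) ≠ 0 := by exact_mod_cast ht.ne'
    rw [← mul_assoc, inv_mul_cancel₀ (pow_ne_zero _ ht'), one_mul]

section

variable {ι κ : Type*} [Fintype ι] [DecidableEq ι]

/-- A family of points moving to infinity in the chamber of `col`, with the coordinate differences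
inside each colour class given by the point `z₀`. -/
structure ChamberLim {α : Type*} (col : ι → ℕ) (l : Filter α) (X : α → ι → ℂ) (z₀ : ι → ℂ) :
    Prop where
  dom_ev : ∀ᶠ t in l, X t ∈ dom col
  dom_mem : z₀ ∈ dom col
  level : ∀ a, Level col a → ∑ i, a i = 0 → ∀ᶠ t in l, exz a (X t) = exz a z₀
  decay : ∀ a, NegCone col a → ¬ Level col a → Tendsto (fun t => exz a (X t)) l (𝓝 0)

namespace RT

variable {col : ι → ℕ} {d e : ℕ} {f ft fl g gt gl : (ι → ℂ) → (κ → ℂ) → ℂ}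

theorem tendsto_top (hf : RT col d f ft fl) : ∀ z ∈ dom col, ∀ ν,
    Tendsto (fun t : ℝ => ((t : ℂ) ^ d)⁻¹ * f z (fun i => (t : ℂ) * ν i)) atTop (𝓝 (ft z ν)) := by
  induction hf with
  | mono a p d ha hp =>
    intro z _ ν
    simp only [← mul_assoc]
    exact (tendsto_top_eval p hp ν).mul_const _
  | inv i j h => intro z _ ν; simp
  | add _ _ h1 h2 =>
    intro z hz ν
    simp only [mul_add]
    exact (h1 z hz ν).add (h2 z hz ν)
  | mul _ _ h1 h2 =>
    intro z hz ν
    refine ((h1 z hz ν).mul (h2 z hz ν)).congr fun t => ?_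
    rw [pow_add, mul_inv]; ring
  | congr _ h ht _ ih =>
    intro z hz ν
    rw [ht z hz]
    simp only [h z hz]
    exact ih z hz ν

/-- Monomials on the face `Level` are eventually constant with their value at `z₀`, and all other
monomials of the cone decay. -/
theorem tendsto_limit {α : Type*} {l : Filter α} {X : α → ι → ℂ} {z₀ : ι → ℂ}
    (hX : ChamberLim col l X z₀) (hf : RT col d f ft fl) (ν : κ → ℂ) :
    Tendsto (fun t => f (X t) ν) l (𝓝 (fl z₀ ν)) := by
  induction hf with
  | mono a p d ha hp =>
    by_cases hl : Level col a
    · simp only [hl, if_true]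
      refine tendsto_const_nhds.congr' ?_
      filter_upwards [hX.level a hl ha.2] with t ht
      rw [ht]
    · simp only [hl, if_false]
      simpa using (hX.decay a ha hl).const_mul (MvPolynomial.eval ν p)
  | inv i j h =>
    have := hX.decay _ (negCone_rootExp h) (not_level_rootExp h)
    simp only [exz_rootExp] at this
    simpa using (tendsto_const_nhds (x := (1 : ℂ))).sub this |>.inv₀ (by simp)
  | add _ _ h1 h2 => exact h1.add h2
  | mul _ _ h1 h2 => exact h1.mul h2
  | congr _ h _ hl ih =>
    rw [hl _ hX.dom_mem]
    refine ih.congr' ?_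
    filter_upwards [hX.dom_ev] with t ht
    exact (h _ ht ν).symm

/-- Exponent vectors are summed over the fibres of `ρ`; since colours are respected, partial sums by
colour do not change. Used to view a function of `y` on all the variables, and to restrict to the
diagonal `y_i = x_i`. -/
theorem pullback {ι' κ' : Type*} [Fintype ι'] [DecidableEq ι'] {col' : ι' → ℕ} (ρ : ι → ι')
    (π : κ → κ') (hρ : ∀ i, col' (ρ i) = col i) (hf : RT col d f ft fl) :
    RT col' d (fun z ν => f (fun i => z (ρ i)) (fun i => ν (π i)))
      (fun z ν => ft (fun i => z (ρ i)) (fun i => ν (π i)))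
      (fun z ν => fl (fun i => z (ρ i)) (fun i => ν (π i))) := by
  have hdom : ∀ z ∈ dom col', (fun i => z (ρ i)) ∈ dom col := fun z hz i j hij =>
    hz _ _ (by rw [hρ, hρ]; exact hij)
  -- Pairing with `φ = 1` gives the total sum of the pushed exponent, and with the indicator of a
  -- set of colours its partial sums.
  have hsum : ∀ (a : ι → ℤ) (φ : ι' → ℤ),
      ∑ i', φ i' * (∑ i, if ρ i = i' then a i else 0) = ∑ i, φ (ρ i) * a i := by
    intro a φ
    simp only [Finset.mul_sum, mul_ite, mul_zero]
    rw [Finset.sum_comm]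
    refine Finset.sum_congr rfl fun i _ => ?_
    simp
  have hps : ∀ (a : ι → ℤ) j, psum col' (fun i' => ∑ i, if ρ i = i' then a i else 0) j =
      psum col a j := by
    intro a j
    unfold psum
    have := hsum a (fun i' => if col' i' ≤ j then 1 else 0)
    simpa [hρ] using this
  have hex : ∀ (a : ι → ℤ) (z : ι' → ℂ), exz (fun i' => ∑ i, if ρ i = i' then a i else 0) z =
      exz a (fun i => z (ρ i)) := by
    intro a z
    unfold exz ex
    congr 1
    push_cast
    simp only [Finset.sum_mul, ite_mul, zero_mul]
    rw [Finset.sum_comm]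
    refine Finset.sum_congr rfl fun i _ => ?_
    simp
  have hlev : ∀ (a : ι → ℤ), Level col' (fun i' => ∑ i, if ρ i = i' then a i else 0) ↔
      Level col a := fun a => by simp only [Level, hps]
  induction hf with
  | mono a p d ha hp =>
    refine (mono (fun i' => ∑ i, if ρ i = i' then a i else 0) (MvPolynomial.rename π p) d ⟨?_, ?_⟩
      ((MvPolynomial.totalDegree_rename_le _ _).trans hp)).congr ?_ ?_ ?_
    · intro j; rw [hps]; exact ha.1 j
    · have := hsum a (fun _ => 1)
      simp only [one_mul] at this
      rw [this]; exact ha.2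
    · intro z _ ν; rw [hex, MvPolynomial.eval_rename]; rfl
    · intro z _ ν; rw [hex, homogeneousComponent_rename, MvPolynomial.eval_rename]; rfl
    · intro z _ ν
      rw [hex, MvPolynomial.eval_rename]
      beta_reduce
      by_cases hl : Level col a
      · rw [if_pos hl, if_pos ((hlev a).2 hl)]; rfl
      · rw [if_neg hl, if_neg fun h => hl ((hlev a).1 h)]
  | inv i j h => exact inv (ρ i) (ρ j) (by rw [hρ, hρ]; exact h)
  | add _ _ h1 h2 => exact h1.add h2
  | mul _ _ h1 h2 => exact h1.mul h2
  | congr _ h ht hl ih =>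
    exact ih.congr (fun z hz ν => h _ (hdom z hz) _) (fun z hz ν => ht _ (hdom z hz) _)
      (fun z hz ν => hl _ (hdom z hz) _)

end RT

end

/-- The open ray through `ζ` stays away from `1`: a non-positive real `ζ` gives distance at least
`1`, and otherwise `|Im ζ| / ‖ζ‖` is the distance from `1` to the real line spanned by `ζ`. -/
theorem exists_pos_le_norm_one_sub {ζ : ℂ} (hζ : ∀ r : ℝ, 0 < r → ζ ≠ r) :
    ∃ c : ℝ, 0 < c ∧ ∀ r : ℝ, 0 < r → c ≤ ‖1 - r * ζ‖ := by
  by_cases him : ζ.im = 0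
  · refine ⟨1, one_pos, fun r hr => ?_⟩
    have hre : ζ.re ≤ 0 := by
      by_contra h
      push Not at h
      exact hζ ζ.re h (Complex.ext (by simp) (by simp [him]))
    refine le_trans ?_ (Complex.re_le_norm _)
    simp only [Complex.sub_re, Complex.one_re, Complex.mul_re, Complex.ofReal_re,
      Complex.ofReal_im, zero_mul, sub_zero]
    nlinarith
  · have hn : 0 < ‖ζ‖ := norm_pos_iff.2 fun h => him (by simp [h])
    refine ⟨|ζ.im| / ‖ζ‖, div_pos (abs_pos.2 him) hn, fun r hr => ?_⟩
    rw [div_le_iff₀ hn, ← norm_mul]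
    have e : |ζ.im| = |((1 - r * ζ) * (starRingEnd ℂ) ζ).im| := by
      rw [← abs_neg]
      congr 1
      simp only [Complex.mul_im, Complex.sub_re, Complex.sub_im, Complex.one_re, Complex.one_im,
        Complex.conj_re, Complex.conj_im, Complex.mul_re, Complex.ofReal_re, Complex.ofReal_im]
      ring
    rw [e]
    refine (Complex.abs_im_le_norm _).trans ?_
    rw [norm_mul, norm_mul, Complex.norm_conj]

/-! ### Exponential bounds under negative real shifts. -/

section

variable {ι κ : Type*} [Fintype ι] [DecidableEq ι] [Fintype κ]

/-- The points for which the negative real shifts stay in the domain. -/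
def Slit (col : ι → ℕ) : Set (ι → ℂ) :=
  {X | ∀ i j, col i < col j → ∀ r : ℝ, 0 < r → Complex.exp (-2 * (X i - X j)) ≠ r}

theorem exp_sub_shift (X : ι → ℂ) (S : ι → ℝ) (i j : ι) :
    Complex.exp (-2 * ((X i - S i) - (X j - S j))) =
      (Real.exp (2 * (S i - S j)) : ℂ) * Complex.exp (-2 * (X i - X j)) := by
  rw [Complex.ofReal_exp, ← Complex.exp_add]
  congr 1
  push_cast
  ring

theorem Slit.shift_mem {col : ι → ℕ} {X : ι → ℂ} (hX : X ∈ Slit col) (S : ι → ℝ) :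
    (fun i => X i - (S i : ℂ)) ∈ dom col := by
  intro i j hij h
  simp only [exp_sub_shift] at h
  refine hX i j hij (Real.exp (-(2 * (S i - S j)))) (Real.exp_pos _) ?_
  rw [Real.exp_neg, Complex.ofReal_inv]
  exact (eq_inv_of_mul_eq_one_right h)

/-- Monomials grow at most exponentially in the shift, and inverse factors stay bounded on the slit
domain. The rate `L` is fixed before `X`, `ρ` and `ν`; this is why the final `R` depends only on `k`
and `m`. -/
theorem RT.bound {col : ι → ℕ} {d : ℕ} {f ft fl : (ι → ℂ) → (κ → ℂ) → ℂ} (hf : RT col d f ft fl) :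
    ∃ L : ℝ, ∀ X ∈ Slit col, ∀ ρ : ℝ, ∃ C : ℝ, 0 ≤ C ∧ ∀ ν : κ → ℂ, ‖ν‖ ≤ ρ → ∀ S : ι → ℝ,
      (∀ i, 0 ≤ S i) → ‖f (fun i => X i - (S i : ℂ)) ν‖ ≤ C * Real.exp (L * ∑ i, S i) := by
  induction hf with
  | mono a p d ha hp =>
    refine ⟨∑ i, |(a i : ℝ)|, fun X _ ρ => ?_⟩
    obtain ⟨C, hC⟩ := (isCompact_closedBall (0 : κ → ℂ) ρ).exists_bound_of_continuousOn
      (f := fun ν => MvPolynomial.eval ν p) (MvPolynomial.continuous_eval p).continuousOn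
    refine ⟨|C| * ‖exz a X‖, by positivity, fun ν hν S hS => ?_⟩
    have hCν : ‖MvPolynomial.eval ν p‖ ≤ |C| :=
      (hC ν (by simpa using hν)).trans (le_abs_self C)
    have e : exz a (fun i => X i - (S i : ℂ)) = exz a X * (Real.exp (-∑ i, (a i : ℝ) * S i) : ℂ) := by
      unfold exz ex
      rw [Complex.ofReal_exp, ← Complex.exp_add]
      congr 1
      push_cast
      simp only [mul_sub, Finset.sum_sub_distrib]
      ring
    change ‖MvPolynomial.eval ν p * exz a (fun i => X i - (S i : ℂ))‖ ≤ _
    rw [e, norm_mul, norm_mul]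
    have h2 : ‖(Real.exp (-∑ i, (a i : ℝ) * S i) : ℂ)‖ ≤
        Real.exp ((∑ i, |(a i : ℝ)|) * ∑ i, S i) := by
      rw [Complex.norm_real, Real.norm_eq_abs, abs_of_pos (Real.exp_pos _), Real.exp_le_exp,
        ← Finset.sum_neg_distrib, Finset.mul_sum]
      refine Finset.sum_le_sum fun i _ => ?_
      have h3 : |(a i : ℝ)| ≤ ∑ i, |(a i : ℝ)| :=
        Finset.single_le_sum (f := fun i => |(a i : ℝ)|) (fun i _ => abs_nonneg _)
          (Finset.mem_univ i)
      have h4 : -(a i : ℝ) ≤ |(a i : ℝ)| := neg_le_abs _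
      rw [← neg_mul]
      exact mul_le_mul_of_nonneg_right (h4.trans h3) (hS i)
    rw [mul_assoc]
    gcongr
  | inv i j h =>
    refine ⟨0, fun X hX ρ => ?_⟩
    obtain ⟨c, hc, hb⟩ := exists_pos_le_norm_one_sub (hX i j h)
    refine ⟨c⁻¹, by positivity, fun ν _ S _ => ?_⟩
    rw [zero_mul, Real.exp_zero, mul_one, norm_inv, exp_sub_shift]
    exact inv_anti₀ hc (hb _ (Real.exp_pos _))
  | add _ _ h1 h2 =>
    obtain ⟨L1, h1⟩ := h1
    obtain ⟨L2, h2⟩ := h2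
    refine ⟨max L1 L2, fun X hX ρ => ?_⟩
    obtain ⟨C1, hC1, h1⟩ := h1 X hX ρ
    obtain ⟨C2, hC2, h2⟩ := h2 X hX ρ
    refine ⟨C1 + C2, by positivity, fun ν hν S hS => ?_⟩
    have hs : 0 ≤ ∑ i, S i := Finset.sum_nonneg fun i _ => hS i
    refine (norm_add_le _ _).trans ?_
    rw [add_mul]
    refine add_le_add ((h1 ν hν S hS).trans ?_) ((h2 ν hν S hS).trans ?_) <;>
      gcongr <;> simp
  | mul _ _ h1 h2 =>
    obtain ⟨L1, h1⟩ := h1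
    obtain ⟨L2, h2⟩ := h2
    refine ⟨L1 + L2, fun X hX ρ => ?_⟩
    obtain ⟨C1, hC1, h1⟩ := h1 X hX ρ
    obtain ⟨C2, hC2, h2⟩ := h2 X hX ρ
    refine ⟨C1 * C2, by positivity, fun ν hν S hS => ?_⟩
    rw [norm_mul, add_mul, Real.exp_add, mul_mul_mul_comm]
    exact mul_le_mul (h1 ν hν S hS) (h2 ν hν S hS) (norm_nonneg _) (by positivity)
  | congr _ h _ _ ih =>
    obtain ⟨L, hL⟩ := ih
    refine ⟨L, fun X hX ρ => ?_⟩
    obtain ⟨C, hC, hb⟩ := hL X hX ρ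
    refine ⟨C, hC, fun ν hν S hS => ?_⟩
    rw [h _ (Slit.shift_mem hX S)]
    exact hb ν hν S hS

end

end TrigBA

end

noncomputable section

namespace TrigBA

/-! ### The kernel of charged particles and its quadratic identity. -/

section SignedKernel

variable {ι : Type*} [Fintype ι] [DecidableEq ι]

/-- The hyperbolic cotangent of `z_a - z_b`, with value `0` for `a = b`. -/
def cth (z : ι → ℂ) (a b : ι) : ℂ :=
  (Complex.exp (-2 * z b) + Complex.exp (-2 * z a)) / (Complex.exp (-2 * z b) - Complex.exp (-2 * z a))

theorem cth_self (z : ι → ℂ) (a : ι) : cth z a a = 0 := by simp [cth]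

theorem cth_antisymm (z : ι → ℂ) (a b : ι) : cth z a b = - cth z b a := by
  unfold cth
  rw [← neg_sub (Complex.exp (-2 * z a)), div_neg, add_comm]

theorem mem_dom_ne {pos : ι → ℕ} (hpos : Function.Injective pos) {z : ι → ℂ} (hz : z ∈ dom pos)
    {a b : ι} (h : a ≠ b) : Complex.exp (-2 * z b) - Complex.exp (-2 * z a) ≠ 0 := by
  have key : ∀ a b : ι, pos a < pos b → Complex.exp (-2 * z b) - Complex.exp (-2 * z a) ≠ 0 := by
    intro a b hab h0
    apply hz a b hab
    rw [mul_sub, Complex.exp_sub, ← sub_eq_zero.1 h0, div_self (Complex.exp_ne_zero _)]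
  rcases lt_or_gt_of_ne (hpos.ne h) with h1 | h1
  · exact key a b h1
  · intro h0
    exact key b a h1 (by rw [← neg_sub, h0, neg_zero])

theorem one_sub_exp_eq (z : ι → ℂ) (a b : ι) : 1 - Complex.exp (-2 * (z a - z b)) =
    (Complex.exp (-2 * z b) - Complex.exp (-2 * z a)) / Complex.exp (-2 * z b) := by
  rw [mul_sub, Complex.exp_sub, sub_div, div_self (Complex.exp_ne_zero _)]

theorem cth_eq {z : ι → ℂ} {a b : ι}
    (h : Complex.exp (-2 * z b) - Complex.exp (-2 * z a) ≠ 0) :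
    cth z a b = 2 * (1 - Complex.exp (-2 * (z a - z b)))⁻¹ - 1 := by
  rw [one_sub_exp_eq, cth]
  have hb : Complex.exp (-2 * z b) ≠ 0 := Complex.exp_ne_zero _
  generalize Complex.exp (-2 * z b) = B at *
  generalize Complex.exp (-2 * z a) = A at *
  field_simp
  ring

theorem cth_sq_sub_one {z : ι → ℂ} {a b : ι}
    (h : Complex.exp (-2 * z b) - Complex.exp (-2 * z a) ≠ 0) :
    cth z a b ^ 2 - 1 = 1 / Complex.sinh (z a - z b) ^ 2 := by
  have e1 : Complex.exp (z a) ≠ 0 := Complex.exp_ne_zero _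
  have e2 : Complex.exp (z b) ≠ 0 := Complex.exp_ne_zero _
  have hA : Complex.exp (-2 * z a) = (Complex.exp (z a) ^ 2)⁻¹ := by
    rw [← Complex.exp_nat_mul, ← Complex.exp_neg]; congr 1; push_cast; ring
  have hB : Complex.exp (-2 * z b) = (Complex.exp (z b) ^ 2)⁻¹ := by
    rw [← Complex.exp_nat_mul, ← Complex.exp_neg]; congr 1; push_cast; ring
  have hs : Complex.sinh (z a - z b) =
      (Complex.exp (z a) ^ 2 - Complex.exp (z b) ^ 2) / (2 * Complex.exp (z a) * Complex.exp (z b)) := by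
    rw [Complex.sinh, neg_sub, Complex.exp_sub, Complex.exp_sub]
    field_simp
  rw [hA, hB] at h
  rw [cth, hs, hA, hB]
  have h2 : Complex.exp (z a) ^ 2 - Complex.exp (z b) ^ 2 ≠ 0 := by
    intro h0
    apply h
    rw [sub_eq_zero.1 h0, sub_self]
  have e3 : (Complex.exp (z b) ^ 2)⁻¹ - (Complex.exp (z a) ^ 2)⁻¹ =
      (Complex.exp (z a) ^ 2 - Complex.exp (z b) ^ 2) / (Complex.exp (z a) ^ 2 * Complex.exp (z b) ^ 2) := by
    field_simp
  rw [e3]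
  field_simp
  ring

/-- The addition theorem of the hyperbolic cotangent in symmetric form; it reduces the three-body
terms to constants. -/
theorem cth_three {z : ι → ℂ} {a b c : ι}
    (hab : Complex.exp (-2 * z b) - Complex.exp (-2 * z a) ≠ 0)
    (hac : Complex.exp (-2 * z c) - Complex.exp (-2 * z a) ≠ 0)
    (hbc : Complex.exp (-2 * z c) - Complex.exp (-2 * z b) ≠ 0) :
    cth z a b * cth z a c + cth z b a * cth z b c + cth z c a * cth z c b = 1 := by
  rw [cth_antisymm z b a, cth_antisymm z c a, cth_antisymm z c b]
  unfold cth
  generalize Complex.exp (-2 * z b) = B at *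
  generalize Complex.exp (-2 * z a) = A at *
  generalize Complex.exp (-2 * z c) = C at *
  field_simp
  ring

/-- The square is expanded into a sum over triples and symmetrised. Triples of distinct indices
contribute constants by `cth_three`, coincidences contribute the two-body terms, and total charge
`1` evaluates the constants. -/
theorem sum_cth_sq {pos : ι → ℕ} (hpos : Function.Injective pos) {z : ι → ℂ} (hz : z ∈ dom pos)
    {ε : ι → ℂ} (hε : ∀ a, ε a ^ 2 = 1) (hs : ∑ a, ε a = 1) :
    ∑ a, ε a * (∑ b, ε b * cth z a b) ^ 2 = ∑ a, ∑ b, ε b * (cth z a b ^ 2 - 1) + 1 := by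
  set S : ι → ι → ι → ℂ := fun a b c => ε a * ε b * ε c * (cth z a b * cth z a c) with hS
  have hL : ∑ a, ε a * (∑ b, ε b * cth z a b) ^ 2 = ∑ a, ∑ b, ∑ c, S a b c := by
    refine Finset.sum_congr rfl fun a _ => ?_
    rw [sq, Finset.sum_mul_sum, Finset.mul_sum]
    refine Finset.sum_congr rfl fun b _ => ?_
    rw [Finset.mul_sum]
    refine Finset.sum_congr rfl fun c _ => ?_
    simp only [hS]; ring
  have h2 : ∑ a, ∑ b, ∑ c, S a b c = ∑ a, ∑ b, ∑ c, S b a c := by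
    rw [Finset.sum_comm]
  have h3 : ∑ a, ∑ b, ∑ c, S a b c = ∑ a, ∑ b, ∑ c, S c a b := by
    have : ∀ a, ∑ b, ∑ c, S c a b = ∑ c, ∑ b, S c a b := fun a => Finset.sum_comm
    simp only [this]
    rw [Finset.sum_comm]
  -- The right side pretends that the symmetrised cotangent product is always `1`, corrects this on
  -- each of the three diagonals, and removes the excess where all indices agree: there `ε - 3 ε + 2
  -- ε = 0`.
  have hpt : ∀ a b c, S a b c + S b a c + S c a b = ε a * ε b * ε c +
      ((if a = b then ε c * (cth z a c ^ 2 - 1) else 0) +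
      (if b = c then ε a * (cth z b a ^ 2 - 1) else 0) +
      (if a = c then ε b * (cth z a b ^ 2 - 1) else 0)) +
      (if a = b then (if b = c then 2 * ε a else 0) else 0) := by
    intro a b c
    have e3 : ∀ a, ε a * ε a * ε a = ε a := fun a => by rw [← sq, hε, one_mul]
    simp only [hS]
    by_cases hab : a = b
    · subst hab
      by_cases hac : a = c
      · subst hac
        simp only [if_true, cth_self]
        linear_combination (- e3 a)
      · rw [if_pos rfl, if_neg hac, if_neg hac, cth_self, cth_antisymm z c a]
        simp only [if_true]
        linear_combination (ε c * (cth z a c) ^ 2 - ε c) * hε a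
    · by_cases hbc : b = c
      · subst hbc
        simp only [if_neg hab, if_true, cth_self]
        rw [cth_antisymm z b a]
        linear_combination (ε a * (cth z a b) ^ 2 - ε a) * hε b
      · by_cases hac : a = c
        · subst hac
          simp only [if_neg hab, if_neg hbc, if_true, cth_self]
          rw [cth_antisymm z b a]
          linear_combination (ε b * (cth z a b) ^ 2 - ε b) * hε a
        · simp only [if_neg hab, if_neg hbc, if_neg hac]
          have := cth_three (mem_dom_ne hpos hz hab) (mem_dom_ne hpos hz hac)
            (mem_dom_ne hpos hz hbc)
          linear_combination ε a * ε b * ε c * this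
  have h1 : 3 * ∑ a, ∑ b, ∑ c, S a b c = ∑ a, ∑ b, ∑ c, (S a b c + S b a c + S c a b) := by
    simp only [Finset.sum_add_distrib]
    rw [← h2, ← h3]; ring
  have e1 : ∑ a, ∑ b, ∑ c, ε a * ε b * ε c = 1 := by
    simp only [← Finset.mul_sum, hs, mul_one]
  have e2 : ∑ a, ∑ b, ∑ c, (if a = b then ε c * (cth z a c ^ 2 - 1) else 0) =
      ∑ a, ∑ b, ε b * (cth z a b ^ 2 - 1) := by
    refine Finset.sum_congr rfl fun a _ => ?_
    rw [Finset.sum_comm]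
    simp
  have e3 : ∑ a, ∑ b, ∑ c, (if b = c then ε a * (cth z b a ^ 2 - 1) else 0) =
      ∑ a, ∑ b, ε b * (cth z a b ^ 2 - 1) := by
    rw [Finset.sum_comm]
    simp
  have e4 : ∑ a, ∑ b, ∑ c, (if a = c then ε b * (cth z a b ^ 2 - 1) else 0) =
      ∑ a, ∑ b, ε b * (cth z a b ^ 2 - 1) := by simp
  have e5 : ∑ a, ∑ b, ∑ c, (if a = b then (if b = c then 2 * ε a else 0) else 0) = 2 := by
    simp [← Finset.mul_sum, hs]
  rw [hL]
  have h4 : 3 * ∑ a, ∑ b, ∑ c, S a b c = 1 + 3 * (∑ a, ∑ b, ε b * (cth z a b ^ 2 - 1)) + 2 := by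
    rw [h1]
    simp only [hpt]
    simp only [Finset.sum_add_distrib]
    rw [e1, e2, e3, e4, e5]; ring
  linear_combination h4 / 3

/-- The kernel attached to positions `pos`, charges `ε` and parameter `q`. -/
def sker (pos : ι → ℕ) (ε : ι → ℤ) (q : ℤ) (z : ι → ℂ) : ℂ :=
  ∏ a, ∏ b, if pos a < pos b then (1 - Complex.exp (-2 * (z a - z b))) ^ (-q * ε a * ε b) else 1

/-- The logarithmic derivative of the kernel. -/
def lker (ε : ι → ℤ) (q : ℤ) (a : ι) (z : ι → ℂ) : ℂ := -q * ε a * ∑ b, ε b * cth z a b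

theorem analyticAt_coord (i : ι) (z : ι → ℂ) : AnalyticAt ℂ (fun z : ι → ℂ => z i) z :=
  (ContinuousLinearMap.proj (R := ℂ) (φ := fun _ : ι => ℂ) i).analyticAt z

theorem analyticAt_exp_diff (c : ℂ) (a b : ι) (z : ι → ℂ) :
    AnalyticAt ℂ (fun z : ι → ℂ => Complex.exp (c * (z a - z b))) z :=
  (analyticAt_const.mul ((analyticAt_coord a z).sub (analyticAt_coord b z))).cexp

theorem pd_exp_diff (c : ℂ) (i a b : ι) (z : ι → ℂ) :
    pd i (fun z : ι → ℂ => Complex.exp (c * (z a - z b))) z =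
      c * ((if i = a then 1 else 0) - (if i = b then 1 else 0)) * Complex.exp (c * (z a - z b)) := by
  rw [pd_exp (by fun_prop), pd_const_mul, pd_sub (by fun_prop) (by fun_prop), pd_coord, pd_coord]
  ring

theorem analyticAt_cth {z : ι → ℂ} {a b : ι}
    (h : a ≠ b → Complex.exp (-2 * z b) - Complex.exp (-2 * z a) ≠ 0) :
    AnalyticAt ℂ (fun z => cth z a b) z := by
  by_cases hab : a = b
  · subst hab; simp only [cth_self]; exact analyticAt_const
  · have hx : ∀ c, AnalyticAt ℂ (fun z : ι → ℂ => Complex.exp (-2 * z c)) z := fun c =>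
      (analyticAt_const.mul (analyticAt_coord c z)).cexp
    exact ((hx b).add (hx a)).div ((hx b).sub (hx a)) (h hab)

theorem pd_cth {z : ι → ℂ} {a b : ι} (hab : a ≠ b)
    (h : Complex.exp (-2 * z b) - Complex.exp (-2 * z a) ≠ 0) (i : ι) :
    pd i (fun z => cth z a b) z =
      ((if i = a then 1 else 0) - (if i = b then 1 else 0)) * (1 - cth z a b ^ 2) := by
  have hev : (fun z => cth z a b) =ᶠ[𝓝 z]
      fun z => 2 * (1 - Complex.exp (-2 * (z a - z b)))⁻¹ - 1 := by
    have hc : ContinuousAt (fun z : ι → ℂ => Complex.exp (-2 * z b) - Complex.exp (-2 * z a)) z := by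
      fun_prop
    filter_upwards [hc.eventually_ne h] with w hw
    exact cth_eq hw
  have h1 : 1 - Complex.exp (-2 * (z a - z b)) ≠ 0 := by
    rw [one_sub_exp_eq]; exact div_ne_zero h (Complex.exp_ne_zero _)
  have hd : DifferentiableAt ℂ (fun z : ι → ℂ => 1 - Complex.exp (-2 * (z a - z b))) z := by
    fun_prop
  have hd2 : DifferentiableAt ℂ (fun z : ι → ℂ => 2 * (1 - Complex.exp (-2 * (z a - z b)))⁻¹) z :=
    (hd.inv h1).const_mul 2
  rw [pd_congr hev, pd_sub hd2 (differentiableAt_const _), pd_const,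
    pd_const_mul, pd_inv hd h1, pd_sub (differentiableAt_const _) (by fun_prop), pd_const,
    pd_exp_diff, cth_eq h]
  generalize Complex.exp (-2 * (z a - z b)) = E at *
  field_simp
  ring

theorem differentiableAt_prod {α : Type*} (s : Finset α) {F : α → (ι → ℂ) → ℂ} {z : ι → ℂ}
    (hF : ∀ a ∈ s, DifferentiableAt ℂ (F a) z) :
    DifferentiableAt ℂ (fun z => ∏ a ∈ s, F a z) z := by
  classical
  induction s using Finset.induction_on with
  | empty => simp
  | insert a s ha ih =>
    simp only [Finset.prod_insert ha]
    exact (hF a (Finset.mem_insert_self _ _)).mul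
      (ih fun b hb => hF b (Finset.mem_insert_of_mem hb))

theorem pd_prod_log {α : Type*} (s : Finset α) {F : α → (ι → ℂ) → ℂ} {lam : α → ℂ} {z : ι → ℂ}
    {i : ι} (hF : ∀ a ∈ s, DifferentiableAt ℂ (F a) z) (h : ∀ a ∈ s, pd i (F a) z = lam a * F a z) :
    pd i (fun z => ∏ a ∈ s, F a z) z = (∑ a ∈ s, lam a) * ∏ a ∈ s, F a z := by
  classical
  induction s using Finset.induction_on with
  | empty => simp [pd_const]
  | insert a s ha ih =>
    have hd : DifferentiableAt ℂ (fun z => ∏ a ∈ s, F a z) z :=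
      differentiableAt_prod _ fun b hb => hF b (Finset.mem_insert_of_mem hb)
    simp only [Finset.prod_insert ha, Finset.sum_insert ha]
    rw [pd_mul (hF a (Finset.mem_insert_self _ _)) hd, h a (Finset.mem_insert_self _ _),
      ih (fun b hb => hF b (Finset.mem_insert_of_mem hb))
        (fun b hb => h b (Finset.mem_insert_of_mem hb))]
    ring

theorem analyticAt_fac_zpow {z : ι → ℂ} {a b : ι} (n : ℤ)
    (h : 1 - Complex.exp (-2 * (z a - z b)) ≠ 0) :
    AnalyticAt ℂ (fun z : ι → ℂ => (1 - Complex.exp (-2 * (z a - z b))) ^ n) z :=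
  (analyticAt_const.sub (analyticAt_exp_diff _ a b z)).fun_zpow h

theorem pd_fac_zpow {z : ι → ℂ} {a b : ι} (n : ℤ) (i : ι)
    (h : Complex.exp (-2 * z b) - Complex.exp (-2 * z a) ≠ 0) :
    pd i (fun z : ι → ℂ => (1 - Complex.exp (-2 * (z a - z b))) ^ n) z =
      (((if i = a then 1 else 0) - (if i = b then 1 else 0)) * (n * (cth z a b - 1))) *
        (1 - Complex.exp (-2 * (z a - z b))) ^ n := by
  have h1 : 1 - Complex.exp (-2 * (z a - z b)) ≠ 0 := by
    rw [one_sub_exp_eq]; exact div_ne_zero h (Complex.exp_ne_zero _)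
  have hd : DifferentiableAt ℂ (fun z : ι → ℂ => 1 - Complex.exp (-2 * (z a - z b))) z := by
    fun_prop
  have h2 : HasDerivAt (fun t => 1 - Complex.exp (-2 * (Function.update z i t a - Function.update z i t b)))
      (pd i (fun z => 1 - Complex.exp (-2 * (z a - z b))) z) (z i) :=
    (differentiableAt_line (i := i) hd).hasDerivAt
  have h3 := (hasDerivAt_zpow n _ (Or.inl (by simpa using h1))).comp (z i) h2
  have h4 := h3.deriv
  simp only [Function.update_eq_self] at h4
  refine Eq.trans h4 ?_
  rw [pd_sub (differentiableAt_const _) (by fun_prop), pd_const, pd_exp_diff, cth_eq h,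
    zpow_sub_one₀ h1]
  generalize Complex.exp (-2 * (z a - z b)) = E at *
  field_simp
  ring

variable {pos : ι → ℕ} {ε : ι → ℤ}

theorem one_sub_ne {z : ι → ℂ} {col : ι → ℕ} (hz : z ∈ dom col) {a b : ι} (h : col a < col b) :
    1 - Complex.exp (-2 * (z a - z b)) ≠ 0 := sub_ne_zero.2 (hz a b h).symm

theorem analyticOnNhd_sker (q : ℤ) : AnalyticOnNhd ℂ (sker pos ε q) (dom pos) := by
  intro z hz
  refine Finset.analyticAt_fun_prod _ fun a _ => Finset.analyticAt_fun_prod _ fun b _ => ?_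
  by_cases h : pos a < pos b
  · simp only [if_pos h]; exact analyticAt_fac_zpow _ (one_sub_ne hz h)
  · simp only [if_neg h]; exact analyticAt_const

theorem analyticOnNhd_lker (hpos : Function.Injective pos) (q : ℤ) (a : ι) :
    AnalyticOnNhd ℂ (lker ε q a) (dom pos) := fun z hz =>
  analyticAt_const.mul (Finset.analyticAt_fun_sum _ fun b _ =>
    analyticAt_const.mul (analyticAt_cth fun h => mem_dom_ne hpos hz h))

/-- Each factor contributes a cotangent minus `1`. The balance of charge before and after `c` makes
the constants cancel, so the logarithmic derivative is a pure sum of cotangents. -/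
theorem pd_sker (hpos : Function.Injective pos)
    (hbal : ∀ c, ∑ b, ((if pos c < pos b then ε b else 0) - (if pos b < pos c then ε b else 0)) = 0)
    (q : ℤ) (c : ι) {z : ι → ℂ} (hz : z ∈ dom pos) :
    pd c (sker pos ε q) z = lker ε q c z * sker pos ε q z := by
  have hf : ∀ a b, DifferentiableAt ℂ (fun z : ι → ℂ => if pos a < pos b then
      (1 - Complex.exp (-2 * (z a - z b))) ^ (-q * ε a * ε b) else 1) z := by
    intro a b
    by_cases h : pos a < pos b
    · simp only [if_pos h]; exact (analyticAt_fac_zpow _ (one_sub_ne hz h)).differentiableAt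
    · simp only [if_neg h]; exact differentiableAt_const _
  have hl : ∀ a b, pd c (fun z : ι → ℂ => if pos a < pos b then
      (1 - Complex.exp (-2 * (z a - z b))) ^ (-q * ε a * ε b) else 1) z =
      (if pos a < pos b then (((if c = a then 1 else 0) - (if c = b then 1 else 0)) *
        (((-q * ε a * ε b : ℤ) : ℂ) * (cth z a b - 1))) else 0) * (if pos a < pos b then
      (1 - Complex.exp (-2 * (z a - z b))) ^ (-q * ε a * ε b) else 1) := by
    intro a b
    by_cases h : pos a < pos b
    · simp only [if_pos h]
      exact pd_fac_zpow _ _ (mem_dom_ne hpos hz fun e => by rw [e] at h; exact lt_irrefl _ h)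
    · simp only [if_neg h]; rw [pd_const, zero_mul]
  have h1 := pd_prod_log (i := c) (z := z) Finset.univ (F := fun a z => ∏ b, if pos a < pos b then
      (1 - Complex.exp (-2 * (z a - z b))) ^ (-q * ε a * ε b) else 1)
      (fun a _ => differentiableAt_prod _ fun b _ => hf a b)
      (fun a _ => pd_prod_log Finset.univ (fun b _ => hf a b) (fun b _ => hl a b))
  refine h1.trans ?_
  change _ * sker pos ε q z = _
  congr 1
  have e1 : ∀ a b, (if pos a < pos b then (((if c = a then 1 else 0) - (if c = b then 1 else 0)) *
        (((-q * ε a * ε b : ℤ) : ℂ) * (cth z a b - 1))) else 0) =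
      (if c = a then (if pos a < pos b then ((-q * ε a * ε b : ℤ) : ℂ) * (cth z a b - 1) else 0) else 0) -
      (if c = b then (if pos a < pos b then ((-q * ε a * ε b : ℤ) : ℂ) * (cth z a b - 1) else 0) else 0) := by
    intro a b
    split_ifs <;> ring
  simp only [e1, Finset.sum_sub_distrib]
  rw [Finset.sum_comm]
  simp only [Finset.sum_ite_eq, Finset.mem_univ, if_true]
  rw [← Finset.sum_sub_distrib, lker, Finset.mul_sum]
  -- The total contribution of the constants `-1`.
  have hb : ((q : ℂ) * ε c) * ∑ b, (((if pos c < pos b then (ε b : ℂ) else 0) -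
      (if pos b < pos c then (ε b : ℂ) else 0))) = 0 := by
    have := congrArg (Int.cast : ℤ → ℂ) (hbal c)
    push_cast at this
    rw [this, mul_zero]
  rw [Finset.mul_sum] at hb
  rw [← sub_eq_zero, ← Finset.sum_sub_distrib]
  refine Eq.trans ?_ hb
  refine Finset.sum_congr rfl fun b _ => ?_
  rcases lt_trichotomy (pos c) (pos b) with h | h | h
  · simp only [if_pos h, if_neg (lt_asymm h)]; push_cast; ring
  · have := hpos h
    subst this
    simp [cth_self]
  · simp only [if_pos h, if_neg (lt_asymm h)]
    rw [cth_antisymm z b c]; push_cast; ring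

theorem sum_lker (q : ℤ) (z : ι → ℂ) : ∑ a, lker ε q a z = 0 := by
  have h : ∑ a, lker ε q a z = - ∑ a, lker ε q a z := by
    unfold lker
    simp only [Finset.mul_sum]
    conv_rhs => rw [Finset.sum_comm]
    rw [← Finset.sum_neg_distrib]
    refine Finset.sum_congr rfl fun a _ => ?_
    rw [← Finset.sum_neg_distrib]
    refine Finset.sum_congr rfl fun b _ => ?_
    rw [cth_antisymm z a b]; ring
  linear_combination h / 2

theorem pd_lker (hpos : Function.Injective pos) (q : ℤ) (a : ι) {z : ι → ℂ} (hz : z ∈ dom pos) :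
    pd a (lker ε q a) z = -q * ε a * ∑ b, if a = b then 0 else ε b * (1 - cth z a b ^ 2) := by
  unfold lker
  rw [pd_const_mul, pd_sum _ fun b _ =>
    ((analyticAt_cth fun h => mem_dom_ne hpos hz h).differentiableAt).const_mul _]
  congr 1
  refine Finset.sum_congr rfl fun b _ => ?_
  rw [pd_const_mul]
  by_cases h : a = b
  · subst h; simp [cth_self, pd_const]
  · rw [pd_cth h (mem_dom_ne hpos hz h), if_neg h, if_pos rfl, if_neg h]; ring

/-- The squares of the cotangent sums give the coefficient `q²` by `sum_cth_sq`, the derivatives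
give `q`, and the cross terms with `μ` add up to zero by `sum_lker`. The left side is the
charge-weighted sum of second derivatives of the kernel times `exp (2 μ ∑ ε_a z_a)`, divided by that
function. -/
theorem kernel_identity (hpos : Function.Injective pos) (hε : ∀ a, ε a ^ 2 = 1)
    (hs : ∑ a, ε a = 1) (q : ℤ) (μ : ℂ) {z : ι → ℂ} (hz : z ∈ dom pos) :
    ∑ a, ε a * ((lker ε q a z + 2 * μ * ε a) ^ 2 + pd a (lker ε q a) z) =
      q * (q + 1) * ∑ a, ∑ b, (if a = b then 0 else ε b * (cth z a b ^ 2 - 1)) + 4 * μ ^ 2 := by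
  have hε' : ∀ a, (ε a : ℂ) ^ 2 = 1 := fun a => by exact_mod_cast hε a
  have hs' : ∑ a, (ε a : ℂ) = 1 := by exact_mod_cast hs
  have h1 := sum_cth_sq hpos hz hε' hs'
  have h2 : ∑ a, ∑ b, (ε b : ℂ) * (cth z a b ^ 2 - 1) + 1 =
      ∑ a, ∑ b, (if a = b then 0 else ε b * (cth z a b ^ 2 - 1)) := by
    have : ∀ a b, (ε b : ℂ) * (cth z a b ^ 2 - 1) =
        (if a = b then 0 else ε b * (cth z a b ^ 2 - 1)) + (if a = b then -ε a else 0) := by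
      intro a b
      by_cases h : a = b
      · subst h; simp [cth_self]
      · simp [h]
    rw [Finset.sum_congr rfl fun a _ => Finset.sum_congr rfl fun b _ => this a b]
    simp only [Finset.sum_add_distrib]
    simp [hs']
  rw [h2] at h1
  have h3 := sum_lker (ε := ε) q z
  have e : ∀ a, (ε a : ℂ) * ((lker ε q a z + 2 * μ * ε a) ^ 2 + pd a (lker ε q a) z) =
      q ^ 2 * (ε a * (∑ b, ε b * cth z a b) ^ 2) +
      q * (∑ b, if a = b then 0 else ε b * (cth z a b ^ 2 - 1)) + 4 * μ * lker ε q a z +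
      4 * μ ^ 2 * ε a := by
    intro a
    rw [pd_lker hpos q a hz]
    have e1 : (∑ b, if a = b then 0 else (ε b : ℂ) * (1 - cth z a b ^ 2)) =
        - ∑ b, if a = b then 0 else (ε b : ℂ) * (cth z a b ^ 2 - 1) := by
      rw [← Finset.sum_neg_distrib]
      refine Finset.sum_congr rfl fun b _ => ?_
      split_ifs <;> ring
    rw [e1]
    have e2 : lker ε q a z ^ 2 = q ^ 2 * (∑ b, ε b * cth z a b) ^ 2 := by
      unfold lker
      linear_combination (q ^ 2 * (∑ b, (ε b : ℂ) * cth z a b) ^ 2) * hε' a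
    linear_combination (ε a : ℂ) * e2 + (q * (∑ b, if a = b then 0 else (ε b : ℂ) * (cth z a b ^ 2 - 1)) +
      4 * μ * lker ε q a z + 4 * μ ^ 2 * ε a) * hε' a
  simp only [e, Finset.sum_add_distrib, ← Finset.mul_sum]
  rw [h1, h3, hs']
  ring

end SignedKernel

end TrigBA

end

noncomputable section

namespace TrigBA

/-! ### The interlaced variables and the action of the kernel on eigenfunctions. -/

section Interlacing

variable {k : ℕ}

/-- The index set of the variables `x_0, y_0, x_1, y_1, …, x_k`. -/
abbrev Idx (k : ℕ) : Type := Fin (k + 1) ⊕ Fin k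

/-- The position of a variable in the order `x_0, y_0, x_1, y_1, …, x_k`. -/
def ipos : Idx k → ℕ := Sum.elim (fun j => 2 * j) (fun i => 2 * i + 1)

/-- The colour of a variable: `x_i` and `y_i` have the same colour. -/
def icol : Idx k → ℕ := Sum.elim (fun j => j) (fun i => i)

/-- The charge of a variable. -/
def chg : Idx k → ℤ := Sum.elim (fun _ => 1) (fun _ => -1)

theorem ipos_injective : Function.Injective (ipos (k := k)) := by
  rintro (a | a) (b | b) h <;> simp only [ipos, Sum.elim_inl, Sum.elim_inr] at h
  · exact congrArg Sum.inl (Fin.ext (by omega))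
  · omega
  · omega
  · exact congrArg Sum.inr (Fin.ext (by omega))

theorem ipos_lt_of_icol_lt {a b : Idx k} (h : icol a < icol b) : ipos a < ipos b := by
  rcases a with a | a <;> rcases b with b | b <;>
    simp only [ipos, icol, Sum.elim_inl, Sum.elim_inr] at h ⊢ <;> omega

theorem dom_ipos_subset : dom (ipos (k := k)) ⊆ dom icol := fun _ hz a b h =>
  hz a b (ipos_lt_of_icol_lt h)

theorem chg_sq (a : Idx k) : chg a ^ 2 = 1 := by rcases a with a | a <;> simp [chg]

theorem sum_chg : ∑ a : Idx k, chg a = 1 := by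
  simp [chg, Fintype.sum_sum_type]

/-- The charges alternate and both ends are `+1`, so the charges before and after an `x` are both
`0`, and before and after a `y` both `1`. -/
theorem chg_balance (c : Idx k) : ∑ b : Idx k,
    ((if ipos c < ipos b then chg b else 0) - (if ipos b < ipos c then chg b else 0)) = 0 := by
  -- Induction on the number of `y` variables for an arbitrary position `p`; the value `-1` occurs
  -- only when `p` lies beyond the last `x`.
  have key : ∀ (p n : ℕ), ∑ j ∈ Finset.range (n + 1), (((if p < 2 * j then 1 else 0) : ℤ) -
      (if 2 * j < p then 1 else 0)) - ∑ i ∈ Finset.range n, ((if p < 2 * i + 1 then 1 else 0) -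
      (if 2 * i + 1 < p then 1 else 0)) = if 2 * n < p then -1 else 0 := by
    intro p n
    induction n with
    | zero =>
      rw [zero_add, Finset.sum_range_one, Finset.sum_range_zero]
      by_cases hp : 0 < p <;> simp [hp]
    | succ n ih =>
      rw [Finset.sum_range_succ _ (n + 1), Finset.sum_range_succ
        (fun i => (((if p < 2 * i + 1 then 1 else 0) : ℤ) - (if 2 * i + 1 < p then 1 else 0))) n]
      have : ∀ A B C D : ℤ, A + B - (C + D) = (A - C) + (B - D) := fun _ _ _ _ => by ring
      rw [this, ih]
      split_ifs <;> omega
  have h2 := key (ipos c) k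
  have hc : ¬ (2 * k < ipos c) := by
    rcases c with c | c <;> simp only [ipos, Sum.elim_inl, Sum.elim_inr] <;> omega
  rw [if_neg hc, Finset.sum_range, Finset.sum_range] at h2
  refine Eq.trans ?_ h2
  rw [Fintype.sum_sum_type, sub_eq_add_neg, ← Finset.sum_neg_distrib]
  refine congrArg₂ (· + ·) rfl (Finset.sum_congr rfl fun i _ => ?_)
  change (if ipos c < 2 * (i : ℕ) + 1 then (-1 : ℤ) else 0) -
    (if 2 * (i : ℕ) + 1 < ipos c then (-1 : ℤ) else 0) = _
  split_ifs <;> rfl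

/-- The shift `σ_i = x_i - y_i`. -/
def sig (i : Fin k) (z : Idx k → ℂ) : ℂ := z (.inl i.castSucc) - z (.inr i)

/-- `T_i = 1 - exp (-2 σ_i)`. -/
def Tf (i : Fin k) (z : Idx k → ℂ) : ℂ := 1 - Complex.exp (-2 * sig i z)

/-- The part of the kernel that is regular on the diagonal. -/
def Nker (q : ℤ) (z : Idx k → ℂ) : ℂ :=
  ∏ a, ∏ b, if icol a < icol b then (1 - Complex.exp (-2 * (z a - z b))) ^ (-q * chg a * chg b) else 1

theorem mem_dom_ipos {z : Idx k → ℂ} :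
    z ∈ dom (ipos (k := k)) ↔ z ∈ dom (icol (k := k)) ∧ ∀ i, Tf i z ≠ 0 := by
  constructor
  · intro hz
    refine ⟨dom_ipos_subset hz, fun i => ?_⟩
    exact one_sub_ne hz (a := .inl i.castSucc) (b := .inr i) (by simp [ipos])
  · rintro ⟨hz, hT⟩ a b hab
    by_cases h : icol a < icol b
    · exact hz a b h
    · rcases a with a | a <;> rcases b with b | b <;>
        simp only [ipos, icol, Sum.elim_inl, Sum.elim_inr] at h hab
      · omega
      · have : a = b.castSucc := Fin.ext (by simp; omega)
        subst this
        exact fun h => hT b (sub_eq_zero.2 h.symm)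
      · omega
      · omega

/-- The only pairs ordered by position but equal in colour are `(x_i, y_i)`. Their charges are
opposite, hence the exponent `+q` on `T_i`. -/
theorem sker_eq (q : ℤ) (z : Idx k → ℂ) :
    sker ipos chg q z = (∏ i, Tf i z ^ q) * Nker q z := by
  have h1 : ∀ a b : Idx k, (if ipos a < ipos b then
      (1 - Complex.exp (-2 * (z a - z b))) ^ (-q * chg a * chg b) else 1) =
      (if ipos a < ipos b ∧ icol a = icol b then
        (1 - Complex.exp (-2 * (z a - z b))) ^ (-q * chg a * chg b) else 1) *
      (if icol a < icol b then
        (1 - Complex.exp (-2 * (z a - z b))) ^ (-q * chg a * chg b) else 1) := by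
    intro a b
    by_cases h : icol a < icol b
    · simp [h, ipos_lt_of_icol_lt h, h.ne]
    · by_cases h2 : ipos a < ipos b
      · have : icol a = icol b := by
          by_contra h3
          exact lt_asymm h2 (ipos_lt_of_icol_lt (by omega))
        simp [h2, this]
      · simp [h, h2]
  unfold sker Nker
  simp only [h1, Finset.prod_mul_distrib]
  congr 1
  rw [Fintype.prod_sum_type]
  simp only [Fintype.prod_sum_type]
  have e1 : ∀ a b : Fin (k + 1), ¬ (ipos (k := k) (.inl a) < ipos (k := k) (.inl b) ∧
      icol (k := k) (.inl a) = icol (k := k) (.inl b)) := by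
    intro a b; simp only [ipos, icol, Sum.elim_inl]; omega
  have e2 : ∀ (a : Fin k) (b : Fin (k + 1)), ¬ (ipos (k := k) (.inr a) < ipos (k := k) (.inl b) ∧
      icol (k := k) (.inr a) = icol (k := k) (.inl b)) := by
    intro a b; simp only [ipos, icol, Sum.elim_inl, Sum.elim_inr]; omega
  have e3 : ∀ a b : Fin k, ¬ (ipos (k := k) (.inr a) < ipos (k := k) (.inr b) ∧
      icol (k := k) (.inr a) = icol (k := k) (.inr b)) := by
    intro a b; simp only [ipos, icol, Sum.elim_inr]; omega
  have e4 : ∀ (a : Fin (k + 1)) (b : Fin k), (ipos (k := k) (.inl a) < ipos (k := k) (.inr b) ∧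
      icol (k := k) (.inl a) = icol (k := k) (.inr b)) ↔ a = b.castSucc := by
    intro a b
    rw [Fin.ext_iff]
    simp only [ipos, icol, Sum.elim_inl, Sum.elim_inr, Fin.val_castSucc]; omega
  simp only [e1, e2, e3, e4, if_false, Finset.prod_const_one, one_mul, mul_one]
  rw [Finset.prod_comm]
  refine Finset.prod_congr rfl fun i _ => ?_
  rw [Finset.prod_ite_eq' Finset.univ i.castSucc]
  simp [chg, Tf, sig]

/-- The diagonal `y_i = x_i`. -/
def diag (x : Fin (k + 1) → ℂ) : Idx k → ℂ := Sum.elim x fun i => x i.castSucc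

theorem diag_mem {x : Fin (k + 1) → ℂ} (hx : x ∈ dom (fun j : Fin (k + 1) => (j : ℕ))) :
    diag x ∈ dom (icol (k := k)) := by
  rintro (a | a) (b | b) h <;> simp only [icol, Sum.elim_inl, Sum.elim_inr] at h <;>
    simp only [diag, Sum.elim_inl, Sum.elim_inr] <;> apply hx <;> simpa using h

theorem sig_diag (i : Fin k) (x : Fin (k + 1) → ℂ) : sig i (diag x) = 0 := by simp [sig, diag]

theorem Tf_diag (i : Fin k) (x : Fin (k + 1) → ℂ) : Tf i (diag x) = 0 := by simp [Tf, sig_diag]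

/-- At `y_i = x_i` the factors pairing `x_i` and `y_i` with any later variable are mutually inverse,
and no variable has a colour beyond that of the last `x`. -/
theorem Nker_diag (q : ℤ) {x : Fin (k + 1) → ℂ} (hx : x ∈ dom (fun j : Fin (k + 1) => (j : ℕ))) :
    Nker q (diag x) = 1 := by
  unfold Nker
  rw [Fintype.prod_sum_type, Fin.prod_univ_castSucc, mul_right_comm, ← Finset.prod_mul_distrib]
  have h1 : ∀ b : Idx k, ¬ icol (k := k) (.inl (Fin.last k)) < icol b := by
    rintro (b | b) <;> simp only [icol, Sum.elim_inl, Sum.elim_inr, Fin.val_last] <;> omega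
  simp only [h1, if_false, Finset.prod_const_one, mul_one]
  refine Finset.prod_eq_one fun i _ => ?_
  rw [← Finset.prod_mul_distrib]
  refine Finset.prod_eq_one fun b _ => ?_
  have h2 : icol (k := k) (.inl i.castSucc) = icol (k := k) (.inr i) := by simp [icol]
  rw [h2]
  split_ifs with h
  · have e : diag x (.inl i.castSucc) = diag x (.inr i) := by simp [diag]
    have hne := one_sub_ne (diag_mem hx) h
    rw [e, ← zpow_add₀ hne]
    simp [chg]
  · simp

theorem analyticOnNhd_Nker (q : ℤ) : AnalyticOnNhd ℂ (Nker (k := k) q) (dom icol) := by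
  intro z hz
  refine Finset.analyticAt_fun_prod _ fun a _ => Finset.analyticAt_fun_prod _ fun b _ => ?_
  by_cases h : icol a < icol b
  · simp only [if_pos h]; exact analyticAt_fac_zpow _ (one_sub_ne hz h)
  · simp only [if_neg h]; exact analyticAt_const

theorem RT_fac_zpow {ι κ : Type*} [Fintype ι] [DecidableEq ι] {col : ι → ℕ} {a b : ι}
    (h : col a < col b) (n : ℤ) :
    RT (κ := κ) col 0 (fun z _ => (1 - Complex.exp (-2 * (z a - z b))) ^ n)
      (fun z _ => (1 - Complex.exp (-2 * (z a - z b))) ^ n) (fun _ _ => 1) := by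
  rcases n with n | n
  · simpa using (RT.fac (κ := κ) a b h).pow n
  · simpa using (RT.inv (κ := κ) a b h).pow (n + 1)

theorem RT_Nker {κ : Type*} (q : ℤ) :
    RT (κ := κ) (icol (k := k)) 0 (fun z _ => Nker q z) (fun z _ => Nker q z) (fun _ _ => 1) := by
  have := RT.prod (κ := κ) (col := icol (k := k)) Finset.univ
    (F := fun a z _ => ∏ b, if icol a < icol b then
      (1 - Complex.exp (-2 * (z a - z b))) ^ (-q * chg a * chg b) else 1)
    (Ft := fun a z _ => ∏ b, if icol a < icol b then
      (1 - Complex.exp (-2 * (z a - z b))) ^ (-q * chg a * chg b) else 1)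
    (Fl := fun a z _ => ∏ b : Idx k, 1) (fun a _ => RT.prod Finset.univ
    (F := fun b z _ => if icol a < icol b then
      (1 - Complex.exp (-2 * (z a - z b))) ^ (-q * chg a * chg b) else 1)
    (Ft := fun b z _ => if icol a < icol b then
      (1 - Complex.exp (-2 * (z a - z b))) ^ (-q * chg a * chg b) else 1)
    (Fl := fun b z _ => 1) (fun b _ => by
      by_cases h : icol a < icol b
      · simp only [if_pos h]; exact RT_fac_zpow h _
      · simp only [if_neg h]; exact RT.const 1))
  refine this.congr ?_ ?_ ?_ <;> intro z _ ν
  · rfl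
  · rfl
  · simp

/-- The sum `∑_{i<j} 1 / sinh² (x_i - x_j)`. -/
def pot {n : ℕ} (x : Fin n → ℂ) : ℂ := ∑ i, ∑ j ∈ Finset.Ioi i, 1 / Complex.sinh (x i - x j) ^ 2

theorem sum_ite_eq_two_mul_sum_Ioi {n : ℕ} (F : Fin n → Fin n → ℂ) (hF : ∀ i j, F i j = F j i) :
    ∑ i, ∑ j, (if i = j then 0 else F i j) = 2 * ∑ i, ∑ j ∈ Finset.Ioi i, F i j := by
  have h : ∀ i j, (if i = j then 0 else F i j) =
      (if i < j then F i j else 0) + (if j < i then F i j else 0) := by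
    intro i j
    rcases lt_trichotomy i j with h | h | h
    · simp [h, h.ne, h.not_gt]
    · simp [h]
    · simp [h, h.ne', h.not_gt]
  have h2 : ∀ i, ∑ j ∈ Finset.Ioi i, F i j = ∑ j, if i < j then F i j else 0 := by
    intro i
    rw [← Finset.sum_filter]
    congr 1
    ext j; simp
  simp only [h, Finset.sum_add_distrib, h2]
  rw [two_mul]
  congr 1
  rw [Finset.sum_comm]
  exact Finset.sum_congr rfl fun i _ => Finset.sum_congr rfl fun j _ => by rw [hF]

/-- The mixed terms cancel: a pair `(x, y)` occurs once weighted by the charge of `y` and once by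
that of `x`. -/
theorem sum_chg_cth {z : Idx k → ℂ} (hz : z ∈ dom (ipos (k := k))) :
    ∑ a, ∑ b, (if a = b then 0 else (chg b : ℂ) * (cth z a b ^ 2 - 1)) =
      2 * pot (fun j => z (.inl j)) - 2 * pot (fun i => z (.inr i)) := by
  have hs : ∀ a b : Idx k, a ≠ b → cth z a b ^ 2 - 1 = 1 / Complex.sinh (z a - z b) ^ 2 := fun a b h =>
    cth_sq_sub_one (mem_dom_ne ipos_injective hz h)
  have hsym : ∀ a b : ℂ, 1 / Complex.sinh (a - b) ^ 2 = 1 / Complex.sinh (b - a) ^ 2 := by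
    intro a b
    rw [← neg_sub, Complex.sinh_neg, neg_sq]
  have h1 : ∀ a b : Idx k, (if a = b then 0 else (chg b : ℂ) * (cth z a b ^ 2 - 1)) =
      if a = b then 0 else (chg b : ℂ) * (1 / Complex.sinh (z a - z b) ^ 2) := by
    intro a b
    split_ifs with h
    · rfl
    · rw [hs a b h]
  simp only [h1]
  rw [pot, pot, ← sum_ite_eq_two_mul_sum_Ioi _ fun i j => hsym _ _,
    ← sum_ite_eq_two_mul_sum_Ioi _ fun i j => hsym _ _]
  simp only [Fintype.sum_sum_type, Finset.sum_add_distrib]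
  have e1 : ∀ a b : Fin (k + 1), ((Sum.inl a : Idx k) = Sum.inl b) ↔ a = b := fun a b => Sum.inl_injective.eq_iff
  have e2 : ∀ a b : Fin k, ((Sum.inr a : Idx k) = Sum.inr b) ↔ a = b := fun a b => Sum.inr_injective.eq_iff
  simp only [e1, e2, chg, Sum.elim_inl, Sum.elim_inr, reduceCtorEq, if_false]
  have e3 : ∑ x : Fin (k + 1), ∑ y : Fin k, (((-1 : ℤ) : ℂ) * (1 / Complex.sinh (z (.inl x) - z (.inr y)) ^ 2)) =
      - ∑ y : Fin k, ∑ x : Fin (k + 1), (((1 : ℤ) : ℂ) * (1 / Complex.sinh (z (.inr y) - z (.inl x)) ^ 2)) := by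
    rw [Finset.sum_comm, ← Finset.sum_neg_distrib]
    refine Finset.sum_congr rfl fun i _ => ?_
    rw [← Finset.sum_neg_distrib]
    refine Finset.sum_congr rfl fun j _ => ?_
    rw [hsym]; push_cast; ring
  rw [e3]
  have e4 : ∑ x : Fin k, ∑ y : Fin k, (if x = y then 0 else
      ((-1 : ℤ) : ℂ) * (1 / Complex.sinh (z (.inr x) - z (.inr y)) ^ 2)) =
      - ∑ x : Fin k, ∑ y : Fin k, (if x = y then 0 else
      (1 / Complex.sinh (z (.inr x) - z (.inr y)) ^ 2)) := by
    rw [← Finset.sum_neg_distrib]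
    refine Finset.sum_congr rfl fun i _ => ?_
    rw [← Finset.sum_neg_distrib]
    refine Finset.sum_congr rfl fun j _ => ?_
    split_ifs <;> simp
  rw [e4]
  simp only [Int.cast_one, one_mul]
  ring

/-- The derivation along `x_i` and `y_i` simultaneously. -/
def Dd (i : Fin k) (f : (Idx k → ℂ) → ℂ) (z : Idx k → ℂ) : ℂ :=
  pd (.inl i.castSucc) f z + pd (.inr i) f z

/-- The Laplacian `∑ D_i² + ∂_{x_k}²`. -/
def lapD (f : (Idx k → ℂ) → ℂ) (z : Idx k → ℂ) : ℂ :=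
  ∑ i, Dd i (Dd i f) z + pd (.inl (Fin.last k)) (pd (.inl (Fin.last k)) f) z

theorem pd_comp_inr (i : Fin k) (Ψ : (Fin k → ℂ) → ℂ) (z : Idx k → ℂ) :
    pd (.inr i) (fun z : Idx k → ℂ => Ψ fun i => z (.inr i)) z = pd i Ψ fun i => z (.inr i) := by
  have : ∀ t, (fun j => Function.update z (.inr i) t (.inr j)) =
      Function.update (fun j => z (.inr j)) i t := by
    intro t
    ext j
    by_cases h : j = i
    · subst h; simp
    · rw [Function.update_of_ne h, Function.update_of_ne (Sum.inr_injective.ne h)]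
  simp only [pd, this]

theorem pd_inl_comp_inr (j : Fin (k + 1)) (Ψ : (Fin k → ℂ) → ℂ) (z : Idx k → ℂ) :
    pd (.inl j) (fun z : Idx k → ℂ => Ψ fun i => z (.inr i)) z = 0 := by
  unfold pd
  simp

/-- The exponential `exp (2 μ (∑ x - ∑ y))`. -/
def twexp (μ : ℂ) (z : Idx k → ℂ) : ℂ := ex (fun a => 2 * μ * chg a) z

theorem analyticAt_twexp (μ : ℂ) (z : Idx k → ℂ) : AnalyticAt ℂ (twexp μ) z := analyticAt_ex _ z

theorem pd_twexp (μ : ℂ) (a : Idx k) (z : Idx k → ℂ) :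
    pd a (twexp μ) z = 2 * μ * chg a * twexp μ z := pd_ex _ a z

/-- The kernel times an eigenfunction. -/
def kerF (q : ℤ) (μ : ℂ) (Ψ : (Fin k → ℂ) → ℂ) (z : Idx k → ℂ) : ℂ :=
  sker ipos chg q z * twexp μ z * Ψ fun i => z (.inr i)

theorem inr_mem_dom {z : Idx k → ℂ} (hz : z ∈ dom (icol (k := k))) :
    (fun i => z (.inr i)) ∈ dom (fun i : Fin k => (i : ℕ)) := fun i j h =>
  hz (.inr i) (.inr j) (by simpa [icol] using h)

theorem analyticAt_comp_inr {Ψ : (Fin k → ℂ) → ℂ} {z : Idx k → ℂ}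
    (h : AnalyticAt ℂ Ψ fun i => z (.inr i)) :
    AnalyticAt ℂ (fun z : Idx k → ℂ => Ψ fun i => z (.inr i)) z := by
  have h2 : AnalyticAt ℂ (fun z : Idx k → ℂ => fun i => z (.inr i)) z :=
    AnalyticAt.pi fun i => analyticAt_coord _ _
  exact AnalyticAt.fun_comp h h2

/-- The kernel identity together with the equation for `Ψ` gives the potential in `x`. What is left
over is a divergence in `y` of the kernel function times `lker` at `x_i` plus `lker` at `y_i`, a
factor that vanishes at `y_i = x_i` by `lker_add`. -/
theorem lapD_kerF (q : ℤ) (μ N : ℂ) {Ψ : (Fin k → ℂ) → ℂ}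
    (hΨ : AnalyticOnNhd ℂ Ψ (dom fun i : Fin k => (i : ℕ)))
    (heq : ∀ y ∈ dom (fun i : Fin k => (i : ℕ)), ∑ i, pd i (pd i Ψ) y =
      (2 * q * (q + 1) * pot y + N) * Ψ y) {z : Idx k → ℂ} (hz : z ∈ dom (ipos (k := k))) :
    lapD (kerF q μ Ψ) z = (2 * q * (q + 1) * pot (fun j => z (.inl j)) + N + 4 * μ ^ 2) *
      kerF q μ Ψ z + 2 * ∑ i, pd (.inr i) (fun z => (lker chg q (.inl i.castSucc) z +
        lker chg q (.inr i) z) * kerF q μ Ψ z) z := by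
  set U := dom (ipos (k := k)) with hU
  have hUo : IsOpen U := isOpen_dom _
  set L : Idx k → (Idx k → ℂ) → ℂ := fun a z => lker chg q a z + 2 * μ * chg a with hL
  set K : (Idx k → ℂ) → ℂ := fun z => sker ipos chg q z * twexp μ z with hK
  set φ : (Idx k → ℂ) → ℂ := fun z => Ψ fun i => z (.inr i) with hφ
  set F := kerF q μ Ψ with hF
  have hFK : F = fun z => K z * φ z := rfl
  have aL : ∀ a, AnalyticOnNhd ℂ (L a) U := fun a z hz =>
    (analyticOnNhd_lker ipos_injective q a z hz).add analyticAt_const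
  have aK : AnalyticOnNhd ℂ K U := fun z hz =>
    (analyticOnNhd_sker q z hz).mul (analyticAt_ex _ z)
  have aφ' : ∀ Ψ : (Fin k → ℂ) → ℂ, AnalyticOnNhd ℂ Ψ (dom fun i : Fin k => (i : ℕ)) →
      AnalyticOnNhd ℂ (fun z : Idx k → ℂ => Ψ fun i => z (.inr i)) U := fun Ψ h z hz =>
    analyticAt_comp_inr (h _ (inr_mem_dom (dom_ipos_subset hz)))
  have aφ : AnalyticOnNhd ℂ φ U := aφ' Ψ hΨ
  have apΨ : ∀ i, AnalyticOnNhd ℂ (pd i Ψ) (dom fun i : Fin k => (i : ℕ)) := fun i y hy =>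
    analyticAt_pd (hΨ y hy)
  have aF : AnalyticOnNhd ℂ F U := fun z hz => (aK z hz).mul (aφ z hz)
  have dK : ∀ a, ∀ z ∈ U, pd a K z = L a z * K z := by
    intro a z hz
    have h1 := pd_mul (i := a) (analyticOnNhd_sker (pos := ipos) (ε := chg) q z hz).differentiableAt
      (analyticAt_twexp μ z).differentiableAt
    refine h1.trans ?_
    rw [pd_sker ipos_injective chg_balance q a hz, pd_twexp]
    simp only [hL, hK]; ring
  have dFx : ∀ j, ∀ z ∈ U, pd (.inl j) F z = L (.inl j) z * F z := by
    intro j z hz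
    rw [hFK, pd_mul (aK z hz).differentiableAt (aφ z hz).differentiableAt, dK _ z hz,
      pd_inl_comp_inr]
    ring
  have dFxx : ∀ j, pd (.inl j) (pd (.inl j) F) z =
      (L (.inl j) z ^ 2 + pd (.inl j) (lker chg q (.inl j)) z) * F z := by
    intro j
    rw [pd_congr_on hUo _ (fun w hw => dFx j w hw) hz,
      pd_mul (aL _ z hz).differentiableAt (aF z hz).differentiableAt, dFx j z hz,
      pd_add (analyticOnNhd_lker ipos_injective q _ z hz).differentiableAt
        (differentiableAt_const _), pd_const]
    ring
  have dKφ : ∀ (i : Fin k) (Ψ : (Fin k → ℂ) → ℂ), AnalyticOnNhd ℂ Ψ (dom fun i : Fin k => (i : ℕ)) →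
      ∀ z ∈ U, pd (.inr i) (fun z => K z * Ψ fun i => z (.inr i)) z =
      L (.inr i) z * (K z * Ψ fun i => z (.inr i)) + K z * pd i Ψ fun i => z (.inr i) := by
    intro i Ψ h z hz
    rw [pd_mul (aK z hz).differentiableAt (aφ' Ψ h z hz).differentiableAt, dK _ z hz, pd_comp_inr]
    ring
  -- From `D_i² = ∂_{x_i}² - ∂_{y_i}² + 2 ∂_{y_i} D_i`. In `D_i F` the terms with `μ` cancel because
  -- `x_i` and `y_i` have opposite charges, and the derivatives of `Ψ` combine to `K ∂_i² Ψ`.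
  have main : ∀ i : Fin k, Dd i (Dd i F) z =
      (L (.inl i.castSucc) z ^ 2 + pd (.inl i.castSucc) (lker chg q (.inl i.castSucc)) z) * F z -
      (L (.inr i) z ^ 2 + pd (.inr i) (lker chg q (.inr i)) z) * F z +
      K z * (pd i (pd i Ψ) fun i => z (.inr i)) +
      2 * pd (.inr i) (fun z => (lker chg q (.inl i.castSucc) z + lker chg q (.inr i) z) * F z) z := by
    intro i
    set X : Idx k := .inl i.castSucc
    set Y : Idx k := .inr i
    have e0 : ∀ a : Idx k, pd a (Dd i F) z = pd a (pd X F) z + pd a (pd Y F) z := fun a =>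
      pd_add (analyticAt_pd (aF z hz)).differentiableAt (analyticAt_pd (aF z hz)).differentiableAt
    have aG : AnalyticAt ℂ (fun z => K z * pd i Ψ fun i => z (.inr i)) z :=
      (aK z hz).mul (aφ' _ (apΨ i) z hz)
    have aLF : AnalyticAt ℂ (fun z => L Y z * F z) z := (aL Y z hz).mul (aF z hz)
    have e1 : pd Y (pd Y F) z = pd Y (fun z => L Y z * F z) z +
        (L Y z * (K z * pd i Ψ fun i => z (.inr i)) + K z * (pd i (pd i Ψ) fun i => z (.inr i))) := by
      have hY : Set.EqOn (pd Y F) (fun w => L Y w * F w + K w * pd i Ψ fun i => w (.inr i)) U :=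
        fun w hw => dKφ i Ψ hΨ w hw
      rw [pd_congr_on hUo Y hY hz, pd_add aLF.differentiableAt aG.differentiableAt, dKφ i _ (apΨ i) z hz]
    have e2 : pd Y (fun z => L Y z * F z) z = pd Y (lker chg q Y) z * F z +
        L Y z * (L Y z * F z + K z * pd i Ψ fun i => z (.inr i)) := by
      rw [pd_mul (aL Y z hz).differentiableAt (aF z hz).differentiableAt]
      rw [show pd Y F z = _ from dKφ i Ψ hΨ z hz,
        pd_add (analyticOnNhd_lker ipos_injective q _ z hz).differentiableAt
        (differentiableAt_const _), pd_const]
      simp only [hFK, hφ]; ring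
    have e3 : pd Y (fun z => (lker chg q X z + lker chg q Y z) * F z) z =
        pd Y (pd X F) z + pd Y (fun z => L Y z * F z) z := by
      rw [← pd_add (analyticAt_pd (aF z hz)).differentiableAt aLF.differentiableAt]
      refine pd_congr_on hUo _ (fun w hw => ?_) hz
      rw [dFx _ w hw]
      simp only [hL, X, Y, chg, Sum.elim_inl, Sum.elim_inr]
      push_cast
      ring
    have e4 : pd X (pd Y F) z = pd Y (pd X F) z := pd_pd_comm (aF z hz)
    have e5 := dFxx i.castSucc
    unfold Dd at e0 ⊢
    rw [e0, e0, e4, e1, e3]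
    linear_combination e5 - e2
  unfold lapD
  simp only [main, Finset.sum_add_distrib, ← Finset.mul_sum, dFxx]
  have hk := kernel_identity ipos_injective chg_sq sum_chg q μ hz
  rw [sum_chg_cth hz, Fintype.sum_sum_type, Fin.sum_univ_castSucc] at hk
  simp only [chg, Sum.elim_inl, Sum.elim_inr] at hk
  have hy := heq _ (inr_mem_dom (dom_ipos_subset hz))
  rw [hy]
  have hFz : F z = K z * Ψ fun i => z (.inr i) := rfl
  simp only [Finset.sum_sub_distrib, ← Finset.sum_mul, hL, chg, Sum.elim_inl, Sum.elim_inr]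
  push_cast at hk ⊢
  simp only [one_mul, neg_one_mul, Finset.sum_neg_distrib] at hk ⊢
  linear_combination F z * hk - (2 * q * (q + 1) * pot (fun i => z (.inr i)) + N) * hFz

end Interlacing

end TrigBA

end

/-! ### Polynomials in commuting operators. -/

noncomputable section

namespace TrigBA

/-- The algebra homomorphism from polynomials given by a commuting family. -/
def commHom {A : Type*} [Ring A] [Algebra ℂ A] {k : ℕ} (T : Fin k → A)
    (hT : ∀ i j, Commute (T i) (T j)) : MvPolynomial (Fin k) ℂ →ₐ[ℂ] A :=
  letI : CommRing (Algebra.adjoin ℂ (Set.range T)) :=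
    { (inferInstance : Ring (Algebra.adjoin ℂ (Set.range T))) with
      mul_comm := fun a b => by
        have h := Algebra.isMulCommutative_adjoin (R := ℂ) (A := A) (s := Set.range T)
          (by rintro _ ⟨i, rfl⟩ _ ⟨j, rfl⟩; exact hT i j)
        exact h.is_comm.comm a b }
  (Algebra.adjoin ℂ (Set.range T)).val.comp
    (MvPolynomial.aeval fun i => (⟨T i, Algebra.subset_adjoin ⟨i, rfl⟩⟩ : Algebra.adjoin ℂ (Set.range T)))

theorem commHom_X {A : Type*} [Ring A] [Algebra ℂ A] {k : ℕ} (T : Fin k → A)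
    (hT : ∀ i j, Commute (T i) (T j)) (i : Fin k) :
    commHom T hT (MvPolynomial.X i) = T i := by
  unfold commHom
  simp

theorem commHom_commute {A : Type*} [Ring A] [Algebra ℂ A] {k : ℕ} {T : Fin k → A}
    (hT : ∀ i j, Commute (T i) (T j)) {B : A} (hB : ∀ i, Commute B (T i)) (p : MvPolynomial (Fin k) ℂ) :
    Commute B (commHom T hT p) := by
  induction p using MvPolynomial.induction_on with
  | C a =>
    rw [← MvPolynomial.algebraMap_eq, AlgHom.commutes]
    exact (Algebra.commutes a B).symm
  | add p q hp hq => rw [map_add]; exact hp.add_right hq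
  | mul_X p i hp => rw [map_mul, commHom_X]; exact hp.mul_right (hB i)

/-! ### Restriction to the diagonal, and the operators on functions analytic across it. -/

section Diagonal

variable {k : ℕ}

theorem hasFDerivAt_diag (x : Fin (k + 1) → ℂ) : HasFDerivAt (diag (k := k))
    (ContinuousLinearMap.pi fun a : Idx k => ContinuousLinearMap.proj (R := ℂ) (φ := fun _ => ℂ)
      (Sum.elim id Fin.castSucc a)) x := by
  have : diag (k := k) = ⇑(ContinuousLinearMap.pi fun a : Idx k =>
      ContinuousLinearMap.proj (R := ℂ) (φ := fun _ : Fin (k + 1) => ℂ)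
      (Sum.elim id Fin.castSucc a)) := by
    ext x a
    rcases a with a | a <;> simp [diag]
  rw [this]
  exact ContinuousLinearMap.hasFDerivAt _

theorem analyticAt_comp_diag {f : (Idx k → ℂ) → ℂ} {x : Fin (k + 1) → ℂ}
    (h : AnalyticAt ℂ f (diag x)) : AnalyticAt ℂ (fun x => f (diag x)) x := by
  have h2 : AnalyticAt ℂ (diag (k := k)) x := AnalyticAt.pi fun a => by
    rcases a with a | a <;> simp only [diag, Sum.elim_inl, Sum.elim_inr] <;> exact analyticAt_coord _ _
  exact AnalyticAt.fun_comp h h2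

theorem pd_diag {f : (Idx k → ℂ) → ℂ} {x : Fin (k + 1) → ℂ} (h : AnalyticAt ℂ f (diag x))
    (j : Fin (k + 1)) : pd j (fun x => f (diag x)) x =
      fderiv ℂ f (diag x) (fun a => if Sum.elim id Fin.castSucc a = j then 1 else 0) := by
  rw [pd_eq_fderiv (analyticAt_comp_diag h).differentiableAt]
  have := (h.differentiableAt.hasFDerivAt.comp x (hasFDerivAt_diag x)).fderiv
  change fderiv ℂ (f ∘ diag) x _ = _
  rw [this]
  change fderiv ℂ f (diag x) _ = _
  congr 1
  ext a
  simp [Pi.single_apply]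

theorem pd_diag_castSucc {f : (Idx k → ℂ) → ℂ} {x : Fin (k + 1) → ℂ} (h : AnalyticAt ℂ f (diag x))
    (i : Fin k) : pd i.castSucc (fun x => f (diag x)) x = Dd i f (diag x) := by
  rw [pd_diag h, Dd, pd_eq_fderiv h.differentiableAt, pd_eq_fderiv h.differentiableAt, ← map_add]
  congr 1
  ext a
  rcases a with a | a <;> simp [Pi.single_apply] <;> congr

theorem pd_diag_last {f : (Idx k → ℂ) → ℂ} {x : Fin (k + 1) → ℂ} (h : AnalyticAt ℂ f (diag x)) :
    pd (Fin.last k) (fun x => f (diag x)) x = pd (.inl (Fin.last k)) f (diag x) := by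
  rw [pd_diag h, pd_eq_fderiv h.differentiableAt]
  congr 1
  ext a
  rcases a with a | a <;> simp [Pi.single_apply] <;> congr

/-- Nonvanishing of the difference of exponentials for different colours. -/
theorem mem_dom_icol_ne {z : Idx k → ℂ} (hz : z ∈ dom (icol (k := k))) {a b : Idx k}
    (h : icol a ≠ icol b) : Complex.exp (-2 * z b) - Complex.exp (-2 * z a) ≠ 0 := by
  have key : ∀ a b : Idx k, icol a < icol b → Complex.exp (-2 * z b) - Complex.exp (-2 * z a) ≠ 0 := by
    intro a b hab h0
    apply hz a b hab
    rw [mul_sub, Complex.exp_sub, ← sub_eq_zero.1 h0, div_self (Complex.exp_ne_zero _)]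
  rcases lt_or_gt_of_ne h with h1 | h1
  · exact key a b h1
  · intro h0
    exact key b a h1 (by rw [← neg_sub, h0, neg_zero])

theorem isOpen_domVal {n : ℕ} : IsOpen (dom fun i : Fin n => (i : ℕ)) := isOpen_dom _

/-- Chain rule: on the diagonal, differentiation in `x_i` becomes `D_i`, while the last variable has
no partner. This is why `lapD` and not the full Laplacian is studied. -/
theorem sum_pd_pd_diag {f : (Idx k → ℂ) → ℂ} (hf : AnalyticOnNhd ℂ f (dom icol))
    {x : Fin (k + 1) → ℂ} (hx : x ∈ dom fun j : Fin (k + 1) => (j : ℕ)) :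
    ∑ j, pd j (pd j fun x => f (diag x)) x = lapD f (diag x) := by
  rw [Fin.sum_univ_castSucc, lapD]
  congr 1
  · refine Finset.sum_congr rfl fun i _ => ?_
    rw [pd_congr_on isOpen_domVal i.castSucc
      (fun w hw => pd_diag_castSucc (hf _ (diag_mem hw)) i) hx]
    refine pd_diag_castSucc ?_ i
    exact (analyticAt_pd (hf _ (diag_mem hx))).add (analyticAt_pd (hf _ (diag_mem hx)))
  · rw [pd_congr_on isOpen_domVal (Fin.last k)
      (fun w hw => pd_diag_last (hf _ (diag_mem hw))) hx]
    exact pd_diag_last (analyticAt_pd (hf _ (diag_mem hx)))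

/-- The space of functions analytic off the walls between different colours. -/
abbrev HolI (k : ℕ) : Type := Hol (dom (icol (k := k)))

/-- Two functions analytic off the walls agree if they agree off the diagonals `T_i = 0`. -/
theorem HolI.ext_off {f g : HolI k} (h : ∀ z ∈ dom (ipos (k := k)), f.1 z = g.1 z) : f = g := by
  refine Hol.ext_on fun z hz => ?_
  -- All `y_i` are moved by one common `t`. Each `exp (-2 σ_i)` has nonzero derivative in `t` at
  -- `0`, so `T_i` does not vanish for small `t ≠ 0`.
  set Z : ℂ → Idx k → ℂ := fun t => Sum.elim (fun j => z (.inl j)) (fun i => z (.inr i) + t) with hZ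
  have hZ0 : Z 0 = z := by
    ext a; rcases a with a | a <;> simp [hZ]
  have hZc : Continuous Z := by
    refine continuous_pi fun a => ?_
    rcases a with a | a <;> simp only [hZ, Sum.elim_inl, Sum.elim_inr] <;> fun_prop
  have hT : Tendsto Z (𝓝[≠] 0) (𝓝 z) := by
    have := hZc.tendsto 0
    rw [hZ0] at this
    exact this.mono_left nhdsWithin_le_nhds
  have h1 : ∀ᶠ t in 𝓝[≠] (0 : ℂ), Z t ∈ dom (ipos (k := k)) := by
    have e1 : ∀ᶠ t in 𝓝[≠] (0 : ℂ), Z t ∈ dom (icol (k := k)) :=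
      hT.eventually ((isOpen_dom _).mem_nhds hz)
    have e2 : ∀ i : Fin k, ∀ᶠ t in 𝓝[≠] (0 : ℂ), Tf i (Z t) ≠ 0 := by
      intro i
      have hd : HasDerivAt (fun t : ℂ => Complex.exp (-2 * (z (.inl i.castSucc) - (z (.inr i) + t))))
          (Complex.exp (-2 * (z (.inl i.castSucc) - (z (.inr i) + 0))) * (-2 * (-1))) 0 := by
        refine HasDerivAt.cexp ?_
        refine HasDerivAt.const_mul _ ?_
        simpa using ((hasDerivAt_id (0 : ℂ)).const_add (z (.inr i))).const_sub (z (.inl i.castSucc))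
      filter_upwards [hd.eventually_ne (c := 1)
        (mul_ne_zero (Complex.exp_ne_zero _) (by norm_num))] with t ht
      exact sub_ne_zero.2 (Ne.symm ht)
    filter_upwards [e1, eventually_all.2 e2] with t h1 h2
    exact mem_dom_ipos.2 ⟨h1, h2⟩
  have hf : Tendsto (fun t => f.1 (Z t)) (𝓝[≠] 0) (𝓝 (f.1 z)) :=
    ((Hol.analytic f z hz).continuousAt.tendsto).comp hT
  have hg : Tendsto (fun t => g.1 (Z t)) (𝓝[≠] 0) (𝓝 (g.1 z)) :=
    ((Hol.analytic g z hz).continuousAt.tendsto).comp hT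
  refine tendsto_nhds_unique hf (hg.congr' ?_)
  filter_upwards [h1] with t ht
  exact (h _ ht).symm

/-- The partial derivatives on `HolI k`. -/
def P (a : Idx k) : Module.End ℂ (HolI k) := pdOp (isOpen_dom _) a

/-- The operators `D_i`. -/
def DOp (i : Fin k) : Module.End ℂ (HolI k) := P (.inl i.castSucc) + P (.inr i)

/-- The Laplacian `∑ D_i² + ∂_{x_k}²` on `HolI k`. -/
def lapOp : Module.End ℂ (HolI k) :=
  ∑ i : Fin k, DOp i * DOp i + P (.inl (Fin.last k)) * P (.inl (Fin.last k))

theorem P_apply (a : Idx k) (f : HolI k) {z : Idx k → ℂ} (hz : z ∈ dom (icol (k := k))) :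
    (P a f).1 z = pd a f.1 z := pdOp_apply _ _ _ hz

theorem DOp_apply (i : Fin k) (f : HolI k) {z : Idx k → ℂ} (hz : z ∈ dom (icol (k := k))) :
    (DOp i f).1 z = Dd i f.1 z := by
  change (P _ f).1 z + (P _ f).1 z = _
  rw [P_apply _ _ hz, P_apply _ _ hz, Dd]

theorem Dd_congr_on {U : Set (Idx k → ℂ)} (hU : IsOpen U) {f g : (Idx k → ℂ) → ℂ} (i : Fin k)
    (h : Set.EqOn f g U) : Set.EqOn (Dd i f) (Dd i g) U := fun z hz =>
  congrArg₂ (· + ·) (pd_congr_on hU _ h hz) (pd_congr_on hU _ h hz)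

theorem lapD_congr_on {U : Set (Idx k → ℂ)} (hU : IsOpen U) {f g : (Idx k → ℂ) → ℂ}
    (h : Set.EqOn f g U) : Set.EqOn (lapD f) (lapD g) U := fun z hz =>
  congrArg₂ (· + ·) (Finset.sum_congr rfl fun i _ => Dd_congr_on hU i (Dd_congr_on hU i h) hz)
    (pd_congr_on hU _ (pd_congr_on hU _ h) hz)

theorem Hol_sum_apply {ι : Type*} [Fintype ι] [DecidableEq ι] {Ω : Set (ι → ℂ)} {α : Type*}
    (s : Finset α) (F : α → Hol Ω) (z : ι → ℂ) :
    (∑ a ∈ s, F a).1 z = ∑ a ∈ s, (F a).1 z := by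
  classical
  induction s using Finset.induction_on with
  | empty => rfl
  | insert a s ha ih => rw [Finset.sum_insert ha, Finset.sum_insert ha, ← ih]; rfl

theorem lapOp_apply (f : HolI k) {z : Idx k → ℂ} (hz : z ∈ dom (icol (k := k))) :
    (lapOp f).1 z = lapD f.1 z := by
  unfold lapOp
  rw [LinearMap.add_apply, LinearMap.sum_apply]
  change (∑ i : Fin k, DOp i (DOp i f)).1 z + (P _ (P _ f)).1 z = _
  rw [Hol_sum_apply, lapD]
  congr 1
  · refine Finset.sum_congr rfl fun i _ => ?_
    rw [DOp_apply i _ hz]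
    exact Dd_congr_on (isOpen_dom _) i (fun w hw => DOp_apply i f hw) hz
  · rw [P_apply _ _ hz]
    exact pd_congr_on (isOpen_dom _) _ (fun w hw => P_apply _ f hw) hz

theorem P_commute (a b : Idx k) : Commute (P a) (P b) := pdOp_commute _ _ _

theorem lapOp_commute {B : Module.End ℂ (HolI k)} (h1 : ∀ i, Commute B (DOp i))
    (h2 : Commute B (P (.inl (Fin.last k)))) : Commute B lapOp :=
  (Commute.sum_right _ _ _ fun i _ => (h1 i).mul_right (h1 i)).add_right (h2.mul_right h2)

theorem exp_ne_one_iff_sinh (w : ℂ) : Complex.exp (-2 * w) ≠ 1 ↔ Complex.sinh w ≠ 0 := by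
  rw [not_iff_not, Complex.sinh, div_eq_zero_iff]
  simp only [OfNat.ofNat_ne_zero, or_false, sub_eq_zero]
  have : Complex.exp (-2 * w) = Complex.exp (-w) / Complex.exp w := by
    rw [← Complex.exp_sub]; congr 1; ring
  rw [this, div_eq_one_iff_eq (Complex.exp_ne_zero _), eq_comm]

theorem analyticAt_pot {n : ℕ} {x : Fin n → ℂ} (hx : x ∈ dom fun j : Fin n => (j : ℕ)) :
    AnalyticAt ℂ (pot (n := n)) x := by
  refine Finset.analyticAt_fun_sum _ fun i _ => Finset.analyticAt_fun_sum _ fun j hj => ?_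
  have h : Complex.sinh (x i - x j) ≠ 0 :=
    (exp_ne_one_iff_sinh _).1 (hx i j (Fin.lt_def.1 (Finset.mem_Ioi.1 hj)))
  have h1 : AnalyticAt ℂ (fun x : Fin n → ℂ => Complex.sinh (x i - x j)) x :=
    (Complex.analyticAt_sinh).comp ((analyticAt_coord i x).sub (analyticAt_coord j x))
  exact analyticAt_const.div (h1.pow 2) (pow_ne_zero 2 h)

theorem inl_mem_dom {z : Idx k → ℂ} (hz : z ∈ dom (icol (k := k))) :
    (fun j => z (.inl j)) ∈ dom (fun j : Fin (k + 1) => (j : ℕ)) := fun i j h =>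
  hz (.inl i) (.inl j) (by simpa [icol] using h)

theorem analyticAt_potX {z : Idx k → ℂ} (hz : z ∈ dom (icol (k := k))) :
    AnalyticAt ℂ (fun z : Idx k → ℂ => pot fun j => z (.inl j)) z := by
  have h2 : AnalyticAt ℂ (fun z : Idx k → ℂ => fun j => z (.inl j)) z :=
    AnalyticAt.pi fun i => analyticAt_coord _ _
  exact AnalyticAt.fun_comp (analyticAt_pot (inl_mem_dom hz)) h2

/-- Multiplication by `c ∑_{i<j} 1 / sinh² (x_i - x_j) + N`. -/
def potOp (c N : ℂ) : Module.End ℂ (HolI k) :=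
  mulOp (fun z => c * pot (fun j => z (.inl j)) + N) fun _ hz =>
    (analyticAt_const.mul (analyticAt_potX hz)).add analyticAt_const

theorem pd_inr_comp_inl (i : Fin k) (Ψ : (Fin (k + 1) → ℂ) → ℂ) (z : Idx k → ℂ) :
    pd (.inr i) (fun z : Idx k → ℂ => Ψ fun j => z (.inl j)) z = 0 := by
  unfold pd
  simp

theorem P_inr_commute_potOp (i : Fin k) (c N : ℂ) : Commute (P (.inr i)) (potOp (k := k) c N) :=
  pdOp_mulOp_commute _ _ _ fun z _ => pd_inr_comp_inl i (fun x => c * pot x + N) z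

/-- The quotient of the sum of the logarithmic derivatives in `x_i`, `y_i` by `T_i`. -/
def lreg (q : ℤ) (i : Fin k) (z : Idx k → ℂ) : ℂ :=
  q * ∑ b, if icol b = i then 0 else chg b * (2 * Complex.exp (-2 * z b) * Complex.exp (-2 * z (.inr i)) /
    ((Complex.exp (-2 * z b) - Complex.exp (-2 * z (.inl i.castSucc))) *
      (Complex.exp (-2 * z b) - Complex.exp (-2 * z (.inr i)))))

theorem analyticOnNhd_lreg (q : ℤ) (i : Fin k) : AnalyticOnNhd ℂ (lreg q i) (dom icol) := by
  intro z hz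
  refine analyticAt_const.mul (Finset.analyticAt_fun_sum _ fun b _ => ?_)
  by_cases h : icol b = i
  · simp only [h, if_true]; exact analyticAt_const
  · simp only [h, if_false]
    have hx : ∀ c, AnalyticAt ℂ (fun z : Idx k → ℂ => Complex.exp (-2 * z c)) z := fun c =>
      (analyticAt_const.mul (analyticAt_coord c z)).cexp
    refine analyticAt_const.mul (((analyticAt_const.mul (hx b)).mul (hx _)).div
      (((hx b).sub (hx _)).mul ((hx b).sub (hx _))) (mul_ne_zero ?_ ?_))
    · exact mem_dom_icol_ne hz (by simpa [icol] using Ne.symm h)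
    · exact mem_dom_icol_ne hz (by simpa [icol] using Ne.symm h)

/-- With opposite charges the sum is a difference of cotangents based at `y_i` and at `x_i`, which
carries the factor `T_i`; the two singular cotangents of the pair itself cancel by antisymmetry. -/
theorem lker_add (q : ℤ) (i : Fin k) {z : Idx k → ℂ} (hz : z ∈ dom (ipos (k := k))) :
    lker chg q (.inl i.castSucc) z + lker chg q (.inr i) z = Tf i z * lreg q i z := by
  have hT : Tf i z = (Complex.exp (-2 * z (.inr i)) - Complex.exp (-2 * z (.inl i.castSucc))) /
      Complex.exp (-2 * z (.inr i)) := one_sub_exp_eq z (.inl i.castSucc) (.inr i)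
  unfold lker lreg
  simp only [chg, Sum.elim_inl, Sum.elim_inr]
  have e : ∀ q S1 S2 S3 T : ℂ, S2 - S1 = T * S3 → -q * ((1 : ℤ) : ℂ) * S1 + -q * ((-1 : ℤ) : ℂ) * S2 =
      T * (q * S3) := by
    intro q S1 S2 S3 T h
    push_cast
    linear_combination q * h
  apply e
  have hc : ∀ b : Idx k, icol b = i ↔ b = .inl i.castSucc ∨ b = .inr i := by
    rintro (b | b)
    · simp only [icol, Sum.elim_inl, Sum.inl.injEq, reduceCtorEq, or_false]
      rw [Fin.ext_iff]; simp
    · simp only [icol, Sum.elim_inr, Sum.inr.injEq, reduceCtorEq, false_or]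
      rw [Fin.ext_iff]
  rw [← Finset.sum_sub_distrib, Finset.mul_sum]
  have key : ∀ b : Idx k, ((Sum.elim (fun _ => 1) (fun _ => -1) b : ℤ) : ℂ) * cth z (.inr i) b -
      ((Sum.elim (fun _ => 1) (fun _ => -1) b : ℤ) : ℂ) * cth z (.inl i.castSucc) b =
      Tf i z * (if icol b = i then 0 else ((Sum.elim (fun _ => 1) (fun _ => -1) b : ℤ) : ℂ) *
        (2 * Complex.exp (-2 * z b) * Complex.exp (-2 * z (.inr i)) /
    ((Complex.exp (-2 * z b) - Complex.exp (-2 * z (.inl i.castSucc))) *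
      (Complex.exp (-2 * z b) - Complex.exp (-2 * z (.inr i)))))) +
      ((if b = .inl i.castSucc then cth z (.inr i) (.inl i.castSucc) else 0) +
      (if b = .inr i then cth z (.inl i.castSucc) (.inr i) else 0)) := by
    intro b
    by_cases h : icol b = i
    · rw [if_pos h, mul_zero]
      rcases (hc b).1 h with rfl | rfl
      · simp [cth_self]
      · simp [cth_self]
    · have hne : ¬ (b = .inl i.castSucc) ∧ ¬ (b = .inr i) := by
        rw [← not_or, ← hc]; exact h
      rw [if_neg h, if_neg hne.1, if_neg hne.2, hT]
      have h1 := mem_dom_ne ipos_injective hz (Ne.symm hne.1)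
      have h2 := mem_dom_ne ipos_injective hz (Ne.symm hne.2)
      have h3 : Complex.exp (-2 * z (.inr i)) ≠ 0 := Complex.exp_ne_zero _
      unfold cth
      generalize ((Sum.elim (fun _ => 1) (fun _ => -1) b : ℤ) : ℂ) = ε
      generalize Complex.exp (-2 * z (.inr i)) = Ey at *
      generalize Complex.exp (-2 * z (.inl i.castSucc)) = Ex at *
      generalize Complex.exp (-2 * z b) = Eb at *
      field_simp
      ring
  rw [Finset.sum_congr rfl fun b _ => key b]
  simp only [Finset.sum_add_distrib, Finset.sum_ite_eq', Finset.mem_univ, if_true]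
  rw [cth_antisymm z (.inr i)]
  ring

end Diagonal

end TrigBA

end

noncomputable section

namespace TrigBA

/-! ### The residue construction: the kernel with `q = -m - 1`. -/

section ResidueStep

variable {k : ℕ}

/-- The factors `T_i^(q+1) exp (2 σ_i)`. -/
def wfac (n : ℤ) (i : Fin k) (z : Idx k → ℂ) : ℂ :=
  (1 - Complex.exp (-2 * (z (.inl i.castSucc) - z (.inr i)))) ^ n *
    Complex.exp (2 * (z (.inl i.castSucc) - z (.inr i)))

theorem T_ne {z : Idx k → ℂ} (hz : z ∈ dom (ipos (k := k))) (i : Fin k) :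
    1 - Complex.exp (-2 * (z (.inl i.castSucc) - z (.inr i))) ≠ 0 := (mem_dom_ipos.1 hz).2 i

theorem analyticAt_wfac (n : ℤ) (i : Fin k) {z : Idx k → ℂ} (hz : z ∈ dom (ipos (k := k))) :
    AnalyticAt ℂ (wfac n i) z :=
  (analyticAt_fac_zpow n (T_ne hz i)).mul (analyticAt_exp_diff _ _ _ _)

theorem pd_wfac (n : ℤ) (i : Fin k) (a : Idx k) {z : Idx k → ℂ} (hz : z ∈ dom (ipos (k := k))) :
    pd a (wfac n i) z = (((if a = .inl i.castSucc then 1 else 0) - (if a = .inr i then 1 else 0)) *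
      (n * (cth z (.inl i.castSucc) (.inr i) - 1) + 2)) * wfac n i z := by
  have hne : Complex.exp (-2 * z (.inr i)) - Complex.exp (-2 * z (.inl i.castSucc)) ≠ 0 :=
    mem_dom_ne ipos_injective hz (by simp)
  refine (pd_mul (analyticAt_fac_zpow n (T_ne hz i)).differentiableAt
    (analyticAt_exp_diff _ _ _ _).differentiableAt).trans ?_
  rw [pd_fac_zpow _ _ hne, pd_exp_diff, wfac]
  ring

/-- The product of the factors. -/
def wprod (n : ℤ) (z : Idx k → ℂ) : ℂ := ∏ i, wfac n i z

theorem analyticAt_wprod (n : ℤ) {z : Idx k → ℂ} (hz : z ∈ dom (ipos (k := k))) :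
    AnalyticAt ℂ (wprod n) z := Finset.analyticAt_fun_prod _ fun i _ => analyticAt_wfac n i hz

theorem pd_wprod (n : ℤ) (a : Idx k) {z : Idx k → ℂ} (hz : z ∈ dom (ipos (k := k))) :
    pd a (wprod n) z = (∑ i, ((if a = .inl i.castSucc then 1 else 0) - (if a = .inr i then 1 else 0)) *
      (n * (cth z (.inl i.castSucc) (.inr i) - 1) + 2)) * wprod n z :=
  pd_prod_log _ (fun i _ => (analyticAt_wfac n i hz).differentiableAt) fun i _ => pd_wfac n i a hz

theorem pd_wprod_inr (n : ℤ) (i : Fin k) {z : Idx k → ℂ} (hz : z ∈ dom (ipos (k := k))) :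
    pd (.inr i) (wprod n) z = -(n * (cth z (.inl i.castSucc) (.inr i) - 1) + 2) * wprod n z := by
  rw [pd_wprod n _ hz]
  congr 1
  simp only [reduceCtorEq, if_false, Sum.inr.injEq, zero_sub, neg_mul]
  rw [Finset.sum_eq_single i]
  · simp
  · intro j _ hj; rw [if_neg (Ne.symm hj)]; simp
  · simp

theorem Dd_wprod (n : ℤ) (i : Fin k) {z : Idx k → ℂ} (hz : z ∈ dom (ipos (k := k))) :
    Dd i (wprod n) z = 0 := by
  rw [Dd, pd_wprod_inr n i hz, pd_wprod n _ hz, ← add_mul]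
  convert zero_mul _
  simp only [reduceCtorEq, if_false, sub_zero, Sum.inl.injEq]
  rw [Finset.sum_eq_single i]
  · simp
  · intro j _ hj
    rw [if_neg (fun h => hj (Fin.castSucc_injective _ h).symm)]; simp
  · simp

theorem pd_wprod_last (n : ℤ) {z : Idx k → ℂ} (hz : z ∈ dom (ipos (k := k))) :
    pd (.inl (Fin.last k)) (wprod n) z = 0 := by
  rw [pd_wprod n _ hz]
  convert zero_mul _
  refine Finset.sum_eq_zero fun i _ => ?_
  simp only [reduceCtorEq, if_false, sub_zero, Sum.inl.injEq]
  rw [if_neg (Fin.castSucc_lt_last i).ne']; simp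

theorem Dd_mul {f g : (Idx k → ℂ) → ℂ} {z : Idx k → ℂ} (hf : DifferentiableAt ℂ f z)
    (hg : DifferentiableAt ℂ g z) (i : Fin k) :
    Dd i (fun z => f z * g z) z = Dd i f z * g z + f z * Dd i g z := by
  unfold Dd
  rw [pd_mul hf hg, pd_mul hf hg]; ring

theorem analyticAt_Dd {f : (Idx k → ℂ) → ℂ} {z : Idx k → ℂ} (hf : AnalyticAt ℂ f z) (i : Fin k) :
    AnalyticAt ℂ (Dd i f) z := (analyticAt_pd hf).add (analyticAt_pd hf)

/-- The weight depends only on the differences `σ_i`, which every `D_i` and the last derivative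
annihilate. -/
theorem lapD_wprod_mul (n : ℤ) {F : (Idx k → ℂ) → ℂ}
    (hF : AnalyticOnNhd ℂ F (dom (ipos (k := k)))) {z : Idx k → ℂ} (hz : z ∈ dom (ipos (k := k))) :
    lapD (fun z => wprod n z * F z) z = wprod n z * lapD F z := by
  have h1 : ∀ (G : (Idx k → ℂ) → ℂ), AnalyticOnNhd ℂ G (dom (ipos (k := k))) → ∀ i,
      Set.EqOn (Dd i (fun z => wprod n z * G z)) (fun z => wprod n z * Dd i G z) (dom (ipos (k := k))) := by
    intro G hG i w hw
    rw [Dd_mul (analyticAt_wprod n hw).differentiableAt (hG w hw).differentiableAt, Dd_wprod n i hw,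
      zero_mul, zero_add]
  have h2 : ∀ (G : (Idx k → ℂ) → ℂ), AnalyticOnNhd ℂ G (dom (ipos (k := k))) →
      Set.EqOn (pd (.inl (Fin.last k)) (fun z => wprod n z * G z))
        (fun z => wprod n z * pd (.inl (Fin.last k)) G z) (dom (ipos (k := k))) := by
    intro G hG w hw
    rw [pd_mul (analyticAt_wprod n hw).differentiableAt (hG w hw).differentiableAt,
      pd_wprod_last n hw, zero_mul, zero_add]
  unfold lapD
  rw [mul_add, Finset.mul_sum]
  congr 1
  · refine Finset.sum_congr rfl fun i _ => ?_
    rw [Dd_congr_on (isOpen_dom _) i (h1 F hF i) hz]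
    exact h1 _ (fun w hw => analyticAt_Dd (hF w hw) i) i hz
  · rw [pd_congr_on (isOpen_dom _) _ (h2 F hF) hz]
    exact h2 _ (fun w hw => analyticAt_pd (hF w hw)) hz

theorem analyticOnNhd_kerF (q : ℤ) (μ : ℂ) {Ψ : (Fin k → ℂ) → ℂ}
    (hΨ : AnalyticOnNhd ℂ Ψ (dom fun i : Fin k => (i : ℕ))) :
    AnalyticOnNhd ℂ (kerF q μ Ψ) (dom (ipos (k := k))) := fun z hz =>
  ((analyticOnNhd_sker q z hz).mul (analyticAt_twexp μ z)).mul
    (analyticAt_comp_inr (hΨ _ (inr_mem_dom (dom_ipos_subset hz))))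

/-- The function `exp (2 ∑ σ) N exp (2 μ (∑ x - ∑ y)) Ψ(y)`. -/
def resFun (m : ℕ) (μ : ℂ) (Ψ : (Fin k → ℂ) → ℂ) (z : Idx k → ℂ) : ℂ :=
  (∏ i, Complex.exp (2 * sig i z)) * Nker (-(m : ℤ) - 1) z * twexp μ z * Ψ fun i => z (.inr i)

theorem analyticOnNhd_resFun (m : ℕ) (μ : ℂ) {Ψ : (Fin k → ℂ) → ℂ}
    (hΨ : AnalyticOnNhd ℂ Ψ (dom fun i : Fin k => (i : ℕ))) :
    AnalyticOnNhd ℂ (resFun m μ Ψ) (dom (icol (k := k))) := fun z hz =>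
  (((Finset.analyticAt_fun_prod _ fun i _ => analyticAt_exp_diff _ _ _ _).mul
    (analyticOnNhd_Nker _ z hz)).mul (analyticAt_twexp μ z)).mul
    (analyticAt_comp_inr (hΨ _ (inr_mem_dom hz)))

theorem resFun_eq (m : ℕ) (μ : ℂ) (Ψ : (Fin k → ℂ) → ℂ) {z : Idx k → ℂ}
    (hz : z ∈ dom (ipos (k := k))) :
    resFun m μ Ψ z = wprod ((m : ℤ) + 1) z * kerF (-(m : ℤ) - 1) μ Ψ z := by
  have h : ∀ i, wfac ((m : ℤ) + 1) i z * Tf i z ^ (-(m : ℤ) - 1) = Complex.exp (2 * sig i z) := by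
    intro i
    have hT : Tf i z ≠ 0 := T_ne hz i
    change Tf i z ^ ((m : ℤ) + 1) * Complex.exp (2 * sig i z) * _ = _
    rw [mul_right_comm, ← zpow_add₀ hT]
    simp
  rw [resFun, kerF, sker_eq, wprod]
  simp only [← h, Finset.prod_mul_distrib]
  ring

/-- The operator `-(1/2) exp (2 σ_i) ∂_{y_i}`. -/
def dOp (i : Fin k) : Module.End ℂ (HolI k) :=
  mulOp (fun z => -(1 / 2) * Complex.exp (2 * (z (.inl i.castSucc) - z (.inr i))))
    (fun z _ => analyticAt_const.mul (analyticAt_exp_diff _ _ _ z)) * P (.inr i)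

theorem dOp_apply (i : Fin k) (f : HolI k) {z : Idx k → ℂ} (hz : z ∈ dom (icol (k := k))) :
    (dOp i f).1 z = -(1 / 2) * Complex.exp (2 * sig i z) * pd (.inr i) f.1 z := by
  change _ * (P (.inr i) f).1 z = _
  rw [P_apply _ _ hz]
  rfl

theorem analyticAt_Tf (i : Fin k) (z : Idx k → ℂ) : AnalyticAt ℂ (Tf i) z :=
  analyticAt_const.sub (analyticAt_exp_diff _ _ _ z)

/-- Multiplication by `T_i`. -/
def TOp (i : Fin k) : Module.End ℂ (HolI k) := mulOp (Tf i) fun z _ => analyticAt_Tf i z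

/-- Multiplying `lapD_kerF` by the weight removes the poles, and `q = -m - 1` leaves `q (q + 1) = m
(m + 1)`. The divergence, rewritten with `d = dOp i`, the derivative in `T_i`, takes the form `T_i d
Q_i - m Q_i`, which `m` further derivatives turn into a multiple of `T_i`. -/
theorem resFun_pde (m : ℕ) (μ N : ℂ) {Ψ : (Fin k → ℂ) → ℂ}
    (hΨ : AnalyticOnNhd ℂ Ψ (dom fun i : Fin k => (i : ℕ)))
    (heq : ∀ y ∈ dom (fun i : Fin k => (i : ℕ)), ∑ i, pd i (pd i Ψ) y =
      (2 * m * (m + 1) * pot y + N) * Ψ y) :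
    ∃ Q : Fin k → HolI k, lapOp (Hol.mk (isOpen_dom _) _ (analyticOnNhd_resFun m μ hΨ)) =
      potOp (2 * m * (m + 1)) (N + 4 * μ ^ 2) (Hol.mk (isOpen_dom _) _ (analyticOnNhd_resFun m μ hΨ)) +
      (-4 : ℂ) • ∑ i, (TOp i (dOp i (Q i)) - (m : ℂ) • Q i) := by
  set f : HolI k := Hol.mk (isOpen_dom _) _ (analyticOnNhd_resFun m μ hΨ) with hf
  set q : ℤ := -(m : ℤ) - 1 with hq
  have aE : ∀ i, AnalyticOnNhd ℂ (fun z : Idx k → ℂ =>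
      Complex.exp (-2 * (z (.inl i.castSucc) - z (.inr i))) * lreg q i z) (dom icol) := fun i z hz =>
    (analyticAt_exp_diff _ _ _ z).mul (analyticOnNhd_lreg q i z hz)
  -- The witness is `Q_i = exp (-2 σ_i) lreg_i f`: since `T_i = exp (-2 σ_i) (exp (2 σ_i) - 1)`, the
  -- weighted boundary term is `(exp (2 σ_i) - 1) Q_i`, regular on the diagonal.
  refine ⟨fun i => mulOp _ (aE i) f, HolI.ext_off fun z hz => ?_⟩
  have hz' := dom_ipos_subset hz
  have hfU : Set.EqOn f.1 (fun z => wprod ((m : ℤ) + 1) z * kerF q μ Ψ z) (dom (ipos (k := k))) := by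
    intro w hw
    exact (Hol.mk_apply _ _ (dom_ipos_subset hw)).trans (resFun_eq m μ Ψ hw)
  have aF := analyticOnNhd_kerF (k := k) q μ hΨ
  have hqq : (2 * (q : ℂ) * (q + 1)) = 2 * m * (m + 1) := by
    rw [hq]; push_cast; ring
  have h1 := lapD_kerF q μ N hΨ (by rw [hqq]; exact heq) hz
  rw [hqq] at h1
  rw [lapOp_apply _ hz', lapD_congr_on (isOpen_dom _) hfU hz, lapD_wprod_mul _ aF hz, h1]
  have h2 : ∀ i, wprod ((m : ℤ) + 1) z * pd (.inr i) (fun z => (lker chg q (.inl i.castSucc) z +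
        lker chg q (.inr i) z) * kerF q μ Ψ z) z = (-2 : ℂ) *
        (TOp i (dOp i (mulOp _ (aE i) f)) - (m : ℂ) • (mulOp _ (aE i) f)).1 z := by
    intro i
    set Qi := mulOp _ (aE i) f with hQi
    have aH : AnalyticOnNhd ℂ (fun z => (lker chg q (.inl i.castSucc) z +
        lker chg q (.inr i) z) * kerF q μ Ψ z) (dom (ipos (k := k))) := fun w hw =>
      ((analyticOnNhd_lker ipos_injective q _ w hw).add
        (analyticOnNhd_lker ipos_injective q _ w hw)).mul (aF w hw)
    have e1 := pd_mul (i := Sum.inr i) (analyticAt_wprod ((m : ℤ) + 1) hz).differentiableAt (aH z hz).differentiableAt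
    have hS : DifferentiableAt ℂ (fun z : Idx k → ℂ =>
        Complex.exp (2 * (z (.inl i.castSucc) - z (.inr i))) - 1) z := by fun_prop
    have e2 : Set.EqOn (fun z => wprod ((m : ℤ) + 1) z * ((lker chg q (.inl i.castSucc) z +
        lker chg q (.inr i) z) * kerF q μ Ψ z)) (fun z =>
        (Complex.exp (2 * (z (.inl i.castSucc) - z (.inr i))) - 1) * Qi.1 z) (dom (ipos (k := k))) := by
      intro w hw
      have hQ : Qi.1 w = Complex.exp (-2 * (w (.inl i.castSucc) - w (.inr i))) * lreg q i w *
          (wprod ((m : ℤ) + 1) w * kerF q μ Ψ w) := by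
        rw [hQi, mulOp_apply, hfU hw]
      beta_reduce
      rw [hQ, lker_add q i hw]
      have e3 : Complex.exp (2 * (w (.inl i.castSucc) - w (.inr i))) *
          Complex.exp (-2 * (w (.inl i.castSucc) - w (.inr i))) = 1 := by
        rw [← Complex.exp_add, ← add_mul]; simp
      have e4 : Tf i w = 1 - Complex.exp (-2 * (w (.inl i.castSucc) - w (.inr i))) := rfl
      linear_combination (lreg q i w * (wprod ((m : ℤ) + 1) w * kerF q μ Ψ w)) * (e4 - e3)
    have e5 := pd_congr_on (isOpen_dom _) (Sum.inr i) e2 hz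
    rw [e1, pd_mul hS (Hol.diff Qi hz'), pd_sub (by fun_prop) (differentiableAt_const _), pd_const,
      pd_exp_diff, pd_wprod_inr _ i hz] at e5
    have e6 := e2 hz
    beta_reduce at e6
    have e7 : (TOp i (dOp i Qi) - (m : ℂ) • Qi).1 z = Tf i z * (-(1 / 2) *
        Complex.exp (2 * (z (.inl i.castSucc) - z (.inr i))) * pd (.inr i) Qi.1 z) - m * Qi.1 z := by
      change Tf i z * (dOp i Qi).1 z - m * Qi.1 z = _
      rw [dOp_apply i Qi hz']
      rfl
    rw [e7]
    have e8 : Tf i z * Complex.exp (2 * (z (.inl i.castSucc) - z (.inr i))) =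
        Complex.exp (2 * (z (.inl i.castSucc) - z (.inr i))) - 1 := by
      have e3 : Complex.exp (2 * (z (.inl i.castSucc) - z (.inr i))) *
          Complex.exp (-2 * (z (.inl i.castSucc) - z (.inr i))) = 1 := by
        rw [← Complex.exp_add, ← add_mul]; simp
      change (1 - Complex.exp (-2 * (z (.inl i.castSucc) - z (.inr i)))) * _ = _
      linear_combination -e3
    have e9 : (cth z (.inl i.castSucc) (.inr i) - 1) *
        (Complex.exp (2 * (z (.inl i.castSucc) - z (.inr i))) - 1) = 2 := by
      rw [cth_eq (mem_dom_ne ipos_injective hz (by simp)), ← e8]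
      have hT := T_ne hz i
      have e3 : Complex.exp (2 * (z (.inl i.castSucc) - z (.inr i))) *
          Complex.exp (-2 * (z (.inl i.castSucc) - z (.inr i))) = 1 := by
        rw [← Complex.exp_add, ← add_mul]; simp
      change _ * ((1 - Complex.exp (-2 * (z (.inl i.castSucc) - z (.inr i)))) * _) = _
      generalize Complex.exp (-2 * (z (.inl i.castSucc) - z (.inr i))) = E1 at *
      generalize Complex.exp (2 * (z (.inl i.castSucc) - z (.inr i))) = E2 at *
      field_simp
      linear_combination 2 * e3
    simp only [reduceCtorEq, if_false, if_true] at e5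
    push_cast at e5
    linear_combination e5 + ((m + 1) * (cth z (.inl i.castSucc) (.inr i) - 1) + 2) * e6 +
      (-1) * pd (.inr i) Qi.1 z * e8 + ((m + 1) * Qi.1 z) * e9
  have h3 : (potOp (2 * m * (m + 1)) (N + 4 * μ ^ 2) f +
      (-4 : ℂ) • ∑ i, (TOp i (dOp i (mulOp _ (aE i) f)) - (m : ℂ) • (mulOp _ (aE i) f))).1 z =
      (2 * m * (m + 1) * pot (fun j => z (.inl j)) + (N + 4 * μ ^ 2)) * f.1 z +
      (-4 : ℂ) * ∑ i, (TOp i (dOp i (mulOp _ (aE i) f)) - (m : ℂ) • (mulOp _ (aE i) f)).1 z := by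
    rw [← Hol_sum_apply]; rfl
  rw [h3, mul_add, hfU hz, mul_left_comm _ (2 : ℂ), Finset.mul_sum, Finset.sum_congr rfl fun i _ => h2 i,
    ← Finset.mul_sum]
  ring

theorem pd_esig (a : Idx k) (c : ℂ) (i : Fin k) (z : Idx k → ℂ) :
    pd a (fun z : Idx k → ℂ => Complex.exp (c * (z (.inl i.castSucc) - z (.inr i)))) z =
      c * ((if a = .inl i.castSucc then 1 else 0) - (if a = .inr i then 1 else 0)) *
        Complex.exp (c * (z (.inl i.castSucc) - z (.inr i))) := pd_exp_diff c a _ _ z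

/-- Multiplication by `-(1/2) exp (2 σ_i)`. -/
def eOp (i : Fin k) : Module.End ℂ (HolI k) :=
  mulOp (fun z => -(1 / 2) * Complex.exp (2 * (z (.inl i.castSucc) - z (.inr i))))
    (fun z _ => analyticAt_const.mul (analyticAt_exp_diff _ _ _ z))

theorem dOp_eq (i : Fin k) : dOp i = eOp i * P (.inr i) := rfl

theorem P_commute_eOp {a : Idx k} {i : Fin k} (h1 : a ≠ .inl i.castSucc) (h2 : a ≠ .inr i) :
    Commute (P a) (eOp i) :=
  pdOp_mulOp_commute _ _ _ fun z _ => by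
    rw [pd_const_mul, pd_esig, if_neg h1, if_neg h2]; ring

theorem DOp_commute_eOp (i j : Fin k) : Commute (DOp i) (eOp j) := by
  by_cases h : i = j
  · subst h
    refine LinearMap.ext fun f => Hol.ext_on fun z hz => ?_
    change (DOp i (eOp i f)).1 z = _ * (DOp i f).1 z
    rw [DOp_apply i _ hz, DOp_apply i _ hz]
    have hd : DifferentiableAt ℂ (fun z : Idx k → ℂ => -(1 / 2) *
        Complex.exp (2 * (z (.inl i.castSucc) - z (.inr i)))) z := by fun_prop
    refine (Dd_mul hd (Hol.diff f hz) i).trans ?_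
    simp only [Dd, pd_const_mul, pd_esig]
    simp
  · exact (P_commute_eOp (by simpa using h) (by simp)).add_left
      (P_commute_eOp (by simp) (by simpa using h))

theorem DOp_commute_dOp (i j : Fin k) : Commute (DOp i) (dOp j) := by
  rw [dOp_eq]
  exact (DOp_commute_eOp i j).mul_right ((P_commute _ _).add_left (P_commute _ _))

theorem dOp_commute (i j : Fin k) : Commute (dOp (k := k) i) (dOp j) := by
  by_cases h : i = j
  · subst h; exact Commute.refl _
  · rw [dOp_eq, dOp_eq]
    have h1 : Commute (eOp i) (eOp (k := k) j) := mulOp_commute _ _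
    have h2 : Commute (P (.inr i)) (eOp j) := P_commute_eOp (by simp) (by simpa using h)
    have h3 : Commute (eOp i) (P (.inr j)) := (P_commute_eOp (by simp) (by simpa using Ne.symm h)).symm
    exact (h1.mul_left h2).mul_right (h3.mul_left (P_commute _ _))

theorem dOp_commute_lapOp (i : Fin k) : Commute (dOp i) lapOp :=
  lapOp_commute (fun j => (DOp_commute_dOp j i).symm)
    ((P_commute_eOp (by simpa using (Fin.castSucc_lt_last i).ne') (by simp)).mul_right
      (P_commute _ _)).symm

theorem dOp_commute_potOp (i : Fin k) (c N : ℂ) : Commute (dOp i) (potOp c N) :=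
  Commute.mul_left (mulOp_commute _ _) (P_inr_commute_potOp i c N)

theorem dOp_commute_TOp {i j : Fin k} (h : i ≠ j) : Commute (dOp i) (TOp j) := by
  refine Commute.mul_left (mulOp_commute _ _) (pdOp_mulOp_commute _ _ _ fun z _ => ?_)
  have hd : DifferentiableAt ℂ (fun z : Idx k → ℂ =>
      Complex.exp (-2 * (z (.inl j.castSucc) - z (.inr j)))) z := (analyticAt_exp_diff _ _ _ z).differentiableAt
  refine (pd_sub (differentiableAt_const _) hd).trans ?_
  rw [pd_const, pd_esig, if_neg (by simp), if_neg (by simpa using h)]; ring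

/-- For fixed `x` the derivative of `T_i` in `y_i` is `-2 exp (-2 σ_i)`, so `dOp i` is `d / dT_i`
and the pair satisfies the Heisenberg relation. -/
theorem dOp_mul_TOp (i : Fin k) : dOp i * TOp i = TOp i * dOp i + 1 := by
  refine LinearMap.ext fun f => Hol.ext_on fun z hz => ?_
  change (dOp i (TOp i f)).1 z = Tf i z * (dOp i f).1 z + f.1 z
  rw [dOp_apply i _ hz, dOp_apply i _ hz]
  have h := pd_mul (i := Sum.inr i) (analyticAt_Tf i z).differentiableAt (Hol.diff f hz)
  have hd : DifferentiableAt ℂ (fun z : Idx k → ℂ =>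
      Complex.exp (-2 * (z (.inl i.castSucc) - z (.inr i)))) z := (analyticAt_exp_diff _ _ _ z).differentiableAt
  have h2 : pd (.inr i) (Tf i) z = -2 * Complex.exp (-2 * sig i z) := by
    refine (pd_sub (differentiableAt_const _) hd).trans ?_
    rw [pd_const, pd_esig, if_neg (by simp), if_pos rfl, sig]; ring
  change pd (.inr i) (TOp i f).1 z = _ at h
  rw [h, h2]
  have e3 : Complex.exp (2 * sig i z) * Complex.exp (-2 * sig i z) = 1 := by
    rw [← Complex.exp_add, ← add_mul]; simp
  linear_combination f.1 z * e3

theorem dOp_pow_mul_TOp (i : Fin k) (n : ℕ) :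
    dOp i ^ n * TOp i = TOp i * dOp i ^ n + n * dOp i ^ (n - 1) := by
  induction n with
  | zero => simp
  | succ n ih =>
    rw [pow_succ', mul_assoc, ih, mul_add, ← mul_assoc, dOp_mul_TOp, Nat.add_sub_cancel]
    rcases n with _ | n
    · simp
    · rw [Nat.add_sub_cancel]
      have : dOp i * (((n + 1 : ℕ) : Module.End ℂ (HolI k)) * dOp i ^ n) =
          ((n + 1 : ℕ) : Module.End ℂ (HolI k)) * dOp i ^ (n + 1) := by
        rw [← mul_assoc, (Nat.cast_commute _ _).symm.eq, mul_assoc, ← pow_succ']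
      rw [this, add_mul, one_mul, mul_assoc]
      push_cast
      noncomm_ring

/-- A consequence of `[d ^ m, T] = m d ^ (m - 1)`. Exactly `m` derivatives absorb the term `-m Q`,
which matches a residue at a pole of order `m + 1`. -/
theorem dOp_pow_mul (i : Fin k) (m : ℕ) (Q : HolI k) :
    (dOp i ^ m) (TOp i (dOp i Q) - (m : ℂ) • Q) = TOp i ((dOp i ^ (m + 1)) Q) := by
  have h := congrArg (fun A : Module.End ℂ (HolI k) => A (dOp i Q)) (dOp_pow_mul_TOp i m)
  change (dOp i ^ m) (TOp i (dOp i Q)) = TOp i ((dOp i ^ m) (dOp i Q)) +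
    ((m : Module.End ℂ (HolI k)) * dOp i ^ (m - 1)) (dOp i Q) at h
  rw [map_sub, h, map_smul]
  have e1 : (dOp i ^ m) (dOp i Q) = (dOp i ^ (m + 1)) Q := by rw [pow_succ]; rfl
  rw [e1]
  rcases m with _ | m
  · simp
  · rw [Nat.add_sub_cancel]
    have e2 : (((m + 1 : ℕ) : Module.End ℂ (HolI k)) * dOp i ^ m) (dOp i Q) =
        ((m + 1 : ℕ) : ℂ) • (dOp i ^ (m + 1)) Q := by
      rw [pow_succ, Nat.cast_smul_eq_nsmul]
      simp [Module.End.mul_apply]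
      exact (succ_nsmul _ _).symm
    rw [e2]
    abel

/-- The algebra homomorphism `X_i ↦ -(1/2) exp (2 σ_i) ∂_{y_i}`. -/
def thetaD : MvPolynomial (Fin k) ℂ →ₐ[ℂ] Module.End ℂ (HolI k) :=
  commHom (A := Module.End ℂ (HolI k)) dOp dOp_commute

theorem thetaD_X (i : Fin k) : thetaD (MvPolynomial.X i) = dOp i :=
  commHom_X (A := Module.End ℂ (HolI k)) dOp dOp_commute i

theorem thetaD_commute {B : Module.End ℂ (HolI k)} (hB : ∀ i, Commute B (dOp i))
    (p : MvPolynomial (Fin k) ℂ) : Commute B (thetaD p) :=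
  commHom_commute (A := Module.End ℂ (HolI k)) dOp_commute hB p

theorem TOp_commute_thetaD (m : ℕ) {i : Fin k} {s : Finset (Fin k)} (hi : i ∉ s) :
    Commute (TOp i) (thetaD (∏ j ∈ s, MvPolynomial.X j ^ m)) := by
  induction s using Finset.induction_on with
  | empty => rw [Finset.prod_empty, map_one]; exact Commute.one_right _
  | insert j s hj ih =>
    rw [Finset.mem_insert, not_or] at hi
    rw [Finset.prod_insert hj, map_mul, map_pow, thetaD_X]
    exact ((dOp_commute_TOp (Ne.symm hi.1)).symm.pow_right m).mul_right (ih hi.2)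

/-- The operator `∏ (-(1/2) exp (2 σ_i) ∂_{y_i})^m`. -/
def resOp (m : ℕ) : Module.End ℂ (HolI k) := thetaD (∏ i, MvPolynomial.X i ^ m)

/-- Taking `m` derivatives in each `T_i` at `T_i = 0` is, up to a constant, the iterated residue of
the kernel function. The operators commute with the Laplacian and with the potential in `x`, so the
equation passes to the diagonal. -/
theorem resOp_pde (m : ℕ) (μ N : ℂ) {Ψ : (Fin k → ℂ) → ℂ}
    (hΨ : AnalyticOnNhd ℂ Ψ (dom fun i : Fin k => (i : ℕ)))
    (heq : ∀ y ∈ dom (fun i : Fin k => (i : ℕ)), ∑ i, pd i (pd i Ψ) y =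
      (2 * m * (m + 1) * pot y + N) * Ψ y) {x : Fin (k + 1) → ℂ}
    (hx : x ∈ dom fun j : Fin (k + 1) => (j : ℕ)) :
    ∑ j, pd j (pd j fun x =>
      (resOp m (Hol.mk (isOpen_dom _) _ (analyticOnNhd_resFun m μ hΨ))).1 (diag x)) x =
      (2 * m * (m + 1) * pot x + (N + 4 * μ ^ 2)) *
        (resOp m (Hol.mk (isOpen_dom _) _ (analyticOnNhd_resFun m μ hΨ))).1 (diag x) := by
  obtain ⟨Q, hQ⟩ := resFun_pde (k := k) m μ N hΨ heq
  set f : HolI k := Hol.mk (isOpen_dom _) _ (analyticOnNhd_resFun m μ hΨ) with hf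
  have hd := diag_mem hx
  have c1 : Commute (resOp m) (lapOp (k := k)) :=
    (thetaD_commute (fun i => (dOp_commute_lapOp i).symm) _).symm
  have c2 : Commute (resOp m) (potOp (k := k) (2 * m * (m + 1)) (N + 4 * μ ^ 2)) :=
    (thetaD_commute (fun i => (dOp_commute_potOp i _ _).symm) _).symm
  have h1 : lapOp (resOp m f) = resOp m (lapOp f) :=
    (congrArg (fun A : Module.End ℂ (HolI k) => A f) c1.eq).symm
  have h2 : resOp m (potOp (2 * m * (m + 1)) (N + 4 * μ ^ 2) f) =
      potOp (2 * m * (m + 1)) (N + 4 * μ ^ 2) (resOp m f) :=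
    congrArg (fun A : Module.End ℂ (HolI k) => A f) c2.eq
  -- The `m` derivatives in `T_i` are applied first. They produce a factor `T_i`, which the
  -- derivatives in the other `T_j` do not touch and which vanishes on the diagonal.
  have h3 : ∀ i, (resOp m (TOp i (dOp i (Q i)) - (m : ℂ) • Q i)).1 (diag x) = 0 := by
    intro i
    have e1 : (∏ j : Fin k, (MvPolynomial.X j : MvPolynomial (Fin k) ℂ) ^ m) =
        (∏ j ∈ Finset.univ.erase i, MvPolynomial.X j ^ m) * MvPolynomial.X i ^ m :=
      (Finset.prod_erase_mul _ _ (Finset.mem_univ i)).symm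
    rw [resOp, e1, map_mul, map_pow, thetaD_X, Module.End.mul_apply, dOp_pow_mul]
    have this := congrArg (fun A : Module.End ℂ (HolI k) => A ((dOp i ^ (m + 1)) (Q i)))
      (TOp_commute_thetaD m (Finset.notMem_erase i Finset.univ)).eq
    change TOp i _ = thetaD _ (TOp i _) at this
    rw [← this]
    change Tf i (diag x) * _ = 0
    rw [Tf_diag, zero_mul]
  rw [sum_pd_pd_diag (Hol.analytic _) hx, ← lapOp_apply _ hd, h1, hQ, map_add, h2, map_smul, map_sum]
  change (_ * _ + (-4 : ℂ) * (∑ i, resOp m (TOp i (dOp i (Q i)) - (m : ℂ) • Q i)).1 (diag x)) = _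
  rw [Hol_sum_apply, Finset.sum_eq_zero fun i _ => h3 i]
  simp [diag]

end ResidueStep

end TrigBA

end

/-! ### Families of eigenfunctions depending polynomially on `ν`. -/

noncomputable section

namespace TrigBA

/-- A family of numerators, rational in the exponentials of `x` and polynomial in `ν`. -/
structure IsFam (n m : ℕ) (h ht hl : (Fin n → ℂ) → (Fin n → ℂ) → ℂ) : Prop where
  rt : RT (fun i : Fin n => (i : ℕ)) (m * n.choose 2) h ht hl
  top : ∀ x ∈ dom (fun i : Fin n => (i : ℕ)), ∀ ν, ht x ν = vand ν ^ m
  limit : ∀ x ∈ dom (fun i : Fin n => (i : ℕ)), ∀ ν, hl x ν = normConst m ν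
  eigen : ∀ ν, ∀ x ∈ dom (fun i : Fin n => (i : ℕ)),
    ∑ i, pd i (pd i fun x => ex (fun i => 2 * ν i) x * h x ν) x =
      (2 * m * (m + 1) * pot x + 4 * ∑ i, ν i ^ 2) * (ex (fun i => 2 * ν i) x * h x ν)

theorem isFam_zero (m : ℕ) : IsFam 0 m (fun _ _ => 1) (fun _ _ => 1) (fun _ _ => 1) where
  rt := by simpa using RT.const (κ := Fin 0) (col := fun i : Fin 0 => (i : ℕ)) 1
  top := fun x _ ν => by simp [vand]
  limit := fun x _ ν => by simp [normConst]
  eigen := fun ν x _ => by simp [pot]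

theorem prod_Ioi_castSucc {M : Type*} [CommMonoid M] {k : ℕ} (F : Fin (k + 1) → Fin (k + 1) → M) :
    ∏ i, ∏ j ∈ Finset.Ioi i, F i j =
      (∏ i : Fin k, ∏ j ∈ Finset.Ioi i, F i.castSucc j.castSucc) *
        ∏ i : Fin k, F i.castSucc (Fin.last k) := by
  have h : ∀ {n : ℕ} (i : Fin n) (G : Fin n → M), ∏ j ∈ Finset.Ioi i, G j =
      ∏ j, if i < j then G j else 1 := by
    intro n i G
    rw [← Finset.prod_filter]
    congr 1
    ext j; simp
  simp only [h]
  rw [Fin.prod_univ_castSucc]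
  simp only [Fin.prod_univ_castSucc, Fin.castSucc_lt_castSucc_iff, Fin.castSucc_lt_last, if_true,
    Finset.prod_mul_distrib]
  have e1 : ∀ i : Fin k, ¬ (Fin.last k < i.castSucc) := fun i => (Fin.castSucc_lt_last i).not_gt
  simp [e1]

theorem vand_succ {k : ℕ} (ν : Fin (k + 1) → ℂ) : vand ν = vand (fun i : Fin k => ν i.castSucc) *
    ∏ i : Fin k, (ν i.castSucc - ν (Fin.last k)) := prod_Ioi_castSucc _

theorem normConst_succ {k : ℕ} (m : ℕ) (ν : Fin (k + 1) → ℂ) :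
    normConst m ν = normConst m (fun i : Fin k => ν i.castSucc) *
      ∏ i : Fin k, ∏ j ∈ Finset.range m, (ν i.castSucc - ν (Fin.last k) - (j + 1)) := by
  unfold normConst
  simp only [prod_Ioi_castSucc, Finset.prod_mul_distrib]
  congr 1
  rw [Finset.prod_comm]
  refine Finset.prod_congr rfl fun i _ => ?_
  have hI : Finset.Icc 1 m = Finset.Ico 1 (m + 1) := by ext; simp
  rw [hI, Finset.prod_Ico_eq_prod_range, Nat.add_sub_cancel]
  refine Finset.prod_congr rfl fun j _ => ?_
  push_cast; ring

/-! ### The inductive step from `k` to `k + 1` variables. -/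

section TwistedFamily

variable {k : ℕ}

/-- The exponential factor of the function on which the residue operator acts. -/
def efac (ν : Fin (k + 1) → ℂ) (z : Idx k → ℂ) : ℂ :=
  twexp (ν (Fin.last k)) z * ex (fun i => 2 * ν i.castSucc) fun i => z (.inr i)

/-- The monomial `exp (2 ∑ c_i σ_i)`. -/
def cexp (c : Fin k → ℕ) (z : Idx k → ℂ) : ℂ :=
  ∏ i, Complex.exp (2 * (z (.inl i.castSucc) - z (.inr i))) ^ c i

theorem pd_cexp (c : Fin k → ℕ) (i : Fin k) (z : Idx k → ℂ) :
    pd (.inr i) (cexp c) z = -2 * c i * cexp c z := by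
  have h : ∀ j, pd (.inr i) (fun z : Idx k → ℂ =>
      Complex.exp (2 * (z (.inl j.castSucc) - z (.inr j))) ^ c j) z =
      (if i = j then -2 * (c j : ℂ) else 0) * Complex.exp (2 * (z (.inl j.castSucc) - z (.inr j))) ^ c j := by
    intro j
    have e : (fun z : Idx k → ℂ => Complex.exp (2 * (z (.inl j.castSucc) - z (.inr j))) ^ c j) =
        fun z : Idx k → ℂ => Complex.exp ((2 * c j) * (z (.inl j.castSucc) - z (.inr j))) := by
      ext z
      rw [← Complex.exp_nat_mul]; congr 1; ring
    rw [e, pd_esig, congrFun e z]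
    by_cases hij : i = j
    · subst hij; simp
    · simp [hij]
  refine (pd_prod_log Finset.univ (fun j _ => ((analyticAt_exp_diff _ _ _ z).fun_pow
    (c j)).differentiableAt) fun j _ => h j).trans ?_
  simp [cexp]

theorem cexp_update (c : Fin k → ℕ) (i : Fin k) (z : Idx k → ℂ) :
    cexp (Function.update c i (c i + 1)) z =
      Complex.exp (2 * (z (.inl i.castSucc) - z (.inr i))) * cexp c z := by
  unfold cexp
  rw [← Finset.mul_prod_erase _ _ (Finset.mem_univ i), ← Finset.mul_prod_erase _ (fun i =>
    Complex.exp (2 * (z (.inl i.castSucc) - z (.inr i))) ^ c i) (Finset.mem_univ i),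
    Function.update_self, pow_succ']
  rw [mul_assoc]
  congr 2
  refine Finset.prod_congr rfl fun j hj => ?_
  rw [Function.update_of_ne (Finset.ne_of_mem_erase hj)]

theorem RT_esig {κ : Type*} (i : Fin k) : RT (κ := κ) (icol (k := k)) 0
    (fun z _ => Complex.exp (2 * (z (.inl i.castSucc) - z (.inr i))))
    (fun z _ => Complex.exp (2 * (z (.inl i.castSucc) - z (.inr i))))
    (fun z _ => Complex.exp (2 * (z (.inl i.castSucc) - z (.inr i)))) := by
  have h := RT.expo (κ := κ) (col := icol (k := k)) (rootExp (.inr i) (.inl i.castSucc))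
    (fun j => by rw [psum_rootExp]; simp only [icol, Sum.elim_inl, Sum.elim_inr, Fin.val_castSucc]; by_cases hj : (i : ℕ) ≤ j <;> simp [hj])
    (by unfold rootExp; rw [← Finset.mul_sum, Finset.sum_sub_distrib]; simp)
  have e : ∀ z : Idx k → ℂ, exz (rootExp (.inr i) (.inl i.castSucc)) z =
      Complex.exp (2 * (z (.inl i.castSucc) - z (.inr i))) := by
    intro z
    rw [exz_rootExp]; congr 1; ring
  simpa only [e] using h

theorem RT_linear {ι κ : Type*} [Fintype ι] [DecidableEq ι] {col : ι → ℕ} (a b : κ) :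
    RT col 1 (fun _ ν => ν a - ν b) (fun _ ν => ν a - ν b) (fun _ ν => ν a - ν b) := by
  have hh : (MvPolynomial.X a - MvPolynomial.X b : MvPolynomial κ ℂ).IsHomogeneous 1 :=
    (MvPolynomial.isHomogeneous_X ℂ a).sub (MvPolynomial.isHomogeneous_X ℂ b)
  refine (RT.poly (col := col) (MvPolynomial.X a - MvPolynomial.X b : MvPolynomial κ ℂ)
    hh.totalDegree_le).congr ?_ ?_ ?_ <;> intro z _ ν
  · simp
  · rw [MvPolynomial.homogeneousComponent_of_mem ((MvPolynomial.mem_homogeneousSubmodule _ _).2 hh)]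
    simp
  · simp

/-- A family of functions of the form `E_ν(z) g(z, ν)` with prescribed leading term and limit. -/
def TwData (d : ℕ) (c : Fin k → ℕ) (a b : (Fin (k + 1) → ℂ) → ℂ) (N : (Idx k → ℂ) → ℂ)
    (φ : (Fin (k + 1) → ℂ) → HolI k) : Prop :=
  ∃ g gt gl, RT (icol (k := k)) d g gt gl ∧
    (∀ ν, ∀ z ∈ dom (icol (k := k)), (φ ν).1 z = efac ν z * g z ν) ∧
    (∀ ν, ∀ z ∈ dom (icol (k := k)), gt z ν = a ν * cexp c z * N z) ∧
    (∀ ν, ∀ z ∈ dom (icol (k := k)), gl z ν = b ν * cexp c z)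

theorem analyticAt_efac (ν : Fin (k + 1) → ℂ) (z : Idx k → ℂ) : AnalyticAt ℂ (efac ν) z :=
  (analyticAt_twexp _ z).mul (analyticAt_comp_inr (analyticAt_ex _ _))

theorem pd_efac (ν : Fin (k + 1) → ℂ) (i : Fin k) (z : Idx k → ℂ) :
    pd (.inr i) (efac ν) z = 2 * (ν i.castSucc - ν (Fin.last k)) * efac ν z := by
  refine (pd_mul (analyticAt_twexp _ z).differentiableAt
    (analyticAt_comp_inr (analyticAt_ex _ _)).differentiableAt).trans ?_
  rw [pd_twexp, pd_comp_inr, pd_ex, efac]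
  simp only [chg, Sum.elim_inr]
  push_cast
  ring

/-- Conjugated by the exponential factor, `dOp i` becomes `exp (2 σ_i) (-(1/2) ∂_{y_i} - (ν_i -
ν_{k+1}))`. The derivative has lower degree in `ν` and does not enter the leading term; on the
limit, a multiple of `exp (2 ∑ c_j σ_j)`, it acts as the scalar `c_i`. -/
theorem TwData.step {d : ℕ} {c : Fin k → ℕ} {a b : (Fin (k + 1) → ℂ) → ℂ} {N : (Idx k → ℂ) → ℂ}
    {φ : (Fin (k + 1) → ℂ) → HolI k} (h : TwData d c a b N φ) (i : Fin k) :
    TwData (d + 1) (Function.update c i (c i + 1))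
      (fun ν => -(ν i.castSucc - ν (Fin.last k)) * a ν)
      (fun ν => (c i - (ν i.castSucc - ν (Fin.last k))) * b ν) N (fun ν => dOp i (φ ν)) := by
  obtain ⟨g, gt, gl, hg, h1, h2, h3⟩ := h
  have hl := ((RT_linear (col := icol (k := k)) i.castSucc (Fin.last k)).mul hg).const_mul (-1)
  rw [add_comm 1 d] at hl
  have hr := ((RT_esig (κ := Fin (k + 1)) i).mul (((hg.pd (.inr i)).const_mul (-(1 / 2))).raise.add hl))
  rw [zero_add] at hr
  refine ⟨_, _, _, hr, ?_, ?_, ?_⟩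
  · intro ν z hz
    have e : Set.EqOn (φ ν).1 (fun z => efac ν z * g z ν) (dom icol) := fun w hw => h1 ν w hw
    rw [dOp_apply i _ hz, pd_congr_on (isOpen_dom _) _ e hz,
      pd_mul (analyticAt_efac ν z).differentiableAt ((hg.analytic ν).1 z hz).differentiableAt, pd_efac, sig]
    ring
  · intro ν z hz
    rw [cexp_update]
    rw [h2 ν z hz]; ring
  · intro ν z hz
    have e : Set.EqOn (fun z => gl z ν) (fun z => b ν * cexp c z) (dom icol) := fun w hw => h3 ν w hw
    rw [cexp_update]
    change _ * (-(1 / 2) * TrigBA.pd (.inr i) (fun z => gl z ν) z + -1 * (_ * gl z ν)) = _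
    rw [pd_congr_on (isOpen_dom _) _ e hz, pd_const_mul, pd_cexp, h3 ν z hz]
    ring

theorem TwData.congr {d d' : ℕ} {c c' : Fin k → ℕ} {a b a' b' : (Fin (k + 1) → ℂ) → ℂ}
    {N : (Idx k → ℂ) → ℂ} {φ φ' : (Fin (k + 1) → ℂ) → HolI k} (h : TwData d c a b N φ) (hd : d = d')
    (hc : c = c') (ha : ∀ ν, a ν = a' ν) (hb : ∀ ν, b ν = b' ν) (hφ : ∀ ν, φ ν = φ' ν) :
    TwData d' c' a' b' N φ' := by
  subst hd hc
  obtain rfl : a = a' := funext ha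
  obtain rfl : b = b' := funext hb
  obtain rfl : φ = φ' := funext hφ
  exact h

theorem TwData.iter {d : ℕ} {c : Fin k → ℕ} {a b : (Fin (k + 1) → ℂ) → ℂ} {N : (Idx k → ℂ) → ℂ}
    {φ : (Fin (k + 1) → ℂ) → HolI k} (h : TwData d c a b N φ) (i : Fin k) (n : ℕ) :
    TwData (d + n) (Function.update c i (c i + n))
      (fun ν => (-(ν i.castSucc - ν (Fin.last k))) ^ n * a ν)
      (fun ν => (∏ j ∈ Finset.range n, ((c i + j : ℂ) - (ν i.castSucc - ν (Fin.last k)))) * b ν) N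
      (fun ν => (dOp i ^ n) (φ ν)) := by
  induction n with
  | zero => exact h.congr rfl (by simp) (by simp) (by simp) (fun _ => rfl)
  | succ n ih =>
    refine (ih.step i).congr (add_assoc _ _ _) ?_ ?_ ?_ ?_
    · ext j
      by_cases hj : j = i
      · subst hj; simp [add_assoc]
      · simp [hj]
    · intro ν; ring
    · intro ν
      rw [Finset.prod_range_succ, Function.update_self]
      push_cast; ring
    · intro ν; rw [pow_succ']; rfl

/-- The exponents start at `1` because of the factors `exp (2 σ_i)` in `resFun`. The `m` steps in
direction `i` see the exponents `1, …, m`, which yields up to sign the new factors of `normConst`.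
-/
theorem TwData.all {d : ℕ} {a b : (Fin (k + 1) → ℂ) → ℂ} {N : (Idx k → ℂ) → ℂ}
    {φ : (Fin (k + 1) → ℂ) → HolI k} (h : TwData d (fun _ => 1) a b N φ) (m : ℕ) (s : Finset (Fin k)) :
    TwData (d + m * s.card) (fun i => if i ∈ s then 1 + m else 1)
      (fun ν => (∏ i ∈ s, (-(ν i.castSucc - ν (Fin.last k))) ^ m) * a ν)
      (fun ν => (∏ i ∈ s, ∏ j ∈ Finset.range m, ((1 + j : ℂ) - (ν i.castSucc - ν (Fin.last k)))) * b ν) N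
      (fun ν => thetaD (∏ i ∈ s, MvPolynomial.X i ^ m) (φ ν)) := by
  induction s using Finset.induction_on with
  | empty => exact h.congr (by simp) (by simp) (by simp) (by simp) (fun ν => by
      rw [Finset.prod_empty, map_one]; rfl)
  | insert i s hi ih =>
    refine (ih.iter i m).congr ?_ ?_ ?_ ?_ ?_
    · rw [Finset.card_insert_of_notMem hi]; ring
    · ext j
      by_cases hj : j = i
      · subst hj; simp [hi]
      · simp [hj]
    · intro ν; rw [Finset.prod_insert hi]; ring
    · intro ν; rw [Finset.prod_insert hi]; simp only [hi, if_false]; push_cast; ring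
    · intro ν
      rw [Finset.prod_insert hi, map_mul, map_pow, thetaD_X]; rfl

theorem pot_eigen_analytic {n m : ℕ} {h ht hl : (Fin n → ℂ) → (Fin n → ℂ) → ℂ}
    (H : IsFam n m h ht hl) (ν : Fin n → ℂ) :
    AnalyticOnNhd ℂ (fun x => ex (fun i => 2 * ν i) x * h x ν) (dom fun i : Fin n => (i : ℕ)) :=
  fun x hx => (analyticAt_ex _ x).mul ((H.rt.analytic ν).1 x hx)

theorem efac_diag (ν : Fin (k + 1) → ℂ) (x : Fin (k + 1) → ℂ) :
    efac ν (diag x) = ex (fun i => 2 * ν i) x := by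
  unfold efac twexp ex
  rw [← Complex.exp_add]
  congr 1
  rw [Fintype.sum_sum_type, Fin.sum_univ_castSucc, Fin.sum_univ_castSucc (f := fun i => 2 * ν i * x i)]
  simp only [diag, chg, Sum.elim_inl, Sum.elim_inr]
  push_cast
  simp only [mul_one, mul_neg, neg_mul, Finset.sum_neg_distrib]
  ring

/-- The residue operator is applied to the family in `k` variables and restricted to the diagonal,
where the regular part of the kernel is `1`. Its leading factors complete the Vandermonde product to
`k + 1` variables. -/
theorem IsFam.succ {m : ℕ} {h ht hl : (Fin k → ℂ) → (Fin k → ℂ) → ℂ} (H : IsFam k m h ht hl) :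
    ∃ h' ht' hl', IsFam (k + 1) m h' ht' hl' := by
  have hΨ := fun ν : Fin (k + 1) → ℂ => pot_eigen_analytic H fun i => ν i.castSucc
  set φ : (Fin (k + 1) → ℂ) → HolI k := fun ν =>
    Hol.mk (isOpen_dom _) _ (analyticOnNhd_resFun m (ν (Fin.last k)) (hΨ ν)) with hφ
  have h0 : TwData (m * k.choose 2) (fun _ => 1) (fun ν => vand (fun i : Fin k => ν i.castSucc) ^ m)
      (fun ν => normConst m fun i : Fin k => ν i.castSucc) (Nker (-(m : ℤ) - 1)) φ := by
    have hc : ∀ z : Idx k → ℂ, cexp (fun _ => 1) z = ∏ i : Fin k,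
        Complex.exp (2 * (z (.inl i.castSucc) - z (.inr i))) := fun z => by simp [cexp]
    have hr := ((RT.prod (κ := Fin (k + 1)) (col := icol (k := k)) Finset.univ
      (fun i _ => RT_esig i)).mul (RT_Nker (-(m : ℤ) - 1))).mul
      (H.rt.pullback (ι' := Idx k) (col' := icol) Sum.inr Fin.castSucc (fun i => by simp [icol]))
    rw [add_zero, zero_add] at hr
    refine ⟨_, _, _, hr, ?_, ?_, ?_⟩
    · intro ν z hz
      refine (Hol.mk_apply _ _ hz).trans ?_
      unfold resFun efac sig
      ring
    · intro ν z hz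
      beta_reduce
      rw [H.top _ (inr_mem_dom hz), hc]; ring
    · intro ν z hz
      beta_reduce
      rw [H.limit _ (inr_mem_dom hz), hc]; ring
  obtain ⟨g, gt, gl, hg, h1, h2, h3⟩ := h0.all m Finset.univ
  beta_reduce at h1 h2 h3
  have hρ : ∀ i : Idx k, (fun j : Fin (k + 1) => (j : ℕ)) (Sum.elim id Fin.castSucc i) = icol i := by
    rintro (i | i) <;> simp [icol]
  have hdiag : ∀ x : Fin (k + 1) → ℂ, (fun i => x (Sum.elim id Fin.castSucc i)) = diag x := by
    intro x; ext a; rcases a with a | a <;> simp [diag]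
  -- The sign `(-1) ^ (k * m)` compensates the `k * m` factors `-(ν_i - ν_{k+1})`.
  have hr := (hg.pullback (ι' := Fin (k + 1)) (col' := fun j : Fin (k + 1) => (j : ℕ))
    (Sum.elim id Fin.castSucc) id hρ).const_mul ((-1) ^ (k * m))
  simp only [hdiag, id] at hr
  -- Each of the `k` directions raises the degree by `m`.
  have hd : m * k.choose 2 + m * (Finset.univ : Finset (Fin k)).card = m * (k + 1).choose 2 := by
    rw [Finset.card_univ, Fintype.card_fin, Nat.choose_succ_succ' k 1, Nat.choose_one_right]; ring
  rw [hd] at hr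
  have hsq : ((-1 : ℂ) ^ (k * m)) * (-1) ^ (k * m) = 1 := by
    rw [← mul_pow]; simp
  have hcd : ∀ (c : Fin k → ℕ) x, cexp c (diag x) = 1 := by
    intro c x; unfold cexp; simp [diag]
  refine ⟨_, _, _, hr, ?_, ?_, ?_⟩
  · intro x hx ν
    rw [h2 ν _ (diag_mem hx), Nker_diag _ hx, hcd, vand_succ]
    have : ∏ i : Fin k, (-(ν i.castSucc - ν (Fin.last k))) ^ m =
        (-1) ^ (k * m) * (∏ i : Fin k, (ν i.castSucc - ν (Fin.last k))) ^ m := by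
      simp only [neg_pow (_ - _ : ℂ) m, Finset.prod_mul_distrib, Finset.prod_const, Finset.card_univ,
        Fintype.card_fin, Finset.prod_pow]
      rw [← pow_mul, mul_comm m k]
    rw [this, mul_pow]
    linear_combination (vand (fun i : Fin k => ν i.castSucc) ^ m *
      (∏ i : Fin k, (ν i.castSucc - ν (Fin.last k))) ^ m) * hsq
  · intro x hx ν
    rw [h3 ν _ (diag_mem hx), hcd, normConst_succ]
    have : ∏ i : Fin k, ∏ j ∈ Finset.range m, ((1 + j : ℂ) - (ν i.castSucc - ν (Fin.last k))) =
        (-1) ^ (k * m) * ∏ i : Fin k, ∏ j ∈ Finset.range m, (ν i.castSucc - ν (Fin.last k) - (j + 1)) := by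
      have e : ∀ (i : Fin k) (j : ℕ), ((1 + j : ℂ) - (ν i.castSucc - ν (Fin.last k))) =
          (-1) * (ν i.castSucc - ν (Fin.last k) - (j + 1)) := by intro i j; ring
      simp only [e, Finset.prod_mul_distrib, Finset.prod_const, Finset.card_univ,
        Fintype.card_fin, Finset.card_range]
      rw [← pow_mul, mul_comm m k]
    rw [this]
    linear_combination (normConst m (fun i : Fin k => ν i.castSucc) *
      ∏ i : Fin k, ∏ j ∈ Finset.range m, (ν i.castSucc - ν (Fin.last k) - (j + 1))) * hsq
  · intro ν x hx
    have e : Set.EqOn (fun x => ex (fun i => 2 * ν i) x * ((-1) ^ (k * m) * g (diag x) ν))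
        (fun x => (-1) ^ (k * m) * (resOp m (φ ν)).1 (diag x)) (dom fun j : Fin (k + 1) => (j : ℕ)) := by
      intro w hw
      have := h1 ν _ (diag_mem hw)
      rw [efac_diag] at this
      change (resOp m (φ ν)).1 (diag w) = _ at this
      beta_reduce
      rw [this]; ring
    have hp := resOp_pde m (ν (Fin.last k)) (4 * ∑ i : Fin k, ν i.castSucc ^ 2) (hΨ ν)
      (H.eigen fun i => ν i.castSucc) hx
    have e2 : ∀ j, pd j (pd j fun x => ex (fun i => 2 * ν i) x * ((-1) ^ (k * m) * g (diag x) ν)) x =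
        (-1) ^ (k * m) * pd j (pd j fun x => (resOp m (φ ν)).1 (diag x)) x := by
      intro j
      rw [pd_congr_on isOpen_domVal j (pd_congr_on isOpen_domVal j e) hx, ← pd_const_mul]
      congr 1
      ext x
      rw [pd_const_mul]
    simp only [e2]
    rw [← Finset.mul_sum]
    refine (congrArg (fun t => (-1) ^ (k * m) * t) hp).trans ?_
    have := e hx
    beta_reduce at this ⊢
    rw [this, Fin.sum_univ_castSucc (f := fun i => ν i ^ 2)]
    change (-1) ^ (k * m) * (_ * (resOp m (φ ν)).1 (diag x)) = _
    ring

theorem exists_isFam (n m : ℕ) : ∃ h ht hl, IsFam n m h ht hl := by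
  induction n with
  | zero => exact ⟨_, _, _, isFam_zero m⟩
  | succ n ih =>
    obtain ⟨h, ht, hl, H⟩ := ih
    exact H.succ

end TwistedFamily

end TrigBA

end

noncomputable section

namespace TrigBA

/-! ### Exponential sums, and division by a wall factor. -/

section ExponentialSums

variable {n : ℕ} {κ : Type*}

/-- An exponential sum with polynomial coefficients. -/
def expSum (Q : (Fin n → ℤ) →₀ MvPolynomial κ ℂ) (x : Fin n → ℂ) (ν : κ → ℂ) : ℂ :=
  Q.sum fun a p => MvPolynomial.eval ν p * exz a x

/-- Functions given by exponential sums with polynomial coefficients of degree at most `d`. -/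
def TP (d : ℕ) (F : (Fin n → ℂ) → (κ → ℂ) → ℂ) : Prop :=
  ∃ Q : (Fin n → ℤ) →₀ MvPolynomial κ ℂ, (∀ a, (Q a).totalDegree ≤ d) ∧ ∀ x ν, F x ν = expSum Q x ν

theorem expSum_add (Q R : (Fin n → ℤ) →₀ MvPolynomial κ ℂ) (x : Fin n → ℂ) (ν : κ → ℂ) :
    expSum (Q + R) x ν = expSum Q x ν + expSum R x ν :=
  Finsupp.sum_add_index' (by simp) (by intros; rw [map_add, add_mul])

theorem expSum_single (a : Fin n → ℤ) (p : MvPolynomial κ ℂ) (x : Fin n → ℂ) (ν : κ → ℂ) :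
    expSum (Finsupp.single a p) x ν = MvPolynomial.eval ν p * exz a x :=
  Finsupp.sum_single_index (by simp)

variable {d e : ℕ} {F G : (Fin n → ℂ) → (κ → ℂ) → ℂ}

theorem TP.congr (h : TP d F) (hG : ∀ x ν, G x ν = F x ν) : TP d G := by
  obtain ⟨Q, h1, h2⟩ := h
  exact ⟨Q, h1, fun x ν => (hG x ν).trans (h2 x ν)⟩

theorem TP.monomial (a : Fin n → ℤ) (p : MvPolynomial κ ℂ) (hp : p.totalDegree ≤ d) :
    TP d (fun x ν => MvPolynomial.eval ν p * exz a x) := by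
  classical
  refine ⟨Finsupp.single a p, fun b => ?_, fun x ν => (expSum_single a p x ν).symm⟩
  rw [Finsupp.single_apply]
  split_ifs
  · exact hp
  · simp

theorem TP.add (hF : TP d F) (hG : TP d G) : TP d (fun x ν => F x ν + G x ν) := by
  obtain ⟨Q, h1, h2⟩ := hF
  obtain ⟨R, h3, h4⟩ := hG
  refine ⟨Q + R, fun a => (MvPolynomial.totalDegree_add _ _).trans (max_le (h1 a) (h3 a)),
    fun x ν => ?_⟩
  beta_reduce
  rw [expSum_add, h2, h4]

theorem TP.zero : TP (n := n) (κ := κ) d (fun _ _ => 0) :=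
  ⟨0, by simp, fun x ν => by simp [expSum]⟩

theorem TP.sum {α : Type*} (s : Finset α) {H : α → (Fin n → ℂ) → (κ → ℂ) → ℂ}
    (h : ∀ a ∈ s, TP d (H a)) : TP d (fun x ν => ∑ a ∈ s, H a x ν) := by
  classical
  induction s using Finset.induction_on with
  | empty => simpa using TP.zero
  | insert a s ha ih =>
    simp only [Finset.sum_insert ha]
    exact (h a (Finset.mem_insert_self _ _)).add (ih fun b hb => h b (Finset.mem_insert_of_mem hb))

theorem TP.mul (hF : TP d F) (hG : TP e G) : TP (d + e) (fun x ν => F x ν * G x ν) := by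
  obtain ⟨Q, h1, h2⟩ := hF
  obtain ⟨R, h3, h4⟩ := hG
  refine (TP.sum Q.support fun a _ => TP.sum R.support fun b _ =>
    TP.monomial (a + b) (Q a * R b) ((MvPolynomial.totalDegree_mul _ _).trans
      (add_le_add (h1 a) (h3 b)))).congr fun x ν => ?_
  rw [h2, h4, expSum, expSum, Finsupp.sum, Finsupp.sum, Finset.sum_mul_sum]
  refine Finset.sum_congr rfl fun a _ => Finset.sum_congr rfl fun b _ => ?_
  rw [map_mul, exz_add]; ring

theorem TP.expo (a : Fin n → ℤ) : TP (κ := κ) 0 (fun x _ => exz a x) :=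
  (TP.monomial a (1 : MvPolynomial κ ℂ) (by simp)).congr fun x ν => by simp

theorem TP.const (c : ℂ) : TP (n := n) (κ := κ) 0 (fun _ _ => c) :=
  (TP.monomial 0 (MvPolynomial.C c : MvPolynomial κ ℂ) (by simp)).congr fun x ν => by simp [exz_zero]

theorem TP.prod {α : Type*} (s : Finset α) {H : α → (Fin n → ℂ) → (κ → ℂ) → ℂ}
    (h : ∀ a ∈ s, TP 0 (H a)) : TP 0 (fun x ν => ∏ a ∈ s, H a x ν) := by
  classical
  induction s using Finset.induction_on with
  | empty => simpa using TP.const 1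
  | insert a s ha ih =>
    simp only [Finset.prod_insert ha]
    exact (h a (Finset.mem_insert_self _ _)).mul (ih fun b hb => h b (Finset.mem_insert_of_mem hb))

theorem TP.pow (hF : TP 0 F) (N : ℕ) : TP 0 (fun x ν => F x ν ^ N) := by
  simpa using TP.prod (Finset.range N) (H := fun _ => F) fun _ _ => hF

theorem TP.continuous (hF : TP d F) (ν : κ → ℂ) : Continuous fun x => F x ν := by
  obtain ⟨Q, _, h2⟩ := hF
  simp only [h2, expSum, Finsupp.sum]
  refine continuous_finsetSum _ fun a _ => continuous_const.mul ?_
  unfold TrigBA.exz ex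
  fun_prop

theorem TP.continuous_param (hF : TP d F) (x : Fin n → ℂ) : Continuous fun ν => F x ν := by
  obtain ⟨Q, _, h2⟩ := hF
  simp only [h2, expSum, Finsupp.sum]
  exact continuous_finsetSum _ fun a _ => (MvPolynomial.continuous_eval _).mul continuous_const

theorem TP.analyticAt (hF : TP d F) (ν : κ → ℂ) (x : Fin n → ℂ) : AnalyticAt ℂ (fun x => F x ν) x := by
  obtain ⟨Q, _, h2⟩ := hF
  simp only [h2, expSum, Finsupp.sum]
  exact Finset.analyticAt_fun_sum _ fun a _ => analyticAt_const.mul (analyticAt_ex _ _)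

/-- The pairs `i < j`. -/
def prs (n : ℕ) : Finset (Fin n × Fin n) := Finset.univ.filter fun p => p.1 < p.2

theorem mem_prs {p : Fin n × Fin n} : p ∈ prs n ↔ p.1 < p.2 := by simp [prs]

theorem prod_prs {M : Type*} [CommMonoid M] (H : Fin n → Fin n → M) :
    ∏ p ∈ prs n, H p.1 p.2 = ∏ i, ∏ j ∈ Finset.Ioi i, H i j := by
  rw [prs, Finset.prod_filter, ← Finset.univ_product_univ, Finset.prod_product]
  refine Finset.prod_congr rfl fun i _ => ?_
  rw [← Finset.prod_filter]
  congr 1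
  ext j; simp

theorem sum_prs {M : Type*} [AddCommMonoid M] (H : Fin n → Fin n → M) :
    ∑ p ∈ prs n, H p.1 p.2 = ∑ i, ∑ j ∈ Finset.Ioi i, H i j := by
  rw [prs, Finset.sum_filter, ← Finset.univ_product_univ, Finset.sum_product]
  refine Finset.sum_congr rfl fun i _ => ?_
  rw [← Finset.sum_filter]
  congr 1
  ext j; simp

/-- The factor `1 - exp (-2 (x_i - x_j))`. -/
def Df (p : Fin n × Fin n) (x : Fin n → ℂ) : ℂ := 1 - Complex.exp (-2 * (x p.1 - x p.2))

theorem TP_Df (p : Fin n × Fin n) : TP (κ := κ) 0 (fun x _ => Df p x) := by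
  refine ((TP.const 1).add ((TP.const (-1)).mul (TP.expo (rootExp p.1 p.2)))).congr fun x ν => ?_
  rw [exz_rootExp, Df]; ring

theorem mem_domVal {x : Fin n → ℂ} :
    x ∈ dom (fun i : Fin n => (i : ℕ)) ↔ ∀ p ∈ prs n, Df p x ≠ 0 := by
  constructor
  · intro h p hp
    exact one_sub_ne h (Fin.lt_def.1 (mem_prs.1 hp))
  · intro h i j hij he
    exact h (i, j) (mem_prs.2 (Fin.lt_def.2 hij)) (by
      change 1 - Complex.exp (-2 * (x i - x j)) = 0
      rw [he, sub_self])

/-- The product of all factors. -/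
def Bh (x : Fin n → ℂ) : ℂ := ∏ p ∈ prs n, Df p x

theorem Bh_ne_zero {x : Fin n → ℂ} (hx : x ∈ dom (fun i : Fin n => (i : ℕ))) : Bh x ≠ 0 :=
  Finset.prod_ne_zero_iff.2 (mem_domVal.1 hx)

theorem TP_Bh (N : ℕ) : TP (κ := κ) (n := n) 0 (fun x _ => Bh x ^ N) :=
  (TP.prod (prs n) fun p _ => TP_Df p).pow N

/-- Only wall factors occur in denominators and each divides `Bh`, so a power of `Bh` clears them;
the degree in `ν` is kept. -/
theorem RT.exists_expSum {f ft fl : (Fin n → ℂ) → (κ → ℂ) → ℂ}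
    (hf : RT (fun i : Fin n => (i : ℕ)) d f ft fl) :
    ∃ (N : ℕ) (T : (Fin n → ℂ) → (κ → ℂ) → ℂ), TP d T ∧
      ∀ x ∈ dom (fun i : Fin n => (i : ℕ)), ∀ ν, f x ν * Bh x ^ N = T x ν := by
  induction hf with
  | mono a p d ha hp => exact ⟨0, _, TP.monomial a p hp, fun x _ ν => by simp⟩
  | inv i j h =>
    have hp : (i, j) ∈ prs n := mem_prs.2 (Fin.lt_def.2 h)
    refine ⟨1, fun x ν => ∏ p ∈ (prs n).erase (i, j), Df p x, TP.prod _ fun p _ => TP_Df p, ?_⟩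
    intro x hx ν
    rw [pow_one, Bh, ← Finset.mul_prod_erase _ _ hp, ← mul_assoc]
    have := mem_domVal.1 hx _ hp
    rw [Df] at this
    rw [Df, inv_mul_cancel₀ this, one_mul]
  | add _ _ h1 h2 =>
    obtain ⟨N1, T1, h1, e1⟩ := h1
    obtain ⟨N2, T2, h2, e2⟩ := h2
    refine ⟨N1 + N2, _, (h1.mul (TP_Bh N2)).add (h2.mul (TP_Bh N1)), fun x hx ν => ?_⟩
    rw [← e1 x hx, ← e2 x hx, pow_add]; ring
  | mul _ _ h1 h2 =>
    obtain ⟨N1, T1, h1, e1⟩ := h1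
    obtain ⟨N2, T2, h2, e2⟩ := h2
    refine ⟨N1 + N2, _, h1.mul h2, fun x hx ν => ?_⟩
    rw [← e1 x hx, ← e2 x hx, pow_add]; ring
  | congr _ h _ _ ih =>
    obtain ⟨N, T, h1, e1⟩ := ih
    exact ⟨N, T, h1, fun x hx ν => by rw [h x hx, e1 x hx]⟩

/-- A geometric sum, also for negative multiples. -/
theorem exists_div_geom (v : Fin n → ℤ) (k : ℤ) : ∃ g : (Fin n → ℂ) → (κ → ℂ) → ℂ, TP 0 g ∧
    ∀ x ν, exz (k • v) x - 1 = (1 - exz v x) * g x ν := by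
  induction k using Int.induction_on with
  | zero => exact ⟨_, TP.zero, fun x ν => by simp [exz_zero]⟩
  | succ i ih =>
    obtain ⟨g, h1, h2⟩ := ih
    refine ⟨_, h1.add ((TP.const (-1)).mul (TP.expo ((i : ℤ) • v))), fun x ν => ?_⟩
    rw [add_smul, one_smul, exz_add]
    linear_combination h2 x ν
  | pred i ih =>
    obtain ⟨g, h1, h2⟩ := ih
    refine ⟨_, h1.add (TP.expo ((-(i : ℤ) - 1) • v)), fun x ν => ?_⟩
    have : exz (-(i : ℤ) • v) x = exz ((-(i : ℤ) - 1) • v) x * exz v x := by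
      rw [← exz_add]; congr 1; rw [sub_smul, one_smul, sub_add_cancel]
    linear_combination h2 x ν - this

/-- The subgroup on which `exp (-2 (x_i - x_j)) = 1`. -/
def wall (p : Fin n × Fin n) : AddSubgroup (Fin n → ℂ) where
  carrier := {x | Complex.exp (-2 * (x p.1 - x p.2)) = 1}
  zero_mem' := by simp
  add_mem' := fun {x y} hx hy => by
    have : -2 * ((x + y) p.1 - (x + y) p.2) = -2 * (x p.1 - x p.2) + -2 * (y p.1 - y p.2) := by
      simp only [Pi.add_apply]; ring
    change Complex.exp _ = 1
    rw [this, Complex.exp_add, hx, hy, one_mul]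
  neg_mem' := fun {x} hx => by
    have : -2 * ((-x) p.1 - (-x) p.2) = -(-2 * (x p.1 - x p.2)) := by
      simp only [Pi.neg_apply]; ring
    change Complex.exp _ = 1
    rw [this, Complex.exp_neg, hx, inv_one]

/-- The character `x ↦ exp (a · x)` of the wall. -/
def wallChar (p : Fin n × Fin n) (a : Fin n → ℤ) : Multiplicative (wall p) →* ℂ where
  toFun g := exz a (Multiplicative.toAdd g).1
  map_one' := by
    change exz a 0 = 1
    simp [exz, ex]
  map_mul' g h := by
    change exz a ((Multiplicative.toAdd g).1 + (Multiplicative.toAdd h).1) = _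
    unfold exz ex
    rw [← Complex.exp_add, ← Finset.sum_add_distrib]
    congr 1
    refine Finset.sum_congr rfl fun i _ => ?_
    simp; ring

/-- On the wall, exponents are seen only modulo the root vector, whose entry at `p.1` is `-2`.
Fixing that entry to be `0` or `1` therefore makes the characters distinct. -/
theorem wallChar_injOn {p : Fin n × Fin n} (hp : p ∈ prs n) {a b : Fin n → ℤ}
    (ha : a p.1 = 0 ∨ a p.1 = 1) (hb : b p.1 = 0 ∨ b p.1 = 1) (h : wallChar p a = wallChar p b) :
    a = b := by
  have hne : p.1 ≠ p.2 := (mem_prs.1 hp).ne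
  have key : ∀ x ∈ wall p, Complex.exp (∑ i, (a i : ℂ) * x i) = Complex.exp (∑ i, (b i : ℂ) * x i) :=
    fun x hx => DFunLike.congr_fun h (Multiplicative.ofAdd ⟨x, hx⟩)
  have hint : ∀ c e : ℤ, Complex.exp c = Complex.exp e → c = e := by
    intro c e he
    have h2 : Real.exp c = Real.exp e := by
      have : ((Real.exp c : ℝ) : ℂ) = ((Real.exp e : ℝ) : ℂ) := by
        push_cast; exact he
      exact_mod_cast this
    exact_mod_cast Real.exp_injective h2
  have h1 : a p.1 = b p.1 := by
    -- This point of the wall detects the parity of the entry at `p.1`; the remaining test points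
    -- detect the sum of the two entries and every other entry.
    have := key (Pi.single p.1 (Real.pi * Complex.I)) (by
      change Complex.exp _ = 1
      rw [Pi.single_eq_same, Pi.single_eq_of_ne hne.symm, sub_zero]
      rw [show -2 * ((Real.pi : ℂ) * Complex.I) = -(2 * Real.pi * Complex.I) by ring, Complex.exp_neg,
        Complex.exp_two_pi_mul_I, inv_one])
    simp only [Pi.single_apply, mul_ite, mul_zero, Finset.sum_ite_eq', Finset.mem_univ, if_true] at this
    rcases ha with ha | ha <;> rcases hb with hb | hb
    · rw [ha, hb]
    · rw [ha, hb] at this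
      norm_num [Complex.exp_pi_mul_I] at this
    · rw [ha, hb] at this
      norm_num [Complex.exp_pi_mul_I] at this
    · rw [ha, hb]
  have h2 : a p.2 = b p.2 := by
    have := key (Pi.single p.1 1 + Pi.single p.2 1) (by
      change Complex.exp _ = 1
      simp [hne, hne.symm])
    simp only [Pi.add_apply, Pi.single_apply, mul_add, mul_ite, mul_one, mul_zero,
      Finset.sum_add_distrib, Finset.sum_ite_eq', Finset.mem_univ, if_true] at this
    have := hint (a p.1 + a p.2) (b p.1 + b p.2) (by push_cast; exact this)
    omega
  ext l
  by_cases hl1 : l = p.1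
  · rw [hl1, h1]
  by_cases hl2 : l = p.2
  · rw [hl2, h2]
  have := key (Pi.single l 1) (by
    change Complex.exp _ = 1
    rw [Pi.single_eq_of_ne (Ne.symm hl1), Pi.single_eq_of_ne (Ne.symm hl2)]; simp)
  simp only [Pi.single_apply, mul_ite, mul_one, mul_zero, Finset.sum_ite_eq', Finset.mem_univ,
    if_true] at this
  exact hint _ _ this

/-- Modulo the wall factor every exponent can be replaced by its representative with entry `0` or
`1` at `p.1`. The reduced sum vanishes on the wall, and independence of characters makes all its
coefficients zero. -/
theorem TP.exists_div {T : (Fin n → ℂ) → (κ → ℂ) → ℂ} (hT : TP d T) {p : Fin n × Fin n}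
    (hp : p ∈ prs n) (h0 : ∀ x ν, Df p x = 0 → T x ν = 0) :
    ∃ T', TP d T' ∧ ∀ x ν, T x ν = Df p x * T' x ν := by
  classical
  obtain ⟨Q, hQ, hT⟩ := hT
  set v := rootExp p.1 p.2 with hv
  have hvx : ∀ x, 1 - exz v x = Df p x := fun x => by rw [hv, exz_rootExp, Df]
  have hne : p.1 ≠ p.2 := (mem_prs.1 hp).ne
  -- Adding `a p.1 / 2` copies of the root vector leaves `a p.1 % 2` at `p.1`.
  set r : (Fin n → ℤ) → (Fin n → ℤ) := fun a => a + (a p.1 / 2) • v with hr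
  have hr1 : ∀ a, r a p.1 = 0 ∨ r a p.1 = 1 := by
    intro a
    have : r a p.1 = a p.1 % 2 := by
      simp only [hr, hv, rootExp, Pi.add_apply, Pi.smul_apply, smul_eq_mul, if_true, if_neg hne]
      omega
    omega
  choose g hg1 hg2 using fun a : Fin n → ℤ => exists_div_geom (κ := κ) v (-(a p.1 / 2))
  have hex : ∀ a x, exz a x = exz (r a) x * exz (-(a p.1 / 2) • v) x := by
    intro a x
    rw [← exz_add]
    congr 1
    simp only [hr, neg_smul, add_neg_cancel_right]
  have hmap : ∀ x ν, expSum (Q.mapDomain r) x ν = ∑ a ∈ Q.support, MvPolynomial.eval ν (Q a) * exz (r a) x := by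
    intro x ν
    rw [expSum, Finsupp.sum_mapDomain_index (by simp) (by intros; rw [map_add, add_mul])]
    rfl
  have hsplit : ∀ x ν, T x ν = Df p x * (∑ a ∈ Q.support, MvPolynomial.eval ν (Q a) *
      exz (r a) x * g a x ν) + expSum (Q.mapDomain r) x ν := by
    intro x ν
    rw [hT, hmap, expSum, Finsupp.sum, Finset.mul_sum, ← Finset.sum_add_distrib]
    refine Finset.sum_congr rfl fun a _ => ?_
    have h1 := hg2 a x ν
    rw [hvx] at h1
    rw [hex a]
    linear_combination (MvPolynomial.eval ν (Q a) * exz (r a) x) * h1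
  have hzero : Q.mapDomain r = 0 := by
    have LI := (linearIndependent_monoidHom (Multiplicative (wall p)) ℂ).comp
      (fun b : {b : Fin n → ℤ // b p.1 = 0 ∨ b p.1 = 1} => wallChar p b.1)
      (fun b c hbc => Subtype.ext (wallChar_injOn hp b.2 c.2 hbc))
    have hsupp : ∀ b ∈ (Q.mapDomain r).support, b p.1 = 0 ∨ b p.1 = 1 := by
      intro b hb
      obtain ⟨a, _, rfl⟩ := Finset.mem_image.1 (Finsupp.mapDomain_support hb)
      exact hr1 a
    ext1 b
    by_contra hb
    have hb' : b ∈ (Q.mapDomain r).support := Finsupp.mem_support_iff.2 hb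
    apply hb
    apply MvPolynomial.funext
    intro ν
    have := linearIndependent_iff'.1 LI ((Q.mapDomain r).support.subtype _)
      (fun b => MvPolynomial.eval ν (Q.mapDomain r b.1)) (by
        ext w
        have hw : Df p (Multiplicative.toAdd w).1 = 0 := by
          have : Complex.exp (-2 * ((Multiplicative.toAdd w).1 p.1 - (Multiplicative.toAdd w).1 p.2)) = 1 :=
            (Multiplicative.toAdd w).2
          rw [Df, this, sub_self]
        have h1 := hsplit (Multiplicative.toAdd w).1 ν
        rw [h0 _ _ hw, hw, zero_mul, zero_add, expSum, Finsupp.sum] at h1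
        rw [Finset.sum_apply, Pi.zero_apply, h1,
          ← Finset.sum_subtype_of_mem (fun b => MvPolynomial.eval ν (Q.mapDomain r b) *
            exz b (Multiplicative.toAdd w).1) hsupp]
        rfl)
      ⟨b, hsupp b hb'⟩ (by simpa using hb')
    simpa using this
  refine ⟨_, TP.sum Q.support fun a _ => (TP.monomial (r a) (Q a) (hQ a)).mul (hg1 a), fun x ν => ?_⟩
  rw [hsplit, hzero]
  simp [expSum]

end ExponentialSums

end TrigBA

end

noncomputable section

namespace TrigBA

/-! ### The order of the poles along the walls. -/

section PoleOrder

variable {n : ℕ} {κ : Type*} {d : ℕ}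

theorem Df_line (p : Fin n × Fin n) (x ξ : Fin n → ℂ) (t : ℂ) :
    Df p (x + t • ξ) = 1 - Complex.exp (-2 * (x p.1 - x p.2)) * Complex.exp (-2 * t * (ξ p.1 - ξ p.2)) := by
  rw [Df, ← Complex.exp_add]
  congr 2
  simp only [Pi.add_apply, Pi.smul_apply, smul_eq_mul]; ring

/-- Along a real direction transversal to the wall the norm of the exponential is strictly monotone
in `t`, so each factor vanishes for at most one `t`. -/
theorem eventually_Df_ne (x : Fin n → ℂ) (ξ : Fin n → ℝ) (s : Finset (Fin n × Fin n))
    (hs : ∀ p ∈ s, ξ p.1 ≠ ξ p.2) :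
    ∀ᶠ t : ℝ in 𝓝[≠] 0, ∀ p ∈ s, Df p (x + (t : ℂ) • fun i => (ξ i : ℂ)) ≠ 0 := by
  rw [Finset.eventually_all]
  intro p hp
  have hsub : {t : ℝ | Df p (x + (t : ℂ) • fun i => (ξ i : ℂ)) = 0}.Subsingleton := by
    intro t ht t' ht'
    simp only [Set.mem_ofPred_eq, Df_line, sub_eq_zero] at ht ht'
    have h := congrArg norm (ht.symm.trans ht')
    rw [norm_mul, norm_mul] at h
    have h2 := mul_left_cancel₀ (norm_ne_zero_iff.2 (Complex.exp_ne_zero _)) h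
    rw [Complex.norm_exp, Complex.norm_exp] at h2
    have h3 := Real.exp_injective h2
    have e : ∀ t : ℝ, (-2 * (t : ℂ) * ((ξ p.1 : ℂ) - ξ p.2)).re = -2 * t * (ξ p.1 - ξ p.2) := by
      intro t
      have : (-2 * (t : ℂ) * ((ξ p.1 : ℂ) - ξ p.2)) = ((-2 * t * (ξ p.1 - ξ p.2) : ℝ) : ℂ) := by
        push_cast; ring
      rw [this, Complex.ofReal_re]
    rw [e, e] at h3
    have h4 := mul_right_cancel₀ (sub_ne_zero.2 (hs p hp)) h3
    linarith
  have h2 := hsub.finite.compl_mem_cofinite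
  have : {t : ℝ | Df p (x + (t : ℂ) • fun i => (ξ i : ℂ)) = 0}ᶜ ∈ 𝓝[≠] (0 : ℝ) := by
    have h3 := (hsub.finite.subset (Set.sdiff_subset (t := {0}))).isClosed.isOpen_compl.mem_nhds (x := 0) (by simp)
    filter_upwards [mem_nhdsWithin_of_mem_nhds h3, self_mem_nhdsWithin] with t h1 h2 h3
    exact h1 ⟨h3, h2⟩
  filter_upwards [this] with t ht h0
  exact ht h0

theorem continuous_line (x ξ : Fin n → ℂ) : Continuous fun t : ℝ => x + (t : ℂ) • ξ := by
  fun_prop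

theorem tendsto_line (x ξ : Fin n → ℂ) : Tendsto (fun t : ℝ => x + (t : ℂ) • ξ) (𝓝[≠] 0) (𝓝 x) := by
  have := ((continuous_line x ξ).tendsto 0).mono_left (nhdsWithin_le_nhds (s := {0}ᶜ))
  simpa using this

theorem dense_domVal : Dense (dom fun i : Fin n => (i : ℕ)) := by
  intro x
  refine mem_closure_of_tendsto (tendsto_line x fun i => ((i : ℝ) : ℂ)) ?_
  have := eventually_Df_ne x (fun i => (i : ℝ)) (prs n) fun p hp => by
    simpa [Fin.val_inj] using (mem_prs.1 hp).ne
  filter_upwards [this] with t ht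
  exact mem_domVal.2 ht

theorem analyticAt_Df (p : Fin n × Fin n) (x : Fin n → ℂ) : AnalyticAt ℂ (Df p) x :=
  (TP_Df (κ := Fin 0) p).analyticAt 0 x

theorem pd_Df (p : Fin n × Fin n) (i : Fin n) (x : Fin n → ℂ) : pd i (Df p) x =
    2 * ((if i = p.1 then 1 else 0) - (if i = p.2 then 1 else 0)) * (1 - Df p x) := by
  have h1 : DifferentiableAt ℂ (fun x : Fin n → ℂ => -2 * (x p.1 - x p.2)) x := by fun_prop
  have e : Df p = fun x => 1 - Complex.exp (-2 * (x p.1 - x p.2)) := rfl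
  rw [e, pd_sub (by fun_prop) (by fun_prop), pd_const, pd_exp h1, pd_const_mul,
    pd_sub (by fun_prop) (by fun_prop), pd_coord, pd_coord]
  ring

theorem pd_pd_mul_zpow {D S : (Fin n → ℂ) → ℂ} {x : Fin n → ℂ} (hS : AnalyticAt ℂ S x)
    (hD : AnalyticAt ℂ D x) (h0 : D x ≠ 0) (i : Fin n) (M : ℕ) :
    D x ^ (M + 2) * pd i (pd i fun x => S x * (D x ^ M)⁻¹) x =
      D x ^ 2 * pd i (pd i S) x - 2 * M * D x * pd i S x * pd i D x +
        S x * (M * (M + 1) * pd i D x ^ 2 - M * D x * pd i (pd i D) x) := by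
  have hne : ∀ᶠ w in 𝓝 x, D w ≠ 0 := hD.continuousAt.eventually_ne h0
  have hpow : ∀ (N : ℕ) w, D w ≠ 0 → AnalyticAt ℂ D w →
      pd i (fun x => (D x ^ N)⁻¹) w = -N * (D w ^ (N + 1))⁻¹ * pd i D w := by
    intro N w hw hD
    have hc := (hasDerivAt_pd hD.differentiableAt (i := i))
    have h2 : HasDerivAt (fun t => (D (Function.update w i t) ^ N)⁻¹) _ (w i) :=
      (hc.pow N).inv (by simp [hw])
    refine h2.deriv.trans ?_
    simp only [Function.update_eq_self, Pi.pow_apply]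
    rw [← pd_eq_fderiv hD.differentiableAt]
    rcases N with _ | N
    · simp
    · simp only [Nat.add_sub_cancel]
      generalize D w = y at *
      field_simp
      try ring
  have h1 : (fun w => pd i (fun x => S x * (D x ^ M)⁻¹) w) =ᶠ[𝓝 x] fun w =>
      pd i S w * (D w ^ M)⁻¹ + S w * (-M * ((D w ^ (M + 1))⁻¹ * pd i D w)) := by
    filter_upwards [hne, hS.eventually_analyticAt, hD.eventually_analyticAt] with w h1 h2 h3
    have h4 : AnalyticAt ℂ (fun x => (D x ^ M)⁻¹) w := (h3.fun_pow M).inv (pow_ne_zero _ h1)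
    rw [pd_mul h2.differentiableAt h4.differentiableAt, hpow M w h1 h3]
    ring
  have a1 := analyticAt_pd (i := i) hS
  have a2 := analyticAt_pd (i := i) hD
  have a3 : ∀ N, AnalyticAt ℂ (fun w => (D w ^ N)⁻¹) x := fun N => (hD.fun_pow N).inv (pow_ne_zero _ h0)
  have a4 : AnalyticAt ℂ (fun w => (D w ^ (M + 1))⁻¹ * pd i D w) x := (a3 _).mul a2
  have a5 : AnalyticAt ℂ (fun w => -(M : ℂ) * ((D w ^ (M + 1))⁻¹ * pd i D w)) x := analyticAt_const.mul a4
  rw [pd_congr h1, pd_add (a1.fun_mul (a3 M)).differentiableAt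
    (hS.fun_mul a5).differentiableAt, pd_mul a1.differentiableAt (a3 M).differentiableAt,
    pd_mul hS.differentiableAt a5.differentiableAt, pd_const_mul,
    pd_mul (a3 _).differentiableAt a2.differentiableAt, hpow M x h0 hD, hpow (M + 1) x h0 hD]
  push_cast
  generalize D x = y at *
  field_simp
  ring

theorem pot_eq {x : Fin n → ℂ} (hx : x ∈ dom fun i : Fin n => (i : ℕ)) :
    pot x = ∑ p ∈ prs n, 4 * (1 - Df p x) / Df p x ^ 2 := by
  rw [pot, ← sum_prs fun i j => 1 / Complex.sinh (x i - x j) ^ 2]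
  refine Finset.sum_congr rfl fun p hp => ?_
  have h0 := mem_domVal.1 hx p hp
  have h1 : Complex.exp (-2 * x p.2) - Complex.exp (-2 * x p.1) ≠ 0 :=
    mem_dom_ne Fin.val_injective hx (mem_prs.1 hp).ne
  rw [← cth_sq_sub_one h1, cth_eq h1]
  change (2 * (Df p x)⁻¹ - 1) ^ 2 - 1 = _
  field_simp
  ring

variable {m : ℕ} {h ht hl : (Fin n → ℂ) → (Fin n → ℂ) → ℂ}

/-- The indicial equation. With a pole of order `M` and leading coefficient `S`, the most singular
term of the Schrödinger equation is `8 (M (M + 1) - m (m + 1)) S`, and `(M - m) (M + m + 1)` is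
nonzero for `M > m`. -/
theorem IsFam.wall_vanish_generic (H : IsFam n m h ht hl) {T : (Fin n → ℂ) → (Fin n → ℂ) → ℂ}
    (hT : TP d T) (M : Fin n × Fin n → ℕ)
    (hM : ∀ x ∈ dom (fun i : Fin n => (i : ℕ)), ∀ ν, h x ν * ∏ p ∈ prs n, Df p x ^ M p = T x ν)
    {p : Fin n × Fin n} (hp : p ∈ prs n) (hMp : m < M p) {x : Fin n → ℂ} (hx : Df p x = 0)
    (hq : ∀ q ∈ (prs n).erase p, Df q x ≠ 0) (ν : Fin n → ℂ) : T x ν = 0 := by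
  set S : (Fin n → ℂ) → ℂ := fun w => ex (fun i => 2 * ν i) w * T w ν *
    (∏ q ∈ (prs n).erase p, Df q w ^ M q)⁻¹ with hSdef
  have hne : ∀ᶠ w in 𝓝 x, ∀ q ∈ (prs n).erase p, Df q w ≠ 0 := by
    rw [Finset.eventually_all]
    exact fun q h => (analyticAt_Df q x).continuousAt.eventually_ne (hq q h)
  have hSan : ∀ w, (∀ q ∈ (prs n).erase p, Df q w ≠ 0) → AnalyticAt ℂ S w := fun w hw =>
    ((analyticAt_ex _ w).mul (hT.analyticAt ν w)).mul
      ((Finset.analyticAt_fun_prod _ fun q _ => (analyticAt_Df q w).fun_pow (M q)).inv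
        (Finset.prod_ne_zero_iff.2 fun q h => pow_ne_zero _ (hw q h)))
  have hS : AnalyticAt ℂ S x := hSan x hq
  have hD := analyticAt_Df p x
  have hψ : ∀ w ∈ dom (fun i : Fin n => (i : ℕ)),
      ex (fun i => 2 * ν i) w * h w ν = S w * (Df p w ^ M p)⁻¹ := by
    intro w hw
    have h1 := mem_domVal.1 hw
    rw [hSdef]
    beta_reduce
    rw [← hM w hw ν, ← Finset.mul_prod_erase _ _ hp]
    have e1 := h1 p hp
    have e2 : ∏ q ∈ (prs n).erase p, Df q w ^ M q ≠ 0 :=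
      Finset.prod_ne_zero_iff.2 fun q h => pow_ne_zero _ (h1 q (Finset.mem_of_mem_erase h))
    field_simp
  -- The equation multiplied by `Df p ^ (M p + 2)`: it is continuous across the wall and vanishes
  -- off the walls, hence also at `x`.
  set E : (Fin n → ℂ) → ℂ := fun w =>
    ∑ i, (Df p w ^ 2 * pd i (pd i S) w - 2 * M p * Df p w * pd i S w * pd i (Df p) w +
        S w * (M p * (M p + 1) * pd i (Df p) w ^ 2 - M p * Df p w * pd i (pd i (Df p)) w)) -
      (2 * m * (m + 1) * (4 * (1 - Df p w) +
        Df p w ^ 2 * ∑ q ∈ (prs n).erase p, 4 * (1 - Df q w) / Df q w ^ 2) +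
        Df p w ^ 2 * (4 * ∑ i, ν i ^ 2)) * S w with hE
  have hE0 : ∀ w ∈ dom (fun i : Fin n => (i : ℕ)), E w = 0 := by
    intro w hw
    have h1 := mem_domVal.1 hw
    have h2 : AnalyticAt ℂ S w := hSan w fun q h => h1 q (Finset.mem_of_mem_erase h)
    have h3 := h1 p hp
    have h4 := H.eigen ν w hw
    have h5 : ∀ i, pd i (pd i fun x => ex (fun i => 2 * ν i) x * h x ν) w =
        pd i (pd i fun x => S x * (Df p x ^ M p)⁻¹) w := fun i =>
      pd_congr_on isOpen_domVal i (pd_congr_on isOpen_domVal i hψ) hw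
    simp only [h5] at h4
    have h6 := congrArg (fun t => Df p w ^ (M p + 2) * t) h4
    beta_reduce at h6
    rw [Finset.mul_sum, Finset.sum_congr rfl fun i _ =>
      pd_pd_mul_zpow h2 (analyticAt_Df p w) h3 i (M p), hψ w hw, pot_eq hw,
      ← Finset.add_sum_erase _ _ hp] at h6
    rw [hE]
    beta_reduce
    rw [h6]
    generalize Df p w = y at *
    field_simp
    ring
  have hEc : ContinuousAt E x := by
    have c1 := hS.continuousAt
    have c2 := hD.continuousAt
    have c3 : ContinuousAt (fun w => ∑ q ∈ (prs n).erase p, 4 * (1 - Df q w) / Df q w ^ 2) x :=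
      tendsto_finsetSum _ fun q h => by
        have := (analyticAt_Df q x).continuousAt
        exact (continuousAt_const.mul (continuousAt_const.sub this)).div (this.pow 2)
          (pow_ne_zero _ (hq q h))
    refine ContinuousAt.sub ?_ ?_
    · refine tendsto_finsetSum _ fun i _ => ?_
      have d1 := (analyticAt_pd (i := i) hS).continuousAt
      have d2 := (analyticAt_pd (i := i) (analyticAt_pd (i := i) hS)).continuousAt
      have d3 := (analyticAt_pd (i := i) hD).continuousAt
      have d4 := (analyticAt_pd (i := i) (analyticAt_pd (i := i) hD)).continuousAt
      exact (((c2.pow 2).mul d2).sub (((continuousAt_const.mul c2).mul d1).mul d3)).add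
        (c1.mul ((continuousAt_const.mul (d3.pow 2)).sub ((continuousAt_const.mul c2).mul d4)))
    · exact ((continuousAt_const.mul ((continuousAt_const.mul (continuousAt_const.sub c2)).add
        ((c2.pow 2).mul c3))).add ((c2.pow 2).mul continuousAt_const)).mul c1
  have hEx : E x = 0 := by
    obtain ⟨f, hf, hlim⟩ := mem_closure_iff_seq_limit.1 (dense_domVal x)
    refine tendsto_nhds_unique (hEc.tendsto.comp hlim) (tendsto_const_nhds.congr fun j => ?_)
    exact (hE0 _ (hf j)).symm
  have hne12 : p.1 ≠ p.2 := (mem_prs.1 hp).ne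
  have hS0 : S x = 0 := by
    rw [hE] at hEx
    simp only [hx, pd_Df] at hEx
    have hsum : ∑ i : Fin n, (2 * (((if i = p.1 then 1 else 0) - (if i = p.2 then 1 else 0)) : ℂ) * (1 - 0)) ^ 2 = 8 := by
      have : ∀ i : Fin n, (2 * (((if i = p.1 then 1 else 0) - (if i = p.2 then 1 else 0)) : ℂ) * (1 - 0)) ^ 2 =
          4 * ((if i = p.1 then 1 else 0) + (if i = p.2 then 1 else 0)) := by
        intro i
        by_cases h1 : i = p.1
        · rw [if_pos h1, if_neg (h1 ▸ hne12)]; norm_num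
        · rw [if_neg h1]; split_ifs <;> norm_num
      rw [Finset.sum_congr rfl fun i _ => this i, ← Finset.mul_sum, Finset.sum_add_distrib]
      simp
      norm_num
    have h2 : S x * (M p * (M p + 1) * 8) - 8 * (m * (m + 1)) * S x = 0 := by
      have hs2 := congrArg (fun t => S x * (M p * (M p + 1) * t)) hsum
      beta_reduce at hs2
      rw [Finset.mul_sum, Finset.mul_sum] at hs2
      rw [← hs2]
      refine Eq.trans ?_ hEx
      congr 1
      · refine Finset.sum_congr rfl fun i _ => ?_
        ring
      · ring
    -- At the wall `∑ (∂_i Df)² = 8`, and the potential contributes `4 * 2 m (m + 1)`.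
    have h3 : S x * (8 * (((M p : ℂ) - m) * (M p + m + 1))) = 0 := by
      linear_combination h2
    refine (mul_eq_zero.1 h3).resolve_right ?_
    refine mul_ne_zero (by norm_num) (mul_ne_zero (sub_ne_zero.2 ?_) ?_)
    · exact_mod_cast hMp.ne'
    · exact_mod_cast Nat.succ_ne_zero (M p + m)
  rw [hSdef] at hS0
  rcases mul_eq_zero.1 hS0 with h1 | h1
  · exact (mul_eq_zero.1 h1).resolve_left (ex_ne_zero _ _)
  · exact absurd h1 (inv_ne_zero (Finset.prod_ne_zero_iff.2 fun q h => pow_ne_zero _ (hq q h)))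

/-- A point of several walls is a limit of points of this wall alone: the direction `ξ` is zero at
the two indices of `p` and takes distinct positive values elsewhere. -/
theorem IsFam.wall_vanish (H : IsFam n m h ht hl) {T : (Fin n → ℂ) → (Fin n → ℂ) → ℂ}
    (hT : TP d T) (M : Fin n × Fin n → ℕ)
    (hM : ∀ x ∈ dom (fun i : Fin n => (i : ℕ)), ∀ ν, h x ν * ∏ p ∈ prs n, Df p x ^ M p = T x ν)
    {p : Fin n × Fin n} (hp : p ∈ prs n) (hMp : m < M p) {x : Fin n → ℂ} (hx : Df p x = 0)
    (ν : Fin n → ℂ) : T x ν = 0 := by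
  set ξ : Fin n → ℝ := fun l => if l = p.1 ∨ l = p.2 then 0 else (l : ℝ) + 1 with hξ
  have hlt := mem_prs.1 hp
  have h1 := eventually_Df_ne x ξ ((prs n).erase p) (by
    intro q hq
    obtain ⟨hqp, hq⟩ := Finset.mem_erase.1 hq
    have hql := mem_prs.1 hq
    simp only [hξ]
    have pos : ∀ l : Fin n, (0 : ℝ) < (l : ℝ) + 1 := fun l => by positivity
    split_ifs with a b b
    · exfalso
      apply hqp
      rcases a with a | a <;> rcases b with b | b
      · rw [a, b] at hql; exact absurd hql (lt_irrefl _)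
      · exact Prod.ext a b
      · rw [a, b] at hql; exact absurd hql hlt.not_gt
      · rw [a, b] at hql; exact absurd hql (lt_irrefl _)
    · exact (pos _).ne
    · exact (pos _).ne'
    · have : (q.1 : ℕ) ≠ q.2 := (Fin.lt_def.1 hql).ne
      exact fun h => this (by exact_mod_cast add_right_cancel h))
  have h2 : ∀ᶠ t : ℝ in 𝓝[≠] 0, T (x + (t : ℂ) • fun i => (ξ i : ℂ)) ν = 0 := by
    filter_upwards [h1] with t ht
    refine H.wall_vanish_generic hT M hM hp hMp ?_ ht ν
    rw [Df_line]
    have e1 : ξ p.1 = 0 := by simp [hξ]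
    have e2 : ξ p.2 = 0 := by simp [hξ]
    rw [e1, e2, sub_self, mul_zero, Complex.exp_zero, mul_one]
    exact hx
  exact tendsto_nhds_unique
    (((hT.continuous ν).tendsto x).comp (tendsto_line x fun i => (ξ i : ℂ)))
    (tendsto_const_nhds.congr' (h2.mono fun t h => h.symm))

/-- As long as some wall has order above `m`, the numerator vanishes there and one wall factor can
be divided out; induction on the total order. -/
theorem IsFam.exists_trigPoly (H : IsFam n m h ht hl) :
    ∃ T, TP (m * n.choose 2) T ∧
      ∀ x ∈ dom (fun i : Fin n => (i : ℕ)), ∀ ν, h x ν * ∏ p ∈ prs n, Df p x ^ m = T x ν := by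
  have key : ∀ (N : ℕ) (M : Fin n × Fin n → ℕ) (T : (Fin n → ℂ) → (Fin n → ℂ) → ℂ),
      ∑ p ∈ prs n, M p = N → (∀ p ∈ prs n, m ≤ M p) → TP (m * n.choose 2) T →
      (∀ x ∈ dom (fun i : Fin n => (i : ℕ)), ∀ ν, h x ν * ∏ p ∈ prs n, Df p x ^ M p = T x ν) →
      ∃ T, TP (m * n.choose 2) T ∧
        ∀ x ∈ dom (fun i : Fin n => (i : ℕ)), ∀ ν, h x ν * ∏ p ∈ prs n, Df p x ^ m = T x ν := by
    intro N
    induction N with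
    | zero =>
      intro M T hN hm hT hM
      refine ⟨T, hT, fun x hx ν => ?_⟩
      rw [← hM x hx ν]
      congr 1
      refine Finset.prod_congr rfl fun p hp => ?_
      have := Finset.sum_eq_zero_iff.1 hN p hp
      have h2 := hm p hp
      rw [show m = M p by omega]
    | succ N ih =>
      intro M T hN hm hT hM
      by_cases hall : ∀ p ∈ prs n, M p = m
      · refine ⟨T, hT, fun x hx ν => ?_⟩
        rw [← hM x hx ν]
        congr 1
        exact Finset.prod_congr rfl fun p hp => by rw [hall p hp]
      push Not at hall
      obtain ⟨p, hp, hne⟩ := hall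
      have hlt : m < M p := lt_of_le_of_ne (hm p hp) (Ne.symm hne)
      obtain ⟨T', hT', hdiv⟩ := hT.exists_div hp fun x ν hx => H.wall_vanish hT M hM hp hlt hx ν
      refine ih (Function.update M p (M p - 1)) T' ?_ ?_ hT' ?_
      · rw [← Finset.add_sum_erase _ _ hp] at hN ⊢
        rw [Function.update_self, Finset.sum_congr rfl fun q hq =>
          Function.update_of_ne (Finset.ne_of_mem_erase hq) _ _]
        omega
      · intro q hq
        by_cases e : q = p
        · rw [e, Function.update_self]; omega
        · rw [Function.update_of_ne e]; exact hm q hq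
      · intro x hx ν
        have h1 := hM x hx ν
        rw [hdiv x ν, ← Finset.mul_prod_erase _ _ hp] at h1
        rw [← Finset.mul_prod_erase _ _ hp, Function.update_self,
          Finset.prod_congr rfl fun q hq => by
            rw [Function.update_of_ne (Finset.ne_of_mem_erase hq)]]
        refine mul_left_cancel₀ (mem_domVal.1 hx p hp) ?_
        rw [← h1]
        obtain ⟨c, hc⟩ : ∃ c, M p = c + 1 := ⟨M p - 1, by omega⟩
        rw [hc, Nat.add_sub_cancel, pow_succ]; ring
  -- The start is the uniform order `N + m`, so that no order lies below `m`.
  obtain ⟨N, T, hT, hNT⟩ := H.rt.exists_expSum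
  refine key _ (fun _ => N + m) (fun x ν => T x ν * Bh x ^ m) rfl (fun _ _ => by omega)
    (hT.mul (TP_Bh m)) fun x hx ν => ?_
  rw [← hNT x hx, Finset.prod_pow, ← Bh, pow_add]; ring

end PoleOrder

end TrigBA

end

noncomputable section

namespace TrigBA

/-! ### Limits in the Weyl chamber. -/

section Chamber

variable {n : ℕ}

theorem psum_val (a : Fin n → ℤ) (j : ℕ) : psum (fun i : Fin n => (i : ℕ)) a j =
    ∑ i ∈ Finset.range (j + 1), if h : i < n then a ⟨i, h⟩ else 0 := by
  have h1 : ∑ i ∈ Finset.range (j + 1), (if h : i < n then a ⟨i, h⟩ else 0) =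
      ∑ i ∈ Finset.range (max n (j + 1)), if i ≤ j then (if h : i < n then a ⟨i, h⟩ else 0) else 0 := by
    rw [← Finset.sum_filter]
    congr 1
    ext i; simp; omega
  have h2 : ∑ i ∈ Finset.range n, (if i ≤ j then (if h : i < n then a ⟨i, h⟩ else 0) else 0) =
      ∑ i ∈ Finset.range (max n (j + 1)), if i ≤ j then (if h : i < n then a ⟨i, h⟩ else 0) else 0 := by
    refine Finset.sum_subset (by intro i; simp; omega) fun i _ hi => ?_
    have : ¬ i < n := by simpa using hi
    simp [this]
  rw [h1, ← h2, ← Fin.sum_univ_eq_sum_range (fun i => if i ≤ j then (if h : i < n then a ⟨i, h⟩ else 0) else 0)]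
  simp [psum]

theorem level_val {a : Fin n → ℤ} (h : Level (fun i : Fin n => (i : ℕ)) a) : a = 0 := by
  ext ⟨i, hi⟩
  have h1 := h i
  rw [psum_val, Finset.sum_range_succ, dif_pos hi] at h1
  rcases i with _ | j
  · simpa using h1
  · have h2 := h j
    rw [psum_val] at h2
    rwa [h2, zero_add] at h1

/-- Summation by parts: the pairing depends on `x` only through the gaps of consecutive coordinates,
with the partial sums as weights. -/
theorem sum_mul_eq_psum (a : Fin n → ℤ) (hs : ∑ i, a i = 0) (x : Fin n → ℝ) :
    ∑ i, (a i : ℝ) * x i = ∑ j ∈ Finset.range (n - 1), (psum (fun i : Fin n => (i : ℕ)) a j : ℝ) *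
      ((if h : j < n then x ⟨j, h⟩ else 0) - (if h : j + 1 < n then x ⟨j + 1, h⟩ else 0)) := by
  have h := Finset.sum_range_by_parts (fun j => if h : j < n then x ⟨j, h⟩ else 0)
    (fun j => ((if h : j < n then a ⟨j, h⟩ else 0 : ℤ) : ℝ)) n
  have e1 : ∑ i ∈ Finset.range n, (if h : i < n then a ⟨i, h⟩ else 0) = ∑ i, a i := by
    rw [← Fin.sum_univ_eq_sum_range (fun i => if h : i < n then a ⟨i, h⟩ else 0)]
    simp
  have e2 : ∑ i ∈ Finset.range n, (if h : i < n then x ⟨i, h⟩ else 0) •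
      ((if h : i < n then a ⟨i, h⟩ else 0 : ℤ) : ℝ) = ∑ i, (a i : ℝ) * x i := by
    rw [← Fin.sum_univ_eq_sum_range (fun i => (if h : i < n then x ⟨i, h⟩ else 0) •
      ((if h : i < n then a ⟨i, h⟩ else 0 : ℤ) : ℝ))]
    refine Finset.sum_congr rfl fun i _ => ?_
    simp [mul_comm]
  rw [← e2, h, ← Int.cast_sum, e1, hs, Int.cast_zero, smul_zero, zero_sub, ← Finset.sum_neg_distrib]
  refine Finset.sum_congr rfl fun j _ => ?_
  rw [psum_val, smul_eq_mul]
  push_cast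
  ring

theorem norm_exz {ι : Type*} [Fintype ι] (a : ι → ℤ) (z : ι → ℂ) :
    ‖exz a z‖ = Real.exp (∑ i, (a i : ℝ) * (z i).re) := by
  rw [exz, ex, Complex.norm_exp]
  congr 1
  rw [Complex.re_sum]
  refine Finset.sum_congr rfl fun i _ => ?_
  rw [← Complex.ofReal_intCast, Complex.re_ofReal_mul]

/-- Each coordinate has its own colour, so `Level` means exponent zero. Any other exponent of the
cone has some partial sum at most `-1`, and the corresponding gap drives the exponential to `0`. -/
theorem chamberLim_val {α : Type*} {l : Filter α} {X : α → Fin n → ℂ}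
    (hX : ∀ i j, i < j → Tendsto (fun t => (X t i).re - (X t j).re) l atTop) {z₀ : Fin n → ℂ}
    (hz : z₀ ∈ dom fun i : Fin n => (i : ℕ)) : ChamberLim (fun i : Fin n => (i : ℕ)) l X z₀ where
  dom_mem := hz
  dom_ev := by
    have h1 : ∀ᶠ t in l, ∀ p ∈ prs n, 0 < (X t p.1).re - (X t p.2).re := by
      rw [Finset.eventually_all]
      exact fun p hp => (hX _ _ (mem_prs.1 hp)).eventually_gt_atTop 0
    filter_upwards [h1] with t ht i j hij he
    have h2 := ht (i, j) (mem_prs.2 (Fin.lt_def.2 hij))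
    have h3 := congrArg norm he
    rw [Complex.norm_exp, norm_one, Real.exp_eq_one_iff] at h3
    simp at h3
    simp only at h2
    linarith
  level := fun a ha _ => by rw [level_val ha]; simp [exz_zero]
  decay := by
    intro a ha hl
    rw [tendsto_zero_iff_norm_tendsto_zero]
    simp only [norm_exz]
    refine Real.tendsto_exp_atBot.comp ?_
    simp only [sum_mul_eq_psum a ha.2]
    have hj : ∃ j < n - 1, psum (fun i : Fin n => (i : ℕ)) a j ≠ 0 := by
      by_contra hc
      push Not at hc
      apply hl
      intro j
      by_cases hjn : j < n - 1
      · exact hc j hjn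
      · have : psum (fun i : Fin n => (i : ℕ)) a j = ∑ i, a i :=
          Finset.sum_congr rfl fun i _ => if_pos (by
            have := i.2
            beta_reduce
            omega)
        rw [this, ha.2]
    obtain ⟨j, hjn, hj⟩ := hj
    have hgap : ∀ j < n - 1, Tendsto (fun t => (if h : j < n then (X t ⟨j, h⟩).re else 0) -
        (if h : j + 1 < n then (X t ⟨j + 1, h⟩).re else 0)) l atTop := by
      intro j hj
      simp only [dif_pos (show j < n by omega), dif_pos (show j + 1 < n by omega)]
      exact hX _ _ (Fin.lt_def.2 (Nat.lt_succ_self j))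
    have hev : ∀ᶠ t in l, ∀ j ∈ Finset.range (n - 1), 0 ≤ (if h : j < n then (X t ⟨j, h⟩).re else 0) -
        (if h : j + 1 < n then (X t ⟨j + 1, h⟩).re else 0) := by
      rw [Finset.eventually_all]
      exact fun j hj => (hgap j (Finset.mem_range.1 hj)).eventually_ge_atTop 0
    refine tendsto_atBot_mono' l ?_ (tendsto_neg_atTop_atBot.comp (hgap j hjn))
    filter_upwards [hev] with t ht
    rw [← Finset.add_sum_erase _ _ (Finset.mem_range.2 hjn)]
    have h1 : ∀ i, (psum (fun i : Fin n => (i : ℕ)) a i : ℝ) ≤ 0 := fun i => by exact_mod_cast ha.1 i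
    have h2 : (psum (fun i : Fin n => (i : ℕ)) a j : ℝ) ≤ -1 := by
      have := ha.1 j
      have : psum (fun i : Fin n => (i : ℕ)) a j ≤ -1 := by omega
      exact_mod_cast this
    have h3 := Finset.sum_nonpos (s := (Finset.range (n - 1)).erase j) fun i hi => mul_nonpos_of_nonpos_of_nonneg (h1 i)
      (ht i (Finset.mem_of_mem_erase hi))
    have h4 := mul_le_mul_of_nonneg_right h2 (ht j (Finset.mem_range.2 hjn))
    simp only [Function.comp]
    linarith only [h3, h4]

theorem tendsto_chamberAtTop {i j : Fin n} (h : i < j) :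
    Tendsto (fun x : Fin n → ℝ => x i - x j) (chamberAtTop n) atTop :=
  (tendsto_comap (f := fun x : Fin n → ℝ => x i - x j)).mono_left
    ((iInf_le _ i).trans ((iInf_le _ j).trans (iInf_le _ (Finset.mem_Ioi.2 h))))

theorem exists_mem_domVal : ∃ z : Fin n → ℂ, z ∈ dom fun i : Fin n => (i : ℕ) :=
  dense_domVal.nonempty

theorem chamberLim_chamberAtTop {z₀ : Fin n → ℂ} (hz : z₀ ∈ dom fun i : Fin n => (i : ℕ)) :
    ChamberLim (fun i : Fin n => (i : ℕ)) (chamberAtTop n) (fun x i => (x i : ℂ)) z₀ :=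
  chamberLim_val (fun i j h => by simpa using tendsto_chamberAtTop h) hz

end Chamber

/-! ### Existence of the Baker-Akhiezer numerator. -/

section Numerator

variable {n m : ℕ}

theorem sinh_eq (p : Fin n × Fin n) (x : Fin n → ℂ) :
    Complex.sinh (x p.1 - x p.2) = Complex.exp (x p.1 - x p.2) / 2 * Df p x := by
  have h : Complex.exp (x p.1 - x p.2) * Complex.exp (-2 * (x p.1 - x p.2)) =
      Complex.exp (-(x p.1 - x p.2)) := by
    rw [← Complex.exp_add]; congr 1; ring
  rw [Complex.sinh, Df, mul_sub, mul_one, div_mul_eq_mul_div, h]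
  ring

theorem sinhVand_eq (x : Fin n → ℂ) : sinhVand x =
    (∏ p ∈ prs n, (Complex.exp (x p.1 - x p.2) / 2)) * ∏ p ∈ prs n, Df p x := by
  rw [sinhVand, ← prod_prs fun i j => Complex.sinh (x i - x j), ← Finset.prod_mul_distrib]
  exact Finset.prod_congr rfl fun p _ => sinh_eq p x

theorem sinhVand_ne_zero {x : Fin n → ℂ} :
    sinhVand x ≠ 0 ↔ x ∈ dom fun i : Fin n => (i : ℕ) := by
  rw [sinhVand_eq, mul_ne_zero_iff, mem_domVal, Finset.prod_ne_zero_iff, Finset.prod_ne_zero_iff]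
  exact and_iff_right fun p _ => div_ne_zero (Complex.exp_ne_zero _) two_ne_zero

theorem TP_sinhVand (N : ℕ) : TP (n := n) (κ := Fin n) 0 fun x _ => sinhVand x ^ N := by
  refine ((TP.prod (prs n) (H := fun p x _ => Complex.exp (x p.1 - x p.2) / 2 * Df p x)
    fun p _ => ?_).pow N).congr fun x ν => ?_
  · refine (((TP.const (2⁻¹)).mul (TP.expo (fun l => (if l = p.1 then 1 else 0) -
      (if l = p.2 then 1 else 0)))).mul (TP_Df p)).congr fun x ν => ?_
    have : exz (fun l => (if l = p.1 then 1 else 0) - (if l = p.2 then 1 else 0)) x =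
        Complex.exp (x p.1 - x p.2) := by
      unfold exz ex
      congr 1
      push_cast
      simp [sub_mul, Finset.sum_sub_distrib]
    rw [this]; ring
  · rw [sinhVand_eq, ← Finset.prod_mul_distrib]

theorem eval_eq_expSum (P : TrigPoly n) (x ν : Fin n → ℂ) : P.eval x ν = expSum P x ν := rfl

theorem TP_eval {d : ℕ} {P : TrigPoly n} (hP : ∀ a, (P a).totalDegree ≤ d) : TP d P.eval :=
  ⟨P, hP, fun _ _ => rfl⟩

theorem sutherland_eq (f : (Fin n → ℂ) → ℂ) (x : Fin n → ℂ) :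
    sutherland m f x = -∑ i, pd i (pd i f) x + 2 * m * (m + 1) * pot x * f x := by
  have h : ∀ i, iteratedDeriv 2 (fun t : ℂ => f (Function.update x i t)) (x i) = pd i (pd i f) x :=
    fun i => iteratedDeriv_two_eq f x i
  rw [sutherland, Finset.sum_congr rfl fun i _ => h i, pot, Finset.mul_sum]
  congr 2
  refine Finset.sum_congr rfl fun i _ => ?_
  rw [Finset.mul_sum]
  exact Finset.sum_congr rfl fun j _ => by ring

theorem exp_two_sum (x ν : Fin n → ℂ) :
    Complex.exp (2 * ∑ i, ν i * x i) = ex (fun i => 2 * ν i) x := by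
  rw [ex, Finset.mul_sum]
  congr 1
  exact Finset.sum_congr rfl fun i _ => by ring

variable {h ht hl : (Fin n → ℂ) → (Fin n → ℂ) → ℂ}

theorem IsFam.baForm_eq {P : TrigPoly n}
    (hP : ∀ x ∈ dom (fun i : Fin n => (i : ℕ)), ∀ ν, P.eval x ν = h x ν * sinhVand x ^ m)
    {x : Fin n → ℂ} (hx : x ∈ dom fun i : Fin n => (i : ℕ)) (ν : Fin n → ℂ) :
    baForm m P x ν = (normConst m ν)⁻¹ * (ex (fun i => 2 * ν i) x * h x ν) := by
  have h0 : sinhVand x ^ m ≠ 0 := pow_ne_zero _ (sinhVand_ne_zero.2 hx)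
  rw [baForm, exp_two_sum, hP x hx, mul_comm (sinhVand x ^ m), mul_div_mul_right _ _ h0]
  ring

/-- After division down to order `m` along each wall, the family times `sinhVand ^ m` is a
trigonometric polynomial with the degree bound. Equation and normalisation are those of the family.
-/
theorem IsFam.exists_isBANumerator (H : IsFam n m h ht hl) : ∃ P, IsBANumerator n m P := by
  obtain ⟨T, hT, hTh⟩ := H.exists_trigPoly
  have hT2 : TP (m * n.choose 2 + 0) (fun x ν => T x ν * (∏ p ∈ prs n, (Complex.exp (x p.1 - x p.2) / 2)) ^ m) := by
    refine hT.mul ((TP.prod (prs n) (H := fun p x _ => Complex.exp (x p.1 - x p.2) / 2)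
      fun p _ => ?_).pow m)
    refine ((TP.const (2⁻¹)).mul (TP.expo (fun l => (if l = p.1 then 1 else 0) -
      (if l = p.2 then 1 else 0)))).congr fun x ν => ?_
    have : exz (fun l => (if l = p.1 then 1 else 0) - (if l = p.2 then 1 else 0)) x =
        Complex.exp (x p.1 - x p.2) := by
      unfold exz ex
      congr 1
      push_cast
      simp [sub_mul, Finset.sum_sub_distrib]
    rw [this]; ring
  obtain ⟨P, hdeg, hP⟩ : ∃ P : TrigPoly n, (∀ a, (P a).totalDegree ≤ m * n.choose 2) ∧ ∀ x ν,
      T x ν * (∏ p ∈ prs n, (Complex.exp (x p.1 - x p.2) / 2)) ^ m = expSum P x ν := hT2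
  have hPh : ∀ x ∈ dom (fun i : Fin n => (i : ℕ)), ∀ ν, P.eval x ν = h x ν * sinhVand x ^ m := by
    intro x hx ν
    rw [eval_eq_expSum, ← hP x ν, ← hTh x hx ν, sinhVand_eq, mul_pow, Finset.prod_pow]
    ring
  refine ⟨P, ⟨hdeg, fun x ν => ?_⟩, fun ν hν x hx => ?_, fun ν hν => ?_⟩
  · have hT3 : ∀ ν, Continuous fun x : Fin n → ℂ => P.sum fun a p =>
        MvPolynomial.eval ν (MvPolynomial.homogeneousComponent (m * n.choose 2) p) *
        Complex.exp (∑ i, (a i : ℂ) * x i) := by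
      intro ν
      simp only [Finsupp.sum]
      fun_prop
    have hT4 : Continuous fun x : Fin n → ℂ => sinhVand x ^ m * vand ν ^ m :=
      ((TP_sinhVand m).continuous ν).mul continuous_const
    refine congrFun ((hT3 ν).ext_on dense_domVal hT4 fun x hx => ?_) x
    -- Off the walls both candidates for the leading term are the limit of the same rescaled
    -- function as `ν` is scaled to infinity; density of the complement of the walls gives the rest.
    have l1 := (H.rt.tendsto_top x hx ν).mul_const (sinhVand x ^ m)
    rw [H.top x hx, mul_comm (vand ν ^ m)] at l1
    refine tendsto_nhds_unique ?_ l1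
    have l2 : Tendsto (fun t : ℝ => ∑ a ∈ P.support, (((t : ℂ) ^ (m * n.choose 2))⁻¹ *
        MvPolynomial.eval (fun i => (t : ℂ) * ν i) (P a)) * Complex.exp (∑ i, (a i : ℂ) * x i)) atTop
        (𝓝 (∑ a ∈ P.support, MvPolynomial.eval ν
          (MvPolynomial.homogeneousComponent (m * n.choose 2) (P a)) *
            Complex.exp (∑ i, (a i : ℂ) * x i))) :=
      tendsto_finsetSum _ fun a _ => (tendsto_top_eval _ (hdeg a) ν).mul_const _
    refine l2.congr fun t => ?_
    have := hPh x hx fun i => (t : ℂ) * ν i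
    rw [mul_assoc, ← this, eval_eq_expSum, expSum, Finsupp.sum, Finset.mul_sum]
    exact Finset.sum_congr rfl fun a _ => mul_assoc _ _ _
  · have hx' := sinhVand_ne_zero.1 hx
    have e : ∀ y ∈ dom (fun i : Fin n => (i : ℕ)), baForm m P y ν = _ :=
      fun y hy => IsFam.baForm_eq hPh hy ν
    have e2 : ∀ j, pd j (pd j fun y => baForm m P y ν) x =
        (normConst m ν)⁻¹ * pd j (pd j fun x => ex (fun i => 2 * ν i) x * h x ν) x := by
      intro j
      rw [pd_congr_on isOpen_domVal j (pd_congr_on isOpen_domVal j e) hx', ← pd_const_mul]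
      congr 1
      ext y
      rw [pd_const_mul]
    rw [sutherland_eq, Finset.sum_congr rfl fun j _ => e2 j, ← Finset.mul_sum, H.eigen ν x hx', e x hx']
    ring
  · obtain ⟨z₀, hz₀⟩ := exists_mem_domVal (n := n)
    have hC := chamberLim_chamberAtTop hz₀
    have l1 := (H.rt.tendsto_limit hC ν).div_const (normConst m ν)
    rw [H.limit z₀ hz₀, div_self hν] at l1
    refine l1.congr' ?_
    filter_upwards [hC.dom_ev] with x hx
    rw [hPh _ hx, mul_comm (sinhVand _ ^ m), mul_div_mul_right _ _ (pow_ne_zero _ (sinhVand_ne_zero.2 hx))]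

end Numerator

end TrigBA

end

noncomputable section

namespace TrigBA

/-! ### Asymptotics along rays of the chamber. -/

section Rays

variable {n : ℕ}

/-- The pairing of an integer vector with a real vector. -/
def zdot (a : Fin n → ℤ) (ξ : Fin n → ℝ) : ℝ := ∑ i, (a i : ℝ) * ξ i

theorem zdot_sub (a b : Fin n → ℤ) (ξ : Fin n → ℝ) : zdot (a - b) ξ = zdot a ξ - zdot b ξ := by
  simp [zdot, sub_mul]

/-- For directions made of powers of `c > 1` two exponents collide only if `c` is a root of the
nonzero polynomial of their difference; finitely many `c` are excluded. -/
theorem exists_strictAnti_injOn (S : Finset (Fin n → ℤ)) :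
    ∃ ξ : Fin n → ℝ, StrictAnti ξ ∧ Set.InjOn (fun a => zdot a ξ) S := by
  classical
  set q : (Fin n → ℤ) → Polynomial ℝ := fun a =>
    ∑ i : Fin n, Polynomial.C (a i : ℝ) * Polynomial.X ^ (n - 1 - (i : ℕ)) with hq
  have hq0 : ∀ a, a ≠ 0 → q a ≠ 0 := by
    intro a ha h
    apply ha
    ext j
    have h1 := congrArg (fun p => Polynomial.coeff p (n - 1 - (j : ℕ))) h
    simp only [hq, Polynomial.finsetSum_coeff, Polynomial.coeff_C_mul, Polynomial.coeff_X_pow,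
      Polynomial.coeff_zero] at h1
    rw [Finset.sum_eq_single j] at h1
    · simpa using h1
    · intro i _ hij
      rw [if_neg, mul_zero]
      intro h2
      apply hij
      ext
      omega
    · simp
  set bad : Set ℝ := ⋃ p ∈ (S ×ˢ S).filter (fun p => p.1 ≠ p.2), {c | (q (p.1 - p.2)).eval c = 0} with hbad
  have hfin : bad.Finite := by
    refine Set.Finite.biUnion (Finset.finite_toSet _) fun p hp => ?_
    have h1 := hq0 (p.1 - p.2) (sub_ne_zero.2 (Finset.mem_filter.1 hp).2)
    refine ((q (p.1 - p.2)).roots.toFinset.finite_toSet).subset fun c hc => ?_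
    simpa [h1] using hc
  obtain ⟨c, hc1, hc2⟩ := (Set.Ioi_infinite (1 : ℝ)).exists_notMem_finite hfin
  have hc1 : 1 < c := hc1
  refine ⟨fun i => c ^ (n - 1 - (i : ℕ)), fun i j hij => ?_, fun a ha b hb hab => ?_⟩
  · refine pow_lt_pow_right₀ hc1 ?_
    have := Fin.lt_def.1 hij
    omega
  · by_contra hne
    apply hc2
    rw [hbad]
    refine Set.mem_biUnion (x := (a, b)) ?_ ?_
    · simp only [Finset.mem_coe, Finset.mem_filter, Finset.mem_product]
      exact ⟨⟨ha, hb⟩, hne⟩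
    · have h1 : zdot (a - b) (fun i : Fin n => c ^ (n - 1 - (i : ℕ))) = 0 := by
        rw [zdot_sub]; exact sub_eq_zero.2 hab
      change Polynomial.eval c (q (a - b)) = 0
      rw [← h1, hq, zdot, Polynomial.eval_finsetSum]
      refine Finset.sum_congr rfl fun i _ => ?_
      simp

/-- The point `t ξ`. -/
def ray (ξ : Fin n → ℝ) (t : ℝ) : Fin n → ℂ := fun i => ((t * ξ i : ℝ) : ℂ)

theorem chamberLim_ray {ξ : Fin n → ℝ} (hξ : StrictAnti ξ) {z₀ : Fin n → ℂ}
    (hz : z₀ ∈ dom fun i : Fin n => (i : ℕ)) :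
    ChamberLim (fun i : Fin n => (i : ℕ)) atTop (ray ξ) z₀ := by
  refine chamberLim_val (fun i j h => ?_) hz
  simp only [ray, Complex.ofReal_re, ← mul_sub]
  exact tendsto_id.atTop_mul_const (sub_pos.2 (hξ h))

theorem tendsto_exz_ray {ξ : Fin n → ℝ} {a : Fin n → ℤ} (h : zdot a ξ < 0) :
    Tendsto (fun t => exz a (ray ξ t)) atTop (𝓝 0) := by
  rw [tendsto_zero_iff_norm_tendsto_zero]
  simp only [norm_exz, ray, Complex.ofReal_re]
  refine Real.tendsto_exp_atBot.comp ?_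
  have : (fun t : ℝ => ∑ i, (a i : ℝ) * (t * ξ i)) = fun t => t * zdot a ξ := by
    ext t
    rw [zdot, Finset.mul_sum]
    exact Finset.sum_congr rfl fun i _ => by ring
  rw [this]
  exact tendsto_id.atTop_mul_const_of_neg h

/-- Functions that tend to `c` along the ray of direction `ξ`, with a controlled remainder. -/
def RayLim (ξ : Fin n → ℝ) (G : (Fin n → ℂ) → ℂ) (c : ℂ) : Prop :=
  ∃ (V₀ : (Fin n → ℂ) → ℂ) (S : Finset (Fin n → ℤ)) (V : (Fin n → ℤ) → (Fin n → ℂ) → ℂ),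
    (∃ d ft, RT (κ := Fin 0) (fun i : Fin n => (i : ℕ)) d (fun x _ => V₀ x) ft fun _ _ => c) ∧
    (∀ e ∈ S, zdot e ξ < 0 ∧ ∃ d ft fl, RT (κ := Fin 0) (fun i : Fin n => (i : ℕ)) d (fun x _ => V e x) ft fl) ∧
    ∀ x ∈ dom (fun i : Fin n => (i : ℕ)), G x = V₀ x + ∑ e ∈ S, V e x * exz e x

theorem RayLim.tendsto {ξ : Fin n → ℝ} {G : (Fin n → ℂ) → ℂ} {c : ℂ} (h : RayLim ξ G c)
    (hξ : StrictAnti ξ) : Tendsto (fun t => G (ray ξ t)) atTop (𝓝 c) := by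
  obtain ⟨V₀, S, V, ⟨d, ft, h0⟩, hS, hG⟩ := h
  obtain ⟨z₀, hz₀⟩ := exists_mem_domVal (n := n)
  have hC := chamberLim_ray hξ hz₀
  have l0 := h0.tendsto_limit hC 0
  have l1 : Tendsto (fun t => V₀ (ray ξ t) + ∑ e ∈ S, V e (ray ξ t) * exz e (ray ξ t)) atTop
      (𝓝 (c + ∑ e ∈ S, 0)) := by
    refine l0.add (tendsto_finsetSum _ fun e he => ?_)
    obtain ⟨h1, d, ft, fl, h2⟩ := hS e he
    simpa using (h2.tendsto_limit hC 0).mul (tendsto_exz_ray h1)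
  rw [Finset.sum_const_zero, add_zero] at l1
  refine l1.congr' ?_
  filter_upwards [hC.dom_ev] with t ht
  rw [hG _ ht]

theorem pd_exz {ι : Type*} [Fintype ι] [DecidableEq ι] (a : ι → ℤ) (i : ι) (z : ι → ℂ) :
    pd i (exz a) z = a i * exz a z := pd_ex _ _ _

theorem analyticAt_exz {ι : Type*} [Fintype ι] [DecidableEq ι] (a : ι → ℤ) (z : ι → ℂ) :
    AnalyticAt ℂ (exz a) z :=
  analyticAt_ex _ _

theorem RayLim.pd {ξ : Fin n → ℝ} {G : (Fin n → ℂ) → ℂ} {c : ℂ} (h : RayLim ξ G c) (i : Fin n) :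
    RayLim ξ (pd i G) 0 := by
  obtain ⟨V₀, S, V, ⟨d, ft, h0⟩, hS, hG⟩ := h
  refine ⟨TrigBA.pd i V₀, S, fun e x => TrigBA.pd i (V e) x + (e i : ℂ) * V e x,
    ⟨d, _, (h0.pd i).congr (fun z _ ν => rfl) (fun z _ ν => rfl) fun z _ ν => (pd_const c).symm⟩,
    fun e he => ?_, fun x hx => ?_⟩
  · obtain ⟨h1, d, ft, fl, h2⟩ := hS e he
    exact ⟨h1, d, _, _, (h2.pd i).add (h2.const_mul (e i : ℂ))⟩
  · have a0 : AnalyticAt ℂ V₀ x := (h0.analytic 0).1 x hx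
    have a1 : ∀ e ∈ S, AnalyticAt ℂ (V e) x := fun e he => by
      obtain ⟨h1, d, ft, fl, h2⟩ := hS e he
      exact (h2.analytic 0).1 x hx
    have a2 : ∀ e ∈ S, AnalyticAt ℂ (fun x => V e x * exz e x) x := fun e he =>
      (a1 e he).fun_mul (analyticAt_exz e x)
    rw [pd_congr_on isOpen_domVal i hG hx, pd_add a0.differentiableAt
      (Finset.analyticAt_fun_sum S a2).differentiableAt, pd_sum S fun e he => (a2 e he).differentiableAt]
    congr 1
    refine Finset.sum_congr rfl fun e he => ?_
    rw [pd_mul (a1 e he).differentiableAt (analyticAt_exz e x).differentiableAt, pd_exz]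
    ring

theorem RT_inv_Bh (N : ℕ) : ∃ ft, RT (κ := Fin 0) (fun i : Fin n => (i : ℕ)) 0
    (fun x _ => (Bh x ^ N)⁻¹) ft fun _ _ => 1 := by
  have h1 := (RT.prod (κ := Fin 0) (col := fun i : Fin n => (i : ℕ)) (prs n)
    (F := fun p x _ => (1 - Complex.exp (-2 * (x p.1 - x p.2)))⁻¹)
    (Ft := fun p x _ => (1 - Complex.exp (-2 * (x p.1 - x p.2)))⁻¹) (Fl := fun _ _ _ => 1)
    fun p hp => RT.inv p.1 p.2 (Fin.lt_def.1 (mem_prs.1 hp))).pow N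
  refine ⟨_, h1.congr (fun x _ ν => ?_) (fun _ _ _ => rfl) fun x _ ν => by simp⟩
  rw [Finset.prod_inv_distrib, inv_pow]
  rfl

variable {κ : Type*} {d : ℕ}

/-- In a direction that separates the exponents, one exponent `b` dominates. Division by its
exponential leaves the coefficient of `b`, up to factors tending to `1`, and decaying terms. -/
theorem exists_rayLim {R : (Fin n → ℂ) → ℂ} {T : (Fin n → ℂ) → (κ → ℂ) → ℂ} (hT : TP d T) {N : ℕ}
    {ν₀ : κ → ℂ} (hR : ∀ x ∈ dom (fun i : Fin n => (i : ℕ)), R x * Bh x ^ N = T x ν₀)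
    (hne : ∃ x ∈ dom (fun i : Fin n => (i : ℕ)), R x ≠ 0) :
    ∃ (ξ : Fin n → ℝ) (b : Fin n → ℤ) (c : ℂ), StrictAnti ξ ∧ c ≠ 0 ∧
      RayLim ξ (fun x => exz (-b) x * R x) c := by
  classical
  obtain ⟨Q, _, hQ⟩ := hT
  obtain ⟨ft, hV⟩ := RT_inv_Bh (n := n) N
  set S := Q.support.filter fun a => MvPolynomial.eval ν₀ (Q a) ≠ 0 with hS
  have hTS : ∀ x, T x ν₀ = ∑ a ∈ S, MvPolynomial.eval ν₀ (Q a) * exz a x := by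
    intro x
    rw [hQ, expSum, Finsupp.sum, hS]
    symm
    refine Finset.sum_filter_of_ne fun a _ h => left_ne_zero_of_mul h
  obtain ⟨x, hx, hxR⟩ := hne
  have hSne : S.Nonempty := by
    rw [Finset.nonempty_iff_ne_empty]
    intro h
    have := hTS x
    rw [h, Finset.sum_empty, ← hR x hx] at this
    exact mul_ne_zero hxR (pow_ne_zero _ (Bh_ne_zero hx)) this
  obtain ⟨ξ, hξ, hinj⟩ := exists_strictAnti_injOn S
  obtain ⟨b, hb, hmax⟩ := S.exists_max_image (fun a => zdot a ξ) hSne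
  refine ⟨ξ, b, MvPolynomial.eval ν₀ (Q b), hξ, (Finset.mem_filter.1 hb).2,
    fun x => MvPolynomial.eval ν₀ (Q b) * (Bh x ^ N)⁻¹, (S.erase b).image fun a => a - b,
    fun e x => MvPolynomial.eval ν₀ (Q (e + b)) * (Bh x ^ N)⁻¹, ⟨_, _, (hV.const_mul _).congr
      (fun _ _ _ => rfl) (fun _ _ _ => rfl) fun _ _ _ => (mul_one _).symm⟩, fun e he => ?_, fun x hx => ?_⟩
  · obtain ⟨a, ha, rfl⟩ := Finset.mem_image.1 he
    obtain ⟨hab, ha⟩ := Finset.mem_erase.1 ha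
    refine ⟨?_, _, _, _, hV.const_mul _⟩
    rw [zdot_sub, sub_neg]
    exact lt_of_le_of_ne (hmax a ha) fun h => hab (hinj ha hb h)
  · have h0 : Bh x ^ N ≠ 0 := pow_ne_zero _ (Bh_ne_zero hx)
    have h1 : R x = T x ν₀ * (Bh x ^ N)⁻¹ := by rw [← hR x hx, mul_assoc, mul_inv_cancel₀ h0, mul_one]
    have hneg : ∀ a, exz (-b) x * exz a x = exz (a - b) x := by
      intro a; rw [← exz_add]; congr 1; abel
    beta_reduce
    rw [h1, hTS, ← Finset.add_sum_erase _ _ hb, Finset.sum_image (by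
      intro a _ a' _ h; exact sub_left_injective h), add_mul, mul_add, Finset.sum_mul, Finset.mul_sum]
    congr 1
    · have h2 := hneg b
      rw [sub_self, exz_zero] at h2
      linear_combination (MvPolynomial.eval ν₀ (Q b) * (Bh x ^ N)⁻¹) * h2
    · refine Finset.sum_congr rfl fun a _ => ?_
      rw [sub_add_cancel, ← hneg a]; ring

/-- A nonzero `R` would have a dominant exponent `b`, and the leading term of the equation forces `∑
(b_i² + 4 ν_i b_i) = 0`. Non-resonance gives `b = 0`, so `R` would tend to a nonzero constant. The
weakened hypothesis `hgen` covers a non-generic parameter in a direction in which `R` is constant.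
-/
theorem ray_vanish {R W : (Fin n → ℂ) → ℂ} (ν : Fin n → ℂ) {T : (Fin n → ℂ) → (κ → ℂ) → ℂ}
    (hT : TP d T) {N : ℕ} {ν₀ : κ → ℂ}
    (hR : ∀ x ∈ dom (fun i : Fin n => (i : ℕ)), R x * Bh x ^ N = T x ν₀)
    (hW : ∀ ξ : Fin n → ℝ, StrictAnti ξ → Tendsto (fun t => W (ray ξ t)) atTop (𝓝 0))
    (hpde : ∀ x ∈ dom (fun i : Fin n => (i : ℕ)),
      ∑ i, (4 * ν i * pd i R x + pd i (pd i R) x) = W x * R x)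
    (hgen : ∀ b : Fin n → ℤ, (∀ i, (∀ x ∈ dom (fun i : Fin n => (i : ℕ)), pd i R x = 0) → b i = 0) →
      ∑ i, ((b i : ℂ) ^ 2 + 4 * ν i * b i) = 0 → b = 0)
    (hlim : ∀ ξ : Fin n → ℝ, StrictAnti ξ → Tendsto (fun t => R (ray ξ t)) atTop (𝓝 0)) :
    ∀ x ∈ dom (fun i : Fin n => (i : ℕ)), R x = 0 := by
  by_contra hne
  push Not at hne
  obtain ⟨ξ, b, c, hξ, hc, hG⟩ := exists_rayLim hT hR hne
  set G : (Fin n → ℂ) → ℂ := fun x => exz (-b) x * R x with hGdef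
  have hRan : ∀ x ∈ dom (fun i : Fin n => (i : ℕ)), AnalyticAt ℂ R x := by
    intro x hx
    have h1 : AnalyticAt ℂ (fun x => T x ν₀ * (Bh x ^ N)⁻¹) x :=
      (hT.analyticAt ν₀ x).mul (((TP_Bh (κ := Fin 0) N).analyticAt 0 x).inv (pow_ne_zero _ (Bh_ne_zero hx)))
    refine h1.congr ?_
    filter_upwards [isOpen_domVal.mem_nhds hx] with y hy
    rw [← hR y hy, mul_assoc, mul_inv_cancel₀ (pow_ne_zero _ (Bh_ne_zero hy)), mul_one]
  have hGan : ∀ x ∈ dom (fun i : Fin n => (i : ℕ)), AnalyticAt ℂ G x := fun x hx =>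
    (analyticAt_exz _ x).mul (hRan x hx)
  have h1 : ∀ i, ∀ x ∈ dom (fun i : Fin n => (i : ℕ)), exz (-b) x * pd i R x = b i * G x + pd i G x := by
    intro i x hx
    rw [hGdef, pd_mul (analyticAt_exz _ x).differentiableAt (hRan x hx).differentiableAt, pd_exz]
    simp only [Pi.neg_apply, Int.cast_neg]
    ring
  have h2 : ∀ i, ∀ x ∈ dom (fun i : Fin n => (i : ℕ)), exz (-b) x * pd i (pd i R) x =
      b i ^ 2 * G x + 2 * b i * pd i G x + pd i (pd i G) x := by
    intro i x hx
    have hx' := analyticAt_pd (i := i) (hRan x hx)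
    have e1 : pd i (fun x => exz (-b) x * pd i R x) x = pd i (fun x => b i * G x + pd i G x) x :=
      pd_congr_on isOpen_domVal i (h1 i) hx
    rw [pd_mul (analyticAt_exz _ x).differentiableAt hx'.differentiableAt, pd_exz,
      pd_add ((hGan x hx).differentiableAt.const_mul _) (analyticAt_pd (hGan x hx)).differentiableAt,
      pd_const_mul] at e1
    have e2 := h1 i x hx
    simp only [Pi.neg_apply, Int.cast_neg] at e1
    linear_combination e1 + (b i : ℂ) * e2
  obtain ⟨z₀, hz₀⟩ := exists_mem_domVal (n := n)
  have hev := (chamberLim_ray hξ hz₀).dom_ev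
  have l0 := hG.tendsto hξ
  have l1 := fun i => (hG.pd i).tendsto hξ
  have l2 := fun i => ((hG.pd i).pd i).tendsto hξ
  -- The equation times `exp (-b · x)`, taken to the limit along the ray: derivatives of the
  -- normalised function tend to `0` and the potential tends to `0`.
  have hb1 : ∑ i, ((b i : ℂ) ^ 2 + 4 * ν i * b i) = 0 := by
    have lim1 : Tendsto (fun t => ∑ i, (4 * ν i * (b i * G (ray ξ t) + pd i G (ray ξ t)) +
        (b i ^ 2 * G (ray ξ t) + 2 * b i * pd i G (ray ξ t) + pd i (pd i G) (ray ξ t)))) atTop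
        (𝓝 (∑ i, (4 * ν i * (b i * c + 0) + (b i ^ 2 * c + 2 * b i * 0 + 0)))) :=
      tendsto_finsetSum _ fun i _ => (((l0.const_mul _).add (l1 i)).const_mul _).add
        (((l0.const_mul _).add ((l1 i).const_mul _)).add (l2 i))
    have lim2 := (hW ξ hξ).mul l0
    have h3 := tendsto_nhds_unique_of_eventuallyEq lim1 lim2 (by
      filter_upwards [hev] with t ht
      rw [Finset.sum_congr rfl fun i _ => by rw [← h1 i _ ht, ← h2 i _ ht]]
      have h4 := congrArg (fun y => exz (-b) (ray ξ t) * y) (hpde _ ht)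
      beta_reduce at h4
      rw [Finset.mul_sum] at h4
      refine Eq.trans (Finset.sum_congr rfl fun i _ => ?_) (h4.trans ?_)
      · ring
      · rw [hGdef]; ring)
    have h4 : c * ∑ i, ((b i : ℂ) ^ 2 + 4 * ν i * b i) = 0 := by
      rw [zero_mul] at h3
      rw [← h3, Finset.mul_sum]
      exact Finset.sum_congr rfl fun i _ => by ring
    exact (mul_eq_zero.1 h4).resolve_left hc
  -- If the `i`-th derivative of `R` vanishes identically, the limit of its normalised form, `b_i
  -- c`, is zero.
  have hb := hgen b (fun i hi => by
    have lim1 := (l0.const_mul (b i : ℂ)).add (l1 i)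
    have h3 := tendsto_nhds_unique_of_eventuallyEq lim1 tendsto_const_nhds (g := fun _ => 0) (by
      filter_upwards [hev] with t ht
      rw [← h1 i _ ht, hi _ ht, mul_zero])
    rw [add_zero] at h3
    exact_mod_cast (mul_eq_zero.1 h3).resolve_right hc) hb1
  refine hc (tendsto_nhds_unique l0 ?_)
  refine (hlim ξ hξ).congr fun t => ?_
  rw [hGdef, hb, neg_zero]
  simp [exz_zero]

theorem tendsto_pot_ray {ξ : Fin n → ℝ} (hξ : StrictAnti ξ) :
    Tendsto (fun t => pot (ray ξ t)) atTop (𝓝 0) := by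
  obtain ⟨z₀, hz₀⟩ := exists_mem_domVal (n := n)
  have hC := chamberLim_ray hξ hz₀
  have h1 : Tendsto (fun t => ∑ p ∈ prs n, 4 * (exz (rootExp p.1 p.2) (ray ξ t)) *
      ((1 - Complex.exp (-2 * (ray ξ t p.1 - ray ξ t p.2)))⁻¹) ^ 2) atTop (𝓝 (∑ p ∈ prs n, 4 * 0 * 1 ^ 2)) := by
    refine tendsto_finsetSum _ fun p hp => ?_
    have hlt := Fin.lt_def.1 (mem_prs.1 hp)
    refine ((hC.decay _ (negCone_rootExp hlt) (not_level_rootExp hlt)).const_mul 4).mul (Tendsto.pow ?_ 2)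
    exact (RT.inv (κ := Fin 0) (col := fun i : Fin n => (i : ℕ)) p.1 p.2 hlt).tendsto_limit hC 0
  simp only [mul_zero, zero_mul, Finset.sum_const_zero] at h1
  refine h1.congr' ?_
  filter_upwards [hC.dom_ev] with t ht
  rw [pot_eq ht]
  refine Finset.sum_congr rfl fun p _ => ?_
  rw [exz_rootExp, inv_pow, ← div_eq_mul_inv, Df, sub_sub_cancel]

end Rays

end TrigBA

end

noncomputable section

namespace TrigBA

/-! ### Generic parameters. -/

section Density

/-- Baire: a countable intersection of complements of proper affine hyperplanes, each open and
dense. -/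
theorem dense_affine {ι : Type*} [Countable ι] {n : ℕ} (c : ι → ℂ) (l : ι → Fin n → ℂ)
    (hl : ∀ i, l i ≠ 0) : Dense {ν : Fin n → ℂ | ∀ i, c i + ∑ j, l i j * ν j ≠ 0} := by
  have hset : {ν : Fin n → ℂ | ∀ i, c i + ∑ j, l i j * ν j ≠ 0} =
      ⋂ i, {ν : Fin n → ℂ | c i + ∑ j, l i j * ν j ≠ 0} := by ext; simp
  have hc : ∀ i, Continuous fun ν : Fin n → ℂ => c i + ∑ j, l i j * ν j := fun i => by fun_prop
  rw [hset]
  refine dense_iInter_of_isOpen (fun i => isOpen_ne_fun (hc i) continuous_const) fun i => ?_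
  intro ν
  obtain ⟨j, hj⟩ := Function.ne_iff.1 (hl i)
  refine mem_closure_of_tendsto (tendsto_line ν (Pi.single j 1)) ?_
  have hline : ∀ t : ℝ, c i + ∑ k, l i k * (ν + (t : ℂ) • (Pi.single j 1 : Fin n → ℂ)) k =
      (c i + ∑ k, l i k * ν k) + t * l i j := by
    intro t
    simp only [Pi.add_apply, Pi.smul_apply, smul_eq_mul, mul_add, Finset.sum_add_distrib, Pi.single_apply,
      mul_ite, mul_one, mul_zero, Finset.sum_ite_eq', Finset.mem_univ, if_true]
    ring
  by_cases h0 : c i + ∑ k, l i k * ν k = 0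
  · filter_upwards [self_mem_nhdsWithin] with t ht
    change c i + ∑ k, l i k * (ν + (t : ℂ) • (Pi.single j 1 : Fin n → ℂ)) k ≠ 0
    rw [hline, h0, zero_add]
    exact mul_ne_zero (by exact_mod_cast ht) hj
  · have := ((hc i).tendsto ν).comp (tendsto_line ν (Pi.single j 1))
    exact this.eventually_ne h0

/-- Parameters for which no nonzero integer vector is resonant and the normalising constant is nonzero. -/
def Gen (n m : ℕ) : Set (Fin n → ℂ) :=
  {ν | (∀ b : Fin n → ℤ, ∑ i, ((b i : ℂ) ^ 2 + 4 * ν i * b i) = 0 → b = 0) ∧ normConst m ν ≠ 0}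

theorem normConst_ne_zero_iff {n m : ℕ} {ν : Fin n → ℂ} :
    normConst m ν ≠ 0 ↔ ∀ l ∈ Finset.Icc 1 m, ∀ p ∈ prs n, ν p.1 - ν p.2 - (l : ℂ) ≠ 0 := by
  rw [normConst, Finset.prod_ne_zero_iff]
  refine forall₂_congr fun l hl => ?_
  rw [← prod_prs fun i j => ν i - ν j - (l : ℂ), Finset.prod_ne_zero_iff]

theorem dense_Gen (n m : ℕ) : Dense (Gen n m) := by
  have h := dense_affine (ι := {b : Fin n → ℤ // b ≠ 0} ⊕ (ℕ × {p : Fin n × Fin n // p.1 < p.2}))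
    (Sum.elim (fun b => ∑ i, (b.1 i : ℂ) ^ 2) fun q => -(q.1 : ℂ))
    (Sum.elim (fun b i => 4 * (b.1 i : ℂ)) fun q i =>
      (if i = q.2.1.1 then 1 else 0) - (if i = q.2.1.2 then 1 else 0)) (by
      rintro (⟨b, hb⟩ | ⟨l, p, hp⟩)
      · obtain ⟨j, hj⟩ := Function.ne_iff.1 hb
        refine Function.ne_iff.2 ⟨j, ?_⟩
        simpa using hj
      · refine Function.ne_iff.2 ⟨p.1, ?_⟩
        simp [hp.ne])
  refine h.mono fun ν hν => ⟨fun b hb => ?_, normConst_ne_zero_iff.2 fun l _ p hp => ?_⟩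
  · by_contra hb0
    apply hν (.inl ⟨b, hb0⟩)
    simp only [Sum.elim_inl]
    rw [← hb, Finset.sum_add_distrib]
    congr 1
    exact Finset.sum_congr rfl fun i _ => by ring
  · have := hν (.inr (l, ⟨p, mem_prs.1 hp⟩))
    simp only [Sum.elim_inr, sub_mul, Finset.sum_sub_distrib, ite_mul, one_mul, zero_mul,
      Finset.sum_ite_eq', Finset.mem_univ, if_true] at this
    intro h0
    apply this
    linear_combination h0

end Density

/-! ### Uniqueness of the eigenfunction and identification of `Phi`. -/

section Uniqueness

variable {n : ℕ} {κ : Type*} {d : ℕ}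

theorem TP.specialize {F : (Fin n → ℂ) → (κ → ℂ) → ℂ} (hF : TP d F) (ν : κ → ℂ) :
    TP (κ := Fin 0) 0 fun x _ => F x ν := by
  obtain ⟨Q, _, hQ⟩ := hF
  refine (TP.sum Q.support fun a _ => (TP.const (κ := Fin 0) (MvPolynomial.eval ν (Q a))).mul
    (TP.expo a)).congr fun x _ => ?_
  rw [hQ]; rfl

/-- Quotients of exponential sums by powers of `Bh`. -/
def TrigRat (R : (Fin n → ℂ) → ℂ) : Prop :=
  ∃ (N : ℕ) (T : (Fin n → ℂ) → (Fin 0 → ℂ) → ℂ), TP 0 T ∧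
    ∀ x ∈ dom (fun i : Fin n => (i : ℕ)), R x * Bh x ^ N = T x 0

theorem TrigRat.sub {R S : (Fin n → ℂ) → ℂ} (hR : TrigRat R) (hS : TrigRat S) :
    TrigRat fun x => R x - S x := by
  obtain ⟨N, T, hT, h1⟩ := hR
  obtain ⟨N', T', hT', h2⟩ := hS
  refine ⟨N + N', _, (hT.mul (TP_Bh N')).add ((TP.const (-1)).mul (hT'.mul (TP_Bh N))), fun x hx => ?_⟩
  beta_reduce
  rw [← h1 x hx, ← h2 x hx, pow_add]; ring

theorem TrigRat.congr {R S : (Fin n → ℂ) → ℂ} (hR : TrigRat R)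
    (h : ∀ x ∈ dom (fun i : Fin n => (i : ℕ)), S x = R x) : TrigRat S := by
  obtain ⟨N, T, hT, h1⟩ := hR
  exact ⟨N, T, hT, fun x hx => by rw [h x hx, h1 x hx]⟩

theorem RT.trigRat {f ft fl : (Fin n → ℂ) → (κ → ℂ) → ℂ}
    (hf : RT (fun i : Fin n => (i : ℕ)) d f ft fl) (ν : κ → ℂ) : TrigRat fun x => f x ν := by
  obtain ⟨N, T, hT, h1⟩ := hf.exists_expSum
  exact ⟨N, _, hT.specialize ν, fun x hx => h1 x hx ν⟩

theorem TP.trigRat_div {F : (Fin n → ℂ) → (κ → ℂ) → ℂ} (hF : TP d F) (ν : κ → ℂ) (m : ℕ) :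
    TrigRat fun x => F x ν / sinhVand x ^ m := by
  have h2 : TP (κ := Fin 0) 0 fun (x : Fin n → ℂ) _ =>
      (∏ p ∈ prs n, (2 * Complex.exp (-(x p.1 - x p.2)))) ^ m := by
    refine (TP.prod (prs n) (H := fun p x _ => 2 * Complex.exp (-(x p.1 - x p.2))) fun p _ => ?_).pow m
    refine ((TP.const 2).mul (TP.expo (fun l => (if l = p.2 then 1 else 0) -
      (if l = p.1 then 1 else 0)))).congr fun x ν => ?_
    have : exz (fun l => (if l = p.2 then 1 else 0) - (if l = p.1 then 1 else 0)) x =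
        Complex.exp (-(x p.1 - x p.2)) := by
      unfold exz ex
      congr 1
      push_cast
      simp [sub_mul, Finset.sum_sub_distrib]
    rw [this]
  refine ⟨m, _, (hF.specialize ν).mul h2, fun x hx => ?_⟩
  beta_reduce
  have h0 := Bh_ne_zero hx
  have h1 : sinhVand x * ∏ p ∈ prs n, (2 * Complex.exp (-(x p.1 - x p.2))) = Bh x := by
    rw [sinhVand_eq, Bh, mul_right_comm, ← Finset.prod_mul_distrib,
      Finset.prod_eq_one fun p _ => ?_, one_mul]
    rw [Complex.exp_neg]
    have := Complex.exp_ne_zero (x p.1 - x p.2)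
    field_simp
  have h3 : sinhVand x ≠ 0 := sinhVand_ne_zero.2 hx
  rw [← h1, mul_pow]
  field_simp

theorem analyticAt_of_trigRat {R : (Fin n → ℂ) → ℂ} (hR : TrigRat R) {x : Fin n → ℂ}
    (hx : x ∈ dom fun i : Fin n => (i : ℕ)) : AnalyticAt ℂ R x := by
  obtain ⟨N, T, hT, h1⟩ := hR
  have h2 : AnalyticAt ℂ (fun x => T x 0 * (Bh x ^ N)⁻¹) x :=
    (hT.analyticAt 0 x).mul (((TP_Bh (κ := Fin 0) N).analyticAt 0 x).inv (pow_ne_zero _ (Bh_ne_zero hx)))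
  refine h2.congr ?_
  filter_upwards [isOpen_domVal.mem_nhds hx] with y hy
  rw [← h1 y hy, mul_assoc, mul_inv_cancel₀ (pow_ne_zero _ (Bh_ne_zero hy)), mul_one]

theorem pd_pd_ex_mul {R : (Fin n → ℂ) → ℂ} {x : Fin n → ℂ} (hR : AnalyticAt ℂ R x) (ν : Fin n → ℂ)
    (i : Fin n) : pd i (pd i fun x => ex (fun i => 2 * ν i) x * R x) x =
      ex (fun i => 2 * ν i) x * (4 * ν i ^ 2 * R x + (4 * ν i * pd i R x + pd i (pd i R) x)) := by
  have h1 : pd i (fun x => ex (fun i => 2 * ν i) x * R x) =ᶠ[𝓝 x]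
      fun x => ex (fun i => 2 * ν i) x * (2 * ν i * R x + pd i R x) := by
    filter_upwards [hR.eventually_analyticAt] with y hy
    rw [pd_mul (analyticAt_ex _ _).differentiableAt hy.differentiableAt, pd_ex]; ring
  have h2 := analyticAt_pd (i := i) hR
  have h3 : AnalyticAt ℂ (fun x => 2 * ν i * R x + pd i R x) x := (analyticAt_const.mul hR).add h2
  rw [pd_congr h1, pd_mul (analyticAt_ex _ _).differentiableAt h3.differentiableAt, pd_ex,
    pd_add (hR.differentiableAt.const_mul _) h2.differentiableAt, pd_const_mul]
  ring

theorem eigen_iff {R : (Fin n → ℂ) → ℂ} {x : Fin n → ℂ} (hR : AnalyticAt ℂ R x) (ν : Fin n → ℂ) (W : ℂ) :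
    ∑ i, pd i (pd i fun x => ex (fun i => 2 * ν i) x * R x) x =
      (W + 4 * ∑ i, ν i ^ 2) * (ex (fun i => 2 * ν i) x * R x) ↔
    ∑ i, (4 * ν i * pd i R x + pd i (pd i R) x) = W * R x := by
  rw [Finset.sum_congr rfl fun i _ => pd_pd_ex_mul hR ν i, ← Finset.mul_sum, Finset.sum_add_distrib,
    ← Finset.sum_mul, ← Finset.mul_sum]
  have h0 := ex_ne_zero (fun i => 2 * ν i) x
  constructor
  · intro h
    refine mul_left_cancel₀ h0 ?_
    linear_combination h
  · intro h
    linear_combination ex (fun i => 2 * ν i) x * h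

/-- Rational solutions of the eigenvalue equation, with limit `c` at infinity in the chamber. -/
structure IsSol (m : ℕ) (ν : Fin n → ℂ) (R : (Fin n → ℂ) → ℂ) (c : ℂ) : Prop where
  rat : TrigRat R
  pde : ∀ x ∈ dom (fun i : Fin n => (i : ℕ)),
    ∑ i, (4 * ν i * pd i R x + pd i (pd i R) x) = 2 * m * (m + 1) * pot x * R x
  lim : ∀ ξ : Fin n → ℝ, StrictAnti ξ → Tendsto (fun t => R (ray ξ t)) atTop (𝓝 c)

theorem IsSol.sub {m : ℕ} {ν : Fin n → ℂ} {R S : (Fin n → ℂ) → ℂ} {c e : ℂ} (hR : IsSol m ν R c)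
    (hS : IsSol m ν S e) : IsSol m ν (fun x => R x - S x) (c - e) where
  rat := hR.rat.sub hS.rat
  pde := by
    intro x hx
    have a1 := fun x hx => analyticAt_of_trigRat (x := x) hR.rat hx
    have a2 := fun x hx => analyticAt_of_trigRat (x := x) hS.rat hx
    have h1 : ∀ i, ∀ x ∈ dom (fun i : Fin n => (i : ℕ)), pd i (fun x => R x - S x) x = pd i R x - pd i S x :=
      fun i x hx => pd_sub (a1 x hx).differentiableAt (a2 x hx).differentiableAt
    have h2 : ∀ i, pd i (pd i fun x => R x - S x) x = pd i (pd i R) x - pd i (pd i S) x := by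
      intro i
      rw [pd_congr_on isOpen_domVal i (h1 i) hx, pd_sub (analyticAt_pd (a1 x hx)).differentiableAt
        (analyticAt_pd (a2 x hx)).differentiableAt]
    rw [Finset.sum_congr rfl fun i _ => by rw [h1 i x hx, h2 i], mul_sub, ← hR.pde x hx, ← hS.pde x hx,
      ← Finset.sum_sub_distrib]
    exact Finset.sum_congr rfl fun i _ => by ring
  lim := fun ξ hξ => (hR.lim ξ hξ).sub (hS.lim ξ hξ)

/-- The difference of two solutions with equal limits has limit `0` along every ray, and generic `ν`
excludes resonances. -/
theorem IsSol.eq {m : ℕ} {ν : Fin n → ℂ} (hν : ν ∈ Gen n m) {R S : (Fin n → ℂ) → ℂ} {c : ℂ}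
    (hR : IsSol m ν R c) (hS : IsSol m ν S c) {x : Fin n → ℂ}
    (hx : x ∈ dom fun i : Fin n => (i : ℕ)) : R x = S x := by
  have h := hR.sub hS
  obtain ⟨N, T, hT, h1⟩ := h.rat
  refine sub_eq_zero.1 (ray_vanish ν hT h1 (W := fun x => 2 * m * (m + 1) * pot x) (fun ξ hξ => ?_)
    h.pde (fun b _ => hν.1 b) (fun ξ hξ => ?_) x hx)
  · simpa using (tendsto_pot_ray hξ).const_mul (2 * (m : ℂ) * (m + 1))
  · simpa using h.lim ξ hξ

variable {m : ℕ} {h ht hl : (Fin n → ℂ) → (Fin n → ℂ) → ℂ}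

theorem IsFam.isSol (H : IsFam n m h ht hl) (ν : Fin n → ℂ) :
    IsSol m ν (fun x => h x ν) (normConst m ν) where
  rat := H.rt.trigRat ν
  pde := fun x hx => (eigen_iff ((H.rt.analytic ν).1 x hx) ν _).1 (H.eigen ν x hx)
  lim := fun ξ hξ => by
    obtain ⟨z₀, hz₀⟩ := exists_mem_domVal (n := n)
    have := H.rt.tendsto_limit (chamberLim_ray hξ hz₀) ν
    rwa [H.limit _ hz₀] at this

theorem RT.continuous_param {f ft fl : (Fin n → ℂ) → (κ → ℂ) → ℂ}
    (hf : RT (fun i : Fin n => (i : ℕ)) d f ft fl) {x : Fin n → ℂ}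
    (hx : x ∈ dom fun i : Fin n => (i : ℕ)) : Continuous fun ν => f x ν := by
  obtain ⟨N, T, hT, h1⟩ := hf.exists_expSum
  have h2 : (fun ν => f x ν) = fun ν => T x ν * (Bh x ^ N)⁻¹ := by
    ext ν
    rw [← h1 x hx ν, mul_assoc, mul_inv_cancel₀ (pow_ne_zero _ (Bh_ne_zero hx)), mul_one]
  rw [h2]
  exact (hT.continuous_param x).mul continuous_const

theorem tendsto_ray_chamberAtTop {ξ : Fin n → ℝ} (hξ : StrictAnti ξ) :
    Tendsto (fun (t : ℝ) i => t * ξ i) atTop (chamberAtTop n) := by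
  refine tendsto_iInf.2 fun i => tendsto_iInf.2 fun j => tendsto_iInf.2 fun hj => tendsto_comap_iff.2 ?_
  have : ((fun x : Fin n → ℝ => x i - x j) ∘ fun (t : ℝ) i => t * ξ i) = fun t => t * (ξ i - ξ j) := by
    ext t; simp [mul_sub]
  rw [this]
  exact tendsto_id.atTop_mul_const (sub_pos.2 (hξ (Finset.mem_Ioi.1 hj)))

theorem IsBANumerator.isSol {Q : TrigPoly n} (hQ : IsBANumerator n m Q) {ν : Fin n → ℂ}
    (hν : normConst m ν ≠ 0) :
    IsSol m ν (fun x => normConst m ν * (Q.eval x ν / (sinhVand x ^ m * normConst m ν))) (normConst m ν) := by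
  have e0 : ∀ x, normConst m ν * (Q.eval x ν / (sinhVand x ^ m * normConst m ν)) =
      Q.eval x ν / sinhVand x ^ m := by
    intro x
    by_cases hx : sinhVand x ^ m = 0
    · simp [hx]
    · field_simp
  have hrat : TrigRat fun x => normConst m ν * (Q.eval x ν / (sinhVand x ^ m * normConst m ν)) :=
    ((TP_eval hQ.leading.1).trigRat_div ν m).congr fun x _ => e0 x
  refine ⟨hrat, fun x hx => ?_, fun ξ hξ => ?_⟩
  · refine (eigen_iff (analyticAt_of_trigRat hrat hx) ν _).1 ?_
    have h1 := hQ.schrodinger ν hν x (sinhVand_ne_zero.2 hx)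
    rw [sutherland_eq] at h1
    have e : (fun x => ex (fun i => 2 * ν i) x *
        (normConst m ν * (Q.eval x ν / (sinhVand x ^ m * normConst m ν)))) =
        fun x => normConst m ν * baForm m Q x ν := by
      ext x
      rw [baForm, exp_two_sum]; ring
    have e2 := congrFun e x
    beta_reduce at e2
    rw [e2, e]
    have e3 : ∀ j, pd j (pd j fun x => normConst m ν * baForm m Q x ν) x =
        normConst m ν * pd j (pd j fun x => baForm m Q x ν) x := by
      intro j
      rw [← pd_const_mul]
      congr 1
      ext y
      rw [pd_const_mul]
    rw [Finset.sum_congr rfl fun j _ => e3 j, ← Finset.mul_sum]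
    linear_combination -(normConst m ν) * h1
  · have := ((hQ.normalised ν hν).comp (tendsto_ray_chamberAtTop hξ)).const_mul (normConst m ν)
    rwa [mul_one] at this

/-- For generic `ν` both sides are the same solution by uniqueness. Both are continuous in `ν`, so
density gives all `ν`, including those with `normConst m ν = 0`. -/
theorem IsFam.eval_eq (H : IsFam n m h ht hl) {Q : TrigPoly n} (hQ : IsBANumerator n m Q) :
    ∀ x ∈ dom (fun i : Fin n => (i : ℕ)), ∀ ν, Q.eval x ν = h x ν * sinhVand x ^ m := by
  intro x hx ν
  have h0 : sinhVand x ^ m ≠ 0 := pow_ne_zero _ (sinhVand_ne_zero.2 hx)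
  have c1 : Continuous fun ν => Q.eval x ν := (TP_eval hQ.leading.1).continuous_param x
  have c2 : Continuous fun ν => h x ν * sinhVand x ^ m := (H.rt.continuous_param hx).mul continuous_const
  refine congrFun (c1.ext_on (dense_Gen n m) c2 fun ν hν => ?_) ν
  have h1 := (hQ.isSol hν.2).eq hν (H.isSol ν) hx
  beta_reduce at h1
  have h2 := hν.2
  rw [← h1]
  field_simp

/-- Every numerator with the defining properties agrees with the family off the walls, so the choice
made in `Phi` is immaterial. -/
theorem IsFam.Phi_eq (H : IsFam n m h ht hl) {x : Fin n → ℂ} (hx : x ∈ dom fun i : Fin n => (i : ℕ))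
    (ν : Fin n → ℂ) : Phi n m x ν = (normConst m ν)⁻¹ * (ex (fun i => 2 * ν i) x * h x ν) :=
  IsFam.baForm_eq (H.eval_eq (Classical.epsilon_spec H.exists_isBANumerator)) hx ν

theorem exz_vadd {ι : Type*} [Fintype ι] (a : ι → ℤ) (z v : ι → ℂ) :
    exz a (fun i => z i + v i) = exz a z * exz a v := by
  unfold exz ex
  rw [← Complex.exp_add, ← Finset.sum_add_distrib]
  simp only [mul_add]

/-- The exponents of the class have coordinate sum zero, so a translation that is trivial on such
characters is invisible. -/
theorem RT.translate_of {ι : Type*} [Fintype ι] [DecidableEq ι] {col : ι → ℕ}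
    {f ft fl : (ι → ℂ) → (κ → ℂ) → ℂ} (hf : RT col d f ft fl) {v : ι → ℂ}
    (hv : ∀ a : ι → ℤ, ∑ i, a i = 0 → exz a v = 1) :
    ∀ z ∈ dom col, ∀ ν, f (fun i => z i + v i) ν = f z ν := by
  have hroot : ∀ (i j : ι) (z : ι → ℂ), Complex.exp (-2 * ((z i + v i) - (z j + v j))) =
      Complex.exp (-2 * (z i - z j)) := by
    intro i j z
    have h0 : ∑ l, rootExp i j l = 0 := by
      unfold rootExp
      rw [← Finset.mul_sum, Finset.sum_sub_distrib]
      simp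
    have := exz_vadd (rootExp i j) z v
    rwa [hv _ h0, mul_one, exz_rootExp, exz_rootExp] at this
  have hdom : ∀ z ∈ dom col, (fun i => z i + v i) ∈ dom col := by
    intro z hz i j hij
    rw [hroot]
    exact hz i j hij
  induction hf with
  | mono a p d ha hp => intro z hz ν; beta_reduce; rw [exz_vadd, hv a ha.2, mul_one]
  | inv i j h => intro z hz ν; beta_reduce; rw [hroot]
  | add _ _ h1 h2 => intro z hz ν; beta_reduce; rw [h1 z hz, h2 z hz]
  | mul _ _ h1 h2 => intro z hz ν; beta_reduce; rw [h1 z hz, h2 z hz]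
  | congr _ h _ _ ih => intro z hz ν; rw [h _ (hdom z hz), h z hz, ih z hz]

theorem RT.translate {ι : Type*} [Fintype ι] [DecidableEq ι] {col : ι → ℕ} {f ft fl : (ι → ℂ) → (κ → ℂ) → ℂ}
    (hf : RT col d f ft fl) (s : ℂ) : ∀ z ∈ dom col, ∀ ν, f (fun i => z i + s) ν = f z ν :=
  hf.translate_of fun a ha => by
    have h2 : ∑ i, (a i : ℂ) = 0 := by exact_mod_cast ha
    simp [exz, ex, ← Finset.sum_mul, h2]

theorem RT.sum_pd_eq_zero {f ft fl : (Fin n → ℂ) → (κ → ℂ) → ℂ}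
    (hf : RT (fun i : Fin n => (i : ℕ)) d f ft fl) {x : Fin n → ℂ}
    (hx : x ∈ dom fun i : Fin n => (i : ℕ)) (ν : κ → ℂ) : ∑ i, TrigBA.pd i (fun x => f x ν) x = 0 := by
  have ha := ((hf.analytic ν).1 x hx).differentiableAt
  have h1 : HasDerivAt (fun s : ℂ => f (fun i => x i + s) ν) (∑ i, TrigBA.pd i (fun x => f x ν) x) 0 := by
    have hd : HasDerivAt (fun s : ℂ => (fun i => x i + s : Fin n → ℂ)) (fun _ => 1) 0 :=
      hasDerivAt_pi.2 fun i => (hasDerivAt_id (0 : ℂ)).const_add (x i)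
    have h2 : HasFDerivAt (fun x => f x ν) (fderiv ℂ (fun x => f x ν) x) (fun i => x i + 0) := by
      simpa using ha.hasFDerivAt
    have h3 := h2.comp_hasDerivAt (0 : ℂ) hd
    refine h3.congr_deriv ?_
    rw [Finset.sum_congr rfl fun i _ => pd_eq_fderiv ha, ← map_sum]
    congr 1
    ext j
    simp [Finset.sum_apply, Pi.single_apply]
  have h2 : (fun s : ℂ => f (fun i => x i + s) ν) = fun _ => f x ν := by
    ext s; exact hf.translate s x hx ν
  rw [h2] at h1
  exact h1.unique (hasDerivAt_const _ _)

theorem normConst_shift (ν : Fin n → ℂ) (b : ℂ) : normConst m (fun i => ν i + b) = normConst m ν := by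
  unfold normConst
  simp only [add_sub_add_right_eq_sub]

/-- Shifting `ν` by `b` adds `4 b ∑ ∂_i h` to the equation, and this sum is zero by translation
invariance. The normalisation involves only differences of the `ν_i`. -/
theorem IsFam.shift (H : IsFam n m h ht hl) {x : Fin n → ℂ} (hx : x ∈ dom fun i : Fin n => (i : ℕ))
    (ν : Fin n → ℂ) (b : ℂ) : h x (fun i => ν i + b) = h x ν := by
  have c1 : Continuous fun ν : Fin n → ℂ => h x fun i => ν i + b :=
    (H.rt.continuous_param hx).comp (by fun_prop)
  refine congrFun (c1.ext_on (dense_Gen n m) (H.rt.continuous_param hx) fun ν hν => ?_) ν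
  have h1 := H.isSol fun i => ν i + b
  rw [normConst_shift] at h1
  refine IsSol.eq hν (R := fun x => h x fun i => ν i + b) ⟨h1.rat, fun x hx => ?_, h1.lim⟩ (H.isSol ν) hx
  rw [← h1.pde x hx]
  have h2 := H.rt.sum_pd_eq_zero hx fun i => ν i + b
  rw [← sub_eq_zero, ← Finset.sum_sub_distrib, ← mul_zero (-4 * b), ← h2, Finset.mul_sum]
  exact Finset.sum_congr rfl fun i _ => by ring

end Uniqueness

end TrigBA

end

noncomputable section

namespace TrigBA

/-! ### Complete homogeneous polynomials. -/

section HPoly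

variable {k : ℕ}

/-- The complete homogeneous symmetric polynomial of degree `p`. -/
def hpoly (k p : ℕ) : MvPolynomial (Fin k) ℂ :=
  ∑ β ∈ Finset.piAntidiag Finset.univ p, ∏ i, MvPolynomial.X i ^ β i

theorem hpoly_zero : hpoly k 0 = 1 := by
  simp [hpoly]

theorem mem_piAnti {p : ℕ} {β : Fin k → ℕ} :
    β ∈ Finset.piAntidiag Finset.univ p ↔ ∑ i, β i = p := by simp

/-- Exactly the monomials without `X_i` survive, so the corresponding operator in `-∂_y` commutes
with multiplication by `T_i`. -/
theorem hpoly_succ (p : ℕ) (i : Fin k) : hpoly k (p + 1) - hpoly k p * MvPolynomial.X i =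
    ∑ β ∈ (Finset.piAntidiag Finset.univ (p + 1)).filter (fun β : Fin k → ℕ => β i = 0),
      ∏ j, MvPolynomial.X j ^ β j := by
  rw [sub_eq_iff_eq_add, hpoly,
    ← Finset.sum_filter_add_sum_filter_not _ (fun β : Fin k → ℕ => β i = 0)]
  congr 1
  rw [hpoly, Finset.sum_mul]
  symm
  refine Finset.sum_bij' (fun β _ => β + Pi.single i 1) (fun β _ => β - Pi.single i 1) ?_ ?_ ?_ ?_ ?_
  · intro β hβ
    rw [mem_piAnti] at hβ
    rw [Finset.mem_filter, mem_piAnti]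
    simp [Finset.sum_add_distrib, hβ]
  · intro β hβ
    rw [Finset.mem_filter, mem_piAnti] at hβ
    rw [mem_piAnti]
    have h1 : β = (β - Pi.single i 1) + Pi.single i 1 := by
      ext j
      by_cases hj : j = i
      · subst hj
        have := hβ.2
        simp; omega
      · simp [hj]
    have h2 := hβ.1
    rw [h1] at h2
    simp only [Pi.add_apply, Finset.sum_add_distrib] at h2
    simpa using h2
  · intro β hβ
    ext j; simp
  · intro β hβ
    rw [Finset.mem_filter] at hβ
    ext j
    by_cases hj : j = i
    · subst hj
      have := hβ.2
      simp; omega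
    · simp [hj]
  · intro β hβ
    simp only [Pi.add_apply, pow_add, Finset.prod_mul_distrib]
    congr 1
    rw [Finset.prod_eq_single i (fun j _ hj => by simp [hj]) (by simp)]
    simp

end HPoly

/-! ### The kernel with `q = m`: recursion for the coefficients of the integral. -/

section Recursion

variable {k : ℕ}

theorem commute_neg {A : Type*} [Ring A] {a b : A} (h : Commute a b) : Commute a (-b) := h.neg_right

/-- The algebra homomorphism `X_i ↦ -∂_{y_i}`. -/
def thetaY : MvPolynomial (Fin k) ℂ →ₐ[ℂ] Module.End ℂ (HolI k) :=
  commHom (A := Module.End ℂ (HolI k)) (fun i => -P (.inr i))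
    fun i j => commute_neg (A := Module.End ℂ (HolI k)) (commute_neg (A := Module.End ℂ (HolI k))
      (P_commute (.inr i) (.inr j)).symm).symm

theorem thetaY_X (i : Fin k) : thetaY (MvPolynomial.X i) = -P (.inr i) :=
  commHom_X (A := Module.End ℂ (HolI k)) _ _ i

theorem thetaY_commute {B : Module.End ℂ (HolI k)} (hB : ∀ i, Commute B (P (.inr i)))
    (p : MvPolynomial (Fin k) ℂ) : Commute B (thetaY p) :=
  commHom_commute (A := Module.End ℂ (HolI k)) _ (fun i => commute_neg (A := Module.End ℂ (HolI k)) (hB i)) p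

theorem TOp_commute_P {i j : Fin k} (h : i ≠ j) : Commute (TOp i) (P (.inr j)) := by
  refine (pdOp_mulOp_commute _ _ _ fun z _ => ?_).symm
  have hd : DifferentiableAt ℂ (fun z : Idx k → ℂ =>
      Complex.exp (-2 * (z (.inl i.castSucc) - z (.inr i)))) z := (analyticAt_exp_diff _ _ _ z).differentiableAt
  refine (pd_sub (differentiableAt_const _) hd).trans ?_
  rw [pd_const, pd_esig, if_neg (by simp), if_neg (by simpa using h.symm)]; ring

theorem TOp_commute_thetaY {i : Fin k} (β : Fin k → ℕ) (hβ : β i = 0) :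
    Commute (TOp i) (thetaY (∏ j, MvPolynomial.X j ^ β j)) := by
  have : ∀ s : Finset (Fin k), Commute (TOp i) (thetaY (∏ j ∈ s, MvPolynomial.X j ^ β j)) := by
    intro s
    induction s using Finset.induction_on with
    | empty => rw [Finset.prod_empty, map_one]; exact Commute.one_right _
    | insert j s hj ih =>
      rw [Finset.prod_insert hj, map_mul, map_pow, thetaY_X]
      refine Commute.mul_right ?_ ih
      by_cases hij : i = j
      · rw [← hij, hβ, pow_zero]; exact Commute.one_right _
      · exact (commute_neg (A := Module.End ℂ (HolI k)) (TOp_commute_P hij)).pow_right _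
  exact this _

theorem lapOp_commute_P (i : Fin k) : Commute (lapOp (k := k)) (P (.inr i)) :=
  (lapOp_commute (fun _ => (P_commute _ _).add_right (P_commute _ _)) (P_commute _ _)).symm

/-- The function `∏ T_i^m N Ψ(y)`. -/
def gfun (m : ℕ) (Ψ : (Fin k → ℂ) → ℂ) (z : Idx k → ℂ) : ℂ :=
  (∏ i, Tf i z ^ m) * Nker m z * Ψ fun i => z (.inr i)

variable {m : ℕ} {Ψ : (Fin k → ℂ) → ℂ} (hΨ : AnalyticOnNhd ℂ Ψ (dom fun i : Fin k => (i : ℕ)))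

theorem analyticOnNhd_gfun (m : ℕ) (hΨ : AnalyticOnNhd ℂ Ψ (dom fun i : Fin k => (i : ℕ))) :
    AnalyticOnNhd ℂ (gfun m Ψ) (dom (icol (k := k))) := fun z hz =>
  ((Finset.analyticAt_fun_prod _ fun i _ => (analyticAt_Tf i z).fun_pow m).mul
    (analyticOnNhd_Nker _ z hz)).mul (analyticAt_comp_inr (hΨ _ (inr_mem_dom hz)))

theorem gfun_eq_kerF (z : Idx k → ℂ) : gfun m Ψ z = kerF m 0 Ψ z := by
  have : twexp 0 z = 1 := by simp [twexp, ex]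
  rw [kerF, sker_eq, this, gfun]
  simp

/-- `gfun` as an element of `HolI k`. -/
def gHol (m : ℕ) (hΨ : AnalyticOnNhd ℂ Ψ (dom fun i : Fin k => (i : ℕ))) : HolI k :=
  Hol.mk (isOpen_dom _) _ (analyticOnNhd_gfun m hΨ)

theorem gHol_apply {z : Idx k → ℂ} (hz : z ∈ dom (icol (k := k))) : (gHol m hΨ).1 z = gfun m Ψ z :=
  Hol.mk_apply _ _ hz

theorem gHol_eqOn : Set.EqOn (gHol m hΨ).1 (kerF m 0 Ψ) (dom (ipos (k := k))) := fun z hz =>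
  (gHol_apply hΨ (dom_ipos_subset hz)).trans (gfun_eq_kerF z)

/-- Multiplication by the regularised logarithmic derivative. -/
def lregOp (q : ℤ) (i : Fin k) : Module.End ℂ (HolI k) := mulOp (lreg q i) (analyticOnNhd_lreg q i)

/-- All logarithmic derivatives of the kernel add up to zero, so the one in the last variable is
minus the sum over the pairs `(x_i, y_i)`, each divisible by `T_i`. -/
theorem P_last_gHol : P (.inl (Fin.last k)) (gHol m hΨ) =
    -∑ i, TOp i (lregOp m i (gHol m hΨ)) := by
  refine HolI.ext_off fun z hz => ?_
  have hz' := dom_ipos_subset hz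
  have h1 : (-∑ i, TOp i (lregOp m i (gHol m hΨ))).1 z = -∑ i, Tf i z * (lreg m i z * (gHol m hΨ).1 z) := by
    change -(∑ i, TOp i (lregOp m i (gHol m hΨ))).1 z = _
    rw [Hol_sum_apply]; rfl
  rw [h1, P_apply _ _ hz', pd_congr_on (isOpen_dom _) _ (gHol_eqOn hΨ) hz, gHol_eqOn hΨ hz]
  have d1 : DifferentiableAt ℂ (fun z : Idx k → ℂ => sker ipos chg m z * twexp 0 z) z :=
    ((analyticOnNhd_sker m z hz).mul (analyticAt_twexp 0 z)).differentiableAt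
  have d2 : DifferentiableAt ℂ (fun z : Idx k → ℂ => Ψ fun i => z (.inr i)) z :=
    (analyticAt_comp_inr (hΨ _ (inr_mem_dom hz'))).differentiableAt
  have h2 : pd (.inl (Fin.last k)) (kerF m 0 Ψ) z = lker chg m (.inl (Fin.last k)) z * kerF m 0 Ψ z := by
    refine (pd_mul d1 d2).trans ?_
    rw [pd_mul (analyticOnNhd_sker (m : ℤ) z hz).differentiableAt (analyticAt_twexp 0 z).differentiableAt,
      pd_sker ipos_injective chg_balance m _ hz, pd_twexp, pd_inl_comp_inr, kerF]
    ring
  rw [h2]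
  have h3 := sum_lker (ε := chg (k := k)) m z
  rw [Fintype.sum_sum_type, Fin.sum_univ_castSucc] at h3
  have h4 : ∑ i, Tf i z * (lreg m i z * kerF m 0 Ψ z) = (∑ i : Fin k, (lker chg m (.inl i.castSucc) z +
      lker chg m (.inr i) z)) * kerF m 0 Ψ z := by
    rw [Finset.sum_mul]
    refine Finset.sum_congr rfl fun i _ => ?_
    rw [lker_add _ _ hz]; ring
  rw [h4, Finset.sum_add_distrib]
  linear_combination kerF m 0 Ψ z * h3

theorem lapOp_gHol {N : ℂ} (heq : ∀ y ∈ dom (fun i : Fin k => (i : ℕ)), ∑ i, pd i (pd i Ψ) y =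
      (2 * m * (m + 1) * pot y + N) * Ψ y) :
    lapOp (gHol m hΨ) = potOp (2 * m * (m + 1)) N (gHol m hΨ) +
      (2 : ℂ) • ∑ i, P (.inr i) (TOp i (lregOp m i (gHol m hΨ))) := by
  refine HolI.ext_off fun z hz => ?_
  have hz' := dom_ipos_subset hz
  have h1 := lapD_kerF (m : ℤ) 0 N hΨ (by push_cast; exact heq) hz
  have h2 : ∀ i, pd (.inr i) (fun z => (lker chg m (.inl i.castSucc) z +
      lker chg m (.inr i) z) * kerF m 0 Ψ z) z = (P (.inr i) (TOp i (lregOp m i (gHol m hΨ)))).1 z := by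
    intro i
    rw [P_apply _ _ hz']
    refine pd_congr_on (isOpen_dom _) _ (fun w hw => ?_) hz
    change _ = Tf i w * (lreg m i w * (gHol m hΨ).1 w)
    rw [gHol_eqOn hΨ hw, lker_add _ _ hw]; ring
  have h3 : (potOp (2 * m * (m + 1)) N (gHol m hΨ) +
      (2 : ℂ) • ∑ i, P (.inr i) (TOp i (lregOp m i (gHol m hΨ)))).1 z =
      (2 * m * (m + 1) * pot (fun j => z (.inl j)) + N) * (gHol m hΨ).1 z +
      (2 : ℂ) * ∑ i, (P (.inr i) (TOp i (lregOp m i (gHol m hΨ)))).1 z := by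
    rw [← Hol_sum_apply]; rfl
  rw [lapOp_apply _ hz', lapD_congr_on (isOpen_dom _) (gHol_eqOn hΨ) hz, h1, h3, gHol_eqOn hΨ hz,
    Finset.sum_congr rfl fun i _ => h2 i]
  push_cast
  ring

/-- The coefficients of the expansion of the integral. -/
def acoef (m p : ℕ) (hΨ : AnalyticOnNhd ℂ Ψ (dom fun i : Fin k => (i : ℕ))) (x : Fin (k + 1) → ℂ) : ℂ :=
  (thetaY (hpoly k p) (gHol m hΨ)).1 (diag x)

theorem P_last_thetaY (p : MvPolynomial (Fin k) ℂ) :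
    P (.inl (Fin.last k)) (thetaY p (gHol m hΨ)) = -∑ i, thetaY p (TOp i (lregOp m i (gHol m hΨ))) := by
  have h := thetaY_commute (B := P (.inl (Fin.last k))) (fun i => P_commute _ _) p
  have h2 : P (.inl (Fin.last k)) (thetaY p (gHol m hΨ)) = thetaY p (P (.inl (Fin.last k)) (gHol m hΨ)) :=
    congrArg (fun B => B (gHol m hΨ)) h.eq
  rw [h2, P_last_gHol, map_neg, map_sum]

theorem TOp_diag (i : Fin k) (f : HolI k) (x : Fin (k + 1) → ℂ) : (TOp i f).1 (diag x) = 0 := by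
  change Tf i (diag x) * f.1 (diag x) = 0
  rw [Tf_diag, zero_mul]

theorem pd_last_acoef (p : ℕ) {x : Fin (k + 1) → ℂ} (hx : x ∈ dom fun j : Fin (k + 1) => (j : ℕ)) :
    pd (Fin.last k) (acoef m p hΨ) x =
      -∑ i, (thetaY (hpoly k p) (TOp i (lregOp m i (gHol m hΨ)))).1 (diag x) := by
  refine (pd_diag_last (Hol.analytic (thetaY (hpoly k p) (gHol m hΨ)) _ (diag_mem hx))).trans ?_
  rw [← P_apply _ _ (diag_mem hx), P_last_thetaY]
  change -(∑ i, thetaY (hpoly k p) (TOp i (lregOp m i (gHol m hΨ)))).1 (diag x) = _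
  rw [Hol_sum_apply]

theorem pd_last_acoef_zero {x : Fin (k + 1) → ℂ} (hx : x ∈ dom fun j : Fin (k + 1) => (j : ℕ)) :
    pd (Fin.last k) (acoef m 0 hΨ) x = 0 := by
  rw [pd_last_acoef hΨ 0 hx, hpoly_zero, map_one, neg_eq_zero]
  exact Finset.sum_eq_zero fun i _ => TOp_diag _ _ _

/-- Integration by parts, coefficient by coefficient. In degree `p` the divergence term of
`lapOp_gHol` carries the operators `hpoly k p * X_i`, which act on multiples of `T_i` at the
diagonal as `hpoly k (p + 1)` does. Their sum is the derivative of the next coefficient in the last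
variable. -/
theorem acoef_rec {N : ℂ} (heq : ∀ y ∈ dom (fun i : Fin k => (i : ℕ)), ∑ i, pd i (pd i Ψ) y =
      (2 * m * (m + 1) * pot y + N) * Ψ y) (p : ℕ) {x : Fin (k + 1) → ℂ}
    (hx : x ∈ dom fun j : Fin (k + 1) => (j : ℕ)) :
    ∑ j, pd j (pd j (acoef m p hΨ)) x = (2 * m * (m + 1) * pot x + N) * acoef m p hΨ x +
      2 * pd (Fin.last k) (acoef m (p + 1) hΨ) x := by
  set g := gHol m hΨ with hg
  have h1 : lapOp (thetaY (hpoly k p) g) = thetaY (hpoly k p) (lapOp g) :=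
    congrArg (fun B => B g) (thetaY_commute lapOp_commute_P (hpoly k p)).eq
  have h2 : thetaY (hpoly k p) (potOp (2 * m * (m + 1)) N g) = potOp (2 * m * (m + 1)) N (thetaY (hpoly k p) g) :=
    (congrArg (fun B => B g) (thetaY_commute (fun i => (P_inr_commute_potOp i _ _).symm) (hpoly k p)).eq).symm
  have h3 : ∀ i, thetaY (hpoly k p) (P (.inr i) (TOp i (lregOp m i g))) =
      -thetaY (hpoly k p * MvPolynomial.X i) (TOp i (lregOp m i g)) := by
    intro i
    rw [map_mul, thetaY_X]
    change _ = -(thetaY (hpoly k p) (-(P (.inr i) (TOp i (lregOp m i g)))))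
    rw [map_neg, neg_neg]
  -- The difference of the two operators is free of `X_i`, so it commutes with `T_i`, and `T_i` is
  -- zero on the diagonal.
  have h4 : ∀ i, (thetaY (hpoly k p * MvPolynomial.X i) (TOp i (lregOp m i g))).1 (diag x) =
      (thetaY (hpoly k (p + 1)) (TOp i (lregOp m i g))).1 (diag x) := by
    intro i
    have e1 : thetaY (hpoly k (p + 1)) (TOp i (lregOp m i g)) -
        thetaY (hpoly k p * MvPolynomial.X i) (TOp i (lregOp m i g)) =
        TOp i (thetaY (hpoly k (p + 1) - hpoly k p * MvPolynomial.X i) (lregOp m i g)) := by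
      have e2 : Commute (TOp i) (thetaY (hpoly k (p + 1) - hpoly k p * MvPolynomial.X i)) := by
        rw [hpoly_succ, map_sum]
        refine Commute.sum_right _ _ _ fun β hβ => TOp_commute_thetaY β (Finset.mem_filter.1 hβ).2
      have e3 := congrArg (fun B => B (lregOp m i g)) e2.eq
      refine Eq.trans ?_ e3.symm
      rw [map_sub]
      rfl
    have e4 : (thetaY (hpoly k (p + 1)) (TOp i (lregOp m i g))).1 (diag x) -
        (thetaY (hpoly k p * MvPolynomial.X i) (TOp i (lregOp m i g))).1 (diag x) = 0 := by
      rw [← TOp_diag i (thetaY (hpoly k (p + 1) - hpoly k p * MvPolynomial.X i) (lregOp m i g)) x, ← e1]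
      rfl
    exact (sub_eq_zero.1 e4).symm
  have hd := diag_mem hx
  refine (sum_pd_pd_diag (Hol.analytic (thetaY (hpoly k p) g)) hx).trans ?_
  rw [← lapOp_apply _ hd, h1, lapOp_gHol hΨ heq, map_add, map_smul, map_sum, h2,
    Finset.sum_congr rfl fun i _ => h3 i, pd_last_acoef hΨ (p + 1) hx]
  have h5 : (potOp (2 * m * (m + 1)) N (thetaY (hpoly k p) g) +
      (2 : ℂ) • ∑ i, -thetaY (hpoly k p * MvPolynomial.X i) (TOp i (lregOp m i g))).1 (diag x) =
      (2 * m * (m + 1) * pot x + N) * (thetaY (hpoly k p) g).1 (diag x) +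
      (2 : ℂ) * ∑ i, (-thetaY (hpoly k p * MvPolynomial.X i) (TOp i (lregOp m i g))).1 (diag x) := by
    rw [← Hol_sum_apply]; rfl
  rw [h5]
  congr 2
  rw [← Finset.sum_neg_distrib]
  refine Finset.sum_congr rfl fun i _ => ?_
  rw [← h4 i]
  rfl

end Recursion

end TrigBA

end

noncomputable section

namespace TrigBA

/-! ### The rational class without parameters. -/

section RationalLimits

variable {ι : Type*} [Fintype ι] [DecidableEq ι]

/-- Rational trigonometric functions without parameters, together with their limit. -/
def RL (col : ι → ℕ) (R L : (ι → ℂ) → ℂ) : Prop :=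
  ∃ ft, RT (κ := Fin 0) col 0 (fun z _ => R z) ft (fun z _ => L z)

variable {col : ι → ℕ} {R L S M : (ι → ℂ) → ℂ}

theorem RL.add (hR : RL col R L) (hS : RL col S M) :
    RL col (fun z => R z + S z) (fun z => L z + M z) := by
  obtain ⟨_, h1⟩ := hR
  obtain ⟨_, h2⟩ := hS
  exact ⟨_, h1.add h2⟩

theorem RL.mul (hR : RL col R L) (hS : RL col S M) :
    RL col (fun z => R z * S z) (fun z => L z * M z) := by
  obtain ⟨_, h1⟩ := hR
  obtain ⟨_, h2⟩ := hS
  exact ⟨_, h1.mul h2⟩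

theorem RL.const (c : ℂ) : RL col (fun _ => c) (fun _ => c) := ⟨_, RT.const c⟩

theorem RL.const_mul (c : ℂ) (hR : RL col R L) : RL col (fun z => c * R z) (fun z => c * L z) :=
  (RL.const c).mul hR

theorem RL.congr (hR : RL col R L) (h1 : ∀ z ∈ dom col, S z = R z) (h2 : ∀ z ∈ dom col, M z = L z) :
    RL col S M := by
  obtain ⟨_, h⟩ := hR
  exact ⟨_, h.congr (fun z hz _ => h1 z hz) (fun _ _ _ => rfl) fun z hz _ => h2 z hz⟩

theorem RL.sum {α : Type*} (s : Finset α) {F G : α → (ι → ℂ) → ℂ} (h : ∀ a ∈ s, RL col (F a) (G a)) :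
    RL col (fun z => ∑ a ∈ s, F a z) (fun z => ∑ a ∈ s, G a z) := by
  classical
  induction s using Finset.induction_on with
  | empty => simpa using RL.const 0
  | insert a s ha ih =>
    simp only [Finset.sum_insert ha]
    exact (h a (Finset.mem_insert_self _ _)).add (ih fun b hb => h b (Finset.mem_insert_of_mem hb))

theorem RL.pd (i : ι) (hR : RL col R L) : RL col (pd i R) (pd i L) := by
  obtain ⟨_, h⟩ := hR
  exact ⟨_, h.pd i⟩

theorem RL.analytic (hR : RL col R L) : AnalyticOnNhd ℂ R (dom col) ∧ AnalyticOnNhd ℂ L (dom col) := by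
  obtain ⟨_, h⟩ := hR
  exact ⟨(h.analytic 0).1, (h.analytic 0).2.2⟩

theorem RL.pullback {ι' : Type*} [Fintype ι'] [DecidableEq ι'] {col' : ι' → ℕ} (ρ : ι → ι')
    (hρ : ∀ i, col' (ρ i) = col i) (hR : RL col R L) :
    RL col' (fun z => R fun i => z (ρ i)) (fun z => L fun i => z (ρ i)) := by
  obtain ⟨_, h⟩ := hR
  exact ⟨_, h.pullback ρ id hρ⟩

theorem RL.tendsto {α : Type*} {l : Filter α} {X : α → ι → ℂ} {z₀ : ι → ℂ}
    (hX : ChamberLim col l X z₀) (hR : RL col R L) : Tendsto (fun t => R (X t)) l (𝓝 (L z₀)) := by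
  obtain ⟨_, h⟩ := hR
  exact h.tendsto_limit hX 0

theorem RT.toRL {κ : Type*} {d : ℕ} {f ft fl : (ι → ℂ) → (κ → ℂ) → ℂ} (hf : RT col d f ft fl) (ν : κ → ℂ) :
    RL col (fun z => f z ν) (fun z => fl z ν) := by
  induction hf with
  | mono a p d ha hp =>
    refine ⟨_, (RT.mono (κ := Fin 0) a (MvPolynomial.C (MvPolynomial.eval ν p)) 0 ha (by simp)).congr
      (fun z _ _ => ?_) (fun _ _ _ => rfl) fun z _ _ => ?_⟩ <;> simp
  | inv i j h => exact ⟨_, RT.inv i j h⟩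
  | add _ _ h1 h2 => exact h1.add h2
  | mul _ _ h1 h2 => exact h1.mul h2
  | congr _ h _ hl ih => exact ih.congr (fun z hz => h z hz ν) fun z hz => hl z hz ν

end RationalLimits

/-! ### The slit domain and the half-line of the last coordinate. -/

section Slits

variable {n : ℕ}

/-- It suffices to avoid the countably many real hyperplanes on which `Im (x_i - x_j)` is an integer
multiple of `π`; Baire again. -/
theorem dense_Slit : Dense (Slit fun i : Fin n => (i : ℕ)) := by
  have h1 : Dense (⋂ q : {p : Fin n × Fin n // p.1 < p.2} × ℤ,
      {x : Fin n → ℂ | (x q.1.1.1).im - (x q.1.1.2).im ≠ q.2 * Real.pi}) := by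
    refine dense_iInter_of_isOpen (fun q => isOpen_ne_fun (by fun_prop) continuous_const) ?_
    rintro ⟨⟨⟨a, b⟩, hab⟩, l⟩ x
    simp only at hab
    refine mem_closure_of_tendsto (tendsto_line x (Pi.single a Complex.I)) ?_
    have him : ∀ t : ℝ, ((x + (t : ℂ) • (Pi.single a Complex.I : Fin n → ℂ)) a).im -
        ((x + (t : ℂ) • (Pi.single a Complex.I : Fin n → ℂ)) b).im = (x a).im - (x b).im + t := by
      intro t
      simp [hab.ne']
      ring
    have hev : ∀ᶠ t : ℝ in 𝓝[≠] 0, (x a).im - (x b).im + t ≠ l * Real.pi := by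
      by_cases h0 : (x a).im - (x b).im = l * Real.pi
      · filter_upwards [self_mem_nhdsWithin] with t ht
        rw [h0]
        simpa using ht
      · have : Tendsto (fun t : ℝ => (x a).im - (x b).im + t) (𝓝[≠] 0) (𝓝 ((x a).im - (x b).im + 0)) :=
          ((continuous_const.add continuous_id).tendsto 0).mono_left nhdsWithin_le_nhds
        rw [add_zero] at this
        exact this.eventually_ne h0
    filter_upwards [hev] with t ht
    change ((x + (t : ℂ) • (Pi.single a Complex.I : Fin n → ℂ)) a).im -
        ((x + (t : ℂ) • (Pi.single a Complex.I : Fin n → ℂ)) b).im ≠ _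
    rw [him]
    exact ht
  refine h1.mono fun x hx i j hij r hr he => ?_
  rw [← Real.exp_log hr, Complex.ofReal_exp, Complex.exp_eq_exp_iff_exists_int] at he
  obtain ⟨l, hl⟩ := he
  have h2 := congrArg Complex.im hl
  refine Set.mem_iInter.1 hx (⟨(i, j), Fin.lt_def.2 hij⟩, -l) ?_
  simp at h2
  simp
  linarith

theorem Slit_subset : Slit (fun i : Fin n => (i : ℕ)) ⊆ dom fun i : Fin n => (i : ℕ) := fun x hx i j hij h =>
  hx i j hij 1 one_pos (by simpa using h)

variable {k : ℕ}

/-- The half-line on which the last coordinate tends to `-∞`. -/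
def lastLine (x : Fin (k + 1) → ℂ) (s : ℝ) : Fin (k + 1) → ℂ :=
  fun i => x i - ((if i = Fin.last k then s else 0 : ℝ) : ℂ)

theorem lastLine_mem {x : Fin (k + 1) → ℂ} (hx : x ∈ Slit fun i : Fin (k + 1) => (i : ℕ)) (s : ℝ) :
    lastLine x s ∈ dom fun i : Fin (k + 1) => (i : ℕ) := Slit.shift_mem hx _

theorem lastLine_castSucc (x : Fin (k + 1) → ℂ) (s : ℝ) (i : Fin k) : lastLine x s i.castSucc = x i.castSucc := by
  simp [lastLine, (Fin.castSucc_lt_last i).ne]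

theorem lastLine_zero (x : Fin (k + 1) → ℂ) : lastLine x 0 = x := by
  ext i; simp [lastLine]

theorem lastLine_const {F : (Fin (k + 1) → ℂ) → ℂ}
    (hF : AnalyticOnNhd ℂ F (dom fun i : Fin (k + 1) => (i : ℕ)))
    (h0 : ∀ x ∈ dom (fun i : Fin (k + 1) => (i : ℕ)), pd (Fin.last k) F x = 0) {x : Fin (k + 1) → ℂ}
    (hx : x ∈ Slit fun i : Fin (k + 1) => (i : ℕ)) (s : ℝ) : F (lastLine x s) = F x := by
  have hd : ∀ s : ℝ, HasDerivAt (fun s : ℝ => F (lastLine x s)) 0 s := by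
    intro s
    have h1 := (hF _ (lastLine_mem hx s)).differentiableAt
    have h2 : HasDerivAt (fun s : ℝ => lastLine x s) (fun i => -((if i = Fin.last k then 1 else 0 : ℝ) : ℂ)) s := by
      refine hasDerivAt_pi.2 fun i => ?_
      by_cases hi : i = Fin.last k
      · simp only [lastLine, hi, if_true]
        exact (HasDerivAt.ofReal_comp (hasDerivAt_id s)).const_sub _
      · simp only [lastLine, hi, if_false]
        simpa using hasDerivAt_const s (x i)
    have h3 := (h1.hasFDerivAt.restrictScalars ℝ).comp_hasDerivAt s h2
    refine h3.congr_deriv ?_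
    have h4 := h0 _ (lastLine_mem hx s)
    rw [pd_eq_fderiv h1] at h4
    have h5 : (fun i => -((if i = Fin.last k then 1 else 0 : ℝ) : ℂ)) =
        -(Pi.single (Fin.last k) 1 : Fin (k + 1) → ℂ) := by
      ext i
      by_cases hi : i = Fin.last k <;> simp [hi]
    rw [h5, map_neg]
    simpa using h4
  have := is_const_of_deriv_eq_zero (fun s => (hd s).differentiableAt) (fun s => (hd s).deriv) s 0
  rwa [lastLine_zero] at this

theorem tendsto_exp_lastLine (x : Fin (k + 1) → ℂ) (i : Fin k) :
    Tendsto (fun s => Complex.exp (-2 * (lastLine x s i.castSucc - lastLine x s (Fin.last k)))) atTop (𝓝 0) := by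
  have h1 : ∀ s, Complex.exp (-2 * (lastLine x s i.castSucc - lastLine x s (Fin.last k))) =
      Complex.exp (-2 * (x i.castSucc - x (Fin.last k))) * (Real.exp (-(2 * s)) : ℂ) := by
    intro s
    rw [lastLine_castSucc, Complex.ofReal_exp, ← Complex.exp_add]
    congr 1
    simp [lastLine]
    ring
  simp only [h1]
  have h2 : Tendsto (fun s : ℝ => Real.exp (-(2 * s))) atTop (𝓝 0) :=
    Real.tendsto_exp_neg_atTop_nhds_zero.comp (tendsto_id.const_mul_atTop two_pos)
  have h3 := (Complex.continuous_ofReal.tendsto 0).comp h2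
  simpa using h3.const_mul (Complex.exp (-2 * (x i.castSucc - x (Fin.last k))))

/-- As the last coordinate tends to `-∞`, monomials of the cone are constant or decay, and wall
factors involving it tend to `1`. So the function converges and its derivative in that coordinate
tends to `0`. -/
theorem RL.tendsto_lastLine {R L : (Fin (k + 1) → ℂ) → ℂ} (hR : RL (fun i : Fin (k + 1) => (i : ℕ)) R L)
    {x : Fin (k + 1) → ℂ} (hx : x ∈ Slit fun i : Fin (k + 1) => (i : ℕ)) :
    (∃ c, Tendsto (fun s => R (lastLine x s)) atTop (𝓝 c)) ∧
      Tendsto (fun s => TrigBA.pd (Fin.last k) R (lastLine x s)) atTop (𝓝 0) := by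
  have key : ∀ {d : ℕ} {f ft fl : (Fin (k + 1) → ℂ) → (Fin 0 → ℂ) → ℂ},
      RT (fun i : Fin (k + 1) => (i : ℕ)) d f ft fl → ∀ ν,
      (∃ c, Tendsto (fun s => f (lastLine x s) ν) atTop (𝓝 c)) ∧
      Tendsto (fun s => TrigBA.pd (Fin.last k) (fun z => f z ν) (lastLine x s)) atTop (𝓝 0) := by
    intro d f ft fl hf ν
    induction hf with
    | mono a p d ha hp =>
      have h1 : ∀ s, exz a (lastLine x s) = exz a x * (Real.exp (-((a (Fin.last k) : ℝ) * s)) : ℂ) := by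
        intro s
        unfold exz ex
        rw [Complex.ofReal_exp, ← Complex.exp_add]
        congr 1
        have h0 : ∑ i, (a i : ℂ) * ((if i = Fin.last k then s else 0 : ℝ) : ℂ) = a (Fin.last k) * s := by
          rw [Finset.sum_eq_single (Fin.last k) (fun i _ hi => by simp [hi]) (by simp)]
          simp
        simp only [lastLine, mul_sub, Finset.sum_sub_distrib, h0]
        push_cast
        ring
      -- The other entries add up to a partial sum, which is at most `0`, and the total is `0`.
      have h2 : 0 ≤ a (Fin.last k) := by
        have e := ha.2
        rw [Fin.sum_univ_castSucc] at e
        rcases Nat.eq_zero_or_pos k with h0 | h0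
        · subst h0
          simp at e
          exact e.ge
        · have e2 := ha.1 (k - 1)
          rw [psum, Fin.sum_univ_castSucc, Finset.sum_congr rfl fun i _ => if_pos (by
            have := i.2
            simp
            omega), if_neg (by simp; omega), add_zero] at e2
          omega
      have h3 : ∀ s, TrigBA.pd (Fin.last k) (fun z => MvPolynomial.eval ν p * exz a z) (lastLine x s) =
          MvPolynomial.eval ν p * (a (Fin.last k) * exz a (lastLine x s)) := fun s => by
        rw [pd_const_mul, pd_exz]
      simp only [h3]
      rcases h2.eq_or_lt with h0 | h0
      · refine ⟨⟨MvPolynomial.eval ν p * exz a x, ?_⟩, ?_⟩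
        · simp [h1, ← h0]
        · simp [← h0]
      · have h4 : Tendsto (fun s => exz a (lastLine x s)) atTop (𝓝 0) := by
          simp only [h1]
          have hpos : (0 : ℝ) < a (Fin.last k) := by exact_mod_cast h0
          have h2 : Tendsto (fun s : ℝ => Real.exp (-((a (Fin.last k) : ℝ) * s))) atTop (𝓝 0) :=
            Real.tendsto_exp_neg_atTop_nhds_zero.comp (tendsto_id.const_mul_atTop hpos)
          have h3 := (Complex.continuous_ofReal.tendsto 0).comp h2
          simpa using h3.const_mul (exz a x)
        exact ⟨⟨_, h4.const_mul _⟩, by simpa using (h4.const_mul (a (Fin.last k) : ℂ)).const_mul (MvPolynomial.eval ν p)⟩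
    | inv i j h =>
      have hij : i < j := Fin.lt_def.2 h
      obtain ⟨i, rfl⟩ : ∃ i', i = Fin.castSucc i' :=
        ⟨i.castPred (hij.trans_le (Fin.le_last j)).ne, by simp⟩
      have hdv : ∀ z ∈ dom (fun i : Fin (k + 1) => (i : ℕ)), TrigBA.pd (Fin.last k)
          (fun z => (1 - Complex.exp (-2 * (z i.castSucc - z j)))⁻¹) z =
          -(-(-2 * (0 - (if Fin.last k = j then 1 else 0)) * Complex.exp (-2 * (z i.castSucc - z j)))) /
            (1 - Complex.exp (-2 * (z i.castSucc - z j))) ^ 2 := by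
        intro z hz
        have hd : DifferentiableAt ℂ (fun z : Fin (k + 1) → ℂ => 1 - Complex.exp (-2 * (z i.castSucc - z j))) z := by
          fun_prop
        rw [pd_inv hd (one_sub_ne hz h), pd_sub (by fun_prop) (by fun_prop), pd_const, pd_exp_diff,
          if_neg (Fin.castSucc_lt_last i).ne']
        ring
      by_cases hj : Fin.last k = j
      · subst hj
        have h1 := tendsto_exp_lastLine x i
        have h2 : Tendsto (fun s => 1 - Complex.exp (-2 * (lastLine x s i.castSucc - lastLine x s (Fin.last k))))
            atTop (𝓝 (1 - 0)) := tendsto_const_nhds.sub h1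
        rw [sub_zero] at h2
        refine ⟨⟨_, h2.inv₀ one_ne_zero⟩, ?_⟩
        have h3 := ((h1.const_mul (2 : ℂ)).div (h2.pow 2) (by simp))
        simp only [mul_zero, zero_div] at h3
        refine (h3.congr fun s => ?_)
        rw [hdv _ (lastLine_mem hx s)]
        simp
      · obtain ⟨j, rfl⟩ : ∃ j', j = Fin.castSucc j' := ⟨j.castPred (Ne.symm hj), by simp⟩
        refine ⟨⟨(1 - Complex.exp (-2 * (x i.castSucc - x j.castSucc)))⁻¹, ?_⟩, ?_⟩
        · simp [lastLine_castSucc]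
        · refine tendsto_const_nhds.congr fun s => ?_
          rw [hdv _ (lastLine_mem hx s), if_neg hj]
          simp
    | add hf hg h1 h2 =>
      obtain ⟨⟨c1, h1⟩, h3⟩ := h1
      obtain ⟨⟨c2, h2⟩, h4⟩ := h2
      refine ⟨⟨_, h1.add h2⟩, ?_⟩
      have h5 := h3.add h4
      rw [add_zero] at h5
      refine h5.congr fun s => (pd_add ?_ ?_).symm
      · exact ((hf.analytic ν).1 _ (lastLine_mem hx s)).differentiableAt
      · exact ((hg.analytic ν).1 _ (lastLine_mem hx s)).differentiableAt
    | mul hf hg h1 h2 =>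
      obtain ⟨⟨c1, h1⟩, h3⟩ := h1
      obtain ⟨⟨c2, h2⟩, h4⟩ := h2
      refine ⟨⟨_, h1.mul h2⟩, ?_⟩
      have h5 := (h3.mul h2).add (h1.mul h4)
      simp only [zero_mul, mul_zero, add_zero] at h5
      refine h5.congr fun s => (pd_mul ?_ ?_).symm
      · exact ((hf.analytic ν).1 _ (lastLine_mem hx s)).differentiableAt
      · exact ((hg.analytic ν).1 _ (lastLine_mem hx s)).differentiableAt
    | congr hf h _ _ ih =>
      obtain ⟨⟨c, h1⟩, h2⟩ := ih
      exact ⟨⟨c, h1.congr fun s => (h _ (lastLine_mem hx s) ν).symm⟩,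
        h2.congr fun s => (pd_congr_on isOpen_domVal _ (fun z hz => h z hz ν) (lastLine_mem hx s)).symm⟩
  obtain ⟨_, h⟩ := hR
  exact key h 0

theorem sum_Ioi_castSucc (F : Fin (k + 1) → Fin (k + 1) → ℂ) :
    ∑ i, ∑ j ∈ Finset.Ioi i, F i j =
      (∑ i : Fin k, ∑ j ∈ Finset.Ioi i, F i.castSucc j.castSucc) + ∑ i : Fin k, F i.castSucc (Fin.last k) :=
  prod_Ioi_castSucc (M := Multiplicative ℂ) F

theorem tendsto_pot_lastLine {x : Fin (k + 1) → ℂ} (hx : x ∈ Slit fun i : Fin (k + 1) => (i : ℕ)) :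
    Tendsto (fun s => pot (lastLine x s) - pot fun i : Fin k => x i.castSucc) atTop (𝓝 0) := by
  have h1 : ∀ s, pot (lastLine x s) - (pot fun i : Fin k => x i.castSucc) =
      ∑ i : Fin k, 4 * (1 - Df (i.castSucc, Fin.last k) (lastLine x s)) /
        Df (i.castSucc, Fin.last k) (lastLine x s) ^ 2 := by
    intro s
    have hs := lastLine_mem hx s
    rw [pot, sum_Ioi_castSucc, pot]
    simp only [lastLine_castSucc]
    rw [add_sub_cancel_left]
    refine Finset.sum_congr rfl fun i _ => ?_
    have hlt := Fin.castSucc_lt_last i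
    have h0 := mem_domVal.1 hs (i.castSucc, Fin.last k) (mem_prs.2 hlt)
    have h1 := mem_dom_ne Fin.val_injective hs hlt.ne
    rw [← lastLine_castSucc x s i, ← cth_sq_sub_one h1, cth_eq h1]
    change (2 * (Df (i.castSucc, Fin.last k) (lastLine x s))⁻¹ - 1) ^ 2 - 1 = _
    field_simp
    ring
  simp only [h1]
  have h2 : Tendsto (fun s => ∑ i : Fin k, 4 * (1 - Df (i.castSucc, Fin.last k) (lastLine x s)) /
        Df (i.castSucc, Fin.last k) (lastLine x s) ^ 2) atTop (𝓝 (∑ i : Fin k, 4 * (1 - (1 - 0)) / (1 - 0) ^ 2)) := by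
    refine tendsto_finsetSum _ fun i _ => ?_
    have h3 : Tendsto (fun s => Df (i.castSucc, Fin.last k) (lastLine x s)) atTop (𝓝 (1 - 0)) :=
      tendsto_const_nhds.sub (tendsto_exp_lastLine x i)
    exact ((tendsto_const_nhds.sub h3).const_mul 4).div (h3.pow 2) (by simp)
  simpa using h2

end Slits

/-! ### A solution of the recursion with zero limits vanishes. -/

section Vanishing

variable {k : ℕ}

theorem pd_zero_on {n : ℕ} {F : (Fin n → ℂ) → ℂ} (hF : ∀ x ∈ dom (fun i : Fin n => (i : ℕ)), F x = 0)
    (i : Fin n) : ∀ x ∈ dom (fun i : Fin n => (i : ℕ)), pd i F x = 0 := fun x hx =>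
  (pd_congr_on isOpen_domVal i (g := fun _ => 0) hF hx).trans (pd_const 0)

theorem pd_last_pd {n : ℕ} {l : Fin n} {F : (Fin n → ℂ) → ℂ}
    (hF : AnalyticOnNhd ℂ F (dom fun i : Fin n => (i : ℕ)))
    (h0 : ∀ x ∈ dom (fun i : Fin n => (i : ℕ)), pd l F x = 0) (i : Fin n) :
    ∀ x ∈ dom (fun i : Fin n => (i : ℕ)), pd l (pd i F) x = 0 := fun x hx =>
  (pd_pd_comm (hF x hx)).trans (pd_zero_on h0 i x hx)

/-- Once the earlier terms vanish, `R p` does not depend on the last coordinate. Sending that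
coordinate to `-∞` removes both its interactions and the term with `R (p + 1)`. What is left is the
equation in the first `k` coordinates, where `ν` is generic, so `ray_vanish` applies. -/
theorem rec_vanish (m : ℕ) {ν : Fin k → ℂ} (hν : ν ∈ Gen k m) {R : ℕ → (Fin (k + 1) → ℂ) → ℂ}
    (hR : ∀ p, RL (fun i : Fin (k + 1) => (i : ℕ)) (R p) fun _ => 0)
    (h0 : ∀ x ∈ dom (fun i : Fin (k + 1) => (i : ℕ)), pd (Fin.last k) (R 0) x = 0)
    (hrec : ∀ p, ∀ x ∈ dom (fun i : Fin (k + 1) => (i : ℕ)),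
      ∑ i : Fin k, 4 * ν i * pd i.castSucc (R p) x + ∑ i, pd i (pd i (R p)) x =
        2 * m * (m + 1) * pot x * R p x + 2 * pd (Fin.last k) (R (p + 1)) x) :
    ∀ p, ∀ x ∈ dom (fun i : Fin (k + 1) => (i : ℕ)), R p x = 0 := by
  intro p
  induction p using Nat.strong_induction_on with
  | _ p ih =>
  have hlast : ∀ x ∈ dom (fun i : Fin (k + 1) => (i : ℕ)), pd (Fin.last k) (R p) x = 0 := by
    rcases p with _ | q
    · exact h0
    · intro x hx
      have z0 := ih q (Nat.lt_succ_self q)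
      have h1 := hrec q x hx
      rw [z0 x hx, Finset.sum_congr rfl fun i _ => by rw [pd_zero_on z0 _ x hx],
        Finset.sum_congr rfl fun i _ => pd_zero_on (pd_zero_on z0 i) i x hx] at h1
      simpa using h1.symm
  have hA : AnalyticOnNhd ℂ (R p) (dom fun i : Fin (k + 1) => (i : ℕ)) := (hR p).analytic.1
  have hA1 : ∀ i, AnalyticOnNhd ℂ (pd i (R p)) (dom fun i : Fin (k + 1) => (i : ℕ)) := fun i x hx =>
    analyticAt_pd (hA x hx)
  have hA2 : ∀ i, AnalyticOnNhd ℂ (pd i (pd i (R p))) (dom fun i : Fin (k + 1) => (i : ℕ)) := fun i x hx =>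
    analyticAt_pd (hA1 i x hx)
  -- The limiting equation, in which the potential retains only the first `k` coordinates. It is
  -- constant along the half-line and tends to `0` there; the slit domain keeps the half-line off
  -- the walls.
  set Q : (Fin (k + 1) → ℂ) → ℂ := fun x => ∑ i : Fin k, 4 * ν i * pd i.castSucc (R p) x +
    ∑ i, pd i (pd i (R p)) x - 2 * m * (m + 1) * (pot fun i : Fin k => x i.castSucc) * R p x with hQ
  have hmem : ∀ x ∈ dom (fun i : Fin (k + 1) => (i : ℕ)),
      (fun i : Fin k => x i.castSucc) ∈ dom fun i : Fin k => (i : ℕ) := fun x hx i j hij => hx _ _ hij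
  have hQslit : ∀ x ∈ Slit (fun i : Fin (k + 1) => (i : ℕ)), Q x = 0 := by
    intro x hx
    have hconst : ∀ s, Q (lastLine x s) = Q x := by
      intro s
      simp only [hQ]
      rw [lastLine_const hA hlast hx, Finset.sum_congr rfl fun i _ => by
          rw [lastLine_const (hA1 _) (pd_last_pd hA hlast _) hx],
        Finset.sum_congr rfl fun i _ => lastLine_const (hA2 i) (pd_last_pd (hA1 i) (pd_last_pd hA hlast i) i) hx s]
      simp only [lastLine_castSucc]
    have hval : ∀ s, Q (lastLine x s) = 2 * m * (m + 1) * (pot (lastLine x s) - pot fun i : Fin k => x i.castSucc) *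
        R p x + 2 * pd (Fin.last k) (R (p + 1)) (lastLine x s) := by
      intro s
      simp only [hQ]
      rw [hrec p _ (lastLine_mem hx s), lastLine_const hA hlast hx]
      simp only [lastLine_castSucc]
      ring
    have hlim : Tendsto (fun s => Q (lastLine x s)) atTop (𝓝 (2 * m * (m + 1) * 0 * R p x + 2 * 0)) := by
      simp only [hval]
      exact (((tendsto_pot_lastLine hx).const_mul _).mul_const _).add
        (((hR (p + 1)).tendsto_lastLine hx).2.const_mul 2)
    simp only [hconst, mul_zero, zero_mul, add_zero] at hlim
    exact tendsto_nhds_unique tendsto_const_nhds hlim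
  have hQ0 : ∀ x ∈ dom (fun i : Fin (k + 1) => (i : ℕ)), Q x = 0 := by
    intro x hx
    have hpot : ContinuousAt (fun x : Fin (k + 1) → ℂ => pot fun i : Fin k => x i.castSucc) x :=
      ContinuousAt.comp (f := fun (x : Fin (k + 1) → ℂ) (i : Fin k) => x i.castSucc)
        (analyticAt_pot (hmem x hx)).continuousAt (continuous_pi fun i => continuous_apply _).continuousAt
    have hc : ContinuousAt Q x := by
      refine ContinuousAt.sub (ContinuousAt.add ?_ ?_) ((continuousAt_const.mul hpot).mul (hA x hx).continuousAt)
      · exact tendsto_finsetSum _ fun i _ => continuousAt_const.mul (hA1 _ x hx).continuousAt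
      · exact tendsto_finsetSum _ fun i _ => (hA2 i x hx).continuousAt
    obtain ⟨f, hf, hlim⟩ := mem_closure_iff_seq_limit.1 (dense_Slit x)
    refine tendsto_nhds_unique (hc.tendsto.comp hlim) (tendsto_const_nhds.congr fun j => ?_)
    exact (hQslit _ (hf j)).symm
  obtain ⟨ft, hrt⟩ := hR p
  obtain ⟨N, T, hT, hNT⟩ := hrt.exists_expSum
  obtain ⟨z₀, hz₀⟩ := exists_mem_domVal (n := k + 1)
  -- The last parameter `0` is not generic, but `R p` is constant in the last direction, which
  -- forces that entry of the exponent to vanish.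
  refine ray_vanish (Fin.snoc ν 0) hT (ν₀ := 0) (fun x hx => hNT x hx 0)
    (W := fun x => 2 * m * (m + 1) * pot fun i : Fin k => x i.castSucc) (fun ξ hξ => ?_)
    (fun x hx => ?_) (fun b hb hs => ?_) fun ξ hξ => ?_
  · have hξ' : StrictAnti fun i : Fin k => ξ i.castSucc := fun i j hij => hξ (Fin.castSucc_lt_castSucc_iff.2 hij)
    have h1 := (tendsto_pot_ray hξ').const_mul (2 * (m : ℂ) * (m + 1))
    rw [mul_zero] at h1
    exact h1
  · have h1 := hQ0 x hx
    simp only [hQ] at h1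
    rw [Finset.sum_add_distrib, Fin.sum_univ_castSucc]
    simp only [Fin.snoc_castSucc, Fin.snoc_last, mul_zero, zero_mul, add_zero]
    linear_combination h1
  · have hbl : b (Fin.last k) = 0 := hb _ hlast
    rw [Fin.sum_univ_castSucc] at hs
    simp only [Fin.snoc_castSucc, Fin.snoc_last, hbl, Int.cast_zero] at hs
    have h2 := hν.1 (fun i => b i.castSucc) (by simpa using hs)
    ext i
    induction i using Fin.lastCases with
    | last => exact hbl
    | cast i => exact congrFun h2 i
  · exact (hR p).tendsto (chamberLim_ray hξ hz₀)

end Vanishing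

end TrigBA

end

noncomputable section

namespace TrigBA

/-! ### Linear structure of the recursion. -/

section Recursions

variable {k : ℕ}

/-- The differential operator `∑ 4 ν_i ∂_i + Δ`. -/
def Lop (ν : Fin k → ℂ) (f : (Fin (k + 1) → ℂ) → ℂ) (x : Fin (k + 1) → ℂ) : ℂ :=
  ∑ i : Fin k, 4 * ν i * pd i.castSucc f x + ∑ i, pd i (pd i f) x

theorem pd_sum_mul_const {α : Type*} (s : Finset α) {F : α → (Fin (k + 1) → ℂ) → ℂ} (c : α → ℂ)
    (hF : ∀ a ∈ s, AnalyticOnNhd ℂ (F a) (dom fun i : Fin (k + 1) => (i : ℕ))) (i : Fin (k + 1)) :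
    ∀ x ∈ dom (fun i : Fin (k + 1) => (i : ℕ)),
      pd i (fun x => ∑ a ∈ s, F a x * c a) x = ∑ a ∈ s, pd i (F a) x * c a := fun x hx => by
  rw [pd_sum s fun a ha => ((hF a ha x hx).differentiableAt.mul_const (c a))]
  refine Finset.sum_congr rfl fun a _ => ?_
  simp only [mul_comm _ (c a)]
  exact pd_const_mul (c a)

theorem Lop_sum_mul_const {α : Type*} (s : Finset α) {F : α → (Fin (k + 1) → ℂ) → ℂ} (c : α → ℂ)
    (hF : ∀ a ∈ s, AnalyticOnNhd ℂ (F a) (dom fun i : Fin (k + 1) => (i : ℕ))) (ν : Fin k → ℂ)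
    {x : Fin (k + 1) → ℂ} (hx : x ∈ dom fun i : Fin (k + 1) => (i : ℕ)) :
    Lop ν (fun x => ∑ a ∈ s, F a x * c a) x = ∑ a ∈ s, Lop ν (F a) x * c a := by
  have h2 : ∀ i, pd i (pd i fun x => ∑ a ∈ s, F a x * c a) x = ∑ a ∈ s, pd i (pd i (F a)) x * c a := by
    intro i
    rw [pd_congr_on isOpen_domVal i (pd_sum_mul_const s c hF i) hx,
      pd_sum_mul_const s c (fun a ha x hx => analyticAt_pd (hF a ha x hx)) i x hx]
  simp only [Lop, h2, pd_sum_mul_const s c hF _ x hx, add_mul, Finset.sum_add_distrib, Finset.sum_mul,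
    Finset.mul_sum]
  congr 1
  · rw [Finset.sum_comm]
    exact Finset.sum_congr rfl fun _ _ => Finset.sum_congr rfl fun _ _ => by ring
  · exact Finset.sum_comm

/-- Sequences of rational functions obeying the recursion satisfied by the coefficients of the
expansion in the last spectral parameter; `l` are their limits. -/
structure RecSol (m : ℕ) (ν : Fin k → ℂ) (R : ℕ → (Fin (k + 1) → ℂ) → ℂ) (l : ℕ → ℂ) : Prop where
  rl : ∀ p, RL (fun i : Fin (k + 1) => (i : ℕ)) (R p) fun _ => l p
  zero : ∀ x ∈ dom (fun i : Fin (k + 1) => (i : ℕ)), pd (Fin.last k) (R 0) x = 0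
  step : ∀ p, ∀ x ∈ dom (fun i : Fin (k + 1) => (i : ℕ)),
    Lop ν (R p) x = 2 * m * (m + 1) * pot x * R p x + 2 * pd (Fin.last k) (R (p + 1)) x

variable {m : ℕ} {ν : Fin k → ℂ} {R S : ℕ → (Fin (k + 1) → ℂ) → ℂ} {l l' : ℕ → ℂ}

/-- Multiplication of a formal solution by a power series with constant coefficients. In the shifted
sum the extra term is the derivative of `R 0` in the last variable, which is zero. -/
theorem RecSol.conv (hR : RecSol m ν R l) (c : ℕ → ℂ) :
    RecSol m ν (fun p x => ∑ q ∈ Finset.HasAntidiagonal.antidiagonal p, R q.1 x * c q.2)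
      (fun p => ∑ q ∈ Finset.HasAntidiagonal.antidiagonal p, l q.1 * c q.2) where
  rl p := RL.sum _ fun q _ => (hR.rl q.1).mul (RL.const (c q.2))
  zero x hx := by
    rw [pd_sum_mul_const (Finset.HasAntidiagonal.antidiagonal 0) (fun q => c q.2) (fun q _ => (hR.rl q.1).analytic.1) _ x hx]
    simp [hR.zero x hx]
  step p x hx := by
    rw [Lop_sum_mul_const (Finset.HasAntidiagonal.antidiagonal p) (fun q => c q.2) (fun q _ => (hR.rl q.1).analytic.1) ν hx,
      pd_sum_mul_const (Finset.HasAntidiagonal.antidiagonal (p + 1)) (fun q => c q.2) (fun q _ => (hR.rl q.1).analytic.1) _ x hx,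
      Finset.Nat.sum_antidiagonal_succ, hR.zero x hx, zero_mul, zero_add, Finset.mul_sum, Finset.mul_sum,
      ← Finset.sum_add_distrib]
    refine Finset.sum_congr rfl fun q _ => ?_
    rw [hR.step q.1 x hx]
    ring

theorem RecSol.eq (hν : ν ∈ Gen k m) (hR : RecSol m ν R l) (hS : RecSol m ν S l) (p : ℕ)
    {x : Fin (k + 1) → ℂ} (hx : x ∈ dom fun i : Fin (k + 1) => (i : ℕ)) : R p x = S p x := by
  -- The difference as a two-term sum with weights `1` and `-1`, so that the linearity lemmas for
  -- finite sums apply.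
  have h1 : ∀ p, (fun x => R p x - S p x) =
      fun x => ∑ b : Bool, (if b then R p else S p) x * (if b then 1 else -1) := by
    intro p; ext x; simp; ring
  have ha : ∀ p, ∀ b ∈ (Finset.univ : Finset Bool), AnalyticOnNhd ℂ (if b then R p else S p)
      (dom fun i : Fin (k + 1) => (i : ℕ)) := by
    rintro p (_ | _) _
    · exact (hS.rl p).analytic.1
    · exact (hR.rl p).analytic.1
  refine sub_eq_zero.1 (rec_vanish m hν (R := fun p x => R p x - S p x) (fun p => ?_) (fun x hx => ?_)
    (fun p x hx => ?_) p x hx)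
  · refine ((hR.rl p).add ((hS.rl p).const_mul (-1))).congr (fun z _ => ?_) fun z _ => ?_ <;> ring
  · rw [h1, pd_sum_mul_const _ _ (ha 0) _ x hx]
    simp [hR.zero x hx, hS.zero x hx]
  · change Lop ν _ x = _
    rw [h1 p, h1 (p + 1), Lop_sum_mul_const _ _ (ha p) ν hx, pd_sum_mul_const _ _ (ha (p + 1)) _ x hx]
    simp [hR.step p x hx, hS.step p x hx]
    ring

/-- One and the same ray serves every base point, since all colours are distinct. -/
theorem RL.limit_const {R L : (Fin (k + 1) → ℂ) → ℂ} (hR : RL (fun i : Fin (k + 1) => (i : ℕ)) R L)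
    {x z : Fin (k + 1) → ℂ} (hx : x ∈ dom fun i : Fin (k + 1) => (i : ℕ))
    (hz : z ∈ dom fun i : Fin (k + 1) => (i : ℕ)) : L x = L z := by
  have hξ : StrictAnti fun i : Fin (k + 1) => -((i : ℕ) : ℝ) := fun i j h => by
    simpa using h
  exact tendsto_nhds_unique (hR.tendsto (chamberLim_ray hξ hx)) (hR.tendsto (chamberLim_ray hξ hz))

theorem ex_snoc_zero (ν : Fin k → ℂ) (x : Fin (k + 1) → ℂ) :
    ex (fun i => 2 * (Fin.snoc ν 0 : Fin (k + 1) → ℂ) i) x = ex (fun i => 2 * ν i) fun i => x i.castSucc := by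
  unfold ex
  rw [Fin.sum_univ_castSucc]
  simp

theorem lap_ex_mul (ν : Fin k → ℂ) {R : (Fin (k + 1) → ℂ) → ℂ} {x : Fin (k + 1) → ℂ}
    (hR : AnalyticAt ℂ R x) :
    ∑ i, pd i (pd i fun x => ex (fun i => 2 * (Fin.snoc ν 0 : Fin (k + 1) → ℂ) i) x * R x) x =
      ex (fun i => 2 * (Fin.snoc ν 0 : Fin (k + 1) → ℂ) i) x *
        (4 * (∑ i, ν i ^ 2) * R x + Lop ν R x) := by
  simp only [pd_pd_ex_mul hR]
  rw [← Finset.mul_sum, Finset.sum_add_distrib, Finset.sum_add_distrib, Fin.sum_univ_castSucc,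
    Fin.sum_univ_castSucc (f := fun i => 4 * (Fin.snoc ν 0 : Fin (k + 1) → ℂ) i * pd i R x), Lop]
  simp only [Fin.snoc_castSucc, Fin.snoc_last, Finset.mul_sum, Finset.sum_mul]
  ring

theorem pd_last_ex_mul (ν : Fin k → ℂ) {R : (Fin (k + 1) → ℂ) → ℂ} {x : Fin (k + 1) → ℂ}
    (hR : AnalyticAt ℂ R x) :
    pd (Fin.last k) (fun x => ex (fun i => 2 * (Fin.snoc ν 0 : Fin (k + 1) → ℂ) i) x * R x) x =
      ex (fun i => 2 * (Fin.snoc ν 0 : Fin (k + 1) → ℂ) i) x * pd (Fin.last k) R x := by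
  rw [pd_mul (analyticAt_ex _ _).differentiableAt hR.differentiableAt, pd_ex]
  simp

end Recursions

/-! ### The coefficients of the integral as a solution of the recursion. -/

section IntegrandCoefficients

variable {k m : ℕ}

theorem RL_Tf (i : Fin k) : RL (icol (k := k)) (Tf i) (Tf i) := by
  have h := RT.expo (κ := Fin 0) (col := icol (k := k)) (rootExp (.inl i.castSucc) (.inr i))
    (fun j => by rw [psum_rootExp]; simp only [icol, Sum.elim_inl, Sum.elim_inr, Fin.val_castSucc]; by_cases hj : (i : ℕ) ≤ j <;> simp [hj])
    (by unfold rootExp; rw [← Finset.mul_sum, Finset.sum_sub_distrib]; simp)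
  have h2 : RL (icol (k := k)) (exz (rootExp (.inl i.castSucc) (.inr i))) (exz (rootExp (.inl i.castSucc) (.inr i))) :=
    ⟨_, h⟩
  refine ((RL.const 1).add (h2.const_mul (-1))).congr (fun z _ => ?_) fun z _ => ?_ <;>
    rw [exz_rootExp, Tf, sig] <;> ring

theorem RL_prod_Tf (m : ℕ) : RL (icol (k := k)) (fun z => ∏ i, Tf i z ^ m) (fun z => ∏ i, Tf i z ^ m) := by
  have h1 : ∀ i : Fin k, RL (icol (k := k)) (fun z => Tf i z ^ m) (fun z => Tf i z ^ m) := by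
    intro i
    induction m with
    | zero => simpa using RL.const 1
    | succ m ih => simpa only [pow_succ] using ih.mul (RL_Tf i)
  have h2 : ∀ s : Finset (Fin k), RL (icol (k := k)) (fun z => ∏ i ∈ s, Tf i z ^ m)
      (fun z => ∏ i ∈ s, Tf i z ^ m) := by
    intro s
    induction s using Finset.induction_on with
    | empty => simpa using RL.const 1
    | insert i s hi ih =>
      simp only [Finset.prod_insert hi]
      exact (h1 i).mul ih
  exact h2 _

theorem analyticOnNhd_limFun (m : ℕ) (ν : Fin k → ℂ) :
    AnalyticOnNhd ℂ (fun z : Idx k → ℂ => (∏ i, Tf i z ^ m) *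
      (normConst m ν * ex (fun i => 2 * ν i) fun i => z (.inr i))) (dom (icol (k := k))) := fun z _ =>
  (Finset.analyticAt_fun_prod _ fun i _ => (analyticAt_Tf i z).fun_pow m).mul
    (analyticAt_const.mul (analyticAt_comp_inr (analyticAt_ex _ _)))

/-- The limit of the integrand. -/
def limHol (m : ℕ) (ν : Fin k → ℂ) : HolI k := Hol.mk (isOpen_dom _) _ (analyticOnNhd_limFun m ν)

/-- An operator with constant coefficients in `∂_y` acts alike on the function and on its chamber
limit. Thus `ecoef` gives the limits of `acoef` after removal of the exponential factor. -/
theorem thetaY_RL (ν : Fin k → ℂ) {φ ψ : HolI k} {f fl : (Idx k → ℂ) → ℂ} (hf : RL (icol (k := k)) f fl)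
    (h1 : ∀ z ∈ dom (icol (k := k)), φ.1 z = ex (fun i => 2 * ν i) (fun i => z (.inr i)) * f z)
    (h2 : ∀ z ∈ dom (icol (k := k)), ψ.1 z = ex (fun i => 2 * ν i) (fun i => z (.inr i)) * fl z)
    (p : MvPolynomial (Fin k) ℂ) : ∃ f fl, RL (icol (k := k)) f fl ∧
      (∀ z ∈ dom (icol (k := k)), (thetaY p φ).1 z = ex (fun i => 2 * ν i) (fun i => z (.inr i)) * f z) ∧
      ∀ z ∈ dom (icol (k := k)), (thetaY p ψ).1 z = ex (fun i => 2 * ν i) (fun i => z (.inr i)) * fl z := by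
  have hpd : ∀ (i : Fin k) {F : (Idx k → ℂ) → ℂ} (χ : HolI k), AnalyticOnNhd ℂ F (dom (icol (k := k))) →
      (∀ z ∈ dom (icol (k := k)), χ.1 z = ex (fun i => 2 * ν i) (fun i => z (.inr i)) * F z) →
      ∀ z ∈ dom (icol (k := k)), (-P (.inr i) χ : HolI k).1 z =
        ex (fun i => 2 * ν i) (fun i => z (.inr i)) * (-(2 * ν i) * F z + -1 * pd (.inr i) F z) := by
    intro i F χ hF hχ z hz
    change -(P (.inr i) χ).1 z = _
    rw [P_apply _ _ hz, pd_congr_on (isOpen_dom _) _ hχ hz,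
      pd_mul (analyticAt_comp_inr (analyticAt_ex _ _)).differentiableAt (hF z hz).differentiableAt,
      pd_comp_inr, pd_ex]
    ring
  induction p using MvPolynomial.induction_on with
  | C a =>
    refine ⟨_, _, hf.const_mul a, fun z hz => ?_, fun z hz => ?_⟩ <;>
      rw [← MvPolynomial.algebraMap_eq, AlgHom.commutes, Module.algebraMap_end_apply]
    · change a * φ.1 z = _
      rw [h1 z hz]; ring
    · change a * ψ.1 z = _
      rw [h2 z hz]; ring
  | add p q hp hq =>
    obtain ⟨f1, l1, r1, a1, b1⟩ := hp
    obtain ⟨f2, l2, r2, a2, b2⟩ := hq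
    refine ⟨_, _, r1.add r2, fun z hz => ?_, fun z hz => ?_⟩ <;> rw [map_add]
    · change (thetaY p φ).1 z + (thetaY q φ).1 z = _
      rw [a1 z hz, a2 z hz]; ring
    · change (thetaY p ψ).1 z + (thetaY q ψ).1 z = _
      rw [b1 z hz, b2 z hz]; ring
  | mul_X p i hp =>
    obtain ⟨f1, l1, r1, a1, b1⟩ := hp
    refine ⟨_, _, (r1.const_mul (-(2 * ν i))).add ((r1.pd (.inr i)).const_mul (-1)), fun z hz => ?_,
      fun z hz => ?_⟩ <;> rw [mul_comm, map_mul, thetaY_X]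
    · exact hpd i (thetaY p φ) r1.analytic.1 a1 z hz
    · exact hpd i (thetaY p ψ) r1.analytic.2 b1 z hz

variable {h ht hl : (Fin k → ℂ) → (Fin k → ℂ) → ℂ}

/-- The coefficients of the expansion of the limit of the integral. -/
def ecoef (m p : ℕ) (ν : Fin k → ℂ) (x : Fin (k + 1) → ℂ) : ℂ :=
  (thetaY (hpoly k p) (limHol m ν)).1 (diag x)

/-- Removing `exp (2 (ν, x))`, with last parameter `0`, turns `acoef_rec` into the recursion of
`RecSol`; this factor does not affect the last derivative. -/
theorem exists_recSol_acoef (H : IsFam k m h ht hl) (ν : Fin k → ℂ) {x₀ : Fin (k + 1) → ℂ}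
    (hx₀ : x₀ ∈ dom fun i : Fin (k + 1) => (i : ℕ)) : ∃ R l, RecSol m ν R l ∧
      (∀ p, ∀ x ∈ dom (fun i : Fin (k + 1) => (i : ℕ)), acoef m p (pot_eigen_analytic H ν) x =
        ex (fun i => 2 * ν i) (fun i => x i.castSucc) * R p x) ∧
      ∀ p, ecoef m p ν x₀ = ex (fun i => 2 * ν i) (fun i => x₀ i.castSucc) * l p := by
  have hbase : RL (icol (k := k)) (fun z => (∏ i, Tf i z ^ m) * Nker m z * h (fun i => z (.inr i)) ν)
      (fun z => (∏ i, Tf i z ^ m) * 1 * normConst m ν) := by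
    have h1 : RL (icol (k := k)) (fun z => Nker m z) (fun _ => 1) := ⟨_, RT_Nker (m : ℤ)⟩
    have h2 : RL (icol (k := k)) (fun z => h (fun i => z (.inr i)) ν) (fun z => normConst m ν) :=
      (RL.pullback (col' := icol (k := k)) (ρ := Sum.inr) (fun i => rfl) (H.rt.toRL ν)).congr
        (fun _ _ => rfl) fun z hz => (H.limit _ (inr_mem_dom hz) ν).symm
    exact ((RL_prod_Tf m).mul h1).mul h2
  have key := fun p => thetaY_RL ν (φ := gHol m (pot_eigen_analytic H ν)) (ψ := limHol m ν) hbase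
    (fun z hz => by rw [gHol_apply _ hz, gfun]; ring)
    (fun z hz => by rw [limHol, Hol.mk_apply _ _ hz]; ring) (hpoly k p)
  choose f fl hf hg hgl using key
  have hrl : ∀ p, RL (fun i : Fin (k + 1) => (i : ℕ)) (fun x => f p (diag x)) (fun x => fl p (diag x)) := by
    intro p
    have h1 := RL.pullback (col' := fun i : Fin (k + 1) => (i : ℕ)) (ρ := Sum.elim id Fin.castSucc)
      (col := icol (k := k)) (fun i => by rcases i with i | i <;> simp [icol]) (hf p)
    have h2 : ∀ z : Fin (k + 1) → ℂ, (fun i => z (Sum.elim id Fin.castSucc i)) = diag z := by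
      intro z; ext (i | i) <;> rfl
    simpa only [h2] using h1
  have ha : ∀ p, ∀ x ∈ dom (fun i : Fin (k + 1) => (i : ℕ)), acoef m p (pot_eigen_analytic H ν) x =
        ex (fun i => 2 * ν i) (fun i => x i.castSucc) * f p (diag x) := fun p x hx => hg p _ (diag_mem hx)
  have ha' : ∀ p, Set.EqOn (acoef m p (pot_eigen_analytic H ν))
      (fun x => ex (fun i => 2 * (Fin.snoc ν 0 : Fin (k + 1) → ℂ) i) x * f p (diag x))
      (dom (fun i : Fin (k + 1) => (i : ℕ))) := fun p x hx => by
    rw [ha p x hx]; beta_reduce; rw [ex_snoc_zero]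
  have hpdl : ∀ p, ∀ x ∈ dom (fun i : Fin (k + 1) => (i : ℕ)),
      pd (Fin.last k) (acoef m p (pot_eigen_analytic H ν)) x =
      ex (fun i => 2 * (Fin.snoc ν 0 : Fin (k + 1) → ℂ) i) x * pd (Fin.last k) (fun x => f p (diag x)) x := by
    intro p x hx
    rw [pd_congr_on isOpen_domVal _ (ha' p) hx, pd_last_ex_mul ν ((hrl p).analytic.1 x hx)]
  refine ⟨fun p x => f p (diag x), fun p => fl p (diag x₀), ⟨fun p => ?_, fun x hx => ?_, fun p x hx => ?_⟩, ha,
    fun p => hgl p _ (diag_mem hx₀)⟩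
  · exact (hrl p).congr (fun _ _ => rfl) fun z hz => (hrl p).limit_const hx₀ hz
  · have h1 := pd_last_acoef_zero (m := m) (pot_eigen_analytic H ν) hx
    rw [hpdl 0 x hx] at h1
    exact (mul_eq_zero.1 h1).resolve_left (ex_ne_zero _ _)
  · have h1 := acoef_rec (m := m) (pot_eigen_analytic H ν) (H.eigen ν) p hx
    have h2 : ∀ i, pd i (pd i (acoef m p (pot_eigen_analytic H ν))) x = pd i (pd i
        (fun x => ex (fun i => 2 * (Fin.snoc ν 0 : Fin (k + 1) → ℂ) i) x * f p (diag x))) x := fun i =>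
      pd_congr_on isOpen_domVal i (pd_congr_on isOpen_domVal i (ha' p)) hx
    simp only [h2] at h1
    rw [lap_ex_mul ν ((hrl p).analytic.1 x hx), hpdl _ x hx, ha' p hx] at h1
    refine mul_left_cancel₀ (ex_ne_zero (fun i => 2 * (Fin.snoc ν 0 : Fin (k + 1) → ℂ) i) x) ?_
    linear_combination h1

end IntegrandCoefficients

/-! ### The coefficients of the `(k + 1)`-variable family in its last spectral parameter. -/

section SpectralCoefficients

variable {k m : ℕ} {h ht hl : (Fin (k + 1) → ℂ) → (Fin (k + 1) → ℂ) → ℂ}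

theorem RT.exists_polynomial {n d : ℕ} {f ft fl : (Fin n → ℂ) → (Fin (k + 1) → ℂ) → ℂ}
    (hf : RT (fun i : Fin n => (i : ℕ)) d f ft fl) (ν : Fin k → ℂ) {x : Fin n → ℂ}
    (hx : x ∈ dom fun i : Fin n => (i : ℕ)) : ∃ Q : Polynomial ℂ, Q.degree < (d + 1 : ℕ) ∧
      ∀ c : ℂ, f x (Fin.snoc ν (-(c / 2))) = Q.eval c := by
  obtain ⟨N, T, ⟨q, hq, hT⟩, h1⟩ := hf.exists_expSum
  have key : ∀ p : MvPolynomial (Fin (k + 1)) ℂ, p.totalDegree ≤ d → ∃ Q : Polynomial ℂ,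
      Q.degree < (d + 1 : ℕ) ∧ ∀ c : ℂ, MvPolynomial.eval (Fin.snoc ν (-(c / 2)) : Fin (k + 1) → ℂ) p = Q.eval c := by
    intro p hp
    set V : Fin (k + 1) → Polynomial ℂ := Fin.snoc (fun i => Polynomial.C (ν i))
      (Polynomial.C (-(1 / 2)) * Polynomial.X) with hV
    have hVd : ∀ i, (V i).natDegree ≤ 1 := by
      intro i
      refine Fin.lastCases ?_ (fun i => ?_) i
      · simp only [hV, Fin.snoc_last]
        exact (Polynomial.natDegree_C_mul_le _ _).trans Polynomial.natDegree_X_le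
      · simp [hV]
    refine ⟨MvPolynomial.aeval V p, ?_, fun c => ?_⟩
    · refine (Polynomial.degree_le_natDegree.trans ?_).trans_lt (WithBot.coe_lt_coe.2 (Nat.lt_succ_self d))
      refine WithBot.coe_le_coe.2 ?_
      rw [MvPolynomial.aeval_def, MvPolynomial.eval₂_eq']
      refine Polynomial.natDegree_sum_le_of_forall_le _ _ fun a ha => ?_
      refine (Polynomial.natDegree_C_mul_le _ _).trans ?_
      refine (Polynomial.natDegree_prod_le _ _).trans ?_
      refine le_trans (Finset.sum_le_sum (g := fun i => a i) fun i _ => ?_) ?_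
      · exact (Polynomial.natDegree_pow_le).trans ((Nat.mul_le_mul_left _ (hVd i)).trans (by simp))
      · have := MvPolynomial.le_totalDegree ha
        rw [Finsupp.sum_fintype _ _ (by simp)] at this
        exact this.trans hp
    · have h2 : (Polynomial.evalRingHom c).comp (MvPolynomial.aeval V : MvPolynomial (Fin (k + 1)) ℂ →ₐ[ℂ] _).toRingHom =
          MvPolynomial.eval (Fin.snoc ν (-(c / 2)) : Fin (k + 1) → ℂ) := by
        refine MvPolynomial.ringHom_ext (fun r => ?_) fun i => ?_
        · simp
        · refine Fin.lastCases ?_ (fun i => ?_) i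
          · simp [hV]; ring
          · simp [hV]
      exact (RingHom.congr_fun h2 p).symm
  choose Q hQd hQ using fun a => key (q a) (hq a)
  refine ⟨∑ a ∈ q.support, Polynomial.C (exz a x * (Bh x ^ N)⁻¹) * Q a, ?_, fun c => ?_⟩
  · refine (Polynomial.degree_sum_le _ _).trans_lt ?_
    rw [Finset.sup_lt_iff (WithBot.bot_lt_coe _)]
    intro a _
    exact (by rw [← Polynomial.smul_eq_C_mul]; exact (Polynomial.degree_smul_le _ _).trans_lt (hQd a))
  · have h2 := h1 x hx (Fin.snoc ν (-(c / 2)))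
    rw [hT, expSum] at h2
    have h3 := pow_ne_zero N (Bh_ne_zero hx)
    rw [← mul_right_inj' h3, mul_comm, h2, Polynomial.eval_finsetSum, Finset.mul_sum, Finsupp.sum]
    refine Finset.sum_congr rfl fun a _ => ?_
    rw [Polynomial.eval_mul, Polynomial.eval_C, hQ]
    field_simp

/-- Lagrange interpolation at `0, …, d` with fixed weights. The coefficients are then finite
combinations of values of the family, hence inherit rationality and limits. -/
theorem exists_coeff (d : ℕ) : ∃ w : ℕ → ℕ → ℂ, ∀ Q : Polynomial ℂ, Q.degree < (d + 1 : ℕ) →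
    ∀ c : ℂ, Q.eval c = ∑ j ∈ Finset.range (d + 1), (∑ i ∈ Finset.range (d + 1), w i j * Q.eval (i : ℂ)) * c ^ j := by
  refine ⟨fun i j => (Lagrange.basis (Finset.range (d + 1)) (fun i : ℕ => (i : ℂ)) i).coeff j, fun Q hQ c => ?_⟩
  have h1 := Lagrange.eq_interpolate (s := Finset.range (d + 1)) (v := fun i : ℕ => (i : ℂ))
    (Nat.cast_injective.injOn) (f := Q) (by rwa [Finset.card_range])
  have h2 : ∀ j, ∑ i ∈ Finset.range (d + 1), (Lagrange.basis (Finset.range (d + 1)) (fun i : ℕ => (i : ℂ)) i).coeff j *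
      Q.eval (i : ℂ) = Q.coeff j := by
    intro j
    conv_rhs => rw [h1]
    rw [Lagrange.interpolate_apply, Polynomial.finsetSum_coeff]
    refine Finset.sum_congr rfl fun i _ => ?_
    rw [Polynomial.coeff_C_mul, mul_comm]
  simp only [h2]
  refine Polynomial.eval_eq_sum_range' ?_ c
  by_cases h0 : Q = 0
  · simp [h0]
  · exact (Polynomial.natDegree_lt_iff_degree_lt h0).2 hQ

theorem coeff_eq_zero_of_forall {d : ℕ} {a : ℕ → ℂ}
    (h : ∀ c : ℂ, ∑ j ∈ Finset.range (d + 1), a j * c ^ j = 0) : ∀ j ≤ d, a j = 0 := by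
  have h1 : ∑ j ∈ Finset.range (d + 1), Polynomial.C (a j) * Polynomial.X ^ j = 0 := by
    refine Polynomial.funext fun c => ?_
    simp [Polynomial.eval_finsetSum, h c]
  intro j hj
  have h2 := congrArg (fun Q => Polynomial.coeff Q j) h1
  simp only [Polynomial.finsetSum_coeff, Polynomial.coeff_C_mul_X_pow, Polynomial.coeff_zero] at h2
  rwa [Finset.sum_ite_eq, if_pos (Finset.mem_range.2 (by omega))] at h2

/-- With last parameter `-c / 2` the first order term in the last variable is `-2 c ∂_{k+1}`, so
comparing powers of `c` couples neighbouring coefficients exactly as in `acoef_rec`. The index `p`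
counts down from the top power `D`. -/
theorem exists_recSol_fam (H : IsFam (k + 1) m h ht hl) (ν : Fin k → ℂ) : ∃ (D : ℕ) (R : ℕ → (Fin (k + 1) → ℂ) → ℂ)
    (l : ℕ → ℂ), RecSol m ν R l ∧ (∀ p, D < p → R p = 0 ∧ l p = 0) ∧
      (∀ x ∈ dom (fun i : Fin (k + 1) => (i : ℕ)), ∀ c : ℂ,
        h x (Fin.snoc ν (-(c / 2))) = ∑ p ∈ Finset.range (D + 1), R p x * c ^ (D - p)) ∧
      ∀ c : ℂ, normConst m (Fin.snoc ν (-(c / 2)) : Fin (k + 1) → ℂ) =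
        ∑ p ∈ Finset.range (D + 1), l p * c ^ (D - p) := by
  obtain ⟨z₀, hz₀⟩ := exists_mem_domVal (n := k + 1)
  set D := m * (k + 1).choose 2 with hD
  obtain ⟨w, hw⟩ := exists_coeff D
  set C : ℕ → (Fin (k + 1) → ℂ) → ℂ := fun j x =>
    ∑ i ∈ Finset.range (D + 1), w i j * h x (Fin.snoc ν (-((i : ℂ) / 2))) with hC
  set e : ℕ → ℂ := fun j =>
    ∑ i ∈ Finset.range (D + 1), w i j * normConst m (Fin.snoc ν (-((i : ℂ) / 2)) : Fin (k + 1) → ℂ) with he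
  have hrl : ∀ j, RL (fun i : Fin (k + 1) => (i : ℕ)) (C j) (fun _ => e j) := fun j =>
    RL.sum _ fun i _ => RL.const_mul _ ((H.rt.toRL _).congr (fun _ _ => rfl) fun z hz => (H.limit z hz _).symm)
  have hsum : ∀ x ∈ dom (fun i : Fin (k + 1) => (i : ℕ)), ∀ c : ℂ,
      h x (Fin.snoc ν (-(c / 2))) = ∑ j ∈ Finset.range (D + 1), C j x * c ^ j := by
    intro x hx c
    obtain ⟨Q, hQ, hQe⟩ := H.rt.exists_polynomial ν hx
    rw [hQe, hw Q hQ]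
    simp only [hC, hQe]
  have hsuml : ∀ c : ℂ, normConst m (Fin.snoc ν (-(c / 2)) : Fin (k + 1) → ℂ) =
      ∑ j ∈ Finset.range (D + 1), e j * c ^ j := by
    intro c
    have hξ : StrictAnti fun i : Fin (k + 1) => -((i : ℕ) : ℝ) := fun i j h => by simpa using h
    have hch := chamberLim_ray hξ hz₀
    have t1 := H.rt.tendsto_limit hch (Fin.snoc ν (-(c / 2)))
    rw [H.limit _ hz₀] at t1
    have t2 : Tendsto (fun t => ∑ j ∈ Finset.range (D + 1), C j (ray (fun i => -((i : ℕ) : ℝ)) t) * c ^ j) atTop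
        (𝓝 (∑ j ∈ Finset.range (D + 1), e j * c ^ j)) :=
      tendsto_finsetSum _ fun j _ => ((hrl j).tendsto hch).mul_const _
    refine tendsto_nhds_unique t1 (t2.congr' ?_)
    filter_upwards [hch.dom_ev] with t ht
    exact (hsum _ ht c).symm
  -- The coefficient of `c ^ j` in the Schrödinger equation. The extra value `j = D + 1` says that
  -- the top coefficient does not depend on the last variable.
  have hcoef : ∀ x ∈ dom (fun i : Fin (k + 1) => (i : ℕ)), ∀ j ≤ D + 1,
      (if j ≤ D then Lop ν (C j) x - 2 * m * (m + 1) * pot x * C j x else 0) -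
        (if j = 0 then 0 else 2 * pd (Fin.last k) (C (j - 1)) x) = 0 := by
    intro x hx
    refine coeff_eq_zero_of_forall fun c => ?_
    have h1 := (H.isSol (Fin.snoc ν (-(c / 2)))).pde x hx
    have hev : Set.EqOn (fun x => h x (Fin.snoc ν (-(c / 2)))) (fun x => ∑ j ∈ Finset.range (D + 1), C j x * c ^ j)
      (dom (fun i : Fin (k + 1) => (i : ℕ))) := fun x hx => hsum x hx c
    have h2 : ∀ i, pd i (pd i fun x => h x (Fin.snoc ν (-(c / 2)))) x = pd i (pd i
        (fun x => ∑ j ∈ Finset.range (D + 1), C j x * c ^ j)) x := fun i =>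
      pd_congr_on isOpen_domVal i (pd_congr_on isOpen_domVal i hev) hx
    have h3 : ∀ i, pd i (fun x => h x (Fin.snoc ν (-(c / 2)))) x = pd i
        (fun x => ∑ j ∈ Finset.range (D + 1), C j x * c ^ j) x := fun i =>
      pd_congr_on isOpen_domVal i hev hx
    simp only [h2, h3] at h1
    rw [Finset.sum_add_distrib, Fin.sum_univ_castSucc, hsum x hx c] at h1
    simp only [Fin.snoc_castSucc, Fin.snoc_last] at h1
    have h4 := Lop_sum_mul_const (Finset.range (D + 1)) (F := C) (fun j => c ^ j)
      (fun j _ => (hrl j).analytic.1) ν hx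
    rw [Lop] at h4
    have h5 := pd_sum_mul_const (Finset.range (D + 1)) (F := C) (fun j => c ^ j)
      (fun j _ => (hrl j).analytic.1) (Fin.last k) x hx
    rw [h5] at h1
    simp only [sub_mul, Finset.sum_sub_distrib]
    rw [Finset.sum_range_succ, Finset.sum_range_succ' (fun j => (if j = 0 then 0 else
      2 * pd (Fin.last k) (C (j - 1)) x) * c ^ j)]
    have h6 : ∑ j ∈ Finset.range (D + 1), (if j ≤ D then Lop ν (C j) x - 2 * m * (m + 1) * pot x * C j x else 0) *
        c ^ j = ∑ j ∈ Finset.range (D + 1), Lop ν (C j) x * c ^ j -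
        2 * m * (m + 1) * pot x * ∑ j ∈ Finset.range (D + 1), C j x * c ^ j := by
      rw [Finset.mul_sum, ← Finset.sum_sub_distrib]
      refine Finset.sum_congr rfl fun j hj => ?_
      rw [if_pos (by have := Finset.mem_range.1 hj; omega)]
      ring
    have h7 : ∑ j ∈ Finset.range (D + 1), (if j + 1 = 0 then 0 else 2 * pd (Fin.last k) (C (j + 1 - 1)) x) *
        c ^ (j + 1) = 2 * c * ∑ j ∈ Finset.range (D + 1), pd (Fin.last k) (C j) x * c ^ j := by
      rw [Finset.mul_sum]
      refine Finset.sum_congr rfl fun j _ => ?_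
      rw [if_neg (by omega), Nat.add_sub_cancel, pow_succ]
      ring
    rw [h6, h7, ← h4]
    simp only [show ¬ (D + 1 ≤ D) by omega, if_true, if_false, zero_mul, add_zero]
    linear_combination h1
  refine ⟨D, fun p => if p ≤ D then C (D - p) else 0, fun p => if p ≤ D then e (D - p) else 0,
    ⟨fun p => ?_, fun x hx => ?_, fun p x hx => ?_⟩, fun p hp => ?_, fun x hx c => ?_, fun c => ?_⟩
  · by_cases hp : p ≤ D
    · simpa only [hp, if_true] using hrl (D - p)
    · simp only [hp, if_false]
      exact RL.const 0
  · have h1 := hcoef x hx (D + 1) le_rfl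
    rw [if_neg (by omega), if_neg (by omega), Nat.add_sub_cancel] at h1
    simpa using h1
  · by_cases hp : p ≤ D
    · have h1 := hcoef x hx (D - p) (by omega)
      rw [if_pos (by omega)] at h1
      simp only [hp, if_true]
      by_cases hp2 : p = D
      · rw [if_neg (by omega)]
        rw [if_pos (by omega)] at h1
        have : pd (Fin.last k) (0 : (Fin (k + 1) → ℂ) → ℂ) x = 0 := pd_const 0
        rw [this]
        linear_combination h1
      · rw [if_pos (by omega)]
        rw [if_neg (by omega), show D - p - 1 = D - (p + 1) by omega] at h1
        linear_combination h1
    · rw [if_neg hp, if_neg (by omega)]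
      have h0 : ∀ i : Fin (k + 1), pd i (0 : (Fin (k + 1) → ℂ) → ℂ) = 0 := fun i => funext fun x => pd_const 0
      simp [Lop, h0]
  · simp [show ¬ p ≤ D by omega]
  · rw [hsum x hx c, ← Finset.sum_range_reflect]
    refine Finset.sum_congr rfl fun j hj => ?_
    have := Finset.mem_range.1 hj
    simp only [show D + 1 - 1 - j = D - j by omega, show j ≤ D by omega, if_true]
  · rw [hsuml c, ← Finset.sum_range_reflect]
    refine Finset.sum_congr rfl fun j hj => ?_
    have := Finset.mem_range.1 hj
    simp only [show D + 1 - 1 - j = D - j by omega, show j ≤ D by omega, if_true]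

end SpectralCoefficients

/-! ### The formal identity. -/

section SeriesIdentity

variable {k m : ℕ} {h ht hl : (Fin k → ℂ) → (Fin k → ℂ) → ℂ}
  {h' ht' hl' : (Fin (k + 1) → ℂ) → (Fin (k + 1) → ℂ) → ℂ}

/-- The integral coefficients convolved with the limits of the family, and the family coefficients
convolved with the limits of the integral, solve the same recursion with the same limits, hence
coincide. -/
theorem series_identity (H : IsFam k m h ht hl) (H' : IsFam (k + 1) m h' ht' hl') {ν : Fin k → ℂ}
    (hν : ν ∈ Gen k m) {x : Fin (k + 1) → ℂ} (hx : x ∈ dom fun i : Fin (k + 1) => (i : ℕ)) :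
    ∃ (D : ℕ) (α β : ℕ → ℂ), (∀ p, D < p → α p = 0 ∧ β p = 0) ∧
      (∀ c : ℂ, normConst m (Fin.snoc ν (-(c / 2)) : Fin (k + 1) → ℂ) =
        ∑ p ∈ Finset.range (D + 1), α p * c ^ (D - p)) ∧
      (∀ c : ℂ, h' x (Fin.snoc ν (-(c / 2))) = ∑ p ∈ Finset.range (D + 1), β p * c ^ (D - p)) ∧
      ∀ p, ∑ q ∈ Finset.HasAntidiagonal.antidiagonal p, acoef m q.1 (pot_eigen_analytic H ν) x * α q.2 =
        ∑ q ∈ Finset.HasAntidiagonal.antidiagonal p, ecoef m q.1 ν x * β q.2 := by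
  obtain ⟨R, e, hR, ha, he⟩ := exists_recSol_acoef H ν hx
  obtain ⟨D, S, l, hS, h0, h1, h2⟩ := exists_recSol_fam H' ν
  refine ⟨D, l, fun p => S p x, fun p hp => ⟨(h0 p hp).2, by simp [(h0 p hp).1]⟩, h2, h1 x hx, fun p => ?_⟩
  have hS' := hS.conv e
  have hl : (fun p => ∑ q ∈ Finset.HasAntidiagonal.antidiagonal p, l q.1 * e q.2) =
      fun p => ∑ q ∈ Finset.HasAntidiagonal.antidiagonal p, e q.1 * l q.2 := by
    ext p
    rw [← Finset.Nat.sum_antidiagonal_swap]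
    exact Finset.sum_congr rfl fun _ _ => mul_comm _ _
  rw [hl] at hS'
  have h3 := (hR.conv l).eq hν hS' p hx
  beta_reduce at h3
  rw [← Finset.Nat.sum_antidiagonal_swap (f := fun q => S q.1 x * e q.2)] at h3
  simp only [ha _ x hx, he, mul_assoc, ← Finset.mul_sum]
  rw [h3]
  congr 1
  exact Finset.sum_congr rfl fun _ _ => mul_comm _ _

end SeriesIdentity

end TrigBA

end

noncomputable section

namespace TrigBA

/-! ### The gamma weight. -/

section GammaWeight

/-- The weight `t ^ n e^{-ct} / n!` on `[0, ∞)`. -/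
def expW (c : ℝ) (n : ℕ) : ℝ → ℝ := (Set.Ici 0).indicator fun t => Real.exp (-(c * t)) * t ^ n / n.factorial

theorem expW_of_nonneg (c : ℝ) (n : ℕ) {t : ℝ} (ht : 0 ≤ t) :
    expW c n t = Real.exp (-(c * t)) * t ^ n / n.factorial := Set.indicator_of_mem ht _

theorem expW_of_neg (c : ℝ) (n : ℕ) {t : ℝ} (ht : t < 0) : expW c n t = 0 :=
  Set.indicator_of_notMem (by simpa using ht) _

theorem expW_nonneg (c : ℝ) (n : ℕ) (t : ℝ) : 0 ≤ expW c n t := by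
  rcases lt_or_ge t 0 with ht | ht
  · rw [expW_of_neg c n ht]
  · rw [expW_of_nonneg c n ht]; positivity

theorem measurable_expW (c : ℝ) (n : ℕ) : Measurable (expW c n) :=
  (Continuous.measurable (by fun_prop)).indicator measurableSet_Ici

variable {c : ℝ} (hc : 0 < c) (n : ℕ)
include hc

theorem integral_expW : ∫ t, expW c n t = (c ^ (n + 1))⁻¹ := by
  have h1 := Real.integral_rpow_mul_exp_neg_mul_Ioi (a := (n : ℝ) + 1) (by positivity) hc
  rw [expW, integral_indicator measurableSet_Ici, integral_Ici_eq_integral_Ioi, integral_div]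
  have h2 : ∫ t in Set.Ioi (0 : ℝ), Real.exp (-(c * t)) * t ^ n =
      ∫ t in Set.Ioi (0 : ℝ), t ^ ((n : ℝ) + 1 - 1) * Real.exp (-(c * t)) := by
    refine setIntegral_congr_fun measurableSet_Ioi fun t _ => ?_
    rw [add_sub_cancel_right, Real.rpow_natCast, mul_comm]
  rw [h2, h1, Real.Gamma_nat_eq_factorial, mul_div_assoc, div_self (by positivity), mul_one, one_div,
    Real.inv_rpow hc.le]
  norm_cast

theorem integrable_expW : Integrable (expW c n) := by
  refine Integrable.of_integral_ne_zero ?_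
  rw [integral_expW hc]
  positivity

end GammaWeight

/-! ### Orthant integrals as Laplace transforms in one variable. -/

section LaplaceTransform

open scoped Pointwise

variable {k : ℕ}

/-- The solid simplex. -/
def splx (k : ℕ) : Set (Fin k → ℝ) := {p | (∀ i, 0 ≤ p i) ∧ ∑ i, p i ≤ 1}

theorem isClosed_splx : IsClosed (splx k) :=
  (isClosed_Ici (a := (0 : Fin k → ℝ))).inter
    (isClosed_le (continuous_finsetSum _ fun i _ => continuous_apply i) continuous_const)

theorem isCompact_splx : IsCompact (splx k) := by
  refine (isCompact_Icc (a := (0 : Fin k → ℝ)) (b := 1)).of_isClosed_subset isClosed_splx fun p hp => ?_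
  exact ⟨hp.1, fun i => (Finset.single_le_sum (fun j _ => hp.1 j) (Finset.mem_univ i)).trans hp.2⟩

theorem smul_splx {r : ℝ} (hr : 0 < r) : r • splx k = {σ | (∀ i, 0 ≤ σ i) ∧ ∑ i, σ i ≤ r} := by
  ext σ
  rw [Set.mem_smul_set_iff_inv_smul_mem₀ hr.ne']
  simp only [splx, Set.mem_ofPred_eq, Pi.smul_apply, smul_eq_mul, ← Finset.mul_sum]
  refine and_congr (forall_congr' fun i => ?_) ?_
  · rw [mul_nonneg_iff_of_pos_left (inv_pos.2 hr)]
  · rw [inv_mul_le_iff₀ hr, mul_one]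

/-- The coefficient functions of the Laplace transform in the variable `∑ σ_i`. -/
def splxInt (n : ℕ) (G : (Fin k → ℝ) → ℂ) (r : ℝ) : ℂ :=
  ∫ p in splx k, (((1 - ∑ i, p i) ^ n / n.factorial : ℝ) : ℂ) * G (r • p)

variable {c : ℝ} (hc : 0 < c) (n : ℕ) {G : (Fin k → ℝ) → ℂ}
  (hG : IntegrableOn (fun σ => (Real.exp (-(c * ∑ i, σ i)) : ℂ) * G σ) (Set.Ici 0))

/-- The two exponentials combine to `exp (-c r)`, the support is the simplex of size `r`, and the
dilation `σ = r p` brings it to the unit simplex. -/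
theorem slice_integral {r : ℝ} (hr : 0 < r) :
    ∫ σ, (expW c n (r - ∑ i, σ i) : ℂ) * (Set.Ici (0 : Fin k → ℝ)).indicator
      (fun σ => (Real.exp (-(c * ∑ i, σ i)) : ℂ) * G σ) σ =
      (Real.exp (-(c * r)) * r ^ (k + n) : ℝ) * splxInt n G r := by
  have h1 := Measure.setIntegral_comp_smul_of_pos (volume : Measure (Fin k → ℝ))
    (fun σ => (((1 - r⁻¹ * ∑ i, σ i) ^ n / n.factorial : ℝ) : ℂ) * G σ) (splx k) hr
  have h2 : splxInt n G r = ∫ p in splx k, (((1 - r⁻¹ * ∑ i, (r • p) i) ^ n / n.factorial : ℝ) : ℂ) * G (r • p) := by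
    refine integral_congr_ae (Eventually.of_forall fun p => ?_)
    simp only [Pi.smul_apply, smul_eq_mul, ← Finset.mul_sum]
    rw [inv_mul_cancel_left₀ hr.ne']
  rw [h2, h1, smul_splx hr, Module.finrank_fin_fun, Complex.real_smul]
  have h3 : (fun σ => (expW c n (r - ∑ i, σ i) : ℂ) * (Set.Ici (0 : Fin k → ℝ)).indicator
      (fun σ => (Real.exp (-(c * ∑ i, σ i)) : ℂ) * G σ) σ) =
      {σ : Fin k → ℝ | (∀ i, 0 ≤ σ i) ∧ ∑ i, σ i ≤ r}.indicator fun σ =>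
        ((Real.exp (-(c * r)) * r ^ n : ℝ) : ℂ) * ((((1 - r⁻¹ * ∑ i, σ i) ^ n / n.factorial : ℝ) : ℂ) * G σ) := by
    ext σ
    by_cases h0 : ∀ i, 0 ≤ σ i
    · rw [Set.indicator_of_mem (show σ ∈ Set.Ici 0 from h0)]
      by_cases hs : ∑ i, σ i ≤ r
      · rw [Set.indicator_of_mem (show σ ∈ {σ : Fin k → ℝ | (∀ i, 0 ≤ σ i) ∧ ∑ i, σ i ≤ r} from ⟨h0, hs⟩),
          expW_of_nonneg _ _ (sub_nonneg.2 hs), ← mul_assoc, ← mul_assoc, ← Complex.ofReal_mul,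
          ← Complex.ofReal_mul]
        congr 2
        have e1 : Real.exp (-(c * (r - ∑ i, σ i))) * Real.exp (-(c * ∑ i, σ i)) = Real.exp (-(c * r)) := by
          rw [← Real.exp_add]; congr 1; ring
        have e2 : (r - ∑ i, σ i) ^ n = r ^ n * (1 - r⁻¹ * ∑ i, σ i) ^ n := by
          rw [← mul_pow]; congr 1; field_simp
        rw [e2, ← e1]; ring
      · rw [Set.indicator_of_notMem (fun h => hs h.2), expW_of_neg _ _ (by linarith)]
        simp
    · rw [Set.indicator_of_notMem (show σ ∉ Set.Ici 0 from h0), Set.indicator_of_notMem (fun h => h0 h.1), mul_zero]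
  have hm : MeasurableSet {σ : Fin k → ℝ | (∀ i, 0 ≤ σ i) ∧ ∑ i, σ i ≤ r} := by
    rw [← smul_splx hr]
    exact (isCompact_splx.smul r).measurableSet
  rw [h3, integral_indicator hm, integral_const_mul, ← mul_assoc]
  congr 1
  push_cast
  have : (r : ℂ) ≠ 0 := Complex.ofReal_ne_zero.2 hr.ne'
  field_simp
  ring

include hc hG

theorem integrable_slice :
    Integrable (fun q : (Fin k → ℝ) × ℝ => (expW c n (q.2 - ∑ i, q.1 i) : ℂ) * (Set.Ici (0 : Fin k → ℝ)).indicator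
      (fun σ => (Real.exp (-(c * ∑ i, σ i)) : ℂ) * G σ) q.1) (volume.prod volume) := by
  have hg := (integrable_indicator_iff measurableSet_Ici).2 hG
  have hw := (integrable_expW hc n).ofReal (𝕜 := ℂ)
  refine (integrable_prod_iff ?_).2 ⟨Eventually.of_forall fun σ => ?_, ?_⟩
  · refine AEStronglyMeasurable.mul ?_ hg.aestronglyMeasurable.comp_fst
    exact (Complex.measurable_ofReal.comp ((measurable_expW c n).comp (by fun_prop))).aestronglyMeasurable
  · exact (hw.comp_sub_right (∑ i, σ i)).mul_const ((Set.Ici (0 : Fin k → ℝ)).indicator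
      (fun σ => (Real.exp (-(c * ∑ i, σ i)) : ℂ) * G σ) σ)
  · have h1 : ∀ σ : Fin k → ℝ, ∫ r, ‖(expW c n (r - ∑ i, σ i) : ℂ) * (Set.Ici (0 : Fin k → ℝ)).indicator
      (fun σ => (Real.exp (-(c * ∑ i, σ i)) : ℂ) * G σ) σ‖ = (c ^ (n + 1))⁻¹ *
        ‖(Set.Ici (0 : Fin k → ℝ)).indicator (fun σ => (Real.exp (-(c * ∑ i, σ i)) : ℂ) * G σ) σ‖ := by
      intro σ
      simp only [norm_mul]
      rw [integral_mul_const, integral_sub_right_eq_self (fun r => ‖(expW c n r : ℂ)‖)]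
      simp only [Complex.norm_real, Real.norm_of_nonneg (expW_nonneg _ _ _), integral_expW hc]
    simp only [h1]
    exact hg.norm.const_mul _

/-- The power `c ^ -(n + 1)` is the Laplace transform of `t ^ n / n!`. Its product with the orthant
integral is computed by Fubini in the variable `r = t + ∑ σ_i`. -/
theorem laplace_eq : IntegrableOn (fun r : ℝ => (Real.exp (-(c * r)) * r ^ (k + n) : ℝ) * splxInt n G r) (Set.Ioi 0) ∧
    ∫ r in Set.Ioi (0 : ℝ), (Real.exp (-(c * r)) * r ^ (k + n) : ℝ) * splxInt n G r =
      ((c ^ (n + 1))⁻¹ : ℝ) * ∫ σ in Set.Ici 0, (Real.exp (-(c * ∑ i, σ i)) : ℂ) * G σ := by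
  have hI := integrable_slice hc n hG
  constructor
  · refine (hI.integral_prod_right.integrableOn (s := Set.Ioi 0)).congr_fun (fun r hr => ?_) measurableSet_Ioi
    exact slice_integral n hr
  · have h1 := integral_integral_swap (f := fun (σ : Fin k → ℝ) r => (expW c n (r - ∑ i, σ i) : ℂ) *
      (Set.Ici (0 : Fin k → ℝ)).indicator (fun σ => (Real.exp (-(c * ∑ i, σ i)) : ℂ) * G σ) σ) hI
    have h2 : ∀ σ : Fin k → ℝ, ∫ r, (expW c n (r - ∑ i, σ i) : ℂ) * (Set.Ici (0 : Fin k → ℝ)).indicator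
        (fun σ => (Real.exp (-(c * ∑ i, σ i)) : ℂ) * G σ) σ = ((c ^ (n + 1))⁻¹ : ℝ) *
        (Set.Ici (0 : Fin k → ℝ)).indicator (fun σ => (Real.exp (-(c * ∑ i, σ i)) : ℂ) * G σ) σ := by
      intro σ
      rw [integral_mul_const, integral_sub_right_eq_self (fun r => (expW c n r : ℂ)), integral_complex_ofReal,
        integral_expW hc]
    simp only [h2] at h1
    rw [integral_const_mul, integral_indicator measurableSet_Ici] at h1
    rw [h1]
    refine Eq.trans ?_ (setIntegral_eq_integral_of_forall_compl_eq_zero (s := Set.Ici 0) fun r hr => ?_)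
    · rw [integral_Ici_eq_integral_Ioi]
      exact (setIntegral_congr_fun measurableSet_Ioi fun r hr => slice_integral n hr).symm
    · rw [Set.mem_Ici, not_le] at hr
      refine integral_eq_zero_of_ae (Eventually.of_forall fun σ => ?_)
      by_cases h0 : ∀ i, 0 ≤ σ i
      · have := Finset.sum_nonneg fun i (_ : i ∈ Finset.univ) => h0 i
        beta_reduce
        rw [expW_of_neg _ _ (by linarith)]
        simp
      · beta_reduce
        rw [Set.indicator_of_notMem (show σ ∉ Set.Ici 0 from h0)]
        simp

end LaplaceTransform

/-! ### Dirichlet's integral over the simplex. -/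

section Dirichlet

variable {k : ℕ}

/-- Apply `laplace_eq` at `c = 1` to a monomial: by homogeneity one side is a gamma integral times
the wanted value, and the other factors into gamma integrals. -/
theorem dirichlet_integral (n : ℕ) (β : Fin k → ℕ) :
    ∫ p in splx k, (((1 - ∑ i, p i) ^ n / n.factorial : ℝ) : ℂ) * ∏ i, ((p i : ℝ) : ℂ) ^ β i =
      (∏ i, ((β i).factorial : ℂ)) / (k + n + ∑ i, β i).factorial := by
  set G : (Fin k → ℝ) → ℂ := fun σ => ∏ i, ((σ i : ℝ) : ℂ) ^ β i with hG
  have hprod : (Set.Ici (0 : Fin k → ℝ)).indicator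
      (fun σ => (Real.exp (-(1 * ∑ i, σ i)) : ℂ) * G σ) =
      fun σ => ∏ i, (((β i).factorial : ℂ) * (expW 1 (β i) (σ i) : ℂ)) := by
    ext σ
    by_cases h0 : ∀ i, 0 ≤ σ i
    · rw [Set.indicator_of_mem (show σ ∈ Set.Ici 0 from h0)]
      simp only [expW_of_nonneg _ _ (h0 _), hG]
      rw [one_mul, ← Finset.sum_neg_distrib, Real.exp_sum, Complex.ofReal_prod, ← Finset.prod_mul_distrib]
      refine Finset.prod_congr rfl fun i _ => ?_
      have : ((β i).factorial : ℂ) ≠ 0 := by exact_mod_cast (β i).factorial_ne_zero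
      push_cast
      rw [one_mul]
      field_simp
    · rw [Set.indicator_of_notMem (show σ ∉ Set.Ici 0 from h0)]
      push Not at h0
      obtain ⟨i, hi⟩ := h0
      exact (Finset.prod_eq_zero (Finset.mem_univ i) (by rw [expW_of_neg _ _ hi]; simp)).symm
  have hint : IntegrableOn (fun σ => (Real.exp (-(1 * ∑ i, σ i)) : ℂ) * G σ) (Set.Ici 0) := by
    rw [← integrable_indicator_iff measurableSet_Ici, hprod]
    exact Integrable.fintype_prod fun i => ((integrable_expW one_pos (β i)).ofReal (𝕜 := ℂ)).const_mul _
  have h1 := (laplace_eq one_pos n hint).2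
  have h2 : ∫ σ in Set.Ici 0, (Real.exp (-(1 * ∑ i, σ i)) : ℂ) * G σ = ∏ i, ((β i).factorial : ℂ) := by
    rw [← integral_indicator measurableSet_Ici, hprod,
      integral_fintype_prod_volume_eq_prod (fun i t => ((β i).factorial : ℂ) * (expW 1 (β i) t : ℂ))]
    refine Finset.prod_congr rfl fun i _ => ?_
    rw [integral_const_mul, integral_complex_ofReal, integral_expW one_pos]
    simp
  have h3 : ∀ r : ℝ, splxInt n G r = ((r ^ ∑ i, β i : ℝ) : ℂ) * splxInt n G 1 := by
    intro r
    simp only [splxInt]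
    rw [← integral_const_mul]
    refine integral_congr_ae (Eventually.of_forall fun p => ?_)
    simp only [hG, Pi.smul_apply, smul_eq_mul, one_mul, Complex.ofReal_mul, mul_pow, Finset.prod_mul_distrib,
      Finset.prod_pow_eq_pow_sum]
    push_cast
    ring
  have h4 : ∫ r in Set.Ioi (0 : ℝ), (Real.exp (-(1 * r)) * r ^ (k + n) : ℝ) * splxInt n G r =
      ((k + n + ∑ i, β i).factorial : ℂ) * splxInt n G 1 := by
    have e1 : ∀ r ∈ Set.Ioi (0 : ℝ), (Real.exp (-(1 * r)) * r ^ (k + n) : ℝ) * splxInt n G r =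
        (((k + n + ∑ i, β i).factorial * expW 1 (k + n + ∑ i, β i) r : ℝ) : ℂ) * splxInt n G 1 := by
      intro r hr
      rw [h3 r, expW_of_nonneg _ _ (le_of_lt hr), ← mul_assoc, ← Complex.ofReal_mul]
      congr 2
      have : ((k + n + ∑ i, β i).factorial : ℝ) ≠ 0 := by exact_mod_cast Nat.factorial_ne_zero _
      rw [pow_add _ (k + n)]
      field_simp
    rw [setIntegral_congr_fun measurableSet_Ioi e1, integral_mul_const, ← integral_Ici_eq_integral_Ioi,
      setIntegral_eq_integral_of_forall_compl_eq_zero (fun r hr => by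
        rw [expW_of_neg _ _ (by simpa using hr)]; simp), integral_complex_ofReal, integral_const_mul,
      integral_expW one_pos]
    simp
  rw [h4, h2] at h1
  have h5 : ((k + n + ∑ i, β i).factorial : ℂ) ≠ 0 := by exact_mod_cast Nat.factorial_ne_zero _
  rw [eq_div_iff h5]
  have h6 : splxInt n G 1 = ∫ p in splx k, (((1 - ∑ i, p i) ^ n / n.factorial : ℝ) : ℂ) *
      ∏ i, ((p i : ℝ) : ℂ) ^ β i := by simp [splxInt, hG]
  rw [← h6, mul_comm, h1]
  simp

end Dirichlet

end TrigBA

end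

noncomputable section

namespace TrigBA

/-! ### Simplex integrals as analytic functions of the dilation. -/

section Parameter

variable {k : ℕ}

/-- Differentiation under an integral over a compact set. -/
theorem hasDerivAt_integral_compact {E : Type*} [TopologicalSpace E] [T2Space E] [MeasurableSpace E]
    [BorelSpace E] [SecondCountableTopology E] {μ : Measure E} [IsFiniteMeasureOnCompacts μ] {K : Set E} (hK : IsCompact K) {U : Set ℂ}
    (hU : IsOpen U) {F F' : ℂ → E → ℂ} (hF : ∀ r ∈ U, ContinuousOn (F r) K)
    (hF' : ContinuousOn (fun q : ℂ × E => F' q.1 q.2) (U ×ˢ K))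
    (hd : ∀ r ∈ U, ∀ p ∈ K, HasDerivAt (fun r => F r p) (F' r p) r) {r : ℂ} (hr : r ∈ U) :
    HasDerivAt (fun r => ∫ p in K, F r p ∂μ) (∫ p in K, F' r p ∂μ) r := by
  obtain ⟨ε, hε, hεU⟩ := Metric.isOpen_iff.1 hU r hr
  have hsub : Metric.closedBall r (ε / 2) ⊆ U := (Metric.closedBall_subset_ball (half_lt_self hε)).trans hεU
  obtain ⟨B, hB⟩ := ((isCompact_closedBall r (ε / 2)).prod hK).exists_bound_of_continuousOn
    (hF'.mono (Set.prod_mono hsub le_rfl))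
  have hF'r : ContinuousOn (F' r) K := hF'.comp (f := fun p => (r, p)) (by fun_prop) fun p hp => ⟨hr, hp⟩
  refine (hasDerivAt_integral_of_dominated_loc_of_deriv_le (bound := fun _ => B)
    (Metric.closedBall_mem_nhds r (half_pos hε)) ?_ ((hF r hr).integrableOn_compact hK)
    (hF'r.aestronglyMeasurable hK.measurableSet) ?_ ?_ ?_).2
  · filter_upwards [hU.mem_nhds hr] with s hs
    exact (hF s hs).aestronglyMeasurable hK.measurableSet
  · filter_upwards [ae_restrict_mem hK.measurableSet] with p hp s hs
    exact hB (s, p) ⟨hs, hp⟩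
  · exact integrableOn_const hK.measure_lt_top.ne
  · filter_upwards [ae_restrict_mem hK.measurableSet] with p hp s hs
    exact hd s (hsub hs) p hp

/-- The point `(x, x' - r p)`. -/
def seg (x : Fin (k + 1) → ℂ) (r : ℂ) (p : Fin k → ℝ) : Idx k → ℂ :=
  Sum.elim x fun i => x i.castSucc - r * p i

theorem seg_zero (x : Fin (k + 1) → ℂ) (p : Fin k → ℝ) : seg x 0 p = diag x := by
  ext (i | i) <;> simp [seg, diag]

theorem seg_smul (x : Fin (k + 1) → ℂ) (r : ℝ) (p : Fin k → ℝ) : seg x 1 (r • p) = seg x r p := by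
  ext (i | i) <;> simp [seg]

theorem continuous_seg (x : Fin (k + 1) → ℂ) : Continuous fun q : ℂ × (Fin k → ℝ) => seg x q.1 q.2 := by
  refine continuous_pi fun i => ?_
  rcases i with i | i <;> simp only [seg, Sum.elim_inl, Sum.elim_inr]
  · exact continuous_const
  · exact continuous_const.sub (continuous_fst.mul (Complex.continuous_ofReal.comp
      ((continuous_apply i).comp continuous_snd)))

/-- The parameters `r` for which the segment stays away from the walls. -/
def segDom (x : Fin (k + 1) → ℂ) : Set ℂ := {r | ∀ p ∈ splx k, seg x r p ∈ dom (icol (k := k))}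

/-- The tube lemma over the compact simplex. -/
theorem isOpen_segDom (x : Fin (k + 1) → ℂ) : IsOpen (segDom x) := by
  refine isOpen_iff_mem_nhds.2 fun r hr => isCompact_splx.eventually_forall_of_forall_eventually
    (P := fun r p => seg x r p ∈ dom (icol (k := k))) fun p hp => ?_
  exact (continuous_seg x).continuousAt.eventually_mem ((isOpen_dom _).mem_nhds (hr p hp))

theorem seg_mem {x : Fin (k + 1) → ℂ} (hx : x ∈ Slit fun i : Fin (k + 1) => (i : ℕ)) {r : ℝ} (hr : 0 ≤ r)
    {p : Fin k → ℝ} (hp : ∀ i, 0 ≤ p i) : seg x r p ∈ dom (icol (k := k)) := by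
  have h1 : diag x ∈ Slit (icol (k := k)) := by
    rintro (a | a) (b | b) h <;> simp only [icol, Sum.elim_inl, Sum.elim_inr] at h <;>
      simp only [diag, Sum.elim_inl, Sum.elim_inr] <;> apply hx <;> simpa using h
  have h2 := Slit.shift_mem h1 (Sum.elim 0 fun i => r * p i)
  have h3 : (fun i => diag x i - ((Sum.elim (0 : Fin (k + 1) → ℝ) (fun i => r * p i) i : ℝ) : ℂ)) = seg x r p := by
    ext (i | i) <;> simp [seg, diag]
  rwa [h3] at h2

theorem ofReal_mem_segDom {x : Fin (k + 1) → ℂ} (hx : x ∈ Slit fun i : Fin (k + 1) => (i : ℕ)) {r : ℝ}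
    (hr : 0 ≤ r) : (r : ℂ) ∈ segDom x := fun _ hp => seg_mem hx hr hp.1

theorem hasDerivAt_seg (f : HolI k) {x : Fin (k + 1) → ℂ} {r : ℂ} {p : Fin k → ℝ}
    (h : seg x r p ∈ dom (icol (k := k))) : HasDerivAt (fun r => f.1 (seg x r p))
      ((thetaY (∑ i, MvPolynomial.C ((p i : ℝ) : ℂ) * MvPolynomial.X i) f).1 (seg x r p)) r := by
  have hd : HasDerivAt (fun r => seg x r p) (∑ i, ((p i : ℝ) : ℂ) • -(Pi.single (.inr i) 1 : Idx k → ℂ)) r := by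
    refine hasDerivAt_pi.2 fun a => ?_
    rcases a with j | j
    · have : (∑ i, ((p i : ℝ) : ℂ) • -(Pi.single (.inr i) 1 : Idx k → ℂ)) (.inl j) = 0 := by
        simp [Finset.sum_apply]
      rw [this]
      exact hasDerivAt_const _ _
    · have : (∑ i, ((p i : ℝ) : ℂ) • -(Pi.single (.inr i) 1 : Idx k → ℂ)) (.inr j) = -(1 * ((p j : ℝ) : ℂ)) := by
        rw [Finset.sum_apply, Finset.sum_eq_single j (fun b _ hb => by simp [hb.symm]) (by simp)]
        simp
      rw [this]
      exact ((hasDerivAt_id r).mul_const _).const_sub _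
  have h1 := (Hol.diff f h).hasFDerivAt.comp_hasDerivAt r hd
  refine h1.congr_deriv ?_
  rw [map_sum, map_sum]
  change _ = ((∑ i, thetaY (MvPolynomial.C ((p i : ℝ) : ℂ) * MvPolynomial.X i)) f).1 (seg x r p)
  rw [LinearMap.sum_apply, Hol_sum_apply]
  refine Finset.sum_congr rfl fun i _ => ?_
  rw [map_smul, map_neg, ← pd_eq_fderiv (Hol.diff f h), map_mul, thetaY_X, ← MvPolynomial.algebraMap_eq,
    AlgHom.commutes]
  change _ = (p i : ℂ) * -((P (.inr i) f).1 (seg x r p))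
  rw [P_apply _ _ h, smul_eq_mul]

/-- Iterated derivatives of `f` along segments. -/
def segD (f : HolI k) (x : Fin (k + 1) → ℂ) (N : ℕ) (r : ℂ) (p : Fin k → ℝ) : ℂ :=
  (thetaY ((∑ i, MvPolynomial.C ((p i : ℝ) : ℂ) * MvPolynomial.X i) ^ N) f).1 (seg x r p)

theorem segD_zero (f : HolI k) (x : Fin (k + 1) → ℂ) (r : ℂ) (p : Fin k → ℝ) :
    segD f x 0 r p = f.1 (seg x r p) := by
  rw [segD, pow_zero, map_one]; rfl

theorem hasDerivAt_segD (f : HolI k) {x : Fin (k + 1) → ℂ} (N : ℕ) {r : ℂ} {p : Fin k → ℝ}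
    (h : seg x r p ∈ dom (icol (k := k))) :
    HasDerivAt (fun r => segD f x N r p) (segD f x (N + 1) r p) r := by
  have h1 := hasDerivAt_seg (thetaY ((∑ i, MvPolynomial.C ((p i : ℝ) : ℂ) * MvPolynomial.X i) ^ N) f) h
  refine h1.congr_deriv ?_
  rw [segD, pow_succ', map_mul]
  rfl

theorem segD_eq (f : HolI k) (x : Fin (k + 1) → ℂ) (N : ℕ) (r : ℂ) (p : Fin k → ℝ) :
    segD f x N r p = ∑ β ∈ Finset.piAntidiag Finset.univ N, ((Nat.multinomial Finset.univ β : ℂ) *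
      ∏ i, ((p i : ℝ) : ℂ) ^ β i) * (thetaY (∏ i, MvPolynomial.X i ^ β i) f).1 (seg x r p) := by
  have h1 : ∀ β : Fin k → ℕ, (Nat.multinomial Finset.univ β : MvPolynomial (Fin k) ℂ) *
      ∏ i, (MvPolynomial.C ((p i : ℝ) : ℂ) * MvPolynomial.X i) ^ β i =
      MvPolynomial.C ((Nat.multinomial Finset.univ β : ℂ) * ∏ i, ((p i : ℝ) : ℂ) ^ β i) *
        ∏ i, MvPolynomial.X i ^ β i := by
    intro β
    simp only [mul_pow, Finset.prod_mul_distrib, map_mul, map_prod, map_pow, map_natCast]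
    ring
  rw [segD, Finset.sum_pow_eq_sum_piAntidiag, map_sum]
  change ((∑ β ∈ _, thetaY _) f).1 _ = _
  rw [LinearMap.sum_apply, Hol_sum_apply]
  refine Finset.sum_congr rfl fun β _ => ?_
  rw [h1, map_mul, ← MvPolynomial.algebraMap_eq, AlgHom.commutes]
  rfl

theorem continuousOn_segD (f : HolI k) (x : Fin (k + 1) → ℂ) (N : ℕ) :
    ContinuousOn (fun q : ℂ × (Fin k → ℝ) => segD f x N q.1 q.2) (segDom x ×ˢ splx k) := by
  simp only [segD_eq]
  refine continuousOn_finsetSum _ fun β _ => ContinuousOn.mul (Continuous.continuousOn ?_) ?_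
  · exact continuous_const.mul (continuous_finsetProd _ fun i _ => ((Complex.continuous_ofReal.comp
      ((continuous_apply i).comp continuous_snd))).pow _)
  · exact (Hol.analytic (thetaY (∏ i, MvPolynomial.X i ^ β i) f)).continuousOn.comp
      (continuous_seg x).continuousOn fun q hq => hq.1 q.2 hq.2

/-- The weight of the simplex integrals. -/
def splxW (n : ℕ) (p : Fin k → ℝ) : ℂ := (((1 - ∑ i, p i) ^ n / n.factorial : ℝ) : ℂ)

theorem continuous_splxW (n : ℕ) : Continuous (splxW (k := k) n) := by
  refine Complex.continuous_ofReal.comp ((Continuous.pow (continuous_const.sub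
    (continuous_finsetSum _ fun i _ => continuous_apply i)) n).div_const _)

/-- The integral of the iterated derivatives over the simplex. -/
def segI (f : HolI k) (x : Fin (k + 1) → ℂ) (n N : ℕ) (r : ℂ) : ℂ := ∫ p in splx k, splxW n p * segD f x N r p

theorem hasDerivAt_segI (f : HolI k) {x : Fin (k + 1) → ℂ} (n N : ℕ) {r : ℂ} (hr : r ∈ segDom x) :
    HasDerivAt (segI f x n N) (segI f x n (N + 1) r) r := by
  have hw := fun N => ((continuous_splxW (k := k) n).comp continuous_snd).continuousOn.mul (continuousOn_segD f x N)
  refine hasDerivAt_integral_compact isCompact_splx (isOpen_segDom x) (F := fun r p => splxW n p * segD f x N r p)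
    (F' := fun r p => splxW n p * segD f x (N + 1) r p) (fun r hr => ?_) (hw (N + 1)) (fun r hr p hp => ?_) hr
  · exact (hw N).comp (f := fun p => (r, p)) (by fun_prop) fun p hp => ⟨hr, hp⟩
  · exact (hasDerivAt_segD f N (hr p hp)).const_mul _

theorem iteratedDeriv_segI (f : HolI k) {x : Fin (k + 1) → ℂ} (n N : ℕ) :
    Set.EqOn (iteratedDeriv N (segI f x n 0)) (segI f x n N) (segDom x) := by
  induction N with
  | zero => intro r _; rw [iteratedDeriv_zero]
  | succ N ih =>
    intro r hr
    rw [iteratedDeriv_succ, (ih.eventuallyEq_of_mem ((isOpen_segDom x).mem_nhds hr)).deriv_eq]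
    exact (hasDerivAt_segI f n N hr).deriv

/-- The multinomial coefficient cancels the factorials in Dirichlet's integral, so all monomials of
degree `N` receive equal weight, which produces the complete homogeneous polynomial. -/
theorem segI_zero (f : HolI k) (x : Fin (k + 1) → ℂ) (n N : ℕ) :
    segI f x n N 0 = N.factorial / (k + n + N).factorial * (thetaY (hpoly k N) f).1 (diag x) := by
  have h1 : ∀ p, splxW n p * segD f x N 0 p = ∑ β ∈ Finset.piAntidiag Finset.univ N,
      ((Nat.multinomial Finset.univ β : ℂ) * (thetaY (∏ i, MvPolynomial.X i ^ β i) f).1 (diag x)) *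
      (splxW n p * ∏ i, ((p i : ℝ) : ℂ) ^ β i) := by
    intro p
    rw [segD_eq, Finset.mul_sum, seg_zero]
    exact Finset.sum_congr rfl fun β _ => by ring
  have h2 : (thetaY (hpoly k N) f).1 (diag x) = ∑ β ∈ Finset.piAntidiag Finset.univ N,
      (thetaY (∏ i, MvPolynomial.X i ^ β i) f).1 (diag x) := by
    rw [hpoly, map_sum]
    change ((∑ β ∈ _, thetaY _) f).1 _ = _
    rw [LinearMap.sum_apply, Hol_sum_apply]
  simp only [segI, h1]
  rw [integral_finsetSum, h2, Finset.mul_sum]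
  · refine Finset.sum_congr rfl fun β hβ => ?_
    rw [integral_const_mul]
    have h3 := dirichlet_integral n β
    have h4 := Nat.multinomial_spec Finset.univ β
    rw [mem_piAnti.1 hβ] at h3 h4
    simp only [splxW]
    rw [h3, ← h4]
    push_cast
    ring
  · intro β _
    refine Integrable.const_mul ?_ _
    refine ContinuousOn.integrableOn_compact isCompact_splx (Continuous.continuousOn ?_)
    exact (continuous_splxW n).mul (continuous_finsetProd _ fun i _ => (Complex.continuous_ofReal.comp
      (continuous_apply i)).pow _)

theorem splxInt_eq (f : HolI k) (x : Fin (k + 1) → ℂ) (n : ℕ) (r : ℝ) :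
    splxInt n (fun σ => f.1 (seg x 1 σ)) r = segI f x n 0 r := by
  simp only [splxInt, segI, segD_zero, seg_smul]
  rfl

end Parameter

/-! ### Borel summation. -/

section Uniqueness

variable {k : ℕ}

/-- The inverse Laplace transform of a polynomial multiple. -/
def borel (f : HolI k) (x : Fin (k + 1) → ℂ) (D : ℕ) (α : ℕ → ℂ) (r : ℂ) : ℂ :=
  ∑ j ∈ Finset.range (D + 1), α j * (r ^ (k + j) * segI f x j 0 r)

theorem analyticOnNhd_borel (f : HolI k) (x : Fin (k + 1) → ℂ) (D : ℕ) (α : ℕ → ℂ) :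
    AnalyticOnNhd ℂ (borel f x D α) (segDom x) := by
  refine DifferentiableOn.analyticOnNhd (fun r hr => DifferentiableAt.differentiableWithinAt ?_) (isOpen_segDom x)
  unfold borel
  refine DifferentiableAt.fun_sum fun j _ => ?_
  exact (differentiableAt_const _).mul ((differentiableAt_id.pow _).mul (hasDerivAt_segI f j 0 hr).differentiableAt)

/-- Taylor expansion at `0` of the simplex integrals. Up to the factor `1 / (k + q)!` the
coefficient of `r ^ (k + q)` is that of the formal product. -/
theorem hasSum_borel (f : HolI k) {x : Fin (k + 1) → ℂ} {D : ℕ} {α : ℕ → ℂ} (hα : ∀ j, D < j → α j = 0) {ε : ℝ}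
    (hε : Metric.ball 0 ε ⊆ segDom x) (h0 : (0 : ℂ) ∈ segDom x) {r : ℂ} (hr : r ∈ Metric.ball 0 ε) :
    HasSum (fun q => r ^ (k + q) / (k + q).factorial *
      ∑ ij ∈ Finset.HasAntidiagonal.antidiagonal q, (thetaY (hpoly k ij.1) f).1 (diag x) * α ij.2) (borel f x D α r) := by
  set A : ℕ → ℂ := fun N => (thetaY (hpoly k N) f).1 (diag x) with hA
  have h1 : ∀ j, HasSum (fun q => if j ≤ q then α j * A (q - j) * (r ^ (k + q) / (k + q).factorial) else 0)
      (α j * (r ^ (k + j) * segI f x j 0 r)) := by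
    intro j
    have hd : DifferentiableOn ℂ (segI f x j 0) (Metric.ball 0 ε) := fun z hz =>
      (hasDerivAt_segI f j 0 (hε hz)).differentiableAt.differentiableWithinAt
    have h2 := ((Complex.hasSum_taylorSeries_on_ball hd hr).mul_left (r ^ (k + j))).mul_left (α j)
    refine (Function.Injective.hasSum_iff (add_left_injective j) fun q hq => ?_).1 (h2.congr_fun fun N => ?_)
    · rw [if_neg]
      intro hjq
      exact hq ⟨q - j, by simp only; omega⟩
    · have hN : (N.factorial : ℂ) ≠ 0 := by exact_mod_cast N.factorial_ne_zero
      simp only [Function.comp, le_add_iff_nonneg_left, zero_le, if_true, Nat.add_sub_cancel,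
        iteratedDeriv_segI f j N h0, segI_zero, sub_zero, smul_eq_mul]
      rw [show k + (N + j) = k + j + N by omega, pow_add r (k + j) N]
      simp only [hA]
      field_simp
  have h2 := hasSum_sum (s := Finset.range (D + 1)) fun j _ => h1 j
  refine h2.congr_fun fun q => ?_
  rw [← Finset.Nat.sum_antidiagonal_swap, Finset.Nat.sum_antidiagonal_eq_sum_range_succ_mk, ← Finset.sum_filter,
    Finset.mul_sum]
  symm
  refine (Finset.sum_subset (fun j hj => ?_) fun j hj hj' => ?_).trans (Finset.sum_congr rfl fun j _ => ?_)
  · simp only [Finset.mem_filter, Finset.mem_range] at hj ⊢; omega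
  · simp only [Finset.mem_filter, Finset.mem_range] at hj hj'
    rw [hα j (by omega)]; ring
  · simp only [Prod.swap]; ring

/-- Equal Taylor coefficients give equal germs at `0`, and the half-line is connected inside the
domain of analyticity. -/
theorem borel_eq {f g : HolI k} {x : Fin (k + 1) → ℂ} (hx : x ∈ Slit fun i : Fin (k + 1) => (i : ℕ)) {D : ℕ}
    {α β : ℕ → ℂ} (hα : ∀ j, D < j → α j = 0) (hβ : ∀ j, D < j → β j = 0)
    (h : ∀ q, ∑ ij ∈ Finset.HasAntidiagonal.antidiagonal q, (thetaY (hpoly k ij.1) f).1 (diag x) * α ij.2 =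
      ∑ ij ∈ Finset.HasAntidiagonal.antidiagonal q, (thetaY (hpoly k ij.1) g).1 (diag x) * β ij.2)
    {r : ℝ} (hr : 0 ≤ r) : borel f x D α r = borel g x D β r := by
  have h0 : (0 : ℂ) ∈ segDom x := by simpa using ofReal_mem_segDom hx le_rfl
  obtain ⟨ε, hε, hεU⟩ := Metric.isOpen_iff.1 (isOpen_segDom x) 0 h0
  have hpre : IsPreconnected (Complex.ofReal '' Set.Ici 0) :=
    isPreconnected_Ici.image _ Complex.continuous_ofReal.continuousOn
  have hsub : Complex.ofReal '' Set.Ici 0 ⊆ segDom x := by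
    rintro _ ⟨r, hr, rfl⟩
    exact ofReal_mem_segDom hx hr
  refine ((analyticOnNhd_borel f x D α).mono hsub).eqOn_of_preconnected_of_eventuallyEq
    ((analyticOnNhd_borel g x D β).mono hsub) hpre (z₀ := 0) ⟨0, Set.self_mem_Ici, by simp⟩ ?_ ⟨r, hr, rfl⟩
  filter_upwards [Metric.ball_mem_nhds 0 hε] with z hz
  have h1 := hasSum_borel f hα hεU h0 hz
  simp only [h] at h1
  exact h1.unique (hasSum_borel g hβ hεU h0 hz)

/-- A sum of the identities `laplace_eq`; the factor `c ^ (D + 1)` makes the negative powers of `c`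
polynomial. -/
theorem laplace_borel (f : HolI k) (x : Fin (k + 1) → ℂ) (D : ℕ) (α : ℕ → ℂ) {c : ℝ} (hc : 0 < c)
    (hf : IntegrableOn (fun σ => (Real.exp (-(c * ∑ i, σ i)) : ℂ) * f.1 (seg x 1 σ)) (Set.Ici 0)) :
    (c : ℂ) ^ (D + 1) * ∫ r in Set.Ioi (0 : ℝ), (Real.exp (-(c * r)) : ℂ) * borel f x D α r =
      (∑ j ∈ Finset.range (D + 1), α j * (c : ℂ) ^ (D - j)) *
        ∫ σ in Set.Ici 0, (Real.exp (-(c * ∑ i, σ i)) : ℂ) * f.1 (seg x 1 σ) := by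
  have h1 : ∀ r : ℝ, (Real.exp (-(c * r)) : ℂ) * borel f x D α r = ∑ j ∈ Finset.range (D + 1),
      α j * ((Real.exp (-(c * r)) * r ^ (k + j) : ℝ) * splxInt j (fun σ => f.1 (seg x 1 σ)) r) := by
    intro r
    rw [borel, Finset.mul_sum]
    refine Finset.sum_congr rfl fun j _ => ?_
    rw [splxInt_eq]
    push_cast
    ring
  simp only [h1]
  rw [integral_finsetSum _ fun j _ => (laplace_eq hc j hf).1.const_mul (α j), Finset.mul_sum, Finset.sum_mul]
  refine Finset.sum_congr rfl fun j hj => ?_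
  rw [integral_const_mul, (laplace_eq hc j hf).2]
  have hc' : (c : ℂ) ≠ 0 := Complex.ofReal_ne_zero.2 hc.ne'
  have h2 : (c : ℂ) ^ (D + 1) = (c : ℂ) ^ (D - j) * (c : ℂ) ^ (j + 1) := by
    rw [← pow_add]; congr 1
    have := Finset.mem_range.1 hj
    omega
  rw [h2]
  push_cast
  field_simp

/-- Two multiples of Laplace transforms agree if their asymptotic expansions agree. -/
theorem laplace_unique {f g : HolI k} {x : Fin (k + 1) → ℂ} (hx : x ∈ Slit fun i : Fin (k + 1) => (i : ℕ)) {D : ℕ}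
    {α β : ℕ → ℂ} (hα : ∀ j, D < j → α j = 0) (hβ : ∀ j, D < j → β j = 0)
    (h : ∀ q, ∑ ij ∈ Finset.HasAntidiagonal.antidiagonal q, (thetaY (hpoly k ij.1) f).1 (diag x) * α ij.2 =
      ∑ ij ∈ Finset.HasAntidiagonal.antidiagonal q, (thetaY (hpoly k ij.1) g).1 (diag x) * β ij.2)
    {c : ℝ} (hc : 0 < c)
    (hf : IntegrableOn (fun σ => (Real.exp (-(c * ∑ i, σ i)) : ℂ) * f.1 (seg x 1 σ)) (Set.Ici 0))
    (hg : IntegrableOn (fun σ => (Real.exp (-(c * ∑ i, σ i)) : ℂ) * g.1 (seg x 1 σ)) (Set.Ici 0)) :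
    (∑ j ∈ Finset.range (D + 1), α j * (c : ℂ) ^ (D - j)) *
        ∫ σ in Set.Ici 0, (Real.exp (-(c * ∑ i, σ i)) : ℂ) * f.1 (seg x 1 σ) =
      (∑ j ∈ Finset.range (D + 1), β j * (c : ℂ) ^ (D - j)) *
        ∫ σ in Set.Ici 0, (Real.exp (-(c * ∑ i, σ i)) : ℂ) * g.1 (seg x 1 σ) := by
  rw [← laplace_borel f x D α hc hf, ← laplace_borel g x D β hc hg]
  congr 1
  refine setIntegral_congr_fun measurableSet_Ioi fun r hr => ?_
  rw [borel_eq hx hα hβ h (le_of_lt hr)]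

end Uniqueness

end TrigBA

end

noncomputable section

namespace TrigBA

/-! ### Integrals over the orthant and the beta integral. -/

section Orthant

variable {k : ℕ}

theorem integrableOn_prod_Ici {g : Fin k → ℝ → ℂ} (hg : ∀ i, IntegrableOn (g i) (Set.Ici 0)) :
    IntegrableOn (fun σ : Fin k → ℝ => ∏ i, g i (σ i)) (Set.Ici 0) ∧
      ∫ σ in Set.Ici (0 : Fin k → ℝ), ∏ i, g i (σ i) = ∏ i, ∫ t in Set.Ici 0, g i t := by
  have h1 : (Set.Ici (0 : Fin k → ℝ)).indicator (fun σ => ∏ i, g i (σ i)) =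
      fun σ => ∏ i, (Set.Ici 0).indicator (g i) (σ i) := by
    ext σ
    by_cases h0 : ∀ i, 0 ≤ σ i
    · rw [Set.indicator_of_mem (show σ ∈ Set.Ici 0 from h0)]
      exact Finset.prod_congr rfl fun i _ => (Set.indicator_of_mem (show σ i ∈ Set.Ici 0 from h0 i) _).symm
    · rw [Set.indicator_of_notMem (show σ ∉ Set.Ici 0 from h0)]
      push Not at h0
      obtain ⟨i, hi⟩ := h0
      exact (Finset.prod_eq_zero (Finset.mem_univ i) (Set.indicator_of_notMem (s := Set.Ici 0) (a := σ i)
        (not_le.2 hi) (g i))).symm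
  rw [← integrable_indicator_iff measurableSet_Ici, ← integral_indicator measurableSet_Ici, h1,
    integral_fintype_prod_volume_eq_prod fun i => (Set.Ici 0).indicator (g i)]
  exact ⟨Integrable.fintype_prod fun i => (integrable_indicator_iff measurableSet_Ici).2 (hg i),
    Finset.prod_congr rfl fun i _ => integral_indicator measurableSet_Ici⟩

theorem integrableOn_exp_sum {δ : ℝ} (hδ : δ < 0) :
    IntegrableOn (fun σ : Fin k → ℝ => Real.exp (δ * ∑ i, σ i)) (Set.Ici 0) := by
  have h0 : IntegrableOn (fun t : ℝ => Real.exp (δ * t)) (Set.Ici 0) :=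
    (integrableOn_Ici_iff_integrableOn_Ioi (by simp)).2 (integrableOn_exp_mul_Ioi hδ 0)
  have h1 := (integrableOn_prod_Ici (k := k) (g := fun _ t => ((Real.exp (δ * t) : ℝ) : ℂ)) fun i =>
    Integrable.ofReal (𝕜 := ℂ) h0).1
  refine h1.norm.congr (Eventually.of_forall fun σ => ?_)
  beta_reduce
  rw [← Complex.ofReal_prod, ← Real.exp_sum, ← Finset.mul_sum, Complex.norm_real, Real.norm_of_nonneg (Real.exp_pos _).le]

/-- Splitting off one factor `1 - exp (-2 t)` expresses the integral for `m + 1` as the difference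
of the integrals for `m` at `a` and at `a + 1`. -/
theorem beta_exp (m : ℕ) : ∀ a : ℂ, 0 < a.re →
    IntegrableOn (fun t : ℝ => Complex.exp (-2 * a * t) * (1 - Complex.exp (-2 * t)) ^ m) (Set.Ici 0) ∧
    ∫ t in Set.Ici (0 : ℝ), Complex.exp (-2 * a * t) * (1 - Complex.exp (-2 * t)) ^ m =
      m.factorial / (2 * ∏ j ∈ Finset.range (m + 1), (a + j)) := by
  induction m with
  | zero =>
    intro a ha
    have ha' : (-2 * a).re < 0 := by simpa using ha
    have ha0 : a ≠ 0 := by rintro rfl; simp at ha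
    rw [integrableOn_Ici_iff_integrableOn_Ioi, integral_Ici_eq_integral_Ioi]
    simp only [pow_zero, mul_one]
    refine ⟨integrableOn_exp_mul_complex_Ioi ha' 0, ?_⟩
    rw [integral_exp_mul_complex_Ioi ha' 0]
    simp
  | succ m ih =>
    intro a ha
    have ha1 : 0 < (a + 1).re := by simp; linarith
    obtain ⟨i1, e1⟩ := ih a ha
    obtain ⟨i2, e2⟩ := ih (a + 1) ha1
    have h1 : (fun t : ℝ => Complex.exp (-2 * a * t) * (1 - Complex.exp (-2 * t)) ^ (m + 1)) = fun t : ℝ =>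
        Complex.exp (-2 * a * t) * (1 - Complex.exp (-2 * t)) ^ m -
        Complex.exp (-2 * (a + 1) * t) * (1 - Complex.exp (-2 * t)) ^ m := by
      ext t
      have : Complex.exp (-2 * (a + 1) * t) = Complex.exp (-2 * a * t) * Complex.exp (-2 * t) := by
        rw [← Complex.exp_add]; congr 1; ring
      rw [this]; ring
    rw [h1]
    refine ⟨i1.sub i2, ?_⟩
    rw [integral_sub i1 i2, e1, e2]
    have hne : ∀ j : ℕ, a + j ≠ 0 := fun j h => by
      have := congrArg Complex.re h
      simp at this
      have hj : (0 : ℝ) ≤ j := Nat.cast_nonneg j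
      linarith
    have h3 : ∏ j ∈ Finset.range (m + 1), (a + 1 + j) = (∏ j ∈ Finset.range m, (a + (j + 1 : ℕ))) * (a + (m + 1 : ℕ)) := by
      rw [Finset.prod_range_succ]
      congr 1
      · exact Finset.prod_congr rfl fun j _ => by push_cast; ring
      · push_cast; ring
    rw [h3, Finset.prod_range_succ' _ (m + 1), Finset.prod_range_succ' _ m, Finset.prod_range_succ _ m]
    have h4 : ∏ j ∈ Finset.range m, (a + (j + 1 : ℕ)) ≠ 0 := Finset.prod_ne_zero_iff.2 fun j _ => hne _
    have h5 := hne 0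
    have h6 := hne (m + 1)
    rw [Nat.factorial_succ]
    generalize ∏ j ∈ Finset.range m, (a + (j + 1 : ℕ)) = Q at *
    have h7 : a ≠ 0 := by simpa using h5
    have h8 : a + (m + 1) ≠ 0 := by simpa using h6
    push_cast
    rw [add_zero]
    field_simp
    ring

end Orthant

/-! ### Convergence and continuity in the parameters. -/

section Estimates

variable {k m : ℕ} {h ht hl : (Fin k → ℂ) → (Fin k → ℂ) → ℂ}

/-- The integrand in additive coordinates. -/
def jfun (m : ℕ) (h : (Fin k → ℂ) → (Fin k → ℂ) → ℂ) (x : Fin (k + 1) → ℂ) (ν : Fin k → ℂ) (σ : Fin k → ℝ) : ℂ :=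
  (Real.exp (-(2 * ∑ i, σ i)) : ℂ) * gfun m (fun y => ex (fun i => 2 * ν i) y * h y ν) (seg x 1 σ)

theorem Tf_seg (x : Fin (k + 1) → ℂ) (σ : Fin k → ℝ) (i : Fin k) :
    Tf i (seg x 1 σ) = 1 - Complex.exp (-2 * (σ i : ℂ)) := by
  simp [Tf, sig, seg]

theorem norm_prod_Tf_le (x : Fin (k + 1) → ℂ) {σ : Fin k → ℝ} (hσ : ∀ i, 0 ≤ σ i) :
    ‖∏ i, Tf i (seg x 1 σ) ^ m‖ ≤ 1 := by
  rw [norm_prod]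
  refine Finset.prod_le_one (fun i _ => norm_nonneg _) fun i _ => ?_
  rw [norm_pow]
  refine pow_le_one₀ (norm_nonneg _) ?_
  have h1 : Tf i (seg x 1 σ) = ((1 - Real.exp (-2 * σ i) : ℝ) : ℂ) := by rw [Tf_seg]; push_cast; rfl
  have h2 : Real.exp (-2 * σ i) ≤ 1 := Real.exp_le_one_iff.2 (by have := hσ i; linarith)
  rw [h1, Complex.norm_real, Real.norm_of_nonneg (by linarith)]
  have := Real.exp_pos (-2 * σ i)
  linarith

theorem norm_ex_le {ρ : ℝ} {ν : Fin k → ℂ} (hν : ‖ν‖ ≤ ρ) (x : Fin (k + 1) → ℂ) (σ : Fin k → ℝ) :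
    ‖ex (fun i => 2 * ν i) (fun i => seg x 1 σ (.inr i))‖ ≤
      Real.exp (2 * ρ * ∑ i : Fin k, ‖x i.castSucc‖) * Real.exp (-(2 * ∑ i, (ν i).re * σ i)) := by
  rw [ex, Complex.norm_exp, ← Real.exp_add, Real.exp_le_exp, Complex.re_sum, Finset.mul_sum, Finset.mul_sum,
    ← Finset.sum_neg_distrib, ← Finset.sum_add_distrib]
  refine Finset.sum_le_sum fun i _ => ?_
  have h1 : (2 * ν i * seg x 1 σ (.inr i)).re = (2 * (ν i * x i.castSucc)).re - 2 * ((ν i).re * σ i) := by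
    simp [seg]; ring
  have h2 : (2 * (ν i * x i.castSucc)).re ≤ 2 * ρ * ‖x i.castSucc‖ := by
    refine (Complex.re_le_norm _).trans ?_
    rw [norm_mul, norm_mul, Complex.norm_ofNat, mul_assoc]
    gcongr
    exact (norm_le_pi_norm ν i).trans hν
  rw [h1]
  linarith

theorem seg_eq_shift (x : Fin (k + 1) → ℂ) (σ : Fin k → ℝ) :
    (fun i => diag x i - ((Sum.elim (0 : Fin (k + 1) → ℝ) σ i : ℝ) : ℂ)) = seg x 1 σ := by
  ext (i | i) <;> simp [seg, diag]

theorem diag_mem_Slit {x : Fin (k + 1) → ℂ} (hx : x ∈ Slit fun i : Fin (k + 1) => (i : ℕ)) :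
    diag x ∈ Slit (icol (k := k)) := by
  rintro (a | a) (b | b) h <;> simp only [icol, Sum.elim_inl, Sum.elim_inr] at h <;>
    simp only [diag, Sum.elim_inl, Sum.elim_inr] <;> apply hx <;> simpa using h

/-- The rate `L` comes from the regular kernel and the family alone. The factors `T_i` are bounded
by `1` and the exponentials supply the decay `-2 θ`, uniformly over bounded sets of `ν`. -/
theorem IsFam.exists_bound (H : IsFam k m h ht hl) : ∃ L : ℝ,
    ∀ x ∈ Slit (fun i : Fin (k + 1) => (i : ℕ)), ∀ ρ θ : ℝ, ∃ C : ℝ, ∀ ν : Fin k → ℂ, ‖ν‖ ≤ ρ →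
      (∀ i, θ ≤ (ν i).re + 1) → ∀ σ : Fin k → ℝ, (∀ i, 0 ≤ σ i) →
        ‖jfun m h x ν σ‖ ≤ C * Real.exp ((L - 2 * θ) * ∑ i, σ i) := by
  have hrt := (RT_Nker (κ := Fin k) (k := k) (m : ℤ)).mul
    (H.rt.pullback (col' := icol (k := k)) Sum.inr id fun i => rfl)
  obtain ⟨L, hL⟩ := hrt.bound
  refine ⟨L, fun x hx ρ θ => ?_⟩
  obtain ⟨C, hC, hb⟩ := hL (diag x) (diag_mem_Slit hx) ρ
  refine ⟨C * Real.exp (2 * ρ * ∑ i : Fin k, ‖x i.castSucc‖), fun ν hν hθ σ hσ => ?_⟩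
  have h1 := hb ν hν (Sum.elim 0 σ) (by rintro (i | i) <;> simp [hσ])
  beta_reduce at h1
  rw [seg_eq_shift, Fintype.sum_sum_type] at h1
  simp only [Sum.elim_inl, Sum.elim_inr, Pi.zero_apply, Finset.sum_const_zero, zero_add, id] at h1
  have e1 : (fun i => diag x (.inr i) - (σ i : ℂ)) = fun i => seg x 1 σ (.inr i) := by ext i; simp [seg, diag]
  rw [e1] at h1
  have h2 := norm_prod_Tf_le (m := m) x hσ
  have h3 := norm_ex_le hν x σ
  have h4 : Real.exp (-(2 * ∑ i, σ i)) * Real.exp (-(2 * ∑ i, (ν i).re * σ i)) ≤ Real.exp (-(2 * θ) * ∑ i, σ i) := by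
    rw [← Real.exp_add, Real.exp_le_exp]
    have : θ * ∑ i, σ i ≤ ∑ i, σ i + ∑ i, (ν i).re * σ i := by
      rw [Finset.mul_sum, ← Finset.sum_add_distrib]
      refine Finset.sum_le_sum fun i _ => ?_
      have := mul_le_mul_of_nonneg_right (hθ i) (hσ i)
      linarith
    linarith
  have h5 : jfun m h x ν σ = (Real.exp (-(2 * ∑ i, σ i)) : ℂ) * ((∏ i, Tf i (seg x 1 σ) ^ m) *
      ((Nker m (seg x 1 σ) * h (fun i => seg x 1 σ (.inr i)) ν) *
        ex (fun i => 2 * ν i) (fun i => seg x 1 σ (.inr i)))) := by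
    rw [jfun, gfun]; ring
  rw [h5, norm_mul, norm_mul, norm_mul _ (ex _ _), Complex.norm_real, Real.norm_of_nonneg (Real.exp_pos _).le]
  calc _ ≤ Real.exp (-(2 * ∑ i, σ i)) * (1 * ((C * Real.exp (L * ∑ i, σ i)) *
        (Real.exp (2 * ρ * ∑ i : Fin k, ‖x i.castSucc‖) * Real.exp (-(2 * ∑ i, (ν i).re * σ i))))) := by gcongr
    _ = C * Real.exp (2 * ρ * ∑ i : Fin k, ‖x i.castSucc‖) * Real.exp (L * ∑ i, σ i) *
        (Real.exp (-(2 * ∑ i, σ i)) * Real.exp (-(2 * ∑ i, (ν i).re * σ i))) := by ring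
    _ ≤ C * Real.exp (2 * ρ * ∑ i : Fin k, ‖x i.castSucc‖) * Real.exp (L * ∑ i, σ i) *
        Real.exp (-(2 * θ) * ∑ i, σ i) := by gcongr
    _ = _ := by
      rw [mul_assoc _ (Real.exp (L * ∑ i, σ i)), ← Real.exp_add]
      congr 2; ring

theorem continuousOn_jfun (H : IsFam k m h ht hl) {x : Fin (k + 1) → ℂ}
    (hx : x ∈ Slit fun i : Fin (k + 1) => (i : ℕ)) (ν : Fin k → ℂ) :
    ContinuousOn (jfun m h x ν) (Set.Ici 0) := by
  refine ContinuousOn.mul (Continuous.continuousOn ?_) ?_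
  · exact Complex.continuous_ofReal.comp (Real.continuous_exp.comp (continuous_const.mul
      (continuous_finsetSum _ fun i _ => continuous_apply i)).neg)
  · refine (analyticOnNhd_gfun m (pot_eigen_analytic H ν)).continuousOn.comp
      ((continuous_seg x).comp (by fun_prop : Continuous fun σ : Fin k → ℝ => ((1 : ℂ), σ))).continuousOn fun σ hσ => ?_
    simpa using seg_mem hx zero_le_one hσ

theorem integrableOn_jfun (H : IsFam k m h ht hl) {L : ℝ} {x : Fin (k + 1) → ℂ}
    (hx : x ∈ Slit fun i : Fin (k + 1) => (i : ℕ)) {C θ : ℝ} (hθ : L - 2 * θ < 0) {ν : Fin k → ℂ}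
    (hb : ∀ σ : Fin k → ℝ, (∀ i, 0 ≤ σ i) → ‖jfun m h x ν σ‖ ≤ C * Real.exp ((L - 2 * θ) * ∑ i, σ i)) :
    IntegrableOn (jfun m h x ν) (Set.Ici 0) := by
  refine Integrable.mono' ((integrableOn_exp_sum hθ).const_mul C)
    ((continuousOn_jfun H hx ν).aestronglyMeasurable measurableSet_Ici) ?_
  filter_upwards [ae_restrict_mem measurableSet_Ici] with σ hσ using hb σ hσ

/-- The region of absolute convergence. -/
def halfSpace (k : ℕ) (R : ℝ) : Set (Fin k → ℂ) := {ν | ∀ i, R < (ν i).re + 1}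

theorem isOpen_halfSpace (R : ℝ) : IsOpen (halfSpace k R) := by
  have : halfSpace k R = ⋂ i, {ν : Fin k → ℂ | R < (ν i).re + 1} := by ext; simp [halfSpace]
  rw [this]
  exact isOpen_iInter_of_finite fun i => isOpen_lt continuous_const
    ((Complex.continuous_re.comp (continuous_apply i)).add continuous_const)

theorem exists_between_halfSpace {R : ℝ} {ν : Fin k → ℂ} (hν : ν ∈ halfSpace k R) :
    ∃ θ, R < θ ∧ ν ∈ halfSpace k θ := by
  rcases isEmpty_or_nonempty (Fin k) with hk | hk
  · exact ⟨R + 1, by linarith, fun i => hk.elim i⟩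
  · obtain ⟨i, hi⟩ := Finite.exists_min fun i => (ν i).re
    have := hν i
    exact ⟨(R + ((ν i).re + 1)) / 2, by linarith, fun j => by have := hi j; linarith⟩

/-- Near each `ν` of the open region one `θ` still works, which gives integrability and, by
dominated convergence, continuity. -/
theorem IsFam.exists_region (H : IsFam k m h ht hl) : ∃ R : ℝ,
    ∀ x ∈ Slit (fun i : Fin (k + 1) => (i : ℕ)), (∀ ν ∈ halfSpace k R, IntegrableOn (jfun m h x ν) (Set.Ici 0)) ∧
      ContinuousOn (fun ν => ∫ σ in Set.Ici 0, jfun m h x ν σ) (halfSpace k R) := by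
  obtain ⟨L, hL⟩ := H.exists_bound
  -- The bound decays exactly when `L - 2 θ < 0`.
  refine ⟨L / 2, fun x hx => ⟨fun ν hν => ?_, fun ν hν => ContinuousAt.continuousWithinAt ?_⟩⟩
  all_goals
    obtain ⟨θ, hθ, hνθ⟩ := exists_between_halfSpace hν
    have hθ' : L - 2 * θ < 0 := by linarith
  · obtain ⟨C, hC⟩ := hL x hx ‖ν‖ θ
    exact integrableOn_jfun H hx hθ' (hC ν le_rfl fun i => (hνθ i).le)
  · obtain ⟨C, hC⟩ := hL x hx (‖ν‖ + 1) θ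
    refine continuousAt_of_dominated (bound := fun σ => C * Real.exp ((L - 2 * θ) * ∑ i, σ i)) ?_ ?_
      ((integrableOn_exp_sum hθ').const_mul C) ?_
    · exact Eventually.of_forall fun μ => (continuousOn_jfun H hx μ).aestronglyMeasurable measurableSet_Ici
    · filter_upwards [(isOpen_halfSpace θ).mem_nhds hνθ,
        (continuous_norm.continuousAt (x := ν)).eventually_lt continuousAt_const (lt_add_one ‖ν‖)] with μ h1 h2
      filter_upwards [ae_restrict_mem measurableSet_Ici] with σ hσ
      exact hC μ h2.le (fun i => (h1 i).le) σ hσ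
    · filter_upwards [ae_restrict_mem measurableSet_Ici] with σ hσ
      have hm : seg x 1 σ ∈ dom (icol (k := k)) := by simpa using seg_mem hx zero_le_one hσ
      have c1 := H.rt.continuous_param (inr_mem_dom hm)
      have c2 : Continuous fun ν : Fin k → ℂ => ex (fun i => 2 * ν i) (fun i => seg x 1 σ (.inr i)) := by
        unfold ex; fun_prop
      exact (continuous_const.mul (continuous_const.mul (c2.mul c1))).continuousAt

/-- Without the interactions the integral factors into beta integrals with `a = ν_i + 1`. -/
theorem limHol_integral {x : Fin (k + 1) → ℂ} (hx : x ∈ Slit fun i : Fin (k + 1) => (i : ℕ)) {ν : Fin k → ℂ}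
    (hν : ν ∈ halfSpace k 0) :
    IntegrableOn (fun σ => (Real.exp (-(2 * ∑ i, σ i)) : ℂ) * (limHol m ν).1 (seg x 1 σ)) (Set.Ici 0) ∧
    ∫ σ in Set.Ici 0, (Real.exp (-(2 * ∑ i, σ i)) : ℂ) * (limHol m ν).1 (seg x 1 σ) =
      normConst m ν * ex (fun i => 2 * ν i) (fun i => x i.castSucc) *
        ∏ i, (m.factorial / (2 * ∏ j ∈ Finset.range (m + 1), (ν i + 1 + j)) : ℂ) := by
  have h1 : ∀ σ ∈ Set.Ici (0 : Fin k → ℝ), normConst m ν * ex (fun i => 2 * ν i) (fun i => x i.castSucc) *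
      ∏ i, (Complex.exp (-2 * (ν i + 1) * σ i) * (1 - Complex.exp (-2 * σ i)) ^ m) =
      (Real.exp (-(2 * ∑ i, σ i)) : ℂ) * (limHol m ν).1 (seg x 1 σ) := by
    intro σ hσ
    have hm : seg x 1 σ ∈ dom (icol (k := k)) := by simpa using seg_mem hx zero_le_one hσ
    rw [limHol, Hol.mk_apply _ _ hm, Finset.prod_mul_distrib, ← Complex.exp_sum]
    simp only [Tf_seg]
    have h2 : (Real.exp (-(2 * ∑ i, σ i)) : ℂ) * ex (fun i => 2 * ν i) (fun i => seg x 1 σ (.inr i)) =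
        ex (fun i => 2 * ν i) (fun i => x i.castSucc) * Complex.exp (∑ i, -2 * (ν i + 1) * σ i) := by
      unfold ex
      rw [Complex.ofReal_exp, ← Complex.exp_add, ← Complex.exp_add]
      congr 1
      push_cast
      rw [Finset.mul_sum, ← Finset.sum_neg_distrib, ← Finset.sum_add_distrib, ← Finset.sum_add_distrib]
      refine Finset.sum_congr rfl fun i _ => ?_
      simp [seg]; ring
    linear_combination -(normConst m ν * ∏ i, (1 - Complex.exp (-2 * (σ i : ℂ))) ^ m) * h2
  have h3 := integrableOn_prod_Ici (k := k) (g := fun i t => Complex.exp (-2 * (ν i + 1) * t) *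
    (1 - Complex.exp (-2 * t)) ^ m) fun i => (beta_exp m (ν i + 1) (by simpa using hν i)).1
  refine ⟨(IntegrableOn.congr_fun (h3.1.const_mul _) h1 measurableSet_Ici), ?_⟩
  rw [← setIntegral_congr_fun measurableSet_Ici h1, integral_const_mul, h3.2]
  congr 1
  exact Finset.prod_congr rfl fun i _ => (beta_exp m (ν i + 1) (by simpa using hν i)).2

end Estimates

/-! ### Evaluation of the orthant integral. -/

section Evaluation

variable {k m : ℕ} {h ht hl : (Fin k → ℂ) → (Fin k → ℂ) → ℂ}
  {h' ht' hl' : (Fin (k + 1) → ℂ) → (Fin (k + 1) → ℂ) → ℂ}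

theorem continuous_normConst (n m : ℕ) : Continuous (normConst (n := n) m) := by
  unfold normConst
  fun_prop

/-- For generic `ν` this is the formal identity made analytic by `laplace_unique`. Both sides are
continuous on the region of convergence, so density extends it. -/
theorem integral_jfun (H : IsFam k m h ht hl) (H' : IsFam (k + 1) m h' ht' hl') : ∃ R : ℝ, (m : ℝ) ≤ R ∧
    ∀ x ∈ Slit (fun i : Fin (k + 1) => (i : ℕ)), ∀ ν ∈ halfSpace k R, IntegrableOn (jfun m h x ν) (Set.Ici 0) ∧
      normConst m (Fin.snoc ν (-1) : Fin (k + 1) → ℂ) * ∫ σ in Set.Ici 0, jfun m h x ν σ =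
      h' x (Fin.snoc ν (-1)) * (normConst m ν * ex (fun i => 2 * ν i) (fun i => x i.castSucc) *
        ∏ i, (m.factorial / (2 * ∏ j ∈ Finset.range (m + 1), (ν i + 1 + j)) : ℂ)) := by
  obtain ⟨R₀, hR₀⟩ := H.exists_region
  -- The bound `m` keeps the normalising constant away from zero later on and makes the beta
  -- integrals converge.
  refine ⟨max R₀ m, le_max_right _ _, fun x hx => ?_⟩
  obtain ⟨hint, hcont⟩ := hR₀ x hx
  have hsub : halfSpace k (max R₀ m) ⊆ halfSpace k R₀ := fun ν hν i => (le_max_left _ _).trans_lt (hν i)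
  have hsub0 : halfSpace k (max R₀ m) ⊆ halfSpace k 0 := fun ν hν i =>
    ((Nat.cast_nonneg m).trans (le_max_right _ _)).trans_lt (hν i)
  have hxd : x ∈ dom fun i : Fin (k + 1) => (i : ℕ) := Slit_subset hx
  have hsn : Continuous fun ν : Fin k → ℂ => (Fin.snoc ν (-1) : Fin (k + 1) → ℂ) := by
    refine continuous_pi fun i => ?_
    refine Fin.lastCases ?_ (fun i => ?_) i
    · simpa using continuous_const
    · simpa using continuous_apply i
  have key : Set.EqOn (fun ν => normConst m (Fin.snoc ν (-1) : Fin (k + 1) → ℂ) * ∫ σ in Set.Ici 0, jfun m h x ν σ)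
      (fun ν => h' x (Fin.snoc ν (-1)) * (normConst m ν * ex (fun i => 2 * ν i) (fun i => x i.castSucc) *
        ∏ i, (m.factorial / (2 * ∏ j ∈ Finset.range (m + 1), (ν i + 1 + j)) : ℂ))) (halfSpace k (max R₀ m)) := by
    refine Set.EqOn.of_subset_closure (s := halfSpace k (max R₀ m) ∩ Gen k m) ?_ ?_ ?_ Set.inter_subset_left
      ((dense_Gen k m).open_subset_closure_inter (isOpen_halfSpace _))
    · rintro ν ⟨hν, hg⟩
      obtain ⟨D, α, β, h0, e1, e2, h1⟩ := series_identity H H' hg hxd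
      have hj : ∀ σ ∈ Set.Ici (0 : Fin k → ℝ), jfun m h x ν σ =
          (Real.exp (-(2 * ∑ i, σ i)) : ℂ) * (gHol m (pot_eigen_analytic H ν)).1 (seg x 1 σ) := fun σ hσ => by
        rw [gHol_apply _ (by simpa using seg_mem hx zero_le_one hσ)]; rfl
      obtain ⟨i2, v2⟩ := limHol_integral (m := m) hx (hsub0 hν)
      -- The value `c = 2` corresponds to last parameter `-1` and to the factor `exp (-2 ∑ σ_i)` in
      -- `jfun`.
      have h2 := laplace_unique hx (fun j hj => (h0 j hj).1) (fun j hj => (h0 j hj).2) h1 two_pos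
        ((hint ν (hsub hν)).congr_fun hj measurableSet_Ici) i2
      rw [v2, ← setIntegral_congr_fun measurableSet_Ici hj] at h2
      have e3 := e1 2
      have e4 := e2 2
      simp only [div_self (two_ne_zero (α := ℂ))] at e3 e4
      rw [Complex.ofReal_ofNat, ← e3, ← e4] at h2
      exact h2
    · exact ((continuous_normConst _ _).comp hsn).continuousOn.mul (hcont.mono hsub)
    · refine ((H'.rt.continuous_param hxd).comp hsn).continuousOn.mul (ContinuousOn.mul (Continuous.continuousOn ?_) ?_)
      · refine (continuous_normConst _ _).mul ?_
        unfold ex; fun_prop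
      · refine continuousOn_finsetProd _ fun i _ => continuousOn_const.div (Continuous.continuousOn (by fun_prop)) ?_
        intro ν hν
        refine mul_ne_zero two_ne_zero (Finset.prod_ne_zero_iff.2 fun j _ hz => ?_)
        have h1 := congrArg Complex.re hz
        have h2 := hsub0 hν i
        simp only [Complex.add_re, Complex.one_re, Complex.natCast_re, Complex.zero_re] at h1
        have : (0 : ℝ) ≤ j := Nat.cast_nonneg j
        linarith
  exact fun ν hν => ⟨hint ν (hsub hν), key hν⟩

end Evaluation

end TrigBA

end

noncomputable section

namespace TrigBA

/-- If `exp (-2 (x_i - x_j))` were positive real, `u_j` would be a positive multiple of `u_i`. -/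
theorem mem_Slit_of_arg_injective {n : ℕ} {x : Fin n → ℂ}
    (hx : Function.Injective fun i => Complex.arg (expVar x i)) : x ∈ Slit fun i : Fin n => (i : ℕ) := by
  intro i j hij r hr he
  have h1 : expVar x j = r * expVar x i := by
    rw [expVar, expVar, ← he, ← Complex.exp_add]
    congr 1; ring
  have h2 : i = j := hx (by
    change Complex.arg (expVar x i) = Complex.arg (expVar x j)
    rw [h1, Complex.arg_real_mul _ hr])
  subst h2
  exact lt_irrefl _ hij

/-! ### The rational kernel of the theorem in exponential coordinates. -/

section KernelIdentity

theorem prod_eq_prod_mem {α : Type*} [Fintype α] {s : Finset α} {f g : α → ℂ} (h1 : ∀ a ∈ s, g a = f a)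
    (h2 : ∀ a ∉ s, g a = 1) : ∏ a, g a = ∏ a ∈ s, f a :=
  (Finset.prod_subset (Finset.subset_univ s) fun a _ ha => h2 a ha).symm.trans (Finset.prod_congr rfl h1)

variable {k : ℕ}

theorem expVar_sub {n : ℕ} (x : Fin n → ℂ) (i j : Fin n) :
    expVar x i - expVar x j = expVar x i * (1 - Complex.exp (-2 * (x i - x j))) := by
  have : expVar x j = expVar x i * Complex.exp (-2 * (x i - x j)) := by
    rw [expVar, expVar, ← Complex.exp_add]; congr 1; ring
  rw [mul_sub, mul_one, ← this]

theorem vand_expVar {n : ℕ} (x : Fin n → ℂ) : vand (expVar x) = (∏ i : Fin n, expVar x i ^ (n - 1 - i)) *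
    ∏ i, ∏ j ∈ Finset.Ioi i, (1 - Complex.exp (-2 * (x i - x j))) := by
  unfold vand
  rw [← Finset.prod_mul_distrib]
  refine Finset.prod_congr rfl fun i _ => ?_
  simp only [expVar_sub]
  rw [Finset.prod_mul_distrib, Finset.prod_const, Fin.card_Ioi]

/-- Each difference is written as its earlier variable times a wall factor in the interlaced order.
Only the pairs `(w_i, u_i)` are in the opposite order, hence `(-1) ^ k`. -/
theorem AStar_expVar (x : Fin (k + 1) → ℂ) (y : Fin k → ℂ) : AStar (expVar y) (expVar x) =
    ((-1) ^ k * ∏ i : Fin k, expVar x i.castSucc * (1 - Complex.exp (-2 * (x i.castSucc - y i)))) *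
    ((∏ i : Fin k, expVar y i ^ (k - (i : ℕ))) * ∏ i : Fin k, ∏ j ∈ Finset.Ioi i.castSucc, (1 - Complex.exp (-2 * (y i - x j)))) *
    ((∏ i : Fin k, expVar x i.castSucc ^ (k - 1 - (i : ℕ))) *
      ∏ i : Fin k, ∏ j ∈ Finset.Iio i.castSucc, (1 - Complex.exp (-2 * (x j - y i)))) := by
  have hyx : ∀ i j, expVar y i - expVar x j = expVar y i * (1 - Complex.exp (-2 * (y i - x j))) := by
    intro i j
    have : expVar x j = expVar y i * Complex.exp (-2 * (y i - x j)) := by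
      rw [expVar, expVar, ← Complex.exp_add]; congr 1; ring
    rw [mul_sub, mul_one, ← this]
  have hxy : ∀ i j, expVar x j - expVar y i = expVar x j * (1 - Complex.exp (-2 * (x j - y i))) := by
    intro i j
    have : expVar y i = expVar x j * Complex.exp (-2 * (x j - y i)) := by
      rw [expVar, expVar, ← Complex.exp_add]; congr 1; ring
    rw [mul_sub, mul_one, ← this]
  have h1 : ∏ i : Fin k, ∏ j ∈ Finset.Iio i.castSucc, expVar x j = ∏ i : Fin k, expVar x i.castSucc ^ (k - 1 - (i : ℕ)) := by
    have h2 : ∀ i : Fin k, ∏ j ∈ Finset.Iio i.castSucc, expVar x j = ∏ j ∈ Finset.Iio i, expVar x j.castSucc := by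
      intro i
      rw [← Fin.map_castSuccEmb_Iio, Finset.prod_map]
      rfl
    simp only [h2]
    rw [Finset.prod_comm' (t' := Finset.univ) (s' := fun j => Finset.Ioi j) (by simp)]
    refine Finset.prod_congr rfl fun j _ => ?_
    rw [Finset.prod_const, Fin.card_Ioi]
  have h3 : ∀ i : Fin k, ∏ j ∈ Finset.Ici i.castSucc, (expVar y i - expVar x j) =
      -1 * (expVar x i.castSucc * (1 - Complex.exp (-2 * (x i.castSucc - y i)))) *
      (expVar y i ^ (k - (i : ℕ)) * ∏ j ∈ Finset.Ioi i.castSucc, (1 - Complex.exp (-2 * (y i - x j)))) := by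
    intro i
    rw [← Finset.Ioi_insert, Finset.prod_insert (by simp), ← hxy]
    simp only [hyx _ _]
    rw [Finset.prod_mul_distrib, Finset.prod_const, Fin.card_Ioi, ← hyx]
    simp
  unfold AStar
  simp only [h3, hxy, Finset.prod_mul_distrib, h1, Finset.prod_const, Finset.card_univ, Fintype.card_fin]

theorem Nker_eq (m : ℕ) (z : Idx k → ℂ) : Nker m z =
    ((∏ i, ∏ j ∈ Finset.Ioi i, (1 - Complex.exp (-2 * (z (.inl i) - z (.inl j))))) ^ m)⁻¹ *
    (∏ i : Fin k, ∏ j ∈ Finset.Iio i.castSucc, (1 - Complex.exp (-2 * (z (.inl j) - z (.inr i))))) ^ m *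
    ((∏ i : Fin k, ∏ j ∈ Finset.Ioi i.castSucc, (1 - Complex.exp (-2 * (z (.inr i) - z (.inl j))))) ^ m *
    ((∏ i, ∏ j ∈ Finset.Ioi i, (1 - Complex.exp (-2 * (z (.inr i) - z (.inr j))))) ^ m)⁻¹) := by
  unfold Nker
  rw [Fintype.prod_sum_type]
  simp only [Fintype.prod_sum_type, Finset.prod_mul_distrib, icol, chg, Sum.elim_inl, Sum.elim_inr]
  rw [Finset.prod_comm (s := (Finset.univ : Finset (Fin (k + 1)))) (t := (Finset.univ : Finset (Fin k)))]
  simp only [← Finset.prod_pow, ← Finset.prod_inv_distrib]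
  congr 2 <;> refine Finset.prod_congr rfl fun i _ => ?_
  · exact prod_eq_prod_mem (fun j hj => (if_pos (Finset.mem_Ioi.1 hj)).trans (by simp))
      fun j hj => if_neg fun h => hj (Finset.mem_Ioi.2 h)
  · exact prod_eq_prod_mem (fun j hj => (if_pos (Finset.mem_Iio.1 hj)).trans (by simp))
      fun j hj => if_neg fun h => hj (Finset.mem_Iio.2 h)
  · exact prod_eq_prod_mem (fun j hj => (if_pos (Finset.mem_Ioi.1 hj)).trans (by simp))
      fun j hj => if_neg fun h => hj (Finset.mem_Ioi.2 h)
  · exact prod_eq_prod_mem (fun j hj => (if_pos (Finset.mem_Ioi.1 hj)).trans (by simp))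
      fun j hj => if_neg fun h => hj (Finset.mem_Ioi.2 h)

/-- Wall factors assemble into the kernel with `q = m`. The monomials cancel except for one power of
each `w_i`, raised to `m`. -/
theorem AStar_pow_div_vand_pow (m : ℕ) {z : Idx k → ℂ} :
    AStar (expVar fun i => z (.inr i)) (expVar fun j => z (.inl j)) ^ m /
      (vand (expVar fun j => z (.inl j)) ^ m * vand (expVar fun i => z (.inr i)) ^ m) =
    (-1) ^ (k * m) * (∏ i, expVar (fun i => z (.inr i)) i) ^ m * ((∏ i, Tf i z ^ m) * Nker m z) := by
  set x : Fin (k + 1) → ℂ := fun j => z (.inl j) with hx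
  set y : Fin k → ℂ := fun i => z (.inr i) with hy
  have hT : ∏ i, Tf i z ^ m = (∏ i : Fin k, (1 - Complex.exp (-2 * (x i.castSucc - y i)))) ^ m := by
    rw [Finset.prod_pow]; rfl
  have hU : ∏ i : Fin (k + 1), expVar x i ^ (k + 1 - 1 - (i : ℕ)) =
      (∏ i : Fin k, expVar x i.castSucc ^ (k - 1 - (i : ℕ))) * ∏ i : Fin k, expVar x i.castSucc := by
    rw [Fin.prod_univ_castSucc, ← Finset.prod_mul_distrib]
    simp only [Fin.val_last, Fin.val_castSucc, Nat.add_sub_cancel, Nat.sub_self, pow_zero, mul_one]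
    refine Finset.prod_congr rfl fun i _ => ?_
    rw [← pow_succ]
    congr 1
    have := i.2
    omega
  have hW : ∏ i : Fin k, expVar y i ^ (k - (i : ℕ)) =
      (∏ i : Fin k, expVar y i ^ (k - 1 - (i : ℕ))) * ∏ i : Fin k, expVar y i := by
    rw [← Finset.prod_mul_distrib]
    refine Finset.prod_congr rfl fun i _ => ?_
    rw [← pow_succ]
    congr 1
    have := i.2
    omega
  have n1 : ∏ i : Fin k, expVar x i.castSucc ^ (k - 1 - (i : ℕ)) ≠ 0 :=
    Finset.prod_ne_zero_iff.2 fun i _ => pow_ne_zero _ (Complex.exp_ne_zero _)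
  have n2 : ∏ i : Fin k, expVar x i.castSucc ≠ 0 := Finset.prod_ne_zero_iff.2 fun i _ => Complex.exp_ne_zero _
  have n3 : ∏ i : Fin k, expVar y i ^ (k - 1 - (i : ℕ)) ≠ 0 :=
    Finset.prod_ne_zero_iff.2 fun i _ => pow_ne_zero _ (Complex.exp_ne_zero _)
  rw [AStar_expVar, vand_expVar, vand_expVar, hU, hW, Nker_eq, hT, Finset.prod_mul_distrib, pow_mul]
  generalize (∏ i : Fin k, expVar x i.castSucc ^ (k - 1 - (i : ℕ))) = a1 at *
  generalize (∏ i : Fin k, expVar x i.castSucc) = a2 at *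
  generalize (∏ i : Fin k, expVar y i ^ (k - 1 - (i : ℕ))) = a3 at *
  simp only [div_eq_mul_inv, mul_inv, mul_pow]
  have e1 := mul_inv_cancel₀ (pow_ne_zero m n1)
  have e2 := mul_inv_cancel₀ (pow_ne_zero m n2)
  have e3 := mul_inv_cancel₀ (pow_ne_zero m n3)
  generalize (a1 ^ m)⁻¹ = b1 at *
  generalize (a2 ^ m)⁻¹ = b2 at *
  generalize (a3 ^ m)⁻¹ = b3 at *
  generalize a1 ^ m = c1 at *
  generalize a2 ^ m = c2 at *
  generalize a3 ^ m = c3 at *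
  generalize ((-1 : ℂ) ^ k) ^ m = s
  generalize (∏ i : Fin k, (1 - Complex.exp (-2 * (x i.castSucc - y i)))) ^ m = t
  generalize ((∏ i, ∏ j ∈ Finset.Ioi i, (1 - Complex.exp (-2 * (x i - x j)))) ^ m)⁻¹ = d1
  generalize ((∏ i, ∏ j ∈ Finset.Ioi i, (1 - Complex.exp (-2 * (y i - y j)))) ^ m)⁻¹ = d2
  generalize (∏ i : Fin k, ∏ j ∈ Finset.Iio i.castSucc, (1 - Complex.exp (-2 * (x j - y i)))) ^ m = d3
  generalize (∏ i : Fin k, ∏ j ∈ Finset.Ioi i.castSucc, (1 - Complex.exp (-2 * (y i - x j)))) ^ m = d4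
  generalize (∏ i : Fin k, expVar y i) ^ m = w
  have e4 : s * (c2 * t) * (c3 * w * d4) * (c1 * d3) * (b1 * b2 * d1 * (b3 * d2)) =
      (c1 * b1) * (c2 * b2) * (c3 * b3) * (s * w * (t * (d1 * d3 * (d4 * d2)))) := by ring
  rw [e4, e1, e2, e3]
  ring

end KernelIdentity

/-! ### The substitution `τ_i = exp (-2 σ_i)`. -/

section ChangeOfVariables

variable {k : ℕ}

/-- The exponential substitution `τ_i = exp (-2 σ_i)`. -/
def expSub (σ : Fin k → ℝ) : Fin k → ℝ := fun i => Real.exp (-2 * σ i)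

theorem expSub_image : expSub '' Set.Ici (0 : Fin k → ℝ) = unitCube k := by
  ext τ
  simp only [unitCube, Set.mem_image, Set.mem_pi, Set.mem_univ, true_implies, Set.mem_Ioc]
  constructor
  · rintro ⟨σ, hσ, rfl⟩ i
    exact ⟨Real.exp_pos _, Real.exp_le_one_iff.2 (by have := hσ i; simp at this; linarith)⟩
  · intro h
    refine ⟨fun i => -(Real.log (τ i) / 2), fun i => ?_, ?_⟩
    · have := Real.log_nonpos (h i).1.le (h i).2
      simp only [Pi.zero_apply]
      linarith
    · ext i
      rw [expSub, show -2 * -(Real.log (τ i) / 2) = Real.log (τ i) by ring, Real.exp_log (h i).1]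

theorem expSub_injective : Function.Injective (expSub (k := k)) := by
  intro σ τ h
  ext i
  have := Real.exp_injective (congrFun h i)
  linarith

theorem hasFDerivAt_expSub (σ : Fin k → ℝ) : HasFDerivAt expSub (ContinuousLinearMap.pi fun i =>
    (ContinuousLinearMap.toSpanSingleton ℝ (-2 * Real.exp (-2 * σ i))).comp
      (ContinuousLinearMap.proj (R := ℝ) (φ := fun _ : Fin k => ℝ) i)) σ := by
  refine hasFDerivAt_pi.2 fun i => ?_
  have h1 : HasDerivAt (fun t : ℝ => Real.exp (-2 * t)) (-2 * Real.exp (-2 * σ i)) (σ i) := by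
    have := ((hasDerivAt_id (σ i)).const_mul (-2)).exp
    refine this.congr_deriv ?_
    simp only [id]; ring
  exact HasFDerivAt.comp (g := fun t : ℝ => Real.exp (-2 * t)) (f := fun σ : Fin k → ℝ => σ i) σ h1.hasFDerivAt (hasFDerivAt_apply i σ)

/-- The substitution is diagonal, so its Jacobian is a product; the omitted endpoint `τ_i = 0`
corresponds to infinity. -/
theorem unitCube_integral (F : (Fin k → ℝ) → ℂ) :
    (IntegrableOn F (unitCube k) ↔ IntegrableOn (fun σ => (∏ i, (2 * Real.exp (-2 * σ i)) : ℝ) • F (expSub σ)) (Set.Ici 0)) ∧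
    ∫ τ in unitCube k, F τ = ∫ σ in Set.Ici 0, (∏ i, (2 * Real.exp (-2 * σ i)) : ℝ) • F (expSub σ) := by
  have hd : ∀ σ : Fin k → ℝ, |(ContinuousLinearMap.pi fun i =>
      (ContinuousLinearMap.toSpanSingleton ℝ (-2 * Real.exp (-2 * σ i))).comp
      (ContinuousLinearMap.proj (R := ℝ) (φ := fun _ : Fin k => ℝ) i)).det| = ∏ i, (2 * Real.exp (-2 * σ i)) := by
    intro σ
    rw [ContinuousLinearMap.det_pi, Finset.abs_prod]
    refine Finset.prod_congr rfl fun i _ => ?_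
    rw [ContinuousLinearMap.det_toSpanSingleton, abs_mul, abs_of_pos (Real.exp_pos _)]
    simp
  have hf := fun (σ : Fin k → ℝ) (_ : σ ∈ Set.Ici 0) => (hasFDerivAt_expSub σ).hasFDerivWithinAt (s := Set.Ici 0)
  have h1 := integrableOn_image_iff_integrableOn_abs_det_fderiv_smul volume measurableSet_Ici hf
    expSub_injective.injOn F
  have h2 := integral_image_eq_integral_abs_det_fderiv_smul volume measurableSet_Ici hf expSub_injective.injOn F
  simp only [hd, expSub_image] at h1 h2
  exact ⟨h1, h2⟩

end ChangeOfVariables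

/-! ### Assembly. -/

section Assembly

variable {k m : ℕ} {h ht hl : (Fin k → ℂ) → (Fin k → ℂ) → ℂ}

theorem segLog_expSub (x : Fin (k + 1) → ℂ) (σ : Fin k → ℝ) :
    segLog x (expSub σ) = fun i => seg x 1 σ (.inr i) := by
  ext i
  simp only [segLog, expSub, Real.log_exp, seg, Sum.elim_inr]
  push_cast
  ring

/-- The kernel's `∏ w_i ^ m` cancels the exponent `-m`, and the shift by `b + 1` cancels the
remaining power `-1 - b` of `w_i`. The decay `exp (-2 ∑ σ_i)` is the Jacobian. -/
theorem selbergIntegrand_expSub (H : IsFam k m h ht hl) {x : Fin (k + 1) → ℂ}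
    (hx : x ∈ Slit fun i : Fin (k + 1) => (i : ℕ)) (ν : Fin k → ℂ) (b : ℂ) {σ : Fin k → ℝ}
    (hσ : σ ∈ Set.Ici (0 : Fin k → ℝ)) :
    (∏ i, (2 * Real.exp (-2 * σ i)) : ℝ) • selbergIntegrand k m x (Fin.snoc (fun i => ν i + (b + 1)) b) (expSub σ) =
      2 ^ k * (-1) ^ (k * m) * (normConst m ν)⁻¹ * Complex.exp (∑ i : Fin k, 2 * x i.castSucc) * jfun m h x ν σ := by
  have hm : seg x 1 σ ∈ dom (icol (k := k)) := by simpa using seg_mem hx zero_le_one hσ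
  have hk := AStar_pow_div_vand_pow m (z := seg x 1 σ)
  have hxl : (fun j => seg x 1 σ (.inl j)) = x := by ext j; rfl
  rw [hxl] at hk
  have hP := H.Phi_eq (inr_mem_dom hm) (fun i => ν i + (b + 1))
  rw [normConst_shift, H.shift (inr_mem_dom hm)] at hP
  simp only [selbergIntegrand, segLog_expSub, Fin.snoc_castSucc, Fin.snoc_last]
  rw [hk, hP, jfun, gfun, Complex.real_smul]
  set y : Fin k → ℂ := fun i => seg x 1 σ (.inr i) with hy
  have h1 : ((∏ i, (2 * Real.exp (-2 * σ i)) : ℝ) : ℂ) = 2 ^ k * Complex.exp (∑ i, -2 * (σ i : ℂ)) := by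
    rw [Finset.prod_mul_distrib, Finset.prod_const, Finset.card_univ, Fintype.card_fin, ← Real.exp_sum]
    push_cast
    rfl
  have h2 : Complex.exp (∑ i, -2 * (σ i : ℂ)) * (∏ i, expVar y i) ^ m *
      (∏ i, Complex.exp (2 * (-(m : ℂ) - 1 - b) * y i)) * ex (fun i => 2 * (ν i + (b + 1))) y *
      ∏ i : Fin k, expVar x i.castSucc =
      Complex.exp (∑ i : Fin k, 2 * x i.castSucc) * (Real.exp (-(2 * ∑ i, σ i)) : ℂ) * ex (fun i => 2 * ν i) y := by
    unfold ex
    simp only [expVar]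
    rw [← Complex.exp_sum, ← Complex.exp_sum, ← Complex.exp_sum, ← Complex.exp_nat_mul, Complex.ofReal_exp,
      ← Complex.exp_add, ← Complex.exp_add, ← Complex.exp_add, ← Complex.exp_add, ← Complex.exp_add, ← Complex.exp_add]
    congr 1
    push_cast
    simp only [Finset.mul_sum, ← Finset.sum_neg_distrib, ← Finset.sum_add_distrib]
    refine Finset.sum_congr rfl fun i _ => ?_
    ring
  rw [h1]
  linear_combination (2 ^ k * (-1) ^ (k * m) * (normConst m ν)⁻¹ * (∏ i, Tf i (seg x 1 σ) ^ m) *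
    Nker m (seg x 1 σ) * h y ν) * h2

theorem Gamma_add_natCast {a : ℂ} (ha : 0 < a.re) (n : ℕ) :
    Complex.Gamma (a + n) = (∏ j ∈ Finset.range n, (a + j)) * Complex.Gamma a := by
  induction n with
  | zero => simp
  | succ n ih =>
    have h0 : a + n ≠ 0 := fun h0 => by
      have := congrArg Complex.re h0
      simp at this
      have hn : (0 : ℝ) ≤ n := Nat.cast_nonneg n
      linarith
    rw [Nat.cast_succ, ← add_assoc, Complex.Gamma_add_one _ h0, ih, Finset.prod_range_succ]
    ring

theorem C3_eq (ν : Fin k → ℂ) (b : ℂ) (hν : ν ∈ halfSpace k 0) : C3 k m (Fin.snoc (fun i => ν i + (b + 1)) b) =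
    (-1) ^ (k * m) * ∏ i, (m.factorial / ∏ j ∈ Finset.range (m + 1), (ν i + 1 + j) : ℂ) := by
  unfold C3
  congr 1
  refine Finset.prod_congr rfl fun i _ => ?_
  simp only [Fin.snoc_castSucc, Fin.snoc_last]
  have ha : 0 < (ν i + 1).re := by simpa using hν i
  have h1 := Gamma_add_natCast ha (m + 1)
  rw [show ν i + (b + 1) - b = ν i + 1 by ring, Complex.Gamma_nat_eq_factorial,
    show ν i + 1 + (m : ℂ) + 1 = ν i + 1 + (m + 1 : ℕ) by push_cast; ring, h1]
  have h2 := Complex.Gamma_ne_zero_of_re_pos ha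
  rw [mul_div_mul_right _ _ h2]

/-- The new factors are `ν_i + 1 - (j + 1)` with `j < m`, whose real parts are positive. -/
theorem normConst_snoc_ne_zero {ν : Fin k → ℂ} (h0 : normConst m ν ≠ 0) (hν : ν ∈ halfSpace k m) :
    normConst m (Fin.snoc ν (-1) : Fin (k + 1) → ℂ) ≠ 0 := by
  rw [normConst_succ]
  simp only [Fin.snoc_castSucc, Fin.snoc_last]
  refine mul_ne_zero h0 (Finset.prod_ne_zero_iff.2 fun i _ => Finset.prod_ne_zero_iff.2 fun j hj hz => ?_)
  have h1 := congrArg Complex.re hz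
  have h2 := hν i
  have h3 : (j : ℝ) + 1 ≤ m := by exact_mod_cast Finset.mem_range.1 hj
  simp at h1
  linarith

end Assembly

/-- All quantities other than explicit exponentials depend only on differences of the `ν_i`, so the
last parameter can be normalised to `-1`, where `integral_jfun` applies. -/
theorem selberg_integral_formula (k m : ℕ) :
    ∃ R : ℝ, ∀ x ν : Fin (k + 1) → ℂ,
      Function.Injective (fun i => Complex.arg (TrigBA.expVar x i)) →
      TrigBA.normConst m (fun i : Fin k => ν i.castSucc) ≠ 0 →
      (∀ i : Fin k, R < (ν i.castSucc - ν (Fin.last k)).re) →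
      MeasureTheory.IntegrableOn (TrigBA.selbergIntegrand k m x ν) (TrigBA.unitCube k) ∧
      (∏ i, Complex.exp (2 * ν (Fin.last k) * x i)) *
          (∫ τ in TrigBA.unitCube k, TrigBA.selbergIntegrand k m x ν τ) =
        TrigBA.C3 k m ν * TrigBA.Phi (k + 1) m x ν := by
  obtain ⟨h, ht, hl, H⟩ := exists_isFam k m
  obtain ⟨h', ht', hl', H'⟩ := exists_isFam (k + 1) m
  obtain ⟨R, hmR, hR⟩ := integral_jfun H H'
  refine ⟨R, fun x ν harg hnc hre => ?_⟩
  have hx := mem_Slit_of_arg_injective harg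
  have hxd : x ∈ dom fun i : Fin (k + 1) => (i : ℕ) := Slit_subset hx
  set b := ν (Fin.last k) with hb
  set μ : Fin k → ℂ := fun i => ν i.castSucc - (b + 1) with hμ
  have hν : ν = Fin.snoc (fun i => μ i + (b + 1)) b := by
    ext i
    refine Fin.lastCases ?_ (fun i => ?_) i
    · simp [hb]
    · simp [hμ]
  -- The same vector as a common shift of `(μ, -1)`, to which `normConst` and the numerator are
  -- insensitive.
  have hν2 : ν = fun i => (Fin.snoc μ (-1) : Fin (k + 1) → ℂ) i + (b + 1) := by
    ext i
    refine Fin.lastCases ?_ (fun i => ?_) i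
    · simp [hb]
    · simp [hμ]
  have hμR : μ ∈ halfSpace k R := fun i => by
    have := hre i
    simp only [hμ, Complex.sub_re, Complex.add_re, Complex.one_re] at this ⊢
    linarith
  have hμm : μ ∈ halfSpace k m := fun i => hmR.trans_lt (hμR i)
  have hμ0 : μ ∈ halfSpace k 0 := fun i => (Nat.cast_nonneg m).trans_lt (hμm i)
  have hncμ : normConst m μ ≠ 0 := by
    have := normConst_shift (m := m) μ (b + 1)
    rw [← this]
    simpa [hμ] using hnc
  have hn1 := normConst_snoc_ne_zero hncμ hμm
  obtain ⟨hint, hval⟩ := hR x hx μ hμR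
  have hcv := unitCube_integral (selbergIntegrand k m x ν)
  have hpt : ∀ σ ∈ Set.Ici (0 : Fin k → ℝ), (∏ i, (2 * Real.exp (-2 * σ i)) : ℝ) •
      selbergIntegrand k m x ν (expSub σ) = 2 ^ k * (-1) ^ (k * m) * (normConst m μ)⁻¹ *
        Complex.exp (∑ i : Fin k, 2 * x i.castSucc) * jfun m h x μ σ := fun σ hσ => by
    have := selbergIntegrand_expSub H hx μ b hσ
    rwa [← hν] at this
  refine ⟨hcv.1.2 (IntegrableOn.congr_fun (hint.const_mul _) (fun σ hσ => (hpt σ hσ).symm) measurableSet_Ici), ?_⟩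
  have hPhi := H'.Phi_eq hxd ν
  have hC3 := C3_eq (m := m) μ b hμ0
  rw [← hν] at hC3
  rw [hcv.2, setIntegral_congr_fun measurableSet_Ici hpt, integral_const_mul, hPhi, hC3]
  have e1 : normConst m ν = normConst m (Fin.snoc μ (-1) : Fin (k + 1) → ℂ) := by
    conv_lhs => rw [hν2]
    exact normConst_shift _ _
  have e2 : h' x ν = h' x (Fin.snoc μ (-1)) := by
    conv_lhs => rw [hν2]
    exact H'.shift hxd _ _
  have e3 : (∏ i, Complex.exp (2 * b * x i)) * Complex.exp (∑ i : Fin k, 2 * x i.castSucc) *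
      ex (fun i => 2 * μ i) (fun i => x i.castSucc) = ex (fun i => 2 * ν i) x := by
    unfold ex
    rw [← Complex.exp_sum, ← Complex.exp_add, ← Complex.exp_add]
    congr 1
    rw [Fin.sum_univ_castSucc, Fin.sum_univ_castSucc (fun i => 2 * ν i * x i), ← hb]
    have : ∑ i : Fin k, 2 * ν i.castSucc * x i.castSucc = ∑ i : Fin k, (2 * b * x i.castSucc + 2 * x i.castSucc +
        2 * μ i * x i.castSucc) := Finset.sum_congr rfl fun i _ => by simp only [hμ]; ring
    rw [this, Finset.sum_add_distrib, Finset.sum_add_distrib]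
    ring
  -- The factors `2` of the Jacobian cancel the factors `1 / 2` of the beta integrals.
  have e4 : (2 : ℂ) ^ k * ∏ i, (m.factorial / (2 * ∏ j ∈ Finset.range (m + 1), (μ i + 1 + j)) : ℂ) =
      ∏ i, (m.factorial / ∏ j ∈ Finset.range (m + 1), (μ i + 1 + j) : ℂ) := by
    have : (2 : ℂ) ^ k = ∏ _i : Fin k, 2 := by simp
    rw [this, ← Finset.prod_mul_distrib]
    refine Finset.prod_congr rfl fun i _ => ?_
    rw [div_mul_eq_div_div_swap, mul_div_cancel₀ _ two_ne_zero]
  rw [e1, e2, ← e3, ← e4]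
  have hval' : (∫ σ in Set.Ici 0, jfun m h x μ σ) = (normConst m (Fin.snoc μ (-1) : Fin (k + 1) → ℂ))⁻¹ *
      (h' x (Fin.snoc μ (-1)) * (normConst m μ * ex (fun i => 2 * μ i) (fun i => x i.castSucc) *
        ∏ i, (m.factorial / (2 * ∏ j ∈ Finset.range (m + 1), (μ i + 1 + j)) : ℂ))) := by
    rw [← hval, inv_mul_cancel_left₀ hn1]
  rw [hval']
  have e5 := inv_mul_cancel₀ hncμ
  generalize normConst m (Fin.snoc μ (-1) : Fin (k + 1) → ℂ) = N1 at *
  generalize ∏ i, (m.factorial / (2 * ∏ j ∈ Finset.range (m + 1), (μ i + 1 + j)) : ℂ) = Q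
  linear_combination ((∏ i, Complex.exp (2 * b * x i)) * 2 ^ k * (-1) ^ (k * m) *
    Complex.exp (∑ i : Fin k, 2 * x i.castSucc) * N1⁻¹ * h' x (Fin.snoc μ (-1)) *
    ex (fun i => 2 * μ i) (fun i => x i.castSucc) * Q) * e5

end TrigBA

end

theorem mainTheorem7 (k m : ℕ) :
    ∃ R : ℝ, ∀ x ν : Fin (k + 1) → ℂ,
      Function.Injective (fun i => Complex.arg (TrigBA.expVar x i)) →
      TrigBA.normConst m (fun i : Fin k => ν i.castSucc) ≠ 0 →
      (∀ i : Fin k, R < (ν i.castSucc - ν (Fin.last k)).re) →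
      MeasureTheory.IntegrableOn (TrigBA.selbergIntegrand k m x ν) (TrigBA.unitCube k) ∧
      (∏ i, Complex.exp (2 * ν (Fin.last k) * x i)) *
          (∫ τ in TrigBA.unitCube k, TrigBA.selbergIntegrand k m x ν τ) =
        TrigBA.C3 k m ν * TrigBA.Phi (k + 1) m x ν :=
  TrigBA.selberg_integral_formula k m
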